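/- **Setting.** The edit distance $d_{\rm edit}(u,v)$ is the least number of character insertions, deletions and substitutions that convert $u$ into $v$. A *gap algorithm* takes $(n,\theta,\delta;x,y)$ with $n$ a power of $2$, $|x|=|y|=n$, $\theta\in(0,1]$ a power of $1/2$, $\delta\in(0,1)$, uses finitely many fair random bits, and accepts or rejects. It satisfies $\mathrm{GapCondition}(T,\zeta,Q)$ if for all such $n,\delta$ and all $\theta\ge n^{-\zeta}$: it always rejects when $d_{\rm edit}(x,y)>Q\theta n$; it accepts with probability at least $1-\delta$ when $d_{\rm edit}(x,y)\le\theta n$; and it always runs in time $O\big(n^{1+1/T}(1+\log n)^{e}(1+\log(1/\delta))\big)$ for some constant $e$. Let $\mathrm{ED}$ be a gap algorithm satisfying $\mathrm{GapCondition}(T',\zeta',Q')$, $T'\ge1$, $\zeta'\ge0$, $Q'\ge1$. Let $n$ be a power of $2$, $\theta\in(0,1]$ a power of $1/2$, $|x|=|y|=n$, $z=xy$, $k\ge1$ an integer, and let $w_1<\dots<w_{k+1}=n$, $d_0>\dots>d_k=1$ be powers of $2$ such that $w_1=d_0$ is the largest power of $2$ not exceeding $\sqrt n$ and, for $1\le j\le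 k$, $d_j\le n/w_j$ and $w_j/w_{j+1}\le\theta/2$. Put $\varepsilon_i=2^{-i}$, $q_0=\lceil\log_2Q'\rceil$, $q_j=3q_{j-1}+21$, and let $c_0$ be a constant. Below $i$ and $i'$ range over $\{0,\dots,\log_2(1/\theta)\}$. An interval $I$ of width $w$ is a set of $w+1$ consecutive integers in $\{0,\dots,2n\}$; $z_I$ is the string of the $z_m$, $\min I<m\le\max I$. For intervals of width $w$, $c(I,J)=d_{\rm edit}(z_I,z_J)/w$. $\mathcal I(w)$ is the set of intervals of width $w$ in $\{0,\dots,n\}$ whose minimum is a multiple of $w$, and $\mathcal I(w,\varepsilon)$ the set of those in $\{0,\dots,2n\}$ whose minimum is a multiple of $\max(\varepsilon w,1)$. Every call $\mathrm{ED}(z_I,z_J,\varepsilon_i)$ has error parameter $n^{-12}$ and uses a prefix of one common string of random bits. For $I'\subseteq I$ of width $w'\le w$, $\mathrm{ZoomIn}(I\times J,i,I',i')$ is the set of $J'\in\mathcal I(w',\varepsilon_{i'+3})$, $J'\subseteq J$, with $|(\min J'-\min J)-(\min I'-\min I)|\le2\varepsilon_iw$. For a list $\mathcal R$ of weighted boxes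 $(I'\times J',\kappa')$, $\mathrm{APM}(I\times\mathcal J,\kappa,\mathcal R)$ returns the $J\in\mathcal J$ for which the cheapest path from $(\min I,0)$ to $(\max I,\max J)$ costs at most $\kappa w$ in the graph with horizontal and vertical unit edges of cost $1$, an edge of cost $\kappa'$ times the width of $I'$ from the lower left to the upper right corner of each box in $\mathcal R$, and edges of cost $0$ from $(\min I,0)$ to $(\min I,\min J)$, $J\in\mathcal J$; it is computed by dynamic programming with a binary tree storing maxima. $\mathrm{Enumerate}(j,I\times\mathcal J,i)$, for $I\in\mathcal I(w_j)$, $\mathcal J\subseteq\mathcal I(w_j,\varepsilon_{i+3})$: if $j=1$, return the $J\in\mathcal J$ for which $\mathrm{ED}(z_I,z_J,\varepsilon_i)$ accepts. If $j>1$, move from $\mathcal J$ to the output the members of $B(j,I,i)$; for each $i'\le i$ and each $I'$ in the sample $SS(j,I,i')$, let $\mathcal J'=\bigcup_{J\in\mathcal J}\mathrm{ZoomIn}(I\times J,i,I',i')$, $\mathcal S'=\mathrm{Enumerate}(j-1,I'\times\mathcal J',i')$, and put into $\mathcal K$ all $J\in\mathcal J$ with $\mathrm{ZoomIn}(I\times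 J,i,I',i')\cap\mathcal S'\ne\emptyset$; finally output also the $J\in\mathcal K$ for which $\mathrm{ED}(z_I,z_J,\varepsilon_i)$ accepts. The candidate $(j,i,I,J)$ is *CLOSE* if $J\in\mathrm{Enumerate}(j,I\times\{J\},i)$. $\mathrm{MAIN}(n,\theta,1/2;x,y)$ performs for $j=1,\dots,k$ the following two steps. (1) For $j=1$ all $B$ and $SS$ are empty. For $j>1$ and all $I\in\mathcal I(w_j)$ and $i$: $SS(j,I,i)$ consists of $30\log_2n$ independent uniform selections from the set of the $I'\in\mathcal I(w_{j-1})$, $I'\subseteq I$, in $\mathrm{Sparse}(j-1,i)$ (it is empty if there are none), and $B(j,I,i)=\mathrm{APM}(I\times\mathcal I(w_j,\varepsilon_{i+3}),\varepsilon_{i-q_{j-1}-5},\{(I'\times J',\kappa')\in R(j-1):I'\subseteq I\})$. (2) For each $i\le q_j$ let $\mathrm{Sparse}(j,i)=\emptyset$ and $\mathrm{Dense}(j,I,i)=\mathcal I(w_j,\varepsilon_{i+3})$ for all $I \in \mathcal I(w_j)$. For each $i>q_j$ start with $\mathcal T=\mathcal I(w_j)$ and, while $\mathcal T\neq\emptyset$,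 take the first $I\in\mathcal T$ and include each element of $\mathcal I(w_j,\varepsilon_{i+3})$ in $\mathcal S$ independently with probability $p=\min(1,c_0\log_2n/d_j)$. If $|\mathrm{Enumerate}(j,I\times\mathcal S,i)|<pd_j$, put $I$ into $\mathrm{Sparse}(j,i)$ and remove it from $\mathcal T$. Otherwise let $h_1=i-q_{j-1}-7$, $h_2=i-2q_{j-1}-14$, $\mathcal X=\mathrm{Enumerate}(j,I\times\mathcal I(w_j),h_1)$, $\mathcal Y'=\mathrm{Enumerate}(j,I\times\mathcal I(w_j,\varepsilon_{h_2+3}),h_2)$, let $\mathcal Y$ be the set of $J\in\mathcal I(w_j,\varepsilon_{i+3})$ which, shifted down to the next member of $\mathcal I(w_j,\varepsilon_{h_2+3})$, are in $\mathcal Y'$, set $\mathrm{Dense}(j,I',i)=\mathcal Y$ for $I'\in\mathcal X$, and remove $\mathcal X$ from $\mathcal T$. Finally $R(j)$ consists, for all $i$, $I\in\mathcal I(w_j)$ and $J\in\mathrm{Dense}(j,I,i)$, of $(I\times J,\varepsilon_{i-q_j})$ and of $(I\times J_s,\varepsilon_{i-q_j}+2^{s+1}/w_j)$, $0\le s<\log_2w_j$,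 where $J_s=[\min J+2^s,\max J-2^s]$. After these iterations it accepts iff $\mathrm{APM}(\{0,\dots,n\}\times\{\{n,\dots,2n\}\},\theta2^{q_k+5},R(k))\neq\emptyset$. *Successful randomization* $\mathrm{SR}$ is the event that, for all $i$, all levels $j$, all $I\in\mathcal I(w_j)$ and all $J\in\mathcal I(w_j,\varepsilon_{i+3})$: (a) $\mathrm{ED}(z_I,z_J,\varepsilon_i)$ accepts if $c(I,J)\le\varepsilon_i$; (b) for $j\ge2$ and $i'\le i$, if the set $S$ of the $I'\subseteq I$ in $\mathrm{Sparse}(j-1,i')$ is non-empty and at least $|S|/3$ of the $I'\in S$ have a $J'\in\mathrm{ZoomIn}(I\times J,i,I',i')$ with $(j-1,i',I',J')$ CLOSE, then $SS(j,I,i')$ contains such an $I'$; (c) for $i>q_j$, with $N=|\mathrm{Enumerate}(j,I\times\mathcal I(w_j,\varepsilon_{i+3}),i)|$, the test of $I$ in step (2) does not declare $I$ dense if $N<d_j/2$ and does not declare it sparse if $N>2d_j$. **Theorem 5.** If the constant $c_0$ is a sufficiently large integer, then for all $n$, $\theta$, $w_1,\dots,w_{k+1}$, $d_0,\dots,d_k$,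 $x$, $y$ as above with $\theta\ge w_1^{-\zeta'}$, the event $\mathrm{SR}$ has positive probability and the expected running time of $\mathrm{MAIN}(n,\theta,1/2;x,y)$ conditioned on $\mathrm{SR}$, on a unit-cost random access machine, is at most $$C(\log n)^e\sum_{j=1}^k\frac{n}{\theta^2w_jd_j}\sum_{h=1}^jd_{h-1}w_h^{1+1/T'},$$ where $C$ and $e$ depend only on $\mathrm{ED}$, $T'$, $\zeta'$, $Q'$, $k$ and $c_0$. -/

import Mathlib

/-! ## Timed computations

A computation is a value together with the number of elementary steps spent on it.  The model is the
unit-cost random access machine with words of `O(log n)` bits: one step is a bounded number of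
word operations (arithmetic or comparison of numbers, reading or writing one cell of an array, reading
one random number, following a pointer).  Arrays are functions that are only changed by `write`, one
cell per step; lists are traversed cell by cell; every pass of every loop is charged. -/

structure Timed (α : Type*) where
  val : α
  time : ℕ

namespace Timed

instance : Monad Timed where
  pure a := ⟨a, 0⟩
  bind m f := ⟨(f m.val).val, m.time + (f m.val).time⟩

/-- Spend `c` steps. -/
def tick (c : ℕ) : Timed Unit := ⟨(), c⟩

/-- An expression that costs one step. -/
def step {α : Type} (a : α) : Timed α := ⟨a, 1⟩

/-- Write out a list, each entry of which is obtained by a bounded number of word operations. -/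
def produce {α : Type} (l : List α) : Timed (List α) := ⟨l, l.length + 1⟩

/-- Write one cell of an array. -/
def write {κ β : Type} [DecidableEq κ] (t : κ → β) (k : κ) (b : β) : Timed (κ → β) :=
  ⟨Function.update t k b, 1⟩

/-- `for x in l do b ← f b x`. -/
def foldL {α β : Type} (f : β → α → Timed β) : β → List α → Timed β
  | b, [] => step b
  | b, x :: xs => do
      tick 1
      let b' ← f b x
      foldL f b' xs

/-- The list of the values `f x`, for `x` in the list. -/
def mapL {α β : Type} (f : α → Timed β) : List α → Timed (List β)
  | [] => step []
  | x :: xs => do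
      tick 1
      let y ← f x
      let ys ← mapL f xs
      pure (y :: ys)

/-- The list of those `x` in the list that pass the test `f`. -/
def filterL {α : Type} (f : α → Timed Bool) : List α → Timed (List α)
  | [] => step []
  | x :: xs => do
      tick 1
      let b ← f x
      let ys ← filterL f xs
      pure (if b then x :: ys else ys)

/-- Whether some `x` in the list passes the test `f`. -/
def anyL {α : Type} (f : α → Timed Bool) : List α → Timed Bool
  | [] => step false
  | x :: xs => do
      tick 1
      let b ← f x
      if b then pure true else anyL f xs

/-- Concatenation of two lists. -/
def appendL {α : Type} (l l' : List α) : Timed (List α) := ⟨l ++ l', l.length + 1⟩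

/-- The concatenation of the lists `f x`, for `x` in the list. -/
def flatMapL {α β : Type} (f : α → Timed (List β)) : List α → Timed (List β)
  | [] => step []
  | x :: xs => do
      tick 1
      let ys ← f x
      let zs ← flatMapL f xs
      appendL ys zs

/-- The length of a list. -/
def lengthL {α : Type} (l : List α) : Timed ℕ := ⟨l.length, l.length + 1⟩

/-- The entry number `r` of a list, found by walking along the list. -/
def nthL (l : List ℕ) (r : ℕ) : Timed ℕ := ⟨l.getD r 0, r + 1⟩

/-- The array that holds `f k` in the cell `k` for each `k` in the list and `b₀` elsewhere. -/
def tabulate {κ β : Type} [DecidableEq κ] (b₀ : β) (f : κ → Timed β) : List κ → Timed (κ → β)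
  | [] => step (fun _ => b₀)
  | k :: ks => do
      tick 1
      let b ← f k
      let t ← tabulate b₀ f ks
      write t k b

/-- The bit array (initially zero) in which the members of a list are marked. -/
def markL {κ : Type} [DecidableEq κ] (l : List κ) : Timed (κ → Bool) :=
  tabulate false (fun _ => pure true) l

/-- Remove repetitions from a list of numbers, with the help of a bit array of the numbers met. -/
def dedupL : (ℕ → Bool) → List ℕ → Timed (List ℕ)
  | _, [] => step []
  | seen, x :: xs => do
      tick 1
      if seen x then dedupL seen xs
      else
        let seen' ← write seen x true
        let ys ← dedupL seen' xs
        pure (x :: ys)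

end Timed

open Timed

/-! ## Edit distance and gap algorithms -/

/-- `Edits u v c`: the string `u` is converted into the string `v` by `c` character insertions, deletions
and substitutions. -/
inductive Edits {σ : Type*} : List σ → List σ → ℕ → Prop
  | nil : Edits [] [] 0
  | keep (a : σ) {u v : List σ} {c : ℕ} : Edits u v c → Edits (a :: u) (a :: v) c
  | delete (a : σ) {u v : List σ} {c : ℕ} : Edits u v c → Edits (a :: u) v (c + 1)
  | insert (b : σ) {u v : List σ} {c : ℕ} : Edits u v c → Edits u (b :: v) (c + 1)
  | substitute (a b : σ) {u v : List σ} {c : ℕ} : Edits u v c → Edits (a :: u) (b :: v) (c + 1)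

/-- The edit distance of two strings: the least number of character insertions, deletions and
substitutions that convert one into the other. -/
noncomputable def editDist {σ : Type*} (u v : List σ) : ℕ := sInf {c | Edits u v c}

/-- A randomized decision algorithm on inputs `(n, θ, δ; x, y)` with `θ = 2⁻ⁱ`: on these parameters it
tosses at most `coins n i δ` fair coins, and for each outcome of the coins it has an answer (`true` is
ACCEPT, `false` is REJECT) and a running time. -/
structure GapAlg (σ : Type*) where
  coins : ℕ → ℕ → ℚ → ℕ
  run : (n i : ℕ) → (δ : ℚ) → (x y : List σ) → (Fin (coins n i δ) → Bool) → Timed Bool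

/-- Quality `Q` with respect to `(n, 2⁻ⁱ, δ)`. -/
def GapAlg.HasQuality {σ : Type*} (A : GapAlg σ) (Q : ℝ) (n i : ℕ) (δ : ℚ) : Prop :=
  ∀ x y : List σ, x.length = n → y.length = n →
    (Q * (1 / 2 : ℝ) ^ i * n < (editDist x y : ℝ) → ∀ r, (A.run n i δ x y r).val = false) ∧
    ((editDist x y : ℝ) ≤ (1 / 2 : ℝ) ^ i * n →
      (1 - (δ : ℝ)) * Fintype.card (Fin (A.coins n i δ) → Bool) ≤
        ((Finset.univ.filter fun r => (A.run n i δ x y r).val = true).card : ℝ))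

/-- The gap condition with parameters `T`, `ζ`, `Q`: quality `Q` and running time
`Õ(n^(1 + 1/T) log(1/δ))`, for `n` a power of two and `n^(-ζ) ≤ θ ≤ 1`.  The summands `1` keep the
bound positive for `n = 1` and for `δ` near `1`. -/
def GapAlg.GapCondition {σ : Type*} (A : GapAlg σ) (T ζ Q : ℝ) : Prop :=
  ∃ (C : ℝ) (e : ℕ), ∀ n i : ℕ, (∃ s, n = 2 ^ s) → (n : ℝ) ^ (-ζ) ≤ (1 / 2 : ℝ) ^ i →
    ∀ δ : ℚ, 0 < δ → δ < 1 →
      A.HasQuality Q n i δ ∧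
      ∀ x y : List σ, x.length = n → y.length = n → ∀ r,
        ((A.run n i δ x y r).time : ℝ) ≤
          C * (1 + Real.log n) ^ e * (n : ℝ) ^ (1 + 1 / T) * (1 + Real.log (1 / (δ : ℝ)))

/-! ## Parameters -/

/-- The parameters of the algorithm: the length `n`, the number `a` with `θ = 2⁻ᵃ`, the number `k` of
levels, the quality exponent `q₀` of the slow algorithm, the sampling constant `c₀`, and the widths
`w 1, …, w (k+1)` and densities `d 0, …, d k`. -/
structure Params where
  n : ℕ
  a : ℕ
  k : ℕ
  q₀ : ℕ
  c₀ : ℕ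
  w : ℕ → ℕ
  d : ℕ → ℕ

namespace Params

/-- The gap parameter `θ`. -/
noncomputable def θ (p : Params) : ℝ := (1 / 2 : ℝ) ^ p.a

/-- The quality parameters. -/
def q (p : Params) : ℕ → ℕ
  | 0 => p.q₀
  | j + 1 => 3 * p.q j + 21

/-- `p · d_j` where `p = min(1, c₀ log n / d_j)` is the sampling rate at level `j`. -/
def threshold (p : Params) (j : ℕ) : ℕ := min (p.d j) (p.c₀ * Nat.log 2 p.n)

/-- The standing assumptions on the parameters. -/
structure Valid (p : Params) : Prop where
  n_pow : ∃ s, p.n = 2 ^ s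
  k_pos : 1 ≤ p.k
  w_pow : ∀ j, 1 ≤ j → j ≤ p.k + 1 → ∃ s, p.w j = 2 ^ s
  d_pow : ∀ j, j ≤ p.k → ∃ s, p.d j = 2 ^ s
  w_first : p.w 1 = 2 ^ Nat.log 2 (Nat.sqrt p.n)
  w_lt : ∀ j, 1 ≤ j → j ≤ p.k → p.w j < p.w (j + 1)
  w_last : p.w (p.k + 1) = p.n
  d_first : p.d 0 = 2 ^ Nat.log 2 (Nat.sqrt p.n)
  d_lt : ∀ j, j < p.k → p.d (j + 1) < p.d j
  d_last : p.d p.k = 1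
  density : ∀ j, 1 ≤ j → j ≤ p.k → (p.d j : ℝ) ≤ (p.n : ℝ) / p.w j
  ratio : ∀ j, 1 ≤ j → j ≤ p.k → (p.w j : ℝ) / p.w (j + 1) ≤ p.θ / 2

end Params

/-- `ε_i = 2⁻ⁱ`. -/
def eps (i : ℤ) : ℚ := (2 : ℚ) ^ (-i)

/-! ## Intervals

An interval is represented by its minimum, its width being known from the level.  The interval with
minimum `I` and width `w` indexes the characters of `z` number `I + 1, …, I + w`. -/

/-- The substring indexed by the interval of width `w` with minimum `I`. -/
def substr {σ : Type*} (z : List σ) (w I : ℕ) : List σ := (z.drop I).take w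

/-- The aligned intervals of width `w` inside `{0, …, n}`. -/
def aligned (n w : ℕ) : List ℕ := (List.range (n / w)).map fun t => t * w

/-- The aligned intervals of width `w'` inside the interval of width `w` with minimum `I`. -/
def alignedIn (w w' I : ℕ) : List ℕ := (List.range (w / w')).map fun t => I + t * w'

/-- `max(ε_{i+3} w, 1)` for `w` a power of two: the minima of `ε_{i+3}`-aligned intervals of width `w`
are the multiples of this number. -/
def gridStep (w i : ℕ) : ℕ := max (w / 2 ^ (i + 3)) 1

/-- The `ε_{i+3}`-aligned intervals of width `w` inside `{0, …, 2n}`. -/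
def grid (n w i : ℕ) : List ℕ :=
  (List.range ((2 * n - w) / gridStep w i + 1)).map fun t => t * gridStep w i

/-- Shift an interval of width `w` down to the next `ε_{h+3}`-aligned one. -/
def roundDown (w h J : ℕ) : ℕ := J / gridStep w h * gridStep w h

/-- ZoomIn: for the box `I × J` of width `w` and the interval `I' ⊆ I` of width `w'`, the
`ε_{i'+3}`-aligned intervals `J' ⊆ J` of width `w'` such that the displacement
`|(J' - J) - (I' - I)|` of `I' × J'` with respect to `I × J` is at most `2 ε_i w`. -/
def zoomIn (w w' I J i I' i' : ℕ) : List ℕ :=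
  let g := gridStep w' i'
  let c := J + (I' - I)
  let r := 2 * w / 2 ^ i
  let lo := max J (c - r)
  let hi := min (J + w - w') (c + r)
  let s := (lo + g - 1) / g
  (List.range (hi / g + 1 - s)).map fun t => (s + t) * g

/-! ## Approximate pattern match -/

/-- A weighted box `(I × {lo, …, hi}, κ)`; the interval `I` is known from the context. -/
structure WBox where
  lo : ℕ
  hi : ℕ
  κ : ℚ

/-- The boxes induced by the box `(I × J, κ)`, `I` and `J` of width `w`. -/
def induced (w J : ℕ) (κ : ℚ) : List WBox :=
  ⟨J, J + w, κ⟩ ::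
    (List.range (Nat.log 2 w)).map fun s => ⟨J + 2 ^ s, J + w - 2 ^ s, κ + 2 ^ (s + 1) / w⟩

/-- A binary tree over the keys below a power of two; each node stores the maximum of the values of the
keys below it.  Keys without a value have the value `0`, and subtrees without values are not built. -/
inductive MaxTree where
  | empty : MaxTree
  | node (a : ℚ) (l r : MaxTree) : MaxTree

namespace MaxTree

def top : MaxTree → ℚ
  | empty => 0
  | node a _ _ => a

def left : MaxTree → MaxTree
  | empty => empty
  | node _ l _ => l

def right : MaxTree → MaxTree
  | empty => empty
  | node _ _ r => r

/-- In a tree of depth `m`, raise the value of the key `y < 2 ^ m` to at least `v`. -/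
def raise : ℕ → MaxTree → ℕ → ℚ → Timed MaxTree
  | 0, t, _, v => step (node (max t.top v) empty empty)
  | m + 1, t, y, v => do
      tick 1
      if y < 2 ^ m then
        let l ← raise m t.left y v
        pure (node (max t.top v) l t.right)
      else
        let r ← raise m t.right (y - 2 ^ m) v
        pure (node (max t.top v) t.left r)

/-- In a tree of depth `m`, the maximum of the values of the keys up to `y < 2 ^ m`. -/
def prefixMax : ℕ → MaxTree → ℕ → Timed ℚ
  | 0, t, _ => step t.top
  | m + 1, t, y => do
      tick 1
      if y < 2 ^ m then prefixMax m t.left y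
      else
        let v ← prefixMax m t.right (y - 2 ^ m)
        pure (max t.left.top v)

end MaxTree

/-- APM with input the stack `I × 𝒥` (all intervals of width `w`), the number `κ`, and the weighted boxes
`cols`, listed column by column: the boxes of the `t`-th list have as horizontal projection the `t`-th
aligned interval of width `w'` in `I`.  A shortcut from `(min I', lo)` to `(max I', hi)` of weight
`κ' w'` has the benefit `w' + (hi - lo) - κ' w'`, horizontal and vertical edges have benefit `0`, and
the auxiliary edges of cost `0` from `(min I, 0)` to `(min I, J)` have the benefit `J`.  After a column
has been treated, the tree holds at `y` the largest benefit of a path whose last shortcut ends at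
height `y`.  The answer consists of the `J` for which the cheapest path from `(min I, 0)` to
`(max I, max J)` costs at most `κ w`.  The parameter `m` is a depth with `2n < 2 ^ m`. -/
def apm (m w w' : ℕ) (κ : ℚ) (cols : List (List WBox)) (𝒥 : List ℕ) : Timed (List ℕ) := do
  let t₀ ← foldL (fun t J => MaxTree.raise m t J J) MaxTree.empty 𝒥
  let t ← foldL (fun t col => do
      let heads ← mapL (fun e : WBox => do
          let v ← MaxTree.prefixMax m t e.lo
          step (e.hi, v + ((w' : ℚ) + ((e.hi : ℚ) - e.lo) - e.κ * w'))) col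
      foldL (fun t (yv : ℕ × ℚ) => MaxTree.raise m t yv.1 yv.2) t heads) t₀ cols
  filterL (fun J => do
      let v ← MaxTree.prefixMax m t (J + w)
      step (decide ((w : ℚ) + (J + w) - v ≤ κ * w))) 𝒥

/-! ## The algorithm -/

/-- The random numbers read by a run.  `bits` is the one string of fair bits of which every call of the
slow algorithm uses a prefix; the bits are generated when they are read, at the expense of that call.
`pick j I i t m` is the number below `m` that makes the `t`-th selection from `m` elements for the
sample of `(j, I, i)`.  `draw j I i J` is the number below `d j` that decides whether `J` belongs to the
random set used to test `I` at level `j` for `i`. -/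
structure Randomness where
  bits : ℕ → Bool
  pick : ℕ → ℕ → ℕ → ℕ → ℕ → ℕ
  draw : ℕ → ℕ → ℕ → ℕ → ℕ

/-- The data computed at one level: `below (I, i)` is the bit array of the set of intervals close to `I`
found by pattern matching, `sample (I, i)` the sample of sparse subintervals of `I`, `sparse i` the bit
array of the intervals declared sparse for `i`, and `boxes I` the weighted boxes on `I`. -/
structure Level where
  below : ℕ × ℕ → ℕ → Bool
  sample : ℕ × ℕ → List ℕ
  sparse : ℕ → ℕ → Bool
  boxes : ℕ → List WBox

/-- The data of a level that has not been treated. -/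
def Level.init : Level := ⟨fun _ _ => false, fun _ => [], fun _ _ => false, fun _ => []⟩

/-- What is fixed during a run: parameters, slow algorithm, the string `z = xy`, random numbers. -/
structure Env (σ : Type*) where
  p : Params
  A : GapAlg σ
  z : List σ
  ω : Randomness

namespace Env

variable {σ : Type*} (E : Env σ)

/-- The call of the slow algorithm on `z_I`, `z_J` with gap `ε_i` and error `n⁻¹²`, for intervals of width
`w j`; the two substrings are copied for it. -/
def callED (j I J i : ℕ) : Timed Bool := do
  tick (2 * E.p.w j + 1)
  E.A.run (E.p.w j) i (((E.p.n : ℚ) ^ 12)⁻¹) (substr E.z (E.p.w j) I) (substr E.z (E.p.w j) J)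
    (fun t => E.ω.bits t)

/-- ZoomIn for the stack `I × 𝒥` at level `j`. -/
def zoomInStack (j I : ℕ) (𝒥 : List ℕ) (i I' i' : ℕ) : Timed (List ℕ) := do
  let l ← flatMapL (fun J => produce (zoomIn (E.p.w j) (E.p.w (j - 1)) I J i I' i')) 𝒥
  dedupL (fun _ => false) l

/-- Enumerate`(j, I × 𝒥, i)`. -/
def enumerate (D : ℕ → Level) : (j I : ℕ) → (𝒥 : List ℕ) → (i : ℕ) → Timed (List ℕ)
  | 0, _, _, _ => step []
  | 1, I, 𝒥, i => filterL (fun J => E.callED 1 I J i) 𝒥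
  | j + 2, I, 𝒥, i => do
      let S₀ ← filterL (fun J => step ((D (j + 2)).below (I, i) J)) 𝒥
      let 𝒥₁ ← filterL (fun J => step (!(D (j + 2)).below (I, i) J)) 𝒥
      let i's ← produce (List.range (i + 1))
      let K ← foldL (fun K i' =>
        foldL (fun K I' => do
          let 𝒥' ← E.zoomInStack (j + 2) I 𝒥₁ i I' i'
          let S' ← enumerate D (j + 1) I' 𝒥' i'
          let inS' ← markL S'
          foldL (fun K J => do
            let zs ← produce (zoomIn (E.p.w (j + 2)) (E.p.w (j + 1)) I J i I' i')
            let hit ← anyL (fun J' => step (inS' J')) zs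
            if hit then write K J true else pure K) K 𝒥₁)
          K ((D (j + 2)).sample (I, i')))
        (fun _ => false) i's
      let S₁ ← filterL (fun J => do
        let b ← step (K J)
        if b then E.callED (j + 2) I J i else pure false) 𝒥₁
      appendL S₀ S₁

/-- The sample `(j, I, i)`: empty if no subinterval of `I` of level `j - 1` is sparse for `i`, and otherwise
`30 log n` independent uniform selections from the sparse ones. -/
def sparseSample (D : ℕ → Level) (j I i : ℕ) : Timed (List ℕ) := do
  let subs ← produce (alignedIn (E.p.w j) (E.p.w (j - 1)) I)
  let sp ← filterL (fun I' => step ((D (j - 1)).sparse i I')) subs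
  let m ← lengthL sp
  if m = 0 then pure []
  else
    let ts ← produce (List.range (30 * Nat.log 2 E.p.n))
    mapL (fun t => do
      let r ← step (E.ω.pick j I i t m)
      nthL sp r) ts

/-- The bit array of the set of intervals close to `I` found by pattern matching at level `j`. -/
def findBelow (D : ℕ → Level) (j I i : ℕ) : Timed (ℕ → Bool) := do
  let subs ← produce (alignedIn (E.p.w j) (E.p.w (j - 1)) I)
  let cols ← mapL (fun I' => step ((D (j - 1)).boxes I')) subs
  let 𝒥 ← produce (grid E.p.n (E.p.w j) i)
  let out ← apm (Nat.log 2 E.p.n + 2) (E.p.w j) (E.p.w (j - 1))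
    (eps ((i : ℤ) - E.p.q (j - 1) - 5)) cols 𝒥
  markL out

/-- The pairs `(I, i)` of level `j`. -/
def pairs (j : ℕ) : List (ℕ × ℕ) :=
  (List.range (E.p.a + 1)).flatMap fun i => (aligned E.p.n (E.p.w j)).map fun I => (I, i)

/-- Preprocess`(j)`. -/
def preprocess (D : ℕ → Level) (j : ℕ) : Timed (ℕ → Level) := do
  if j = 1 then write D 1 Level.init
  else
    let ps ← produce (E.pairs j)
    let sample ← tabulate [] (fun Ii : ℕ × ℕ => E.sparseSample D j Ii.1 Ii.2) ps
    let below ← tabulate (fun _ => false) (fun Ii : ℕ × ℕ => E.findBelow D j Ii.1 Ii.2) ps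
    write D j ⟨below, sample, fun _ _ => false, fun _ => []⟩

/-- The random set used to test `I` at level `j` for `i`: each `ε_{i+3}`-aligned interval is included
independently with probability `min(1, c₀ log n / d_j)`. -/
def drawSet (j I i : ℕ) : Timed (List ℕ) := do
  let 𝒥 ← produce (grid E.p.n (E.p.w j) i)
  filterL (fun J => step (decide (E.ω.draw j I i J < E.p.threshold j))) 𝒥

/-- The test by which `I` is declared sparse (`true`) or dense (`false`). -/
def testSparse (D : ℕ → Level) (j I i : ℕ) : Timed Bool := do
  let S ← E.drawSet j I i
  let out ← E.enumerate D j I S i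
  let m ← lengthL out
  step (decide (m < E.p.threshold j))

/-- The while loop of ProcessDense`(j)` for `i`, on the list of the unprocessed intervals and on the two arrays
that hold the sparse intervals and the dense neighborhoods.  The first argument bounds the number of
rounds; the loop is called with the number of intervals, and a round removes at least its own interval
whenever the slow algorithm makes no error and the samples are successful. -/
def denseLoop (D : ℕ → Level) (j i : ℕ) :
    ℕ → List ℕ → (ℕ → Bool) × (ℕ → List ℕ) → Timed ((ℕ → Bool) × (ℕ → List ℕ))
  | 0, _, out => step out
  | _ + 1, [], out => step out
  | f + 1, I :: 𝒯, (sp, dn) => do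
      tick 1
      let sparse ← E.testSparse D j I i
      if sparse then
        let sp' ← write sp I true
        denseLoop D j i f 𝒯 (sp', dn)
      else
        let h₁ := i - E.p.q (j - 1) - 7
        let h₂ := i - 2 * E.p.q (j - 1) - 14
        let 𝒥₁ ← produce (aligned E.p.n (E.p.w j))
        let X ← E.enumerate D j I 𝒥₁ h₁
        let 𝒥₂ ← produce (grid E.p.n (E.p.w j) h₂)
        let Y' ← E.enumerate D j I 𝒥₂ h₂
        let inY' ← markL Y'
        let 𝒥 ← produce (grid E.p.n (E.p.w j) i)
        let Y ← filterL (fun J => step (inY' (roundDown (E.p.w j) h₂ J))) 𝒥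
        let dn' ← foldL (fun dn I' => write dn I' Y) dn X
        let inX ← markL X
        let 𝒯' ← filterL (fun I' => step (!inX I')) (I :: 𝒯)
        denseLoop D j i f 𝒯' (sp, dn')

/-- The part of ProcessDense`(j)` for one `i`: the sparse intervals and the dense neighborhoods. -/
def denseFor (D : ℕ → Level) (j i : ℕ) : Timed ((ℕ → Bool) × (ℕ → List ℕ)) := do
  let 𝒯 ← produce (aligned E.p.n (E.p.w j))
  if i ≤ E.p.q j then
    let 𝒥 ← produce (grid E.p.n (E.p.w j) i)
    let dn ← tabulate [] (fun _ => pure 𝒥) 𝒯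
    pure (fun _ => false, dn)
  else
    let f ← lengthL 𝒯
    E.denseLoop D j i f 𝒯 (fun _ => false, fun _ => [])

/-- ProcessDense`(j)`. -/
def processDense (D : ℕ → Level) (j : ℕ) : Timed (ℕ → Level) := do
  let is ← produce (List.range (E.p.a + 1))
  let res ← tabulate (fun _ => false, fun _ => []) (fun i => E.denseFor D j i) is
  let Is ← produce (aligned E.p.n (E.p.w j))
  let boxes ← tabulate [] (fun I =>
    flatMapL (fun i : ℕ =>
      flatMapL (fun J => produce (induced (E.p.w j) J (eps ((i : ℤ) - E.p.q j)))) ((res i).2 I)) is) Is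
  write D j ⟨(D j).below, (D j).sample, fun i => (res i).1, boxes⟩

/-- The first `j` iterations. -/
def levels : ℕ → Timed (ℕ → Level)
  | 0 => step (fun _ => Level.init)
  | j + 1 => do
      let D ← levels j
      let D' ← E.preprocess D (j + 1)
      E.processDense D' (j + 1)

/-- All the iterations and the final call of the pattern match. -/
def run : Timed Bool := do
  let D ← E.levels E.p.k
  let Is ← produce (aligned E.p.n (E.p.w E.p.k))
  let cols ← mapL (fun I => step ((D E.p.k).boxes I)) Is
  let out ← apm (Nat.log 2 E.p.n + 2) E.p.n (E.p.w E.p.k)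
    (eps ((E.p.a : ℤ) - E.p.q E.p.k - 5)) cols [E.p.n]
  step (!out.isEmpty)

/-! ## Successful randomization -/

/-- The data at the end of the run; those of a level do not change after the iteration of that level. -/
def data : ℕ → Level := (E.levels E.p.k).val

/-- The level `j` candidate given by `i`, `I`, `J` is classified as CLOSE. -/
def Close (j I J i : ℕ) : Prop := J ∈ (E.enumerate E.data j I [J] i).val

/-- No call of the slow algorithm fails. -/
def GoodED : Prop :=
  ∀ j, 1 ≤ j → j ≤ E.p.k → ∀ i, i ≤ E.p.a →
    ∀ I ∈ aligned E.p.n (E.p.w j), ∀ J ∈ grid E.p.n (E.p.w j) i,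
      (editDist (substr E.z (E.p.w j) I) (substr E.z (E.p.w j) J) : ℚ) ≤ eps i * E.p.w j →
        (E.callED j I J i).val = true

/-- The subintervals of `I` of level `j - 1` that are sparse for `i`. -/
def sparseIn (j I i : ℕ) : Finset ℕ :=
  (alignedIn (E.p.w j) (E.p.w (j - 1)) I).toFinset.filter fun I' => (E.data (j - 1)).sparse i I' = true

open Classical in
/-- The `I'` such that `(I', i')` is a marker for the level `j` candidate given by `i`, `I`, `J`. -/
noncomputable def winners (j I J i i' : ℕ) : Finset ℕ :=
  (E.sparseIn j I i').filter fun I' =>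
    ∃ J' ∈ zoomIn (E.p.w j) (E.p.w (j - 1)) I J i I' i', E.Close (j - 1) I' J' i'

/-- All samples of level `j` are successful: whenever at least a third of the sparse subintervals of
`I` are markers, the sample contains one. -/
def GoodSamples (j : ℕ) : Prop :=
  ∀ I ∈ aligned E.p.n (E.p.w j), ∀ i, i ≤ E.p.a → ∀ J ∈ grid E.p.n (E.p.w j) i, ∀ i', i' ≤ i →
    (E.sparseIn j I i').Nonempty →
    (E.sparseIn j I i').card ≤ 3 * (E.winners j I J i i').card →
      ∃ I' ∈ (E.data j).sample (I, i'), I' ∈ E.winners j I J i i'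

/-- Successful sampling in ProcessDense`(j)`: no interval that is tested with less than `d_j / 2` close
intervals is declared dense, and none with more than `2 d_j` is declared sparse.  Each interval has its
own random set, whether or not it comes to be tested. -/
def GoodTests (j : ℕ) : Prop :=
  ∀ I ∈ aligned E.p.n (E.p.w j), ∀ i, E.p.q j < i → i ≤ E.p.a →
    (2 * (E.enumerate E.data j I (grid E.p.n (E.p.w j) i) i).val.length < E.p.d j →
      (E.testSparse E.data j I i).val = true) ∧
    (2 * E.p.d j < (E.enumerate E.data j I (grid E.p.n (E.p.w j) i) i).val.length →
      (E.testSparse E.data j I i).val = false)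

/-- Successful randomization. -/
def Success : Prop :=
  E.GoodED ∧ (∀ j, 2 ≤ j → j ≤ E.p.k → E.GoodSamples j) ∧ ∀ j, 1 ≤ j → j ≤ E.p.k → E.GoodTests j

end Env

/-! ## The probability space and the expected running time -/

/-- A number of bits that suffices for every call of the slow algorithm. -/
def coinBound {σ : Type*} (p : Params) (A : GapAlg σ) : ℕ :=
  (Finset.Icc 1 p.k ×ˢ Finset.range (p.a + 1)).sup fun ji =>
    A.coins (p.w ji.1) ji.2 (((p.n : ℚ) ^ 12)⁻¹)

/-- The outcomes of the random choices.  All coordinates are independent and uniform: `b` fair bits;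
for each `j`, `I`, `i`, `t`, and each possible number `m + 1` of elements to select from, a number below
`m + 1`; and for each `j`, `I`, `i`, `J` a number below `d_j`. -/
abbrev Outcome (p : Params) (b : ℕ) : Type :=
  (Fin b → Bool) ×
  (Fin (p.k + 1) → Fin (p.n + 1) → Fin (p.a + 1) → Fin (30 * Nat.log 2 p.n) →
    (m : Fin p.n) → Fin (m.val + 1)) ×
  ((j : Fin (p.k + 1)) → Fin (p.n + 1) → Fin (p.a + 1) → Fin (2 * p.n + 1) → Fin (p.d j))

/-- The random numbers given by an outcome (`0` outside the ranges that occur). -/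
def Outcome.toRandomness {p : Params} {b : ℕ} (ω : Outcome p b) : Randomness where
  bits t := if h : t < b then ω.1 ⟨t, h⟩ else false
  pick j I i t m :=
    if h : (j < p.k + 1 ∧ I < p.n + 1) ∧ (i < p.a + 1 ∧ t < 30 * Nat.log 2 p.n) ∧ m - 1 < p.n then
      (ω.2.1 ⟨j, h.1.1⟩ ⟨I, h.1.2⟩ ⟨i, h.2.1.1⟩ ⟨t, h.2.1.2⟩ ⟨m - 1, h.2.2⟩).val
    else 0
  draw j I i J :=
    if h : (j < p.k + 1 ∧ I < p.n + 1) ∧ i < p.a + 1 ∧ J < 2 * p.n + 1 then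
      (ω.2.2 ⟨j, h.1.1⟩ ⟨I, h.1.2⟩ ⟨i, h.2.1⟩ ⟨J, h.2.2⟩).val
    else 0

section Main

variable {σ : Type*} (p : Params) (A : GapAlg σ) (x y : List σ)

/-- What is fixed during the run of MAIN on the strings `x`, `y` for the outcome `ω`. -/
def mainEnv (ω : Outcome p (coinBound p A)) : Env σ := ⟨p, A, x ++ y, Outcome.toRandomness ω⟩

/-- MAIN`(n, θ, 1/2; x, y)`: the concatenation of the strings, the iterations, and the final answer. -/
def mainAlg (ω : Outcome p (coinBound p A)) : Timed Bool := do
  tick (x.length + y.length + 1)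
  (mainEnv p A x y ω).run

open Classical in
/-- The set of outcomes with successful randomization. -/
noncomputable def successSet : Finset (Outcome p (coinBound p A)) :=
  Finset.univ.filter fun ω => (mainEnv p A x y ω).Success

/-- The expected running time of MAIN, conditioned on successful randomization: the outcomes are uniformly
distributed, so it is the average over those with successful randomization. -/
noncomputable def condExpTime : ℝ :=
  (∑ ω ∈ successSet p A x y, ((mainAlg p A x y ω).time : ℝ)) / (successSet p A x y).card

end Main

-- Enumerate judges candidate by candidate: on any list its answer is, up to order, the list
-- filtered by one Boolean function `closeB` (`enumerate_perm`). Hence a call on a random subset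
-- returns the drawn part of a fixed set, and the time of a call is bounded by an overhead plus a
-- share `cost` of each candidate (`enumerate_time_le`).
--
-- On successful randomization CLOSE lies between two distance conditions: every candidate at
-- distance at most ε_i w_j is CLOSE (`closeComplete`), and every CLOSE candidate has distance at
-- most ε_{i-q_{j-1}-6} w_j (`closeSound`). Soundness is an induction on the level: all weighted
-- boxes are certified by edit distances, and a path of the pattern match concatenates certificates.
-- For completeness an optimal alignment of I with J is cut into blocks of the next smaller width.
-- Suppose that no sampled subinterval is a marker. Then at each scale i' at most a third of the
-- sparse blocks are markers, while a sparse block with a cheap alignment is a marker; so the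
-- markers are at most half as many as the blocks that are expensive at scale i'. Summing the
-- geometric series over the scales, the extra cost of replacing sparse blocks by coarser dense
-- boxes is O(ε_i w_j), up to the factor of the box quality. Thus the pattern match finds J
-- (`closeComplete_succ`).
--
-- Rounds that declare an interval dense: two intervals with a common CLOSE candidate are so near to
-- each other that one is removed in the round of the other. So the CLOSE sets of the intervals
-- declared dense are disjoint; each has at least d_j/2 members among O(n/(θ w_j)) candidates, and
-- there are O(n/(θ w_j d_j)) such rounds (`denseLoop_time_le`).
--
-- Cost of all candidates for one interval: at level 1 there are O(d_0/θ) calls of the slow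
-- algorithm, as n ≤ 2 w_1^2 and w_1 = d_0. At a level h > 1 it is called only for candidates with a
-- CLOSE marker in a sample. Sampled intervals are sparse, so each has at most 2 d_{h-1} CLOSE
-- candidates, each found by ZoomIn from at most 33 candidates of level h. The total is θ^{-1} Σ
-- d_{h-1} w_h^{1+1/T'} up to polylogarithmic factors (`sum_cost_le`, `costBound_le`).
--
-- Multiplying the two gives the claimed sum. The tests contribute no more: there are n/w_j
-- intervals for each scale, and a test pays in expectation only a fraction c_0 log n / d_j of the
-- cost above, since the draws of level j are independent of the costs at level j
-- (`sum_testCost_le`). All other work is n/θ up to polylogarithmic factors and is absorbed by the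
-- sum (`le_levelSum`).
--
-- Each possible failure concerns random coordinates that are independent of the set they are tested
-- against, so elementary tail bounds and a union bound show that the randomization fails with
-- probability at most 1/2 (`prob_not_success_le`). In particular success has positive probability,
-- and conditioning on it at most doubles the expectation of a nonnegative quantity.

universe u

/-! ### Values and running times of the timed combinators -/

namespace Timed

@[simp] theorem bind_val {α β : Type u} (m : Timed α) (f : α → Timed β) :
    (m >>= f).val = (f m.val).val := rfl

@[simp] theorem bind_time {α β : Type u} (m : Timed α) (f : α → Timed β) :
    (m >>= f).time = m.time + (f m.val).time := rfl

@[simp] theorem pure_val {α : Type*} (a : α) : (pure a : Timed α).val = a := rfl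
@[simp] theorem pure_time {α : Type*} (a : α) : (pure a : Timed α).time = 0 := rfl
@[simp] theorem tick_val (c : ℕ) : (tick c).val = () := rfl
@[simp] theorem tick_time (c : ℕ) : (tick c).time = c := rfl
@[simp] theorem step_val {α : Type} (a : α) : (step a).val = a := rfl
@[simp] theorem step_time {α : Type} (a : α) : (step a).time = 1 := rfl
@[simp] theorem produce_val {α : Type} (l : List α) : (produce l).val = l := rfl
@[simp] theorem produce_time {α : Type} (l : List α) : (produce l).time = l.length + 1 := rfl
@[simp] theorem appendL_val {α : Type} (l l' : List α) : (appendL l l').val = l ++ l' := rfl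
@[simp] theorem appendL_time {α : Type} (l l' : List α) :
    (appendL l l').time = l.length + 1 := rfl
@[simp] theorem lengthL_val {α : Type} (l : List α) : (lengthL l).val = l.length := rfl
@[simp] theorem lengthL_time {α : Type} (l : List α) : (lengthL l).time = l.length + 1 := rfl
@[simp] theorem nthL_val (l : List ℕ) (r : ℕ) : (nthL l r).val = l.getD r 0 := rfl
@[simp] theorem nthL_time (l : List ℕ) (r : ℕ) : (nthL l r).time = r + 1 := rfl
@[simp] theorem write_val {κ β : Type} [DecidableEq κ] (t : κ → β) (k : κ) (b : β) :
    (write t k b).val = Function.update t k b := rfl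
@[simp] theorem write_time {κ β : Type} [DecidableEq κ] (t : κ → β) (k : κ) (b : β) :
    (write t k b).time = 1 := rfl

theorem foldL_val {α β : Type} (f : β → α → Timed β) (b : β) (l : List α) :
    (foldL f b l).val = l.foldl (fun b x => (f b x).val) b := by
  induction l generalizing b with
  | nil => rfl
  | cons x xs ih => simp [foldL, ih]

/-- Each pass is bounded uniformly in the state of the loop, so that no invariant has to be carried
along. -/
theorem foldL_time_le {α β : Type} {f : β → α → Timed β} {g : α → ℕ} {l : List α}
    (h : ∀ b, ∀ x ∈ l, (f b x).time ≤ g x) (b : β) :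
    (foldL f b l).time ≤ 1 + (l.map fun x => 1 + g x).sum := by
  induction l generalizing b with
  | nil => simp [foldL]
  | cons x xs ih =>
    have h1 := ih (fun b y hy => h b y (List.mem_cons_of_mem _ hy)) (f b x).val
    have h2 := h b x List.mem_cons_self
    simp only [foldL, bind_time, tick_time, List.map_cons, List.sum_cons] at *
    omega

theorem mapL_val {α β : Type} (f : α → Timed β) (l : List α) :
    (mapL f l).val = l.map fun x => (f x).val := by
  induction l with
  | nil => rfl
  | cons x xs ih => simp [mapL, ih]

theorem mapL_time {α β : Type} (f : α → Timed β) (l : List α) :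
    (mapL f l).time = 1 + (l.map fun x => 1 + (f x).time).sum := by
  induction l with
  | nil => rfl
  | cons x xs ih => simp [mapL, ih]; omega

theorem filterL_val {α : Type} (f : α → Timed Bool) (l : List α) :
    (filterL f l).val = l.filter fun x => (f x).val := by
  induction l with
  | nil => rfl
  | cons x xs ih => simp [filterL, ih, List.filter_cons]

theorem filterL_time {α : Type} (f : α → Timed Bool) (l : List α) :
    (filterL f l).time = 1 + (l.map fun x => 1 + (f x).time).sum := by
  induction l with
  | nil => rfl
  | cons x xs ih => simp [filterL, ih]; omega

theorem anyL_val {α : Type} (f : α → Timed Bool) (l : List α) :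
    (anyL f l).val = l.any fun x => (f x).val := by
  induction l with
  | nil => rfl
  | cons x xs ih =>
    cases h : (f x).val <;> simp [anyL, ih, h]

theorem anyL_time_le {α : Type} (f : α → Timed Bool) (l : List α) :
    (anyL f l).time ≤ 1 + (l.map fun x => 1 + (f x).time).sum := by
  induction l with
  | nil => simp [anyL]
  | cons x xs ih =>
    simp only [List.map_cons, List.sum_cons]
    cases h : (f x).val <;> simp only [anyL, bind_time, tick_time, h, if_true,
      Bool.false_eq_true, if_false, pure_time] <;> omega

theorem flatMapL_val {α β : Type} (f : α → Timed (List β)) (l : List α) :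
    (flatMapL f l).val = l.flatMap fun x => (f x).val := by
  induction l with
  | nil => rfl
  | cons x xs ih => simp [flatMapL, ih, List.flatMap_cons]

/-- The length of each partial result enters because `appendL` traverses its first argument. -/
theorem flatMapL_time {α β : Type} (f : α → Timed (List β)) (l : List α) :
    (flatMapL f l).time = 1 + (l.map fun x => 2 + (f x).time + (f x).val.length).sum := by
  induction l with
  | nil => rfl
  | cons x xs ih => simp [flatMapL, ih]; omega

theorem tabulate_val {κ β : Type} [DecidableEq κ] (b₀ : β) (f : κ → Timed β) (l : List κ) (k : κ) :
    (tabulate b₀ f l).val k = if k ∈ l then (f k).val else b₀ := by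
  induction l with
  | nil => simp [tabulate]
  | cons x xs ih =>
    by_cases h : k = x
    · subst h; simp [tabulate]
    · simp [tabulate, ih, h]

theorem tabulate_time {κ β : Type} [DecidableEq κ] (b₀ : β) (f : κ → Timed β) (l : List κ) :
    (tabulate b₀ f l).time = 1 + (l.map fun x => 2 + (f x).time).sum := by
  induction l with
  | nil => rfl
  | cons x xs ih => simp [tabulate, ih]; omega

theorem markL_val {κ : Type} [DecidableEq κ] (l : List κ) (k : κ) :
    (markL l).val k = decide (k ∈ l) := by
  simp only [markL, tabulate_val, pure_val]
  split_ifs with h <;> simp [h]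

theorem markL_time {κ : Type} [DecidableEq κ] (l : List κ) :
    (markL l).time = 1 + 2 * l.length := by
  simp [markL, tabulate_time, mul_comm]

theorem dedupL_sublist (seen : ℕ → Bool) (l : List ℕ) : (dedupL seen l).val.Sublist l := by
  induction l generalizing seen with
  | nil => simp [dedupL]
  | cons x xs ih =>
    cases h : seen x
    · simpa [dedupL, h] using ih _
    · simpa [dedupL, h] using (ih seen).cons x

theorem mem_dedupL (seen : ℕ → Bool) (l : List ℕ) (x : ℕ) :
    x ∈ (dedupL seen l).val ↔ x ∈ l ∧ seen x = false := by
  induction l generalizing seen with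
  | nil => simp [dedupL]
  | cons y ys ih =>
    cases h : seen y
    · by_cases hxy : x = y
      · subst hxy; simp [dedupL, h]
      · simp [dedupL, h, ih, hxy]
    · by_cases hxy : x = y
      · subst hxy; simp [dedupL, h, ih]
      · simp [dedupL, h, ih, hxy]

theorem dedupL_time_le (seen : ℕ → Bool) (l : List ℕ) :
    (dedupL seen l).time ≤ 1 + 2 * l.length := by
  induction l generalizing seen with
  | nil => simp [dedupL]
  | cons y ys ih =>
    cases h : seen y
    · have := ih (Function.update seen y true)
      simp [dedupL, h]; omega
    · have := ih seen
      simp [dedupL, h]; omega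

end Timed

/-! ### Sums over lists -/

theorem List.sum_map_le_sum_map' {α : Type*} {f g : α → ℕ} {l : List α}
    (h : ∀ x ∈ l, f x ≤ g x) : (l.map f).sum ≤ (l.map g).sum :=
  List.sum_le_sum h

theorem List.sum_map_le_length_mul {α : Type*} {f : α → ℕ} {l : List α} {c : ℕ}
    (h : ∀ x ∈ l, f x ≤ c) : (l.map f).sum ≤ l.length * c := by
  simpa using List.sum_le_card_nsmul (l.map f) c (by simpa using h)

theorem List.Sublist.sum_map_le {α : Type*} {l l' : List α} (h : l.Sublist l') (f : α → ℕ) :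
    (l.map f).sum ≤ (l'.map f).sum :=
  (h.map f).sum_le_sum (by simp)

/-! ### Correctness and cost of the maximum tree -/

namespace MaxTree

theorem prefixMax_empty (m y : ℕ) : (prefixMax m empty y).val = 0 := by
  induction m generalizing y with
  | zero => rfl
  | succ m ih =>
    unfold prefixMax
    by_cases h : y < 2 ^ m
    · simp [h, left, ih]
    · simp [h, left, right, top, ih]

theorem top_raise (m : ℕ) (t : MaxTree) (y : ℕ) (v : ℚ) :
    (raise m t y v).val.top = max t.top v := by
  cases m with
  | zero => rfl
  | succ m =>
    unfold raise
    by_cases h : y < 2 ^ m <;> simp [h, top]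

/-- Together with `prefixMax_empty` this determines all prefix maxima. The tree is arbitrary: no
relation between the value of a node and its subtrees is needed, because a raise updates every node
on its way. If y lies in the left half and z in the right half, the query reads the top of the left
subtree, and `top_raise` applies. -/
theorem prefixMax_raise (m : ℕ) (t : MaxTree) (y : ℕ) (v : ℚ) (z : ℕ) (hy : y < 2 ^ m)
    (hz : z < 2 ^ m) :
    (prefixMax m (raise m t y v).val z).val =
      if y ≤ z then max (prefixMax m t z).val v else (prefixMax m t z).val := by
  induction m generalizing t y z with
  | zero =>
    have : y = 0 := by simpa using hy
    subst this
    simp [prefixMax, raise, top]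
  | succ m ih =>
    rw [pow_succ] at hy hz
    unfold raise prefixMax
    by_cases h : y < 2 ^ m <;> by_cases h' : z < 2 ^ m
    · simp [h, h', left, ih _ _ _ h h']
    · have : y ≤ z := by omega
      simp [h, h', left, right, top_raise, this, max_right_comm]
    · have : ¬ y ≤ z := by omega
      simp [h, h', left, this]
    · simp only [h, h', if_false, bind_val, pure_val, left, right]
      rw [ih _ _ _ (by omega) (by omega)]
      have : y - 2 ^ m ≤ z - 2 ^ m ↔ y ≤ z := by omega
      simp only [this]
      split_ifs
      · rw [max_assoc]
      · rfl

theorem raise_time (m : ℕ) (t : MaxTree) (y : ℕ) (v : ℚ) : (raise m t y v).time = m + 1 := by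
  induction m generalizing t y with
  | zero => rfl
  | succ m ih =>
    unfold raise
    by_cases h : y < 2 ^ m <;> simp [h, ih] <;> omega

theorem prefixMax_time (m : ℕ) (t : MaxTree) (y : ℕ) : (prefixMax m t y).time = m + 1 := by
  induction m generalizing t y with
  | zero => rfl
  | succ m ih =>
    unfold prefixMax
    by_cases h : y < 2 ^ m <;> simp [h, ih] <;> omega

/-- Raising a tree at the keys and values of a list preserves every property of prefix maxima that
holds for the given tree and for the values of the list. -/
theorem prefixMax_foldl_raise {α : Type} (m : ℕ) (f : α → ℕ) (g : α → ℚ) (l : List α) (t : MaxTree)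
    (Q : ℕ → ℚ → Prop) (hl : ∀ x ∈ l, f x < 2 ^ m)
    (ht : ∀ y < 2 ^ m, Q y (prefixMax m t y).val)
    (hQ : ∀ x ∈ l, ∀ y, f x ≤ y → Q y (g x)) :
    ∀ y < 2 ^ m, Q y (prefixMax m (l.foldl (fun t x => (raise m t (f x) (g x)).val) t) y).val := by
  induction l generalizing t with
  | nil => simpa using ht
  | cons x xs ih =>
    rw [List.foldl_cons]
    refine ih _ (fun z hz => hl z (List.mem_cons_of_mem _ hz)) (fun y hy => ?_)
      (fun z hz => hQ z (List.mem_cons_of_mem _ hz))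
    rw [prefixMax_raise m t _ _ _ (hl x List.mem_cons_self) hy]
    split_ifs with h
    · rcases max_choice (prefixMax m t y).val (g x) with h' | h' <;> rw [h']
      · exact ht y hy
      · exact hQ x List.mem_cons_self y h
    · exact ht y hy

theorem prefixMax_le_foldl_raise {α : Type} (m : ℕ) (f : α → ℕ) (g : α → ℚ) (l : List α)
    (t : MaxTree) (hl : ∀ x ∈ l, f x < 2 ^ m) (y : ℕ) (hy : y < 2 ^ m) :
    (prefixMax m t y).val ≤
      (prefixMax m (l.foldl (fun t x => (raise m t (f x) (g x)).val) t) y).val := by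
  induction l generalizing t with
  | nil => simp
  | cons x xs ih =>
    rw [List.foldl_cons]
    refine le_trans ?_ (ih _ (fun z hz => hl z (List.mem_cons_of_mem _ hz)))
    rw [prefixMax_raise m t _ _ _ (hl x List.mem_cons_self) hy]
    split_ifs <;> simp

theorem le_prefixMax_foldl_raise {α : Type} (m : ℕ) (f : α → ℕ) (g : α → ℚ) (l : List α)
    (t : MaxTree) (hl : ∀ x ∈ l, f x < 2 ^ m) (y : ℕ) (hy : y < 2 ^ m) {x : α} (hx : x ∈ l)
    (hxy : f x ≤ y) :
    g x ≤ (prefixMax m (l.foldl (fun t x => (raise m t (f x) (g x)).val) t) y).val := by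
  induction l generalizing t with
  | nil => simp at hx
  | cons z xs ih =>
    rw [List.foldl_cons]
    have hl' : ∀ x ∈ xs, f x < 2 ^ m := fun z hz => hl z (List.mem_cons_of_mem _ hz)
    rcases List.mem_cons.1 hx with rfl | h
    · refine le_trans ?_ (prefixMax_le_foldl_raise m f g xs _ hl' y hy)
      rw [prefixMax_raise m t _ _ _ (hl x List.mem_cons_self) hy, if_pos hxy]
      exact le_max_right _ _
    · exact ih _ hl' h

/-- The tree after a column of boxes has been treated. -/
def afterColumn (m w' : ℕ) (t : MaxTree) (col : List WBox) : MaxTree :=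
  col.foldl (fun s e => (raise m s e.hi
    ((prefixMax m t e.lo).val + ((w' : ℚ) + ((e.hi : ℚ) - e.lo) - e.κ * w'))).val) t

end MaxTree

/-! ### The dynamic program of the pattern match -/

open MaxTree

/-- The tree on which the final answers of the pattern match are based. -/
def finalTree (m w' : ℕ) (cols : List (List WBox)) (𝒥 : List ℕ) : MaxTree :=
  cols.foldl (afterColumn m w') (𝒥.foldl (fun t J => (raise m t J J).val) MaxTree.empty)

/-- A cost is recovered from a benefit: the path goes w to the right and climbs from height 0 to J +
w, and the benefit is what it saves against horizontal and vertical edges alone. -/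
theorem mem_apm {m w w' : ℕ} {κ : ℚ} {cols : List (List WBox)} {𝒥 : List ℕ} {J : ℕ} :
    J ∈ (apm m w w' κ cols 𝒥).val ↔ J ∈ 𝒥 ∧
      (w : ℚ) + (J + w) - (prefixMax m (finalTree m w' cols 𝒥) (J + w)).val ≤ κ * w := by
  have h : finalTree m w' cols 𝒥 = (foldL (fun t (col : List WBox) => do
      let heads ← mapL (fun e : WBox => do
          let v ← MaxTree.prefixMax m t e.lo
          step (e.hi, v + ((w' : ℚ) + ((e.hi : ℚ) - e.lo) - e.κ * w'))) col
      foldL (fun t (yv : ℕ × ℚ) => MaxTree.raise m t yv.1 yv.2) t heads)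
      (foldL (fun t J => MaxTree.raise m t J J) MaxTree.empty 𝒥).val cols).val := by
    simp only [finalTree, foldL_val, bind_val, mapL_val, step_val, List.foldl_map]
    rfl
  simp only [apm, bind_val, filterL_val, List.mem_filter, step_val, decide_eq_true_eq, ← h]

theorem length_apm_le (m w w' : ℕ) (κ : ℚ) (cols : List (List WBox)) (𝒥 : List ℕ) :
    (apm m w w' κ cols 𝒥).val.length ≤ 𝒥.length := by
  simp only [apm, bind_val, filterL_val]
  exact List.length_filter_le _ _

/-- One update and one query of a tree of depth m for each interval of the stack and for each box.
-/
theorem apm_time_le (m w w' : ℕ) (κ : ℚ) (cols : List (List WBox)) (𝒥 : List ℕ) :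
    (apm m w w' κ cols 𝒥).time ≤
      3 + 𝒥.length * (2 * m + 5) + (cols.map fun col => 3 + col.length * (2 * m + 5)).sum := by
  have h1 : ∀ t, (foldL (fun t J => MaxTree.raise m t J (J : ℚ)) t 𝒥).time ≤
      1 + 𝒥.length * (m + 2) := fun t => by
    refine (foldL_time_le (g := fun _ => m + 1) (fun b x _ => (raise_time ..).le) t).trans ?_
    simp; ring_nf; rfl
  have h2 : ∀ t, (foldL (fun t (col : List WBox) => do
      let heads ← mapL (fun e : WBox => do
          let v ← MaxTree.prefixMax m t e.lo
          step (e.hi, v + ((w' : ℚ) + ((e.hi : ℚ) - e.lo) - e.κ * w'))) col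
      foldL (fun t (yv : ℕ × ℚ) => MaxTree.raise m t yv.1 yv.2) t heads) t cols).time ≤
      1 + (cols.map fun col => 1 + (2 + col.length * (2 * m + 5))).sum := fun t => by
    refine foldL_time_le (fun t col _ => ?_) t
    have h3 := foldL_time_le (f := fun t (yv : ℕ × ℚ) => MaxTree.raise m t yv.1 yv.2)
      (g := fun _ => m + 1) (l := col.map fun e : WBox =>
        (e.hi, (prefixMax m t e.lo).val + ((w' : ℚ) + ((e.hi : ℚ) - e.lo) - e.κ * w')))
      (fun b x _ => (raise_time ..).le) t
    simp only [bind_time, mapL_time, mapL_val, bind_val, step_val, step_time, prefixMax_time]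
    simp only [List.map_map] at h3
    simp only [Function.comp_def, List.map_const', List.sum_replicate, smul_eq_mul] at h3 ⊢
    nlinarith
  simp only [apm, bind_time, filterL_time, step_time, prefixMax_time]
  have h4 := h1 MaxTree.empty
  have h5 := h2 (foldL (fun t J => MaxTree.raise m t J (J : ℚ)) MaxTree.empty 𝒥).val
  simp only [List.map_const', List.sum_replicate, smul_eq_mul] at *
  have h6 : (cols.map fun col => 1 + (2 + col.length * (2 * m + 5))).sum =
    (cols.map fun col => 3 + col.length * (2 * m + 5)).sum := by
    congr 1; apply List.map_congr_left; intros; omega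
  rw [h6] at h5
  nlinarith

/-- Soundness of the dynamic program: a property `Q s y v` of columns, heights and benefits that holds
for the auxiliary edges and is preserved by all edges holds for the benefits that are computed. -/
theorem finalTree_sound {m w' : ℕ} {cols : List (List WBox)} {𝒥 : List ℕ}
    (Q : ℕ → ℕ → ℚ → Prop) (h𝒥 : ∀ J ∈ 𝒥, J < 2 ^ m)
    (hcols : ∀ col ∈ cols, ∀ e ∈ col, e.lo < 2 ^ m ∧ e.hi < 2 ^ m)
    (h0 : ∀ y, Q 0 y 0) (hJ : ∀ J ∈ 𝒥, ∀ y, J ≤ y → Q 0 y J)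
    (hstep : ∀ s y v, Q s y v → Q (s + 1) y v)
    (hbox : ∀ (s : ℕ) (hs : s < cols.length), ∀ e ∈ cols[s], ∀ v, Q s e.lo v → ∀ y, e.hi ≤ y →
      Q (s + 1) y (v + ((w' : ℚ) + ((e.hi : ℚ) - e.lo) - e.κ * w'))) :
    ∀ y < 2 ^ m, Q cols.length y (prefixMax m (finalTree m w' cols 𝒥) y).val := by
  -- The induction is on the columns still to be treated; t is the tree reached after the first s
  -- columns.
  have key : ∀ (cs : List (List WBox)) (s : ℕ) (t : MaxTree), cs = cols.drop s → s ≤ cols.length →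
      (∀ y < 2 ^ m, Q s y (prefixMax m t y).val) →
      ∀ y < 2 ^ m, Q cols.length y (prefixMax m (cs.foldl (afterColumn m w') t) y).val := by
    intro cs
    induction cs with
    | nil =>
      intro s t hs hs' ht
      have : cols.length ≤ s := List.drop_eq_nil_iff.1 hs.symm
      have : s = cols.length := by omega
      subst this
      simpa using ht
    | cons c cs ih =>
      intro s t hs hs' ht
      have hlt : s < cols.length := by
        by_contra h
        rw [List.drop_eq_nil_of_le (by omega)] at hs
        simp at hs
      rw [List.drop_eq_getElem_cons hlt] at hs
      obtain ⟨rfl, hcs⟩ := List.cons.inj hs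
      rw [List.foldl_cons]
      refine ih (s + 1) _ hcs hlt ?_
      have hc := hcols _ (List.getElem_mem hlt)
      exact prefixMax_foldl_raise m (fun e : WBox => e.hi) _ _ t (Q (s + 1))
        (fun e he => (hc e he).2) (fun y hy => hstep _ _ _ (ht y hy))
        (fun e he y hy => hbox s hlt e he _ (ht _ (hc e he).1) y hy)
  exact key cols 0 _ (by simp) (by simp)
    (prefixMax_foldl_raise m (fun J : ℕ => J) (fun J : ℕ => (J : ℚ)) 𝒥 _ (Q 0) h𝒥
      (fun y hy => by rw [prefixMax_empty]; exact h0 y) hJ)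

/-- Completeness of the dynamic program: the benefit that is computed is at least that of any path. -/
theorem finalTree_complete {m w' : ℕ} {cols : List (List WBox)} {𝒥 : List ℕ}
    (h𝒥 : ∀ J ∈ 𝒥, J < 2 ^ m)
    (hcols : ∀ col ∈ cols, ∀ e ∈ col, e.lo < 2 ^ m ∧ e.hi < 2 ^ m)
    (b : ℕ → ℕ) (c : ℕ → ℚ) (hb : b 0 ∈ 𝒥) (hm : ∀ s < cols.length, b s ≤ b (s + 1))
    (hlast : b cols.length < 2 ^ m)
    (hc : ∀ (s : ℕ) (hs : s < cols.length),
      (w' : ℚ) + ((b (s + 1) : ℚ) - b s) ≤ c s ∨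
      ∃ e ∈ cols[s], b s ≤ e.lo ∧ e.hi ≤ b (s + 1) ∧
        e.κ * w' + ((b (s + 1) : ℚ) - b s) - ((e.hi : ℚ) - e.lo) ≤ c s) :
    (cols.length : ℚ) * w' + b cols.length - ∑ s ∈ Finset.range cols.length, c s ≤
      (prefixMax m (finalTree m w' cols 𝒥) (b cols.length)).val := by
  have hb_le : ∀ d s, s + d = cols.length → b s ≤ b cols.length := by
    intro d
    induction d with
    | zero => intro s hs; simp at hs; rw [hs]
    | succ d ih => intro s hs; exact (hm s (by omega)).trans (ih (s + 1) (by omega))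
  have key : ∀ (cs : List (List WBox)) (s : ℕ) (t : MaxTree), cs = cols.drop s → s ≤ cols.length →
      (∀ y, b s ≤ y → y < 2 ^ m →
        (s : ℚ) * w' + b s - ∑ r ∈ Finset.range s, c r ≤ (prefixMax m t y).val) →
      (cols.length : ℚ) * w' + b cols.length - ∑ r ∈ Finset.range cols.length, c r ≤
        (prefixMax m (cs.foldl (afterColumn m w') t) (b cols.length)).val := by
    intro cs
    induction cs with
    | nil =>
      intro s t hs hs' ht
      have : cols.length ≤ s := List.drop_eq_nil_iff.1 hs.symm
      have : s = cols.length := by omega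
      subst this
      simpa using ht _ le_rfl hlast
    | cons cl cs ih =>
      intro s t hs hs' ht
      have hlt : s < cols.length := by
        by_contra h
        rw [List.drop_eq_nil_of_le (by omega)] at hs
        simp at hs
      rw [List.drop_eq_getElem_cons hlt] at hs
      obtain ⟨rfl, hcs⟩ := List.cons.inj hs
      rw [List.foldl_cons]
      refine ih (s + 1) _ hcs hlt (fun y hy hy' => ?_)
      have hcl := hcols _ (List.getElem_mem hlt)
      have hbs : (b s : ℚ) ≤ b (s + 1) := by exact_mod_cast hm s hlt
      rw [Finset.sum_range_succ]
      push_cast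
      -- Either the column is crossed without a shortcut and the benefit is merely kept, or a
      -- shortcut is taken, with vertical edges from b s up to its lower end and from its upper end
      -- to b (s + 1).
      rcases hc s hlt with h | ⟨e, he, hlo, hhi, h⟩
      · have h1 := ht y ((hm s hlt).trans hy) hy'
        have h2 := prefixMax_le_foldl_raise m (fun e : WBox => e.hi) (fun e : WBox =>
          (prefixMax m t e.lo).val + ((w' : ℚ) + ((e.hi : ℚ) - e.lo) - e.κ * w')) cols[s] t
          (fun e he => (hcl e he).2) y hy'
        change _ ≤ (prefixMax m (afterColumn m w' t cols[s]) y).val at h2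
        linarith
      · have h1 := ht e.lo hlo (hcl e he).1
        have h2 := le_prefixMax_foldl_raise m (fun e : WBox => e.hi) (fun e : WBox =>
          (prefixMax m t e.lo).val + ((w' : ℚ) + ((e.hi : ℚ) - e.lo) - e.κ * w')) cols[s] t
          (fun e he => (hcl e he).2) y hy' he (hhi.trans hy)
        change _ ≤ (prefixMax m (afterColumn m w' t cols[s]) y).val at h2
        linarith
  refine key cols 0 _ (by simp) (by simp) (fun y hy hy' => ?_)
  simpa using le_prefixMax_foldl_raise m (fun J : ℕ => J) (fun J : ℕ => (J : ℚ)) 𝒥 MaxTree.empty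
    h𝒥 y hy' hb hy

/-! ### Edit distance of strings and substrings -/

namespace Edits

variable {σ : Type*}

theorem refl (u : List σ) : Edits u u 0 := by
  induction u with
  | nil => exact .nil
  | cons a u ih => exact .keep a ih

theorem symm {u v : List σ} {c : ℕ} (h : Edits u v c) : Edits v u c := by
  induction h with
  | nil => exact .nil
  | keep a _ ih => exact .keep a ih
  | delete a _ ih => exact .insert a ih
  | insert b _ ih => exact .delete b ih
  | substitute a b _ ih => exact .substitute b a ih

theorem to_nil (u : List σ) : Edits u [] u.length := by
  induction u with
  | nil => exact .nil
  | cons a u ih => exact .delete a ih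

theorem append {u v u' v' : List σ} {c c' : ℕ} (h : Edits u v c) (h' : Edits u' v' c') :
    Edits (u ++ u') (v ++ v') (c + c') := by
  induction h with
  | nil => simpa using h'
  | keep a _ ih => exact .keep a ih
  | delete a _ ih => rw [Nat.add_right_comm]; exact .delete a ih
  | insert b _ ih => rw [Nat.add_right_comm]; exact .insert b ih
  | substitute a b _ ih => rw [Nat.add_right_comm]; exact .substitute a b ih

theorem length_le {u v : List σ} {c : ℕ} (h : Edits u v c) : u.length ≤ v.length + c := by
  induction h <;> simp at * <;> omega

/-- A conversion of a concatenation splits. -/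
theorem split {u u' v : List σ} {c : ℕ} (h : Edits (u ++ u') v c) :
    ∃ v₁ v₂ c₁ c₂, v = v₁ ++ v₂ ∧ c = c₁ + c₂ ∧ Edits u v₁ c₁ ∧ Edits u' v₂ c₂ := by
  generalize hs : u ++ u' = s at h
  induction h generalizing u with
  | nil =>
    obtain ⟨rfl, rfl⟩ := List.append_eq_nil_iff.1 hs
    exact ⟨[], [], 0, 0, rfl, rfl, .nil, .nil⟩
  | keep a h ih =>
    cases u with
    | nil => exact ⟨[], _, 0, _, rfl, (Nat.zero_add _).symm, .nil, by
        rw [List.nil_append] at hs; subst hs; exact .keep a h⟩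
    | cons x u =>
      obtain ⟨rfl, hs'⟩ := List.cons.inj hs
      obtain ⟨v₁, v₂, c₁, c₂, rfl, rfl, h₁, h₂⟩ := ih hs'
      exact ⟨x :: v₁, v₂, c₁, c₂, rfl, rfl, .keep x h₁, h₂⟩
  | delete a h ih =>
    cases u with
    | nil => exact ⟨[], _, 0, _, rfl, (Nat.zero_add _).symm, .nil, by
        rw [List.nil_append] at hs; subst hs; exact .delete a h⟩
    | cons x u =>
      obtain ⟨rfl, hs'⟩ := List.cons.inj hs
      obtain ⟨v₁, v₂, c₁, c₂, rfl, rfl, h₁, h₂⟩ := ih hs'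
      exact ⟨v₁, v₂, c₁ + 1, c₂, rfl, by omega, .delete x h₁, h₂⟩
  | insert b h ih =>
    obtain ⟨v₁, v₂, c₁, c₂, rfl, rfl, h₁, h₂⟩ := ih hs
    exact ⟨b :: v₁, v₂, c₁ + 1, c₂, rfl, by omega, .insert b h₁, h₂⟩
  | substitute a b h ih =>
    cases u with
    | nil => exact ⟨[], _, 0, _, rfl, (Nat.zero_add _).symm, .nil, by
        rw [List.nil_append] at hs; subst hs; exact .substitute a b h⟩
    | cons x u =>
      obtain ⟨rfl, hs'⟩ := List.cons.inj hs
      obtain ⟨v₁, v₂, c₁, c₂, rfl, rfl, h₁, h₂⟩ := ih hs'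
      exact ⟨b :: v₁, v₂, c₁ + 1, c₂, rfl, by omega, .substitute x b h₁, h₂⟩

/-- The inner inductions on the second conversion are needed because it may insert characters before
it reaches the first character of the intermediate string. -/
theorem trans {u v t : List σ} {c c' : ℕ} (h : Edits u v c) (h' : Edits v t c') :
    ∃ c'' ≤ c + c', Edits u t c'' := by
  induction h generalizing t c' with
  | nil => exact ⟨c', by omega, h'⟩
  | @keep a u v c h ih =>
    generalize hs : a :: v = s at h'
    induction h' with
    | nil => simp at hs
    | keep a' h₂ _ =>
      obtain ⟨rfl, rfl⟩ := List.cons.inj hs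
      obtain ⟨d, hd, h₃⟩ := ih h₂
      exact ⟨d, hd, .keep a h₃⟩
    | delete a' h₂ _ =>
      obtain ⟨rfl, rfl⟩ := List.cons.inj hs
      obtain ⟨d, hd, h₃⟩ := ih h₂
      exact ⟨d + 1, by omega, .delete a h₃⟩
    | insert b h₂ ih₂ =>
      obtain ⟨d, hd, h₃⟩ := ih₂ hs
      exact ⟨d + 1, by omega, .insert b h₃⟩
    | substitute a' b h₂ _ =>
      obtain ⟨rfl, rfl⟩ := List.cons.inj hs
      obtain ⟨d, hd, h₃⟩ := ih h₂
      exact ⟨d + 1, by omega, .substitute a b h₃⟩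
  | delete a h ih =>
    obtain ⟨d, hd, h₃⟩ := ih h'
    exact ⟨d + 1, by omega, .delete a h₃⟩
  | @insert a u v c h ih =>
    generalize hs : a :: v = s at h'
    induction h' with
    | nil => simp at hs
    | keep a' h₂ _ =>
      obtain ⟨rfl, rfl⟩ := List.cons.inj hs
      obtain ⟨d, hd, h₃⟩ := ih h₂
      exact ⟨d + 1, by omega, .insert a h₃⟩
    | delete a' h₂ _ =>
      obtain ⟨rfl, rfl⟩ := List.cons.inj hs
      obtain ⟨d, hd, h₃⟩ := ih h₂
      exact ⟨d, by omega, h₃⟩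
    | insert b h₂ ih₂ =>
      obtain ⟨d, hd, h₃⟩ := ih₂ hs
      exact ⟨d + 1, by omega, .insert b h₃⟩
    | substitute a' b h₂ _ =>
      obtain ⟨rfl, rfl⟩ := List.cons.inj hs
      obtain ⟨d, hd, h₃⟩ := ih h₂
      exact ⟨d + 1, by omega, .insert b h₃⟩
  | @substitute x a u v c h ih =>
    generalize hs : a :: v = s at h'
    induction h' with
    | nil => simp at hs
    | keep a' h₂ _ =>
      obtain ⟨rfl, rfl⟩ := List.cons.inj hs
      obtain ⟨d, hd, h₃⟩ := ih h₂
      exact ⟨d + 1, by omega, .substitute x a h₃⟩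
    | delete a' h₂ _ =>
      obtain ⟨rfl, rfl⟩ := List.cons.inj hs
      obtain ⟨d, hd, h₃⟩ := ih h₂
      exact ⟨d + 1, by omega, .delete x h₃⟩
    | insert b h₂ ih₂ =>
      obtain ⟨d, hd, h₃⟩ := ih₂ hs
      exact ⟨d + 1, by omega, .insert b h₃⟩
    | substitute a' b h₂ _ =>
      obtain ⟨rfl, rfl⟩ := List.cons.inj hs
      obtain ⟨d, hd, h₃⟩ := ih h₂
      exact ⟨d + 1, by omega, .substitute x b h₃⟩

end Edits

section EditDist

variable {σ : Type*}

theorem editDist_le {u v : List σ} {c : ℕ} (h : Edits u v c) : editDist u v ≤ c :=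
  Nat.sInf_le h

theorem edits_editDist (u v : List σ) : Edits u v (editDist u v) :=
  Nat.sInf_mem (s := {c | Edits u v c})
    ⟨_, by simpa using (Edits.to_nil u).append (Edits.to_nil v).symm⟩

theorem editDist_self (u : List σ) : editDist u u = 0 :=
  Nat.le_zero.1 (editDist_le (Edits.refl u))

theorem editDist_comm (u v : List σ) : editDist u v = editDist v u :=
  le_antisymm (editDist_le (edits_editDist v u).symm) (editDist_le (edits_editDist u v).symm)

theorem editDist_triangle (u v t : List σ) : editDist u t ≤ editDist u v + editDist v t := by
  obtain ⟨c, hc, h⟩ := (edits_editDist u v).trans (edits_editDist v t)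
  exact (editDist_le h).trans hc

theorem editDist_append_le (u v u' v' : List σ) :
    editDist (u ++ u') (v ++ v') ≤ editDist u v + editDist u' v' :=
  editDist_le ((edits_editDist u v).append (edits_editDist u' v'))

theorem length_le_add_editDist (u v : List σ) : u.length ≤ v.length + editDist u v :=
  (edits_editDist u v).length_le

theorem editDist_nil_right_le (u : List σ) : editDist u [] ≤ u.length :=
  editDist_le (Edits.to_nil u)

theorem editDist_nil_left_le (u : List σ) : editDist [] u ≤ u.length :=
  editDist_le (Edits.to_nil u).symm

theorem editDist_le_length_add_length (u v : List σ) : editDist u v ≤ u.length + v.length :=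
  (editDist_triangle u [] v).trans
    (Nat.add_le_add (editDist_nil_right_le u) (editDist_nil_left_le v))

/-- The substring of the characters number `a + 1, …, b`. -/
def seg (z : List σ) (a b : ℕ) : List σ := (z.drop a).take (b - a)

theorem substr_eq_seg (z : List σ) (w I : ℕ) : substr z w I = seg z I (I + w) := by
  simp [substr, seg]

theorem length_seg_le (z : List σ) (a b : ℕ) : (seg z a b).length ≤ b - a :=
  List.length_take_le _ _

theorem length_seg {z : List σ} {a b : ℕ} (h : b ≤ z.length) : (seg z a b).length = b - a := by
  simp [seg]; omega

theorem length_substr {z : List σ} {w I : ℕ} (h : I + w ≤ z.length) :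
    (substr z w I).length = w := by
  rw [substr_eq_seg, length_seg h]; omega

theorem seg_append {z : List σ} {a b c : ℕ} (hab : a ≤ b) (hbc : b ≤ c) :
    seg z a b ++ seg z b c = seg z a c := by
  have h1 : c - a = (b - a) + (c - b) := by omega
  have h2 : z.drop b = (z.drop a).drop (b - a) := by
    rw [List.drop_drop]; congr 1; omega
  rw [seg, seg, seg, h1, List.take_add, h2]

theorem seg_self (z : List σ) (a : ℕ) : seg z a a = [] := by simp [seg]

/-- The surplus at both ends is deleted and the core is kept. -/
theorem editDist_seg_core_le {z : List σ} {a b a' b' : ℕ} (ha : a ≤ a') (hab : a' ≤ b')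
    (hb : b' ≤ b) : editDist (seg z a b) (seg z a' b') ≤ (a' - a) + (b - b') := by
  rw [← seg_append ha (hab.trans hb), ← seg_append hab hb]
  calc _ ≤ editDist (seg z a a') [] + editDist (seg z a' b' ++ seg z b' b) (seg z a' b') := by
        simpa using editDist_append_le (seg z a a') [] (seg z a' b' ++ seg z b' b) (seg z a' b')
    _ ≤ (a' - a) + (editDist (seg z a' b') (seg z a' b') + editDist (seg z b' b) []) := by
        gcongr
        · exact (editDist_nil_right_le _).trans (length_seg_le _ _ _)
        · simpa using editDist_append_le (seg z a' b') (seg z a' b') (seg z b' b) []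
    _ ≤ _ := by
        rw [editDist_self, Nat.zero_add]
        gcongr
        exact (editDist_nil_right_le _).trans (length_seg_le _ _ _)

/-- Moving the ends of a substring. -/
theorem editDist_seg_le {z : List σ} {a b a' b' : ℕ} (h : a ≤ b) (h' : a' ≤ b') :
    editDist (seg z a b) (seg z a' b') ≤ (a - a') + (a' - a) + ((b - b') + (b' - b)) := by
  -- Overlapping substrings are compared through their common part. Otherwise deleting one and
  -- inserting the other costs the sum of the lengths, which does not exceed the displacement of the
  -- ends.
  by_cases ho : max a a' ≤ min b b'
  · have h1 := editDist_seg_core_le (z := z) (le_max_left a a') ho (min_le_left b b')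
    have h2 := editDist_seg_core_le (z := z) (le_max_right a a') ho (min_le_right b b')
    rw [editDist_comm] at h2
    have h3 := editDist_triangle (seg z a b) (seg z (max a a') (min b b')) (seg z a' b')
    omega
  · have h1 := editDist_le_length_add_length (seg z a b) (seg z a' b')
    have h2 := length_seg_le z a b
    have h3 := length_seg_le z a' b'
    omega

/-- A conversion of a substring that is cut into blocks of width `w'` cuts the result into
consecutive substrings. -/
theorem exists_block_alignment {z : List σ} {w' : ℕ} (N : ℕ) {I J e : ℕ} (hJ : J ≤ e)
    (he : e ≤ z.length) {c : ℕ} (h : Edits (seg z I (I + (N + 1) * w')) (seg z J e) c) :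
    ∃ b t : ℕ → ℕ, b 0 = J ∧ b (N + 1) = e ∧ (∀ s < N + 1, b s ≤ b (s + 1)) ∧
      (∀ s < N + 1,
        editDist (seg z (I + s * w') (I + (s + 1) * w')) (seg z (b s) (b (s + 1))) ≤ t s) ∧
      ∑ s ∈ Finset.range (N + 1), t s ≤ c := by
  induction N generalizing I J c with
  -- The base case is one block: with no block at all the prescribed heights b 0 = J and b 0 = e
  -- would clash.
  | zero =>
    refine ⟨fun s => if s = 0 then J else e, fun _ => c, rfl, rfl, ?_, ?_, by simp⟩
    · intro s hs
      obtain rfl : s = 0 := by omega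
      simpa using hJ
    · intro s hs
      obtain rfl : s = 0 := by omega
      simpa using editDist_le h
  | succ N ih =>
    rw [← seg_append (b := I + w') (by omega) (by nlinarith)] at h
    obtain ⟨v₁, v₂, c₁, c₂, hv, rfl, h₁, h₂⟩ := h.split
    have hlen : v₁.length + v₂.length = e - J := by
      rw [← length_seg he, hv, List.length_append]
    have hsp := seg_append (z := z) (a := J) (b := J + v₁.length) (c := e) (by omega) (by omega)
    rw [hv] at hsp
    obtain ⟨e₁, e₂⟩ := List.append_inj hsp (by rw [length_seg (by omega)]; omega)
    rw [← e₁] at h₁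
    rw [← e₂] at h₂
    have harg : I + (N + 1 + 1) * w' = I + w' + (N + 1) * w' := by ring
    rw [harg] at h₂
    obtain ⟨b, t, hb0, hbN, hb, ht, hsum⟩ := ih (by omega) h₂
    refine ⟨fun s => Nat.casesOn s J b, fun s => Nat.casesOn s c₁ t, rfl, hbN, ?_, ?_, ?_⟩
    · rintro (_ | s) hs
      · simp [hb0]
      · exact hb s (by omega)
    · rintro (_ | s) hs
      · simpa [hb0] using editDist_le h₁
      · have := ht s (by omega)
        have e3 : I + w' + s * w' = I + (s + 1) * w' := by ring
        have e4 : I + w' + (s + 1) * w' = I + (s + 1 + 1) * w' := by ring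
        rw [e3, e4] at this
        exact this
    · rw [Finset.sum_range_succ']
      change (∑ s ∈ Finset.range (N + 1), t s) + c₁ ≤ c₁ + c₂
      omega

end EditDist

/-! ### Lists: exchange of sums, filters, and loops that set marks -/

theorem List.sum_map_sum_comm {α β : Type*} (l : List α) (l' : List β) (f : α → β → ℕ) :
    (l.map fun x => (l'.map fun y => f x y).sum).sum =
      (l'.map fun y => (l.map fun x => f x y).sum).sum := by
  induction l with
  | nil => simp
  | cons x xs ih => simp [ih, List.sum_map_add]

theorem List.sum_map_flatMap {α β : Type*} (l : List α) (g : α → List β) (f : β → ℕ) :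
    ((l.flatMap g).map f).sum = (l.map fun x => ((g x).map f).sum).sum := by
  induction l with
  | nil => simp
  | cons x xs ih => simp [List.flatMap_cons, ih]

/-- The shape of the answer of Enumerate: first the members of B, then the survivors among the
others. -/
theorem List.filter_append_filter_perm {α : Type*} (p q : α → Bool) (l : List α) :
    (l.filter p ++ (l.filter fun x => !p x).filter q).Perm (l.filter fun x => p x || q x) := by
  have h := List.filter_append_perm p (l.filter fun x => p x || q x)
  rw [List.filter_filter, List.filter_filter] at h
  rw [List.filter_filter]
  refine .trans (.of_eq ?_) h
  congr 1 <;> apply List.filter_congr <;> intro x _ <;> cases p x <;> simp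

theorem List.foldl_update_true (p : ℕ → Bool) (l : List ℕ) (K : ℕ → Bool) (x : ℕ) :
    l.foldl (fun K J => if p J then Function.update K J true else K) K x =
      (K x || (decide (x ∈ l) && p x)) := by
  induction l generalizing K with
  | nil => simp
  | cons y ys ih =>
    rw [List.foldl_cons, ih]
    by_cases hxy : x = y
    · subst hxy
      cases h : p x <;> simp
    · cases h : p y <;> simp [hxy]

/-- A loop that only sets marks computes a disjunction. Applied twice, this resolves the nested
loops of Enumerate over the scales and the samples. -/
theorem List.foldl_or {α : Type*} (q : α → ℕ → Bool) (G : (ℕ → Bool) → α → ℕ → Bool)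
    (l : List α) (hG : ∀ K, ∀ a ∈ l, ∀ x, G K a x = (K x || q a x)) (K : ℕ → Bool) (x : ℕ) :
    l.foldl G K x = (K x || l.any fun a => q a x) := by
  induction l generalizing K with
  | nil => simp
  | cons y ys ih =>
    rw [List.foldl_cons, ih (fun K a ha => hG K a (List.mem_cons_of_mem _ ha)),
      hG K y List.mem_cons_self, List.any_cons, Bool.or_assoc]

theorem zoomIn_add_le {w w' I J i I' i' J' : ℕ} (hw : w' ≤ w) (h : J' ∈ zoomIn w w' I J i I' i') :
    J' + w' ≤ J + w := by
  simp only [zoomIn, List.mem_map, List.mem_range] at h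
  obtain ⟨t, ht, rfl⟩ := h
  have h1 := Nat.mul_le_of_le_div (gridStep w' i') _ _
    (Nat.le_of_lt_succ (Nat.add_lt_of_lt_sub' ht))
  have h2 := min_le_left (J + w - w') (J + (I' - I) + 2 * w / 2 ^ i)
  omega

/-! ### Enumerate: verdicts and costs of single candidates -/

namespace Env

variable {σ : Type*} (E : Env σ)

/-- Whether `J` is returned by `Enumerate(j, I × {J}, i)`. -/
def closeB (D : ℕ → Level) : (j I J i : ℕ) → Bool
  | 0, _, _, _ => false
  | 1, I, J, i => (E.callED 1 I J i).val
  | j + 2, I, J, i => (D (j + 2)).below (I, i) J ||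
      (((List.range (i + 1)).any fun i' => ((D (j + 2)).sample (I, i')).any fun I' =>
        (zoomIn (E.p.w (j + 2)) (E.p.w (j + 1)) I J i I' i').any fun J' =>
          closeB D (j + 1) I' J' i') && (E.callED (j + 2) I J i).val)

/-- Whether a member of a sample of `(j, I)` is a marker for the candidate given by `j`, `i`, `I`, `J`. -/
def hit (D : ℕ → Level) (j I J i : ℕ) : Bool :=
  (List.range (i + 1)).any fun i' => ((D j).sample (I, i')).any fun I' =>
    (zoomIn (E.p.w j) (E.p.w (j - 1)) I J i I' i').any fun J' => E.closeB D (j - 1) I' J' i'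

theorem closeB_add_two (D : ℕ → Level) (j I J i : ℕ) :
    E.closeB D (j + 2) I J i =
      ((D (j + 2)).below (I, i) J || (E.hit D (j + 2) I J i && (E.callED (j + 2) I J i).val)) := rfl

theorem hit_iff (D : ℕ → Level) (j I J i : ℕ) :
    E.hit D j I J i = true ↔ ∃ i' ≤ i, ∃ I' ∈ (D j).sample (I, i'),
      ∃ J' ∈ zoomIn (E.p.w j) (E.p.w (j - 1)) I J i I' i', E.closeB D (j - 1) I' J' i' = true := by
  simp [hit]

/-- The marking of the candidates that survive the recursive calls. -/
def markHits (D : ℕ → Level) (j I : ℕ) (𝒥₁ : List ℕ) (i : ℕ) : Timed (ℕ → Bool) :=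
  foldL (fun K i' =>
    foldL (fun K I' => do
      let 𝒥' ← E.zoomInStack (j + 2) I 𝒥₁ i I' i'
      let S' ← E.enumerate D (j + 1) I' 𝒥' i'
      let inS' ← markL S'
      foldL (fun K J => do
        let zs ← produce (zoomIn (E.p.w (j + 2)) (E.p.w (j + 1)) I J i I' i')
        let hit ← anyL (fun J' => step (inS' J')) zs
        if hit then write K J true else pure K) K 𝒥₁)
      K ((D (j + 2)).sample (I, i')))
    (fun _ => false) (List.range (i + 1))

/-- The final test of the marked candidates. -/
def survivors (K : ℕ → Bool) (j I : ℕ) (𝒥₁ : List ℕ) (i : ℕ) : Timed (List ℕ) :=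
  filterL (fun J => do
    let b ← step (K J)
    if b then E.callED j I J i else pure false) 𝒥₁

theorem survivors_val (K : ℕ → Bool) (j I : ℕ) (𝒥₁ : List ℕ) (i : ℕ) :
    (E.survivors K j I 𝒥₁ i).val = 𝒥₁.filter fun J => K J && (E.callED j I J i).val := by
  rw [survivors, filterL_val]
  apply List.filter_congr
  intro J _
  simp only [bind_val, step_val]
  cases K J <;> simp

theorem survivors_time (K : ℕ → Bool) (j I : ℕ) (𝒥₁ : List ℕ) (i : ℕ) :
    (E.survivors K j I 𝒥₁ i).time =
      1 + (𝒥₁.map fun J => 2 + if K J then (E.callED j I J i).time else 0).sum := by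
  rw [survivors, filterL_time]
  congr 2
  apply List.map_congr_left
  intro J _
  simp only [bind_time, step_val, step_time]
  cases K J <;> simp
  omega

theorem enumerate_add_two (D : ℕ → Level) (j I : ℕ) (𝒥 : List ℕ) (i : ℕ) :
    E.enumerate D (j + 2) I 𝒥 i = (do
      let S₀ ← filterL (fun J => step ((D (j + 2)).below (I, i) J)) 𝒥
      let 𝒥₁ ← filterL (fun J => step (!(D (j + 2)).below (I, i) J)) 𝒥
      let _ ← produce (List.range (i + 1))
      let K ← E.markHits D j I 𝒥₁ i
      let S₁ ← E.survivors K (j + 2) I 𝒥₁ i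
      appendL S₀ S₁) := by
  rw [enumerate]; rfl

theorem mem_zoomInStack {j I : ℕ} {𝒥 : List ℕ} {i I' i' J' : ℕ} :
    J' ∈ (E.zoomInStack j I 𝒥 i I' i').val ↔
      ∃ J ∈ 𝒥, J' ∈ zoomIn (E.p.w j) (E.p.w (j - 1)) I J i I' i' := by
  simp [zoomInStack, mem_dedupL, flatMapL_val]

theorem zoomInStack_sublist (j I : ℕ) (𝒥 : List ℕ) (i I' i' : ℕ) :
    (E.zoomInStack j I 𝒥 i I' i').val.Sublist
      (𝒥.flatMap fun J => zoomIn (E.p.w j) (E.p.w (j - 1)) I J i I' i') := by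
  simpa [zoomInStack, flatMapL_val] using dedupL_sublist (fun _ => false)
    (𝒥.flatMap fun J => zoomIn (E.p.w j) (E.p.w (j - 1)) I J i I' i')

/-- By `ih` the recursive call on the union of all zoomed-in intervals returns exactly its close
members. So ZoomIn of J meets the answer if and only if it contains a close member, whatever other
candidates are treated together with J. -/
theorem markHits_val (D : ℕ → Level) (j I : ℕ) (𝒥₁ : List ℕ) (i : ℕ)
    (ih : ∀ I 𝒥 i, (E.enumerate D (j + 1) I 𝒥 i).val.Perm
      (𝒥.filter fun J => E.closeB D (j + 1) I J i)) {J : ℕ} (hJ : J ∈ 𝒥₁) :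
    (E.markHits D j I 𝒥₁ i).val J = E.hit D (j + 2) I J i := by
  have hin : ∀ i' I', J ∈ 𝒥₁ →
      ((zoomIn (E.p.w (j + 2)) (E.p.w (j + 1)) I J i I' i').any fun J' =>
        (markL (E.enumerate D (j + 1) I' (E.zoomInStack (j + 2) I 𝒥₁ i I' i').val i').val).val J') =
      (zoomIn (E.p.w (j + 2)) (E.p.w (j + 1)) I J i I' i').any fun J' =>
        E.closeB D (j + 1) I' J' i' := by
    intro i' I' hJ
    rw [Bool.eq_iff_iff]
    simp only [List.any_eq_true, markL_val, decide_eq_true_eq, (ih _ _ _).mem_iff,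
      List.mem_filter, mem_zoomInStack]
    constructor
    · rintro ⟨J', h1, _, h2⟩; exact ⟨J', h1, h2⟩
    · rintro ⟨J', h1, h2⟩; exact ⟨J', h1, ⟨J, hJ, h1⟩, h2⟩
  rw [markHits, foldL_val]
  rw [List.foldl_or (q := fun i' x => ((D (j + 2)).sample (I, i')).any fun I' =>
      decide (x ∈ 𝒥₁) && (zoomIn (E.p.w (j + 2)) (E.p.w (j + 1)) I x i I' i').any fun J' =>
        (markL (E.enumerate D (j + 1) I' (E.zoomInStack (j + 2) I 𝒥₁ i I' i').val i').val).val J')]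
  · simp only [hJ, decide_true, Bool.true_and, hin _ _ hJ, Bool.false_or]
    rfl
  · intro K i' _ x
    rw [foldL_val]
    rw [List.foldl_or (q := fun I' x => decide (x ∈ 𝒥₁) &&
      (zoomIn (E.p.w (j + 2)) (E.p.w (j + 1)) I x i I' i').any fun J' =>
        (markL (E.enumerate D (j + 1) I' (E.zoomInStack (j + 2) I 𝒥₁ i I' i').val i').val).val J')]
    intro K I' _ x
    simp only [bind_val, foldL_val, produce_val, anyL_val, step_val]
    refine Eq.trans ?_ (List.foldl_update_true (fun x =>
      (zoomIn (E.p.w (j + 2)) (E.p.w (j + 1)) I x i I' i').any fun J' =>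
        (markL (E.enumerate D (j + 1) I' (E.zoomInStack (j + 2) I 𝒥₁ i I' i').val i').val).val J')
      𝒥₁ K x)
    refine congrArg (fun g => List.foldl g K 𝒥₁ x) ?_
    funext K J
    split_ifs <;> rfl

/-- Enumerate selects its answer element by element. -/
theorem enumerate_perm (D : ℕ → Level) (j I : ℕ) (𝒥 : List ℕ) (i : ℕ) :
    (E.enumerate D j I 𝒥 i).val.Perm (𝒥.filter fun J => E.closeB D j I J i) := by
  induction j using Nat.strong_induction_on generalizing I 𝒥 i with
  | _ j ih =>
    match j, ih with
    | 0, _ => simp [enumerate, closeB]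
    | 1, _ => rw [enumerate, filterL_val]; rfl
    | j + 2, ih =>
      rw [enumerate_add_two]
      simp only [bind_val, filterL_val, step_val, appendL_val, survivors_val]
      refine .trans (.of_eq ?_) (List.filter_append_filter_perm _ _ _)
      congr 1
      apply List.filter_congr
      intro J hJ
      rw [E.markHits_val D j I _ i (ih (j + 1) (by omega)) hJ]
      rfl

theorem mem_enumerate {D : ℕ → Level} {j I : ℕ} {𝒥 : List ℕ} {i J : ℕ} :
    J ∈ (E.enumerate D j I 𝒥 i).val ↔ J ∈ 𝒥 ∧ E.closeB D j I J i = true := by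
  rw [(E.enumerate_perm D j I 𝒥 i).mem_iff, List.mem_filter]

theorem length_enumerate (D : ℕ → Level) (j I : ℕ) (𝒥 : List ℕ) (i : ℕ) :
    (E.enumerate D j I 𝒥 i).val.length = (𝒥.filter fun J => E.closeB D j I J i).length :=
  (E.enumerate_perm D j I 𝒥 i).length_eq

/-- An upper bound on the share of the candidate `J` in the running time of Enumerate, where `M j` bounds the
time of a call of the slow algorithm at level `j`. -/
def cost (D : ℕ → Level) (M : ℕ → ℕ) : (j I J i : ℕ) → ℕ
  | 0, _, _, _ => 0
  | 1, _, _, _ => M 1 + 1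
  | j + 2, I, J, i => 7 + (((List.range (i + 1)).map fun i' =>
      (((D (j + 2)).sample (I, i')).map fun I' =>
        10 * (zoomIn (E.p.w (j + 2)) (E.p.w (j + 1)) I J i I' i').length + 10 +
        ((zoomIn (E.p.w (j + 2)) (E.p.w (j + 1)) I J i I' i').map fun J' =>
          cost D M (j + 1) I' J' i').sum).sum).sum +
      if E.hit D (j + 2) I J i then M (j + 2) else 0)

/-- The part of the running time of Enumerate that does not depend on the candidates, for samples of length
at most `s`. -/
def overhead (a s : ℕ) : ℕ → ℕ
  | 0 => 1
  | 1 => 1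
  | j + 2 => 6 + (a + 1) * (3 + s * (5 + overhead a s (j + 1)))

theorem zoomInStack_time_le (j I : ℕ) (𝒥 : List ℕ) (i I' i' : ℕ) :
    (E.zoomInStack j I 𝒥 i I' i').time ≤
      2 + (𝒥.map fun J => 3 + 4 * (zoomIn (E.p.w j) (E.p.w (j - 1)) I J i I' i').length).sum := by
  have h := dedupL_time_le (fun _ => false)
    (𝒥.flatMap fun J => zoomIn (E.p.w j) (E.p.w (j - 1)) I J i I' i')
  simp only [zoomInStack, bind_time, flatMapL_time, flatMapL_val, produce_val, produce_time]
  simp only [List.length_flatMap] at h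
  have h2 : (𝒥.map fun J => 3 + 4 * (zoomIn (E.p.w j) (E.p.w (j - 1)) I J i I' i').length).sum =
      (𝒥.map fun J => 2 + ((zoomIn (E.p.w j) (E.p.w (j - 1)) I J i I' i').length + 1) +
        (zoomIn (E.p.w j) (E.p.w (j - 1)) I J i I' i').length).sum +
      2 * (𝒥.map fun J => (zoomIn (E.p.w j) (E.p.w (j - 1)) I J i I' i').length).sum := by
    rw [← List.sum_map_mul_left, ← List.sum_map_add]
    congr 1
    apply List.map_congr_left
    intros; omega
  omega

/-- Removing repetitions only shortens the list of zoomed-in intervals, so the recursive call costs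
at most the sum over J of the costs over ZoomIn of J. This makes the bound additive over the
candidates. -/
theorem markHits_time_le (D : ℕ → Level) (M : ℕ → ℕ) (j I : ℕ) (𝒥₁ : List ℕ) (i ov : ℕ)
    (hen : ∀ i' ≤ i, ∀ I' ∈ (D (j + 2)).sample (I, i'),
      (E.enumerate D (j + 1) I' (E.zoomInStack (j + 2) I 𝒥₁ i I' i').val i').time ≤ ov +
        ((E.zoomInStack (j + 2) I 𝒥₁ i I' i').val.map fun J' => E.cost D M (j + 1) I' J' i').sum) :
    (E.markHits D j I 𝒥₁ i).time ≤ 1 + ((List.range (i + 1)).map fun i' => 2 +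
      (((D (j + 2)).sample (I, i')).map fun I' => 5 + ov + (𝒥₁.map fun J =>
        10 * (zoomIn (E.p.w (j + 2)) (E.p.w (j + 1)) I J i I' i').length + 10 +
        ((zoomIn (E.p.w (j + 2)) (E.p.w (j + 1)) I J i I' i').map fun J' =>
          E.cost D M (j + 1) I' J' i').sum).sum).sum).sum := by
  refine (foldL_time_le (g := fun i' => 1 +
    (((D (j + 2)).sample (I, i')).map fun I' => 5 + ov + (𝒥₁.map fun J =>
        10 * (zoomIn (E.p.w (j + 2)) (E.p.w (j + 1)) I J i I' i').length + 10 +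
        ((zoomIn (E.p.w (j + 2)) (E.p.w (j + 1)) I J i I' i').map fun J' =>
          E.cost D M (j + 1) I' J' i').sum).sum).sum) ?_ _).trans ?_
  · intro K i' hi'
    have hi'' : i' ≤ i := Nat.lt_succ_iff.1 (List.mem_range.1 hi')
    refine (foldL_time_le (g := fun I' => 4 + ov + (𝒥₁.map fun J =>
        10 * (zoomIn (E.p.w (j + 2)) (E.p.w (j + 1)) I J i I' i').length + 10 +
        ((zoomIn (E.p.w (j + 2)) (E.p.w (j + 1)) I J i I' i').map fun J' =>
          E.cost D M (j + 1) I' J' i').sum).sum) ?_ _).trans ?_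
    · intro K I' hI'
      have h1 := E.zoomInStack_time_le (j + 2) I 𝒥₁ i I' i'
      have h2 := hen i' hi'' I' hI'
      have hsub := E.zoomInStack_sublist (j + 2) I 𝒥₁ i I' i'
      have h3 := hsub.sum_map_le (fun J' => E.cost D M (j + 1) I' J' i')
      have h4 := hsub.length_le
      have h5 : (E.enumerate D (j + 1) I' (E.zoomInStack (j + 2) I 𝒥₁ i I' i').val i').val.length ≤
          (E.zoomInStack (j + 2) I 𝒥₁ i I' i').val.length := by
        rw [length_enumerate]; exact List.length_filter_le _ _
      rw [List.sum_map_flatMap] at h3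
      rw [List.length_flatMap] at h4
      simp only [bind_time, markL_time]
      have h6 : ∀ (inS' : ℕ → Bool) (K : ℕ → Bool), (foldL (fun K J => do
          let zs ← produce (zoomIn (E.p.w (j + 2)) (E.p.w (j + 1)) I J i I' i')
          let hit ← anyL (fun J' => step (inS' J')) zs
          if hit then write K J true else pure K) K 𝒥₁).time ≤ 1 + (𝒥₁.map fun J => 1 +
            (3 + 3 * (zoomIn (E.p.w (j + 2)) (E.p.w (j + 1)) I J i I' i').length)).sum := by
        intro inS' K
        refine foldL_time_le (fun K J _ => ?_) K
        have h7 := anyL_time_le (fun J' => step (inS' J'))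
          (zoomIn (E.p.w (j + 2)) (E.p.w (j + 1)) I J i I' i')
        simp only [step_time, List.map_const', List.sum_replicate, smul_eq_mul] at h7
        simp only [bind_time, produce_time, produce_val]
        split_ifs
        · rw [write_time]; omega
        · rw [pure_time]; omega
      have h8 := h6 (markL (E.enumerate D (j + 1) I'
        (E.zoomInStack (j + 2) I 𝒥₁ i I' i').val i').val).val K
      -- With ℓ the length of ZoomIn, the charge 10 ℓ + 10 is split into 4 ℓ + 3 for forming the
      -- stack, 3 ℓ + 4 for looking up the marks, 2 ℓ for setting them, and ℓ + 3 to spare.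
      have h9 : (𝒥₁.map fun J =>
          10 * (zoomIn (E.p.w (j + 2)) (E.p.w (j + 1)) I J i I' i').length + 10 +
          ((zoomIn (E.p.w (j + 2)) (E.p.w (j + 1)) I J i I' i').map fun J' =>
            E.cost D M (j + 1) I' J' i').sum).sum =
          (𝒥₁.map fun J => 3 +
            4 * (zoomIn (E.p.w (j + 2)) (E.p.w (j + 1)) I J i I' i').length).sum +
          (𝒥₁.map fun J => 1 +
            (3 + 3 * (zoomIn (E.p.w (j + 2)) (E.p.w (j + 1)) I J i I' i').length)).sum +
          (𝒥₁.map fun J => (zoomIn (E.p.w (j + 2)) (E.p.w (j + 1)) I J i I' i').length).sum * 2 +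
          (𝒥₁.map fun J => 3 +
            (zoomIn (E.p.w (j + 2)) (E.p.w (j + 1)) I J i I' i').length).sum +
          (𝒥₁.map fun J => ((zoomIn (E.p.w (j + 2)) (E.p.w (j + 1)) I J i I' i').map fun J' =>
            E.cost D M (j + 1) I' J' i').sum).sum := by
        rw [← List.sum_map_mul_right, ← List.sum_map_add, ← List.sum_map_add, ← List.sum_map_add,
          ← List.sum_map_add]
        congr 1
        apply List.map_congr_left
        intros; omega
      simp only [show j + 2 - 1 = j + 1 from rfl] at h1 h3 h4
      omega
    · refine Nat.add_le_add_left (List.sum_map_le_sum_map' fun I' _ => ?_) _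
      omega
  · refine Nat.add_le_add_left (List.sum_map_le_sum_map' fun i' _ => ?_) _
    omega

/-- The running time of Enumerate is bounded by the overhead and the shares of the candidates. -/
theorem enumerate_time_le (D : ℕ → Level) (M : ℕ → ℕ) (k s : ℕ)
    (hM : ∀ j, 1 ≤ j → j ≤ k → ∀ i ≤ E.p.a, ∀ I J, I + E.p.w j ≤ E.p.n → J + E.p.w j ≤ 2 * E.p.n →
      (E.callED j I J i).time ≤ M j)
    (hw : ∀ j, 2 ≤ j → j ≤ k → E.p.w (j - 1) ≤ E.p.w j)
    (hs : ∀ j, 2 ≤ j → j ≤ k → ∀ I i, ((D j).sample (I, i)).length ≤ s)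
    (hsI : ∀ j, 2 ≤ j → j ≤ k → ∀ I i, ∀ I' ∈ (D j).sample (I, i), I' + E.p.w (j - 1) ≤ E.p.n)
    (j I : ℕ) (𝒥 : List ℕ) (i : ℕ) (hj : j ≤ k) (hi : i ≤ E.p.a) (hI : I + E.p.w j ≤ E.p.n)
    (hJ : ∀ J ∈ 𝒥, J + E.p.w j ≤ 2 * E.p.n) :
    (E.enumerate D j I 𝒥 i).time ≤
      overhead E.p.a s j + (𝒥.map fun J => E.cost D M j I J i).sum := by
  induction j using Nat.strong_induction_on generalizing I 𝒥 i with
  | _ j ih =>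
    match j, ih with
    | 0, _ => simp [enumerate, overhead]
    | 1, _ =>
      rw [enumerate, filterL_time]
      simp only [overhead, cost]
      refine Nat.add_le_add_left (List.sum_map_le_sum_map' fun J h => ?_) _
      have := hM 1 le_rfl hj i hi I J hI (hJ J h)
      omega
    | j + 2, ih =>
      rw [enumerate_add_two]
      simp only [bind_time, filterL_val, filterL_time, step_val, step_time, appendL_time,
        produce_time, List.length_range, survivors_time]
      set 𝒥₁ := 𝒥.filter fun J => !(D (j + 2)).below (I, i) J with h𝒥₁
      have hsub : ∀ J ∈ 𝒥₁, J ∈ 𝒥 := fun J h => (List.mem_filter.1 h).1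
      have h1 := E.markHits_time_le D M j I 𝒥₁ i (overhead E.p.a s (j + 1)) (by
        intro i' hi' I' hI'
        refine ih (j + 1) (by omega) I' _ i' (by omega) (by omega)
          (hsI (j + 2) (by omega) hj I i' I' hI') ?_
        intro J' hJ'
        obtain ⟨J, h, hz⟩ := (E.mem_zoomInStack).1 hJ'
        exact (zoomIn_add_le (hw (j + 2) (by omega) hj) hz).trans (hJ J (hsub J h)))
      -- The mark of a candidate is its `hit`, so the slow algorithm is charged only to candidates
      -- that are hit.
      have h2 : (𝒥₁.map fun J => 2 + if (E.markHits D j I 𝒥₁ i).val J then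
          (E.callED (j + 2) I J i).time else 0).sum ≤
          (𝒥₁.map fun J => 2 + if E.hit D (j + 2) I J i then M (j + 2) else 0).sum := by
        refine List.sum_map_le_sum_map' fun J h => ?_
        rw [E.markHits_val D j I 𝒥₁ i (fun I 𝒥 i => E.enumerate_perm D (j + 1) I 𝒥 i) h]
        split_ifs
        · have := hM (j + 2) (by omega) hj i hi I J hI (hJ J (hsub J h))
          omega
        · rfl
      have h3 : ((List.range (i + 1)).map fun i' => 2 + (((D (j + 2)).sample (I, i')).map fun I' =>
          5 + overhead E.p.a s (j + 1) + (𝒥₁.map fun J =>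
          10 * (zoomIn (E.p.w (j + 2)) (E.p.w (j + 1)) I J i I' i').length + 10 +
          ((zoomIn (E.p.w (j + 2)) (E.p.w (j + 1)) I J i I' i').map fun J' =>
            E.cost D M (j + 1) I' J' i').sum).sum).sum).sum ≤
          (i + 1) * (2 + s * (5 + overhead E.p.a s (j + 1))) +
          (𝒥₁.map fun J => ((List.range (i + 1)).map fun i' =>
            (((D (j + 2)).sample (I, i')).map fun I' =>
            10 * (zoomIn (E.p.w (j + 2)) (E.p.w (j + 1)) I J i I' i').length + 10 +
            ((zoomIn (E.p.w (j + 2)) (E.p.w (j + 1)) I J i I' i').map fun J' =>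
              E.cost D M (j + 1) I' J' i').sum).sum).sum).sum := by
        rw [List.sum_map_sum_comm]
        have h4 : (i + 1) * (2 + s * (5 + overhead E.p.a s (j + 1))) =
            ((List.range (i + 1)).map fun _ => 2 + s * (5 + overhead E.p.a s (j + 1))).sum := by
          simp
        rw [h4, ← List.sum_map_add]
        refine List.sum_map_le_sum_map' fun i' _ => ?_
        rw [List.sum_map_sum_comm, List.sum_map_add]
        have h5 := hs (j + 2) (by omega) hj I i'
        have h6 := Nat.mul_le_mul_right (5 + overhead E.p.a s (j + 1)) h5
        simp only [List.map_const', List.sum_replicate, smul_eq_mul]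
        omega
      have h7 : (i + 1) * (2 + s * (5 + overhead E.p.a s (j + 1))) + i + 1 ≤
          (E.p.a + 1) * (3 + s * (5 + overhead E.p.a s (j + 1))) := by
        calc _ = (i + 1) * (3 + s * (5 + overhead E.p.a s (j + 1))) := by ring
          _ ≤ _ := by gcongr
      have h8 : (𝒥.map fun J => E.cost D M (j + 2) I J i).sum =
          ((𝒥.filter fun J => (D (j + 2)).below (I, i) J).map
            fun J => E.cost D M (j + 2) I J i).sum +
          (𝒥₁.map fun J => E.cost D M (j + 2) I J i).sum := by
        rw [← List.sum_append, ← List.map_append]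
        exact ((List.filter_append_perm _ 𝒥).map _).sum_eq.symm
      have h9 : (𝒥.filter fun J => (D (j + 2)).below (I, i) J).length * 7 ≤
          ((𝒥.filter fun J => (D (j + 2)).below (I, i) J).map
            fun J => E.cost D M (j + 2) I J i).sum := by
        rw [← smul_eq_mul, ← List.sum_replicate, ← List.map_const']
        refine List.sum_map_le_sum_map' fun J _ => ?_
        simp only [cost]
        omega
      have h10 : 𝒥.length = (𝒥.filter fun J => (D (j + 2)).below (I, i) J).length +
          𝒥₁.length := by
        rw [← List.length_append]
        exact (List.filter_append_perm _ 𝒥).length_eq.symm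
      have h11 : (𝒥₁.map fun J => E.cost D M (j + 2) I J i).sum = 𝒥₁.length * 5 +
          (𝒥₁.map fun J => ((List.range (i + 1)).map fun i' =>
            (((D (j + 2)).sample (I, i')).map fun I' =>
            10 * (zoomIn (E.p.w (j + 2)) (E.p.w (j + 1)) I J i I' i').length + 10 +
            ((zoomIn (E.p.w (j + 2)) (E.p.w (j + 1)) I J i I' i').map fun J' =>
              E.cost D M (j + 1) I' J' i').sum).sum).sum).sum +
          (𝒥₁.map fun J => 2 + if E.hit D (j + 2) I J i then M (j + 2) else 0).sum := by
        rw [← smul_eq_mul, ← List.sum_replicate, ← List.map_const', ← List.sum_map_add,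
          ← List.sum_map_add]
        congr 1
        apply List.map_congr_left
        intro J _
        simp only [cost]
        omega
      simp only [List.map_const', List.sum_replicate, smul_eq_mul, overhead]
      omega

theorem callED_congr (p : Params) (A : GapAlg σ) (z : List σ) {ω ω' : Randomness}
    (hb : ω.bits = ω'.bits) (j I J i : ℕ) :
    (⟨p, A, z, ω⟩ : Env σ).callED j I J i = (⟨p, A, z, ω'⟩ : Env σ).callED j I J i := by
  simp only [callED, hb]

/-- Enumerate does not depend on the random selections other than through the data of the levels. -/
theorem enumerate_congr (p : Params) (A : GapAlg σ) (z : List σ) {ω ω' : Randomness}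
    (hb : ω.bits = ω'.bits) {D D' : ℕ → Level} (j : ℕ)
    (hD : ∀ l, 2 ≤ l → l ≤ j → (D l).below = (D' l).below ∧ (D l).sample = (D' l).sample)
    (I : ℕ) (𝒥 : List ℕ) (i : ℕ) :
    (⟨p, A, z, ω⟩ : Env σ).enumerate D j I 𝒥 i = (⟨p, A, z, ω'⟩ : Env σ).enumerate D' j I 𝒥 i := by
  induction j using Nat.strong_induction_on generalizing I 𝒥 i with
  | _ j ih =>
    match j, ih with
    | 0, _ => simp [enumerate]
    | 1, _ => simp only [enumerate, callED_congr p A z hb]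
    | j + 2, ih =>
      have h := hD (j + 2) (by omega) le_rfl
      have ih' := ih (j + 1) (by omega) (fun l h1 h2 => hD l h1 (by omega))
      simp only [enumerate, callED_congr p A z hb, h.1, h.2, ih', zoomInStack]

theorem closeB_congr (p : Params) (A : GapAlg σ) (z : List σ) {ω ω' : Randomness}
    (hb : ω.bits = ω'.bits) {D D' : ℕ → Level} (j : ℕ)
    (hD : ∀ l, 2 ≤ l → l ≤ j → (D l).below = (D' l).below ∧ (D l).sample = (D' l).sample)
    (I J i : ℕ) :
    (⟨p, A, z, ω⟩ : Env σ).closeB D j I J i = (⟨p, A, z, ω'⟩ : Env σ).closeB D' j I J i := by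
  have h1 := (⟨p, A, z, ω⟩ : Env σ).mem_enumerate (D := D) (j := j) (I := I) (𝒥 := [J]) (i := i)
    (J := J)
  have h2 := (⟨p, A, z, ω'⟩ : Env σ).mem_enumerate (D := D') (j := j) (I := I) (𝒥 := [J]) (i := i)
    (J := J)
  rw [enumerate_congr p A z hb j hD] at h1
  rw [Bool.eq_iff_iff]
  simpa using h1.symm.trans h2

/-- Verdicts and costs at level j are functions of the bits and of the fields `below` and `sample`
up to level j. This makes the draws of level j independent of them. -/
theorem cost_congr (p : Params) (A : GapAlg σ) (z : List σ) {ω ω' : Randomness}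
    (hb : ω.bits = ω'.bits) {D D' : ℕ → Level} (M : ℕ → ℕ) (j : ℕ)
    (hD : ∀ l, 2 ≤ l → l ≤ j → (D l).below = (D' l).below ∧ (D l).sample = (D' l).sample)
    (I J i : ℕ) :
    (⟨p, A, z, ω⟩ : Env σ).cost D M j I J i = (⟨p, A, z, ω'⟩ : Env σ).cost D' M j I J i := by
  induction j using Nat.strong_induction_on generalizing I J i with
  | _ j ih =>
    match j, ih with
    | 0, _ => simp [cost]
    | 1, _ => simp [cost]
    | j + 2, ih =>
      have h := hD (j + 2) (by omega) le_rfl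
      have ih' := ih (j + 1) (by omega) (fun l h1 h2 => hD l h1 (by omega))
      have hc := closeB_congr p A z hb (D := D) (D' := D') (j + 1)
        (fun l h1 h2 => hD l h1 (by omega))
      simp only [cost, hit, h.2, ih', show j + 2 - 1 = j + 1 from rfl, hc]

end Env

/-! ### Which random numbers a level depends on, and the data at the end of the run -/

namespace Env

variable {σ : Type*} (E : Env σ)

section Congr

variable (p : Params) (A : GapAlg σ) (z : List σ) {ω ω' : Randomness}

theorem preprocess_congr (D : ℕ → Level) {j : ℕ} (hp : ω.pick j = ω'.pick j) :
    (⟨p, A, z, ω⟩ : Env σ).preprocess D j = (⟨p, A, z, ω'⟩ : Env σ).preprocess D j := by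
  simp only [preprocess, sparseSample, findBelow, pairs, hp]

theorem testSparse_congr (hb : ω.bits = ω'.bits) {D D' : ℕ → Level} {j : ℕ}
    (hD : ∀ l, 2 ≤ l → l ≤ j → (D l).below = (D' l).below ∧ (D l).sample = (D' l).sample)
    (hd : ω.draw j = ω'.draw j) (I i : ℕ) :
    (⟨p, A, z, ω⟩ : Env σ).testSparse D j I i = (⟨p, A, z, ω'⟩ : Env σ).testSparse D' j I i := by
  simp only [testSparse, drawSet, enumerate_congr p A z hb j hD, hd]

theorem denseLoop_congr (hb : ω.bits = ω'.bits) {D D' : ℕ → Level} {j : ℕ}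
    (hD : ∀ l, 2 ≤ l → l ≤ j → (D l).below = (D' l).below ∧ (D l).sample = (D' l).sample)
    (hd : ω.draw j = ω'.draw j) (i f : ℕ) (𝒯 : List ℕ) (out : (ℕ → Bool) × (ℕ → List ℕ)) :
    (⟨p, A, z, ω⟩ : Env σ).denseLoop D j i f 𝒯 out =
      (⟨p, A, z, ω'⟩ : Env σ).denseLoop D' j i f 𝒯 out := by
  induction f generalizing 𝒯 out with
  | zero => simp only [denseLoop]
  | succ f ih =>
    cases 𝒯 with
    | nil => simp only [denseLoop]
    | cons I 𝒯 =>
      obtain ⟨sp, dn⟩ := out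
      simp only [denseLoop, testSparse_congr p A z hb hD hd, enumerate_congr p A z hb j hD, ih]

theorem denseFor_congr (hb : ω.bits = ω'.bits) {D D' : ℕ → Level} {j : ℕ}
    (hD : ∀ l, 2 ≤ l → l ≤ j → (D l).below = (D' l).below ∧ (D l).sample = (D' l).sample)
    (hd : ω.draw j = ω'.draw j) (i : ℕ) :
    (⟨p, A, z, ω⟩ : Env σ).denseFor D j i = (⟨p, A, z, ω'⟩ : Env σ).denseFor D' j i := by
  simp only [denseFor, denseLoop_congr p A z hb hD hd]

theorem processDense_congr (hb : ω.bits = ω'.bits) (D : ℕ → Level) {j : ℕ}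
    (hd : ω.draw j = ω'.draw j) :
    (⟨p, A, z, ω⟩ : Env σ).processDense D j = (⟨p, A, z, ω'⟩ : Env σ).processDense D j := by
  simp only [processDense, denseFor_congr p A z hb (D := D) (fun _ _ _ => ⟨rfl, rfl⟩) hd]

/-- The first levels depend only on the random selections of these levels. -/
theorem levels_congr (hb : ω.bits = ω'.bits) (j : ℕ)
    (hp : ∀ l, 1 ≤ l → l ≤ j → ω.pick l = ω'.pick l)
    (hd : ∀ l, 1 ≤ l → l ≤ j → ω.draw l = ω'.draw l) :
    (⟨p, A, z, ω⟩ : Env σ).levels j = (⟨p, A, z, ω'⟩ : Env σ).levels j := by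
  induction j with
  | zero => simp only [levels]
  | succ j ih =>
    simp only [levels, ih (fun l h1 h2 => hp l h1 (by omega)) (fun l h1 h2 => hd l h1 (by omega)),
      preprocess_congr p A z _ (hp (j + 1) (by omega) le_rfl),
      processDense_congr p A z hb _ (hd (j + 1) (by omega) le_rfl)]

end Congr

/-- The data after `j` iterations. -/
def lev (j : ℕ) : ℕ → Level := (E.levels j).val

/-- The data after the preprocessing of the iteration `j + 1`. -/
def stage (j : ℕ) : ℕ → Level := (E.preprocess (E.lev j) (j + 1)).val

theorem preprocess_val_of_ne (D : ℕ → Level) {j l : ℕ} (h : l ≠ j) :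
    (E.preprocess D j).val l = D l := by
  unfold preprocess
  split_ifs with h1
  · subst h1; simp [h]
  · simp [h]

theorem processDense_val_of_ne (D : ℕ → Level) {j l : ℕ} (h : l ≠ j) :
    (E.processDense D j).val l = D l := by
  simp [processDense, h]

theorem lev_succ (j : ℕ) : E.lev (j + 1) = (E.processDense (E.stage j) (j + 1)).val := rfl

theorem stage_of_le {j l : ℕ} (h : l ≤ j) : E.stage j l = E.lev j l :=
  E.preprocess_val_of_ne _ (by omega)

theorem lev_of_le {j l m : ℕ} (h : l ≤ j) (hm : j ≤ m) : E.lev m l = E.lev j l := by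
  induction m, hm using Nat.le_induction with
  | base => rfl
  | succ m hm ih => rw [lev_succ, processDense_val_of_ne _ _ (by omega), stage_of_le _ (by omega), ih]

theorem lev_eq_data {j l : ℕ} (h : l ≤ j) (hj : j ≤ E.p.k) : E.lev j l = E.data l :=
  (E.lev_of_le h hj).symm

theorem stage_eq_data {j l : ℕ} (h : l ≤ j) (hj : j ≤ E.p.k) : E.stage j l = E.data l := by
  rw [E.stage_of_le h, E.lev_eq_data h hj]

theorem data_succ {j : ℕ} (hj : j + 1 ≤ E.p.k) :
    E.data (j + 1) = (E.processDense (E.stage j) (j + 1)).val (j + 1) := by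
  rw [← E.lev_eq_data le_rfl hj]; rfl

/-- ProcessDense changes only the fields `sparse` and `boxes` of its level, and Enumerate reads
neither. So the calls made during an iteration already see final values, and everything can be
expressed through `data`. -/
theorem stage_below_sample {j l : ℕ} (h : l ≤ j + 1) (hj : j + 1 ≤ E.p.k) :
    (E.stage j l).below = (E.data l).below ∧ (E.stage j l).sample = (E.data l).sample := by
  rcases Nat.lt_or_ge j l with h' | h'
  · obtain rfl : l = j + 1 := by omega
    rw [E.data_succ hj]
    simp [processDense]
  · rw [E.stage_eq_data h' (by omega)]; exact ⟨rfl, rfl⟩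

theorem denseFor_stage {j : ℕ} (hj : j + 1 ≤ E.p.k) (i : ℕ) :
    E.denseFor (E.stage j) (j + 1) i = E.denseFor E.data (j + 1) i :=
  denseFor_congr E.p E.A E.z rfl (fun _ _ h => E.stage_below_sample h hj) rfl i

theorem sparseSample_lev {j : ℕ} (hj : j ≤ E.p.k) (I i : ℕ) :
    E.sparseSample (E.lev j) (j + 1) I i = E.sparseSample E.data (j + 1) I i := by
  simp only [sparseSample, Nat.add_sub_cancel, E.lev_eq_data le_rfl hj]

theorem findBelow_lev {j : ℕ} (hj : j ≤ E.p.k) (I i : ℕ) :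
    E.findBelow (E.lev j) (j + 1) I i = E.findBelow E.data (j + 1) I i := by
  simp only [findBelow, Nat.add_sub_cancel, E.lev_eq_data le_rfl hj]

theorem mem_pairs {j : ℕ} {I i : ℕ} :
    (I, i) ∈ E.pairs j ↔ I ∈ aligned E.p.n (E.p.w j) ∧ i ≤ E.p.a := by
  simp [pairs, and_comm]

theorem length_pairs (j : ℕ) : (E.pairs j).length = (E.p.a + 1) * (E.p.n / E.p.w j) := by
  simp [pairs, aligned, List.length_flatMap]

theorem data_sample {j : ℕ} (hj : 2 ≤ j) (hk : j ≤ E.p.k) (I i : ℕ) :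
    (E.data j).sample (I, i) =
      if (I, i) ∈ E.pairs j then (E.sparseSample E.data j I i).val else [] := by
  obtain ⟨j, rfl⟩ : ∃ l, j = l + 1 := ⟨j - 1, by omega⟩
  rw [← (E.stage_below_sample le_rfl hk).2, stage, preprocess, if_neg (by omega)]
  simp only [bind_val, write_val, produce_val, Function.update_self, tabulate_val,
    E.sparseSample_lev (show j ≤ E.p.k by omega)]

theorem data_below {j : ℕ} (hj : 2 ≤ j) (hk : j ≤ E.p.k) (I i : ℕ) :
    (E.data j).below (I, i) =
      if (I, i) ∈ E.pairs j then (E.findBelow E.data j I i).val else fun _ => false := by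
  obtain ⟨j, rfl⟩ : ∃ l, j = l + 1 := ⟨j - 1, by omega⟩
  rw [← (E.stage_below_sample le_rfl hk).1, stage, preprocess, if_neg (by omega)]
  simp only [bind_val, write_val, produce_val, Function.update_self, tabulate_val,
    E.findBelow_lev (show j ≤ E.p.k by omega)]

/-- The dense neighborhoods that are found at level `j`. -/
def dense (j i I : ℕ) : List ℕ := (E.denseFor E.data j i).val.2 I

theorem data_sparse {j : ℕ} (hj : 1 ≤ j) (hk : j ≤ E.p.k) {i : ℕ} (hi : i ≤ E.p.a) :
    (E.data j).sparse i = (E.denseFor E.data j i).val.1 := by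
  obtain ⟨j, rfl⟩ : ∃ l, j = l + 1 := ⟨j - 1, by omega⟩
  rw [E.data_succ hk]
  simp [processDense, tabulate_val, E.denseFor_stage hk, hi]

theorem data_boxes {j : ℕ} (hj : 1 ≤ j) (hk : j ≤ E.p.k) {I : ℕ}
    (hI : I ∈ aligned E.p.n (E.p.w j)) :
    (E.data j).boxes I = (List.range (E.p.a + 1)).flatMap fun i =>
      (E.dense j i I).flatMap fun J => induced (E.p.w j) J (eps ((i : ℤ) - E.p.q j)) := by
  obtain ⟨j, rfl⟩ : ∃ l, j = l + 1 := ⟨j - 1, by omega⟩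
  rw [E.data_succ hk]
  simp only [processDense, bind_val, write_val, produce_val, Function.update_self, tabulate_val,
    E.denseFor_stage hk, flatMapL_val, hI, if_true]
  rw [List.flatMap_def, List.flatMap_def]
  congr 1
  apply List.map_congr_left
  intro i hi
  rw [if_pos hi]
  rfl

theorem length_induced (w J : ℕ) (κ : ℚ) : (induced w J κ).length = Nat.log 2 w + 1 := by
  simp [induced]

/-- The time of an iteration, in terms of the final data. -/
theorem levels_succ_time_le {j : ℕ} (hk : j + 1 ≤ E.p.k) :
    (E.levels (j + 1)).time ≤ (E.levels j).time +
      (5 + (E.pairs (j + 1)).length + (if j = 0 then 0 else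
        ((E.pairs (j + 1)).map fun Ii => 4 + (E.sparseSample E.data (j + 1) Ii.1 Ii.2).time +
          (E.findBelow E.data (j + 1) Ii.1 Ii.2).time).sum)) +
      (6 + E.p.a + ((List.range (E.p.a + 1)).map fun i =>
          2 + (E.denseFor E.data (j + 1) i).time).sum +
        (aligned E.p.n (E.p.w (j + 1))).length +
        ((aligned E.p.n (E.p.w (j + 1))).map fun I => 3 + ((List.range (E.p.a + 1)).map fun i =>
          3 + (E.dense (j + 1) i I).length * (6 + 3 * Nat.log 2 (E.p.w (j + 1)))).sum).sum) := by
  have h1 : (E.preprocess (E.lev j) (j + 1)).time ≤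
      5 + (E.pairs (j + 1)).length + (if j = 0 then 0 else
        ((E.pairs (j + 1)).map fun Ii => 4 + (E.sparseSample E.data (j + 1) Ii.1 Ii.2).time +
          (E.findBelow E.data (j + 1) Ii.1 Ii.2).time).sum) := by
    unfold preprocess
    rcases Nat.eq_zero_or_pos j with rfl | hj
    · simp; omega
    · rw [if_neg (by omega), if_neg (by omega)]
      simp only [bind_time, produce_time, tabulate_time, write_time, produce_val,
        E.sparseSample_lev (show j ≤ E.p.k by omega), E.findBelow_lev (show j ≤ E.p.k by omega)]
      have : ((E.pairs (j + 1)).map fun Ii => 4 + (E.sparseSample E.data (j + 1) Ii.1 Ii.2).time +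
          (E.findBelow E.data (j + 1) Ii.1 Ii.2).time).sum =
          ((E.pairs (j + 1)).map fun Ii =>
            2 + (E.sparseSample E.data (j + 1) Ii.1 Ii.2).time).sum +
          ((E.pairs (j + 1)).map fun Ii =>
            2 + (E.findBelow E.data (j + 1) Ii.1 Ii.2).time).sum := by
        rw [← List.sum_map_add]
        congr 1
        apply List.map_congr_left
        intros; omega
      omega
  have h2 : (E.processDense (E.stage j) (j + 1)).time ≤
      6 + E.p.a + ((List.range (E.p.a + 1)).map fun i =>
          2 + (E.denseFor E.data (j + 1) i).time).sum +
        (aligned E.p.n (E.p.w (j + 1))).length +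
        ((aligned E.p.n (E.p.w (j + 1))).map fun I => 3 + ((List.range (E.p.a + 1)).map fun i =>
          3 + (E.dense (j + 1) i I).length * (6 + 3 * Nat.log 2 (E.p.w (j + 1)))).sum).sum := by
    simp only [processDense, bind_time, produce_time, tabulate_time, write_time, produce_val,
      E.denseFor_stage hk, flatMapL_time, flatMapL_val, tabulate_val, length_induced,
      List.length_range, List.length_flatMap]
    have h3 : ((aligned E.p.n (E.p.w (j + 1))).map fun I => 2 + (1 +
        ((List.range (E.p.a + 1)).map fun i => 2 + (1 + (((if i ∈ List.range (E.p.a + 1) then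
            (E.denseFor E.data (j + 1) i).val else (fun _ => false, fun _ => [])).2 I).map fun J =>
              2 + (Nat.log 2 (E.p.w (j + 1)) + 1 + 1) + (Nat.log 2 (E.p.w (j + 1)) + 1)).sum) +
            (((if i ∈ List.range (E.p.a + 1) then
            (E.denseFor E.data (j + 1) i).val else (fun _ => false, fun _ => [])).2 I).map fun J =>
              Nat.log 2 (E.p.w (j + 1)) + 1).sum).sum)).sum ≤
        ((aligned E.p.n (E.p.w (j + 1))).map fun I => 3 + ((List.range (E.p.a + 1)).map fun i =>
          3 + (E.dense (j + 1) i I).length * (6 + 3 * Nat.log 2 (E.p.w (j + 1)))).sum).sum := by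
      refine List.sum_map_le_sum_map' fun I _ => ?_
      have : ∀ i ∈ List.range (E.p.a + 1), 2 + (1 + (((if i ∈ List.range (E.p.a + 1) then
            (E.denseFor E.data (j + 1) i).val else (fun _ => false, fun _ => [])).2 I).map fun J =>
              2 + (Nat.log 2 (E.p.w (j + 1)) + 1 + 1) + (Nat.log 2 (E.p.w (j + 1)) + 1)).sum) +
            (((if i ∈ List.range (E.p.a + 1) then
            (E.denseFor E.data (j + 1) i).val else (fun _ => false, fun _ => [])).2 I).map fun J =>
              Nat.log 2 (E.p.w (j + 1)) + 1).sum ≤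
          3 + (E.dense (j + 1) i I).length * (6 + 3 * Nat.log 2 (E.p.w (j + 1))) := by
        intro i hi
        rw [if_pos hi]
        simp only [List.map_const', List.sum_replicate, smul_eq_mul, dense]
        apply le_of_eq; ring
      have := List.sum_map_le_sum_map' this
      omega
    omega
  have h3 : (E.levels (j + 1)).time = (E.levels j).time + (E.preprocess (E.lev j) (j + 1)).time +
      (E.processDense (E.stage j) (j + 1)).time := by
    rw [levels]
    simp only [bind_time, lev, stage]
    omega
  omega

end Env

/-! Powers of two, grids and intervals -/

theorem eps_pos (i : ℤ) : 0 < eps i := by unfold eps; positivity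

theorem eps_sub_nat (i : ℤ) (m : ℕ) : eps (i - m) = 2 ^ m * eps i := by
  unfold eps
  rw [neg_sub, sub_eq_add_neg, zpow_add₀ (by norm_num), zpow_natCast]

theorem eps_natCast (i : ℕ) : eps i = 1 / 2 ^ i := by
  unfold eps
  rw [zpow_neg, zpow_natCast, one_div]

theorem eps_add_nat (i : ℤ) (m : ℕ) : eps (i + m) * 2 ^ m = eps i := by
  have := eps_sub_nat (i + m) m
  rw [add_sub_cancel_right] at this
  rw [this, mul_comm]

theorem gridStep_two_pow (m i : ℕ) : gridStep (2 ^ m) i = 2 ^ (m - (i + 3)) := by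
  unfold gridStep
  rcases Nat.lt_or_ge m (i + 3) with h | h
  · rw [Nat.div_eq_of_lt (Nat.pow_lt_pow_right (by norm_num) h), Nat.sub_eq_zero_of_le h.le]
    rfl
  · rw [Nat.pow_div h (by norm_num)]
    exact max_eq_left Nat.one_le_two_pow

theorem gridStep_pos (w i : ℕ) : 0 < gridStep w i := lt_max_of_lt_right one_pos

theorem mem_grid {n w i J : ℕ} (hw : w ≤ 2 * n) :
    J ∈ grid n w i ↔ gridStep w i ∣ J ∧ J + w ≤ 2 * n := by
  have hg := gridStep_pos w i
  simp only [grid, List.mem_map, List.mem_range, Nat.lt_succ_iff]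
  constructor
  · rintro ⟨t, ht, rfl⟩
    have := (Nat.le_div_iff_mul_le hg).1 ht
    exact ⟨dvd_mul_left _ _, by omega⟩
  · rintro ⟨⟨t, rfl⟩, h⟩
    refine ⟨t, (Nat.le_div_iff_mul_le hg).2 ?_, mul_comm _ _⟩
    rw [mul_comm]; omega

theorem grid_nodup (n w i : ℕ) : (grid n w i).Nodup := by
  refine List.Nodup.map (fun a b h => ?_) List.nodup_range
  exact Nat.eq_of_mul_eq_mul_right (gridStep_pos w i) h

theorem mem_aligned {n w I : ℕ} (hw : 0 < w) : I ∈ aligned n w ↔ w ∣ I ∧ I + w ≤ n := by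
  simp only [aligned, List.mem_map, List.mem_range]
  constructor
  · rintro ⟨t, ht, rfl⟩
    have := (Nat.le_div_iff_mul_le hw).1 (Nat.succ_le_of_lt ht)
    exact ⟨dvd_mul_left _ _, by rw [Nat.succ_mul] at this; exact this⟩
  · rintro ⟨⟨t, rfl⟩, h⟩
    refine ⟨t, Nat.lt_of_succ_le ((Nat.le_div_iff_mul_le hw).2 ?_), mul_comm _ _⟩
    rw [Nat.succ_mul, mul_comm t]; exact h

theorem aligned_nodup {n w : ℕ} (hw : 0 < w) : (aligned n w).Nodup :=
  List.Nodup.map (fun _ _ h => Nat.eq_of_mul_eq_mul_right hw h) List.nodup_range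

theorem length_aligned (n w : ℕ) : (aligned n w).length = n / w := by simp [aligned]

theorem mem_alignedIn {w w' I I' : ℕ} :
    I' ∈ alignedIn w w' I ↔ ∃ t < w / w', I' = I + t * w' := by
  simp [alignedIn, eq_comm]

theorem mem_zoomIn {w w' I J i I' i' J' : ℕ} :
    J' ∈ zoomIn w w' I J i I' i' ↔ gridStep w' i' ∣ J' ∧ J ≤ J' ∧
      J + (I' - I) - 2 * w / 2 ^ i ≤ J' ∧ J' ≤ J + w - w' ∧
        J' ≤ J + (I' - I) + 2 * w / 2 ^ i := by
  have hg := gridStep_pos w' i'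
  simp only [zoomIn, List.mem_map, List.mem_range]
  generalize 2 * w / 2 ^ i = r
  set g := gridStep w' i'
  constructor
  · rintro ⟨t, ht, rfl⟩
    have h1 : ((max J (J + (I' - I) - r) + g - 1) / g + t) * g ≤
        min (J + w - w') (J + (I' - I) + r) :=
      Nat.mul_le_of_le_div g _ _ (Nat.le_of_lt_succ (Nat.add_lt_of_lt_sub' ht))
    have h2 : max J (J + (I' - I) - r) ≤
        (max J (J + (I' - I) - r) + g - 1) / g * g := by
      have := Nat.div_add_mod (max J (J + (I' - I) - r) + g - 1) g
      have h3 := Nat.mod_lt (max J (J + (I' - I) - r) + g - 1) hg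
      rw [mul_comm]
      omega
    rw [Nat.add_mul] at *
    have h4 := le_max_left J (J + (I' - I) - r)
    have h5 := le_max_right J (J + (I' - I) - r)
    have h6 := min_le_left (J + w - w') (J + (I' - I) + r)
    have h7 := min_le_right (J + w - w') (J + (I' - I) + r)
    refine ⟨⟨_, by rw [← Nat.add_mul, mul_comm]⟩, ?_, ?_, ?_, ?_⟩ <;> omega
  · rintro ⟨⟨u, rfl⟩, h1, h2, h3, h4⟩
    have h5 : (max J (J + (I' - I) - r) + g - 1) / g ≤ u := by
      rw [Nat.div_le_iff_le_mul_add_pred hg]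
      have := max_le h1 h2
      omega
    have h6 : u ≤ min (J + w - w') (J + (I' - I) + r) / g := by
      rw [Nat.le_div_iff_mul_le hg, mul_comm]
      exact le_min h3 h4
    exact ⟨u - (max J (J + (I' - I) - r) + g - 1) / g, by omega, by
      rw [Nat.add_sub_cancel' h5, mul_comm]⟩

theorem zoomIn_nodup (w w' I J i I' i' : ℕ) : (zoomIn w w' I J i I' i').Nodup := by
  refine List.Nodup.map (fun a b h => ?_) List.nodup_range
  exact Nat.add_left_cancel (Nat.eq_of_mul_eq_mul_right (gridStep_pos w' i') h)

theorem roundDown_le (w h J : ℕ) : roundDown w h J ≤ J := Nat.div_mul_le_self _ _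

theorem lt_roundDown_add (w h J : ℕ) : J < roundDown w h J + gridStep w h := by
  unfold roundDown
  have h1 := Nat.div_add_mod J (gridStep w h)
  have h2 := Nat.mod_lt J (gridStep_pos w h)
  rw [mul_comm] at h1
  omega

/-- Rounding down to the grid moves an integer by at most the step minus one. The subtraction of one
lets the estimate survive when the step is clipped to 1, where ε_h w / 8 may be smaller than the
step. -/
theorem gridStep_sub_one_le (m h : ℕ) :
    ((gridStep (2 ^ m) h - 1 : ℕ) : ℚ) * 8 ≤ eps h * (2 ^ m : ℕ) := by
  rw [gridStep_two_pow, eps_natCast]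
  rcases Nat.lt_or_ge m (h + 3) with h' | h'
  · rw [Nat.sub_eq_zero_of_le h'.le]
    simp
  · have h1 : (2 : ℚ) ^ m = 2 ^ (m - (h + 3)) * 8 * 2 ^ h := by
      rw [show (8 : ℚ) = 2 ^ 3 by norm_num, mul_assoc, ← pow_add, ← pow_add]
      congr 1; omega
    have h2 : ((2 ^ (m - (h + 3)) - 1 : ℕ) : ℚ) ≤ 2 ^ (m - (h + 3)) := by
      exact_mod_cast Nat.sub_le _ _
    push_cast
    rw [h1, one_div, ← div_eq_inv_mul, mul_div_assoc, div_self (by positivity), mul_one]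
    linarith

theorem editDist_le_of_length_eq {σ : Type*} {u v : List σ} (h : u.length = v.length) :
    editDist u v ≤ u.length := by
  have : Edits u v u.length := by
    induction u generalizing v with
    | nil => rw [List.length_nil] at h; rw [List.eq_nil_of_length_eq_zero h.symm]; exact .nil
    | cons a u ih =>
      cases v with
      | nil => simp at h
      | cons b v => exact .substitute a b (ih (by simpa using h))
  exact editDist_le this

/-! ### Consequences of the assumptions on the parameters -/

namespace Params.Valid

variable {p : Params} (hp : p.Valid)

include hp

theorem w_pos {j : ℕ} (hj : 1 ≤ j) (hk : j ≤ p.k + 1) : 0 < p.w j := by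
  obtain ⟨s, hs⟩ := hp.w_pow j hj hk
  rw [hs]; positivity

theorem w_one_le {j : ℕ} (hj : 1 ≤ j) (hk : j ≤ p.k + 1) : p.w 1 ≤ p.w j := by
  induction j, hj using Nat.le_induction with
  | base => exact le_rfl
  | succ m hm ih => exact (ih (by omega)).trans (hp.w_lt m hm (by omega)).le

theorem w_le_n {j : ℕ} (hj : 1 ≤ j) (hk : j ≤ p.k + 1) : p.w j ≤ p.n := by
  rw [← hp.w_last]
  induction hk using Nat.decreasingInduction with
  | self => exact le_rfl
  | of_succ m hm ih => exact (hp.w_lt m hj (by omega)).le.trans (ih (by omega))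

theorem w_one_eq : p.w 1 = p.d 0 := by rw [hp.w_first, hp.d_first]

theorem n_pos : 0 < p.n := by
  obtain ⟨s, hs⟩ := hp.n_pow
  rw [hs]; positivity

theorem d_pos {j : ℕ} (hj : j ≤ p.k) : 0 < p.d j := by
  obtain ⟨s, hs⟩ := hp.d_pow j hj
  rw [hs]; positivity

theorem d_le {j l : ℕ} (hjl : j ≤ l) (hl : l ≤ p.k) : p.d l ≤ p.d j := by
  induction l, hjl using Nat.le_induction with
  | base => exact le_rfl
  | succ m hm ih => exact (hp.d_lt m (by omega)).le.trans (ih (by omega))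

/-- The strict decrease d 1 < d 0 excludes width 1. It follows that n is at least 4, which bounds
the logarithms from below. -/
theorem two_le_w_one : 2 ≤ p.w 1 := by
  have h := hp.d_lt 0 hp.k_pos
  have h1 := hp.d_pos (j := 0 + 1) hp.k_pos
  rw [hp.w_one_eq]
  omega

theorem w_one_sq_le : p.w 1 * p.w 1 ≤ p.n := by
  have h1 : Nat.sqrt p.n ≠ 0 := by
    rw [Ne, Nat.sqrt_eq_zero]; exact hp.n_pos.ne'
  have h2 : p.w 1 ≤ Nat.sqrt p.n := by
    rw [hp.w_first]; exact Nat.pow_log_le_self 2 h1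
  exact (Nat.mul_le_mul h2 h2).trans (Nat.sqrt_le p.n)

/-- The choice of w 1 gives n < 4 (w 1)^2, and both sides are powers of two. -/
theorem n_le_w_one_sq : p.n ≤ 2 * (p.w 1 * p.w 1) := by
  obtain ⟨s, hs⟩ := hp.n_pow
  have h1 : Nat.sqrt p.n < 2 * p.w 1 := by
    rw [hp.w_first, ← pow_succ']; exact Nat.lt_pow_succ_log_self (by norm_num) _
  have h2 : p.n < (2 * p.w 1) * (2 * p.w 1) := Nat.sqrt_lt.1 h1
  rw [hp.w_first, hs] at h2 ⊢
  set m := Nat.log 2 (Nat.sqrt (2 ^ s))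
  have h3 : 2 * 2 ^ m * (2 * 2 ^ m) = 2 ^ (2 * m + 2) := by ring
  have h4 : 2 * (2 ^ m * 2 ^ m) = 2 ^ (2 * m + 1) := by ring
  rw [h3] at h2
  rw [h4]
  have := (Nat.pow_lt_pow_iff_right (by norm_num : 1 < 2)).1 h2
  exact Nat.pow_le_pow_right (by norm_num) (by omega)

theorem four_le_n : 4 ≤ p.n := by
  have := hp.w_one_sq_le
  have := hp.two_le_w_one
  nlinarith

theorem two_pow_mul_w_le {j : ℕ} (hj : 1 ≤ j) (hk : j ≤ p.k) :
    2 ^ (p.a + 1) * p.w j ≤ p.w (j + 1) := by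
  have h := hp.ratio j hj hk
  have h1 : (0 : ℝ) < p.w (j + 1) := by exact_mod_cast hp.w_pos (by omega) (by omega)
  rw [div_le_iff₀ h1, Params.θ] at h
  have h2 : (2 : ℝ) ^ (p.a + 1) * p.w j ≤ p.w (j + 1) := by
    calc (2 : ℝ) ^ (p.a + 1) * p.w j ≤ 2 ^ (p.a + 1) * ((1 / 2) ^ p.a / 2 * p.w (j + 1)) := by
          gcongr
      _ = (2 * (1 / 2)) ^ p.a * p.w (j + 1) := by rw [mul_pow]; ring
      _ = p.w (j + 1) := by norm_num
  exact_mod_cast h2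

/-- The exponents of consecutive widths. -/
theorem exists_exponents {j : ℕ} (hj : 1 ≤ j) (hk : j ≤ p.k) :
    ∃ m' m, p.w j = 2 ^ m' ∧ p.w (j + 1) = 2 ^ m ∧ m' + p.a + 1 ≤ m := by
  obtain ⟨m', hm'⟩ := hp.w_pow j hj (by omega)
  obtain ⟨m, hm⟩ := hp.w_pow (j + 1) (by omega) (by omega)
  refine ⟨m', m, hm', hm, ?_⟩
  have h := hp.two_pow_mul_w_le hj hk
  rw [hm', hm, ← pow_add] at h
  have := (Nat.pow_le_pow_iff_right (by norm_num : 1 < 2)).1 h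
  omega

theorem w_dvd_w_succ {j : ℕ} (hj : 1 ≤ j) (hk : j ≤ p.k) : p.w j ∣ p.w (j + 1) := by
  obtain ⟨m', m, h1, h2, h3⟩ := hp.exists_exponents hj hk
  rw [h1, h2]
  exact pow_dvd_pow 2 (by omega)

theorem w_dvd_n {j : ℕ} (hj : 1 ≤ j) (hk : j ≤ p.k + 1) : p.w j ∣ p.n := by
  rw [← hp.w_last]
  induction hk using Nat.decreasingInduction with
  | self => exact dvd_rfl
  | of_succ m hm ih => exact (hp.w_dvd_w_succ hj (by omega)).trans (ih (by omega))

/-- The first ratio of widths is at least 2^(a+1) and at most n. Hence the number of scales is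
logarithmic. -/
theorem a_add_one_le_log : p.a + 1 ≤ Nat.log 2 p.n := by
  have h := hp.two_pow_mul_w_le le_rfl hp.k_pos
  have h1 := hp.w_le_n (j := 1 + 1) (by omega) (by have := hp.k_pos; omega)
  have h2 := hp.two_le_w_one
  refine Nat.le_log_of_pow_le (by norm_num) ?_
  nlinarith [Nat.one_le_two_pow (n := p.a + 1)]

theorem mem_aligned_iff {j I : ℕ} (hj : 1 ≤ j) (hk : j ≤ p.k + 1) :
    I ∈ aligned p.n (p.w j) ↔ p.w j ∣ I ∧ I + p.w j ≤ p.n :=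
  mem_aligned (hp.w_pos hj hk)

theorem mem_grid_iff {j i J : ℕ} (hj : 1 ≤ j) (hk : j ≤ p.k + 1) :
    J ∈ grid p.n (p.w j) i ↔ gridStep (p.w j) i ∣ J ∧ J + p.w j ≤ 2 * p.n :=
  mem_grid (by have := hp.w_le_n hj hk; omega)

theorem gridStep_dvd_w {j : ℕ} (hj : 1 ≤ j) (hk : j ≤ p.k + 1) (i : ℕ) :
    gridStep (p.w j) i ∣ p.w j := by
  obtain ⟨m, hm⟩ := hp.w_pow j hj hk
  rw [hm, gridStep_two_pow]
  exact pow_dvd_pow 2 (by omega)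

/-- The ratio of consecutive widths is at least 2/θ, so every grid of level j refines every grid of
level j + 1. In particular both ends of J are grid points for the smaller intervals inside J. -/
theorem gridStep_dvd_gridStep_succ {j : ℕ} (hj : 1 ≤ j) (hk : j ≤ p.k) {i i' : ℕ} (hi : i ≤ p.a) :
    gridStep (p.w j) i' ∣ gridStep (p.w (j + 1)) i := by
  obtain ⟨m', m, h1, h2, h3⟩ := hp.exists_exponents hj hk
  rw [h1, h2, gridStep_two_pow, gridStep_two_pow]
  exact pow_dvd_pow 2 (by omega)

theorem mem_grid_of_mem_aligned {j : ℕ} (hj : 1 ≤ j) (hk : j ≤ p.k + 1) {I : ℕ}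
    (h : I ∈ aligned p.n (p.w j)) (i : ℕ) : I ∈ grid p.n (p.w j) i := by
  rw [hp.mem_aligned_iff hj hk] at h
  rw [hp.mem_grid_iff hj hk]
  exact ⟨(hp.gridStep_dvd_w hj hk i).trans h.1, by omega⟩

theorem roundDown_mem_grid {j : ℕ} (hj : 1 ≤ j) (hk : j ≤ p.k + 1) {J i h : ℕ}
    (hJ : J ∈ grid p.n (p.w j) i) : roundDown (p.w j) h J ∈ grid p.n (p.w j) h := by
  rw [hp.mem_grid_iff hj hk] at hJ ⊢
  have := roundDown_le (p.w j) h J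
  exact ⟨dvd_mul_left _ _, by omega⟩

theorem mem_aligned_of_mem_alignedIn {j : ℕ} (hj : 1 ≤ j) (hk : j ≤ p.k) {I I' : ℕ}
    (hI : I ∈ aligned p.n (p.w (j + 1))) (h : I' ∈ alignedIn (p.w (j + 1)) (p.w j) I) :
    I' ∈ aligned p.n (p.w j) := by
  rw [hp.mem_aligned_iff (by omega) (by omega)] at hI ⊢
  obtain ⟨t, ht, rfl⟩ := mem_alignedIn.1 h
  have h1 := Nat.div_mul_cancel (hp.w_dvd_w_succ hj hk)
  have h2 := Nat.mul_le_mul_right (p.w j) (Nat.succ_le_of_lt ht)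
  rw [Nat.succ_mul] at h2
  exact ⟨dvd_add ((hp.w_dvd_w_succ hj hk).trans hI.1) (dvd_mul_left _ _), by omega⟩

theorem mem_grid_of_mem_zoomIn {j : ℕ} (hj : 1 ≤ j) (hk : j ≤ p.k) {I J i I' i' J' : ℕ}
    (hJ : J ∈ grid p.n (p.w (j + 1)) i)
    (h : J' ∈ zoomIn (p.w (j + 1)) (p.w j) I J i I' i') : J' ∈ grid p.n (p.w j) i' := by
  rw [hp.mem_grid_iff (by omega) (by omega)] at hJ ⊢
  have h1 := zoomIn_add_le (hp.w_lt j hj hk).le h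
  exact ⟨(mem_zoomIn.1 h).1, by omega⟩

/-- The division in the radius of `zoomIn` is exact, since 2^i divides the width. -/
theorem two_mul_div_two_pow {j : ℕ} (hj : 1 ≤ j) (hk : j ≤ p.k) {i : ℕ} (hi : i ≤ p.a) :
    ((2 * p.w (j + 1) / 2 ^ i : ℕ) : ℚ) = 2 * (eps i * p.w (j + 1)) := by
  obtain ⟨m', m, h1, h2, h3⟩ := hp.exists_exponents hj hk
  rw [h2, eps_natCast, Nat.cast_div]
  · push_cast; ring
  · exact (pow_dvd_pow 2 (by omega)).trans (dvd_mul_left _ _)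
  · positivity

theorem gridStep_sub_one_le {j : ℕ} (hj : 1 ≤ j) (hk : j ≤ p.k + 1) (h : ℕ) :
    ((gridStep (p.w j) h - 1 : ℕ) : ℚ) * 8 ≤ eps h * p.w j := by
  obtain ⟨m, hm⟩ := hp.w_pow j hj hk
  rw [hm]
  exact _root_.gridStep_sub_one_le m h

end Params.Valid

/-- All paths found by the pattern match are witnessed by edit distances. -/
theorem apm_sound {σ : Type*} {z : List σ} {m w w' I : ℕ} {κ : ℚ} {cols : List (List WBox)}
    {𝒥 : List ℕ} (hlen : cols.length * w' = w) (h𝒥 : ∀ J ∈ 𝒥, J + w < 2 ^ m)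
    (hcols : ∀ col ∈ cols, ∀ e ∈ col, e.lo ≤ e.hi ∧ e.hi < 2 ^ m)
    (hcert : ∀ (s : ℕ) (hs : s < cols.length), ∀ e ∈ cols[s],
      (editDist (seg z (I + s * w') (I + (s + 1) * w')) (seg z e.lo e.hi) : ℚ) ≤ e.κ * w')
    {J : ℕ} (hI : I + w ≤ z.length) (hJ : J + w ≤ z.length)
    (h : J ∈ (apm m w w' κ cols 𝒥).val) :
    (editDist (substr z w I) (substr z w J) : ℚ) ≤ 2 * (κ * w) := by
  obtain ⟨hJ𝒥, hle⟩ := mem_apm.1 h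
  -- Invariant after s columns: a benefit v at height y comes from some starting height J' ≤ y, and
  -- s w' + (y - v) bounds the distance of the substrings read since then.
  have hs := finalTree_sound (m := m) (w' := w') (cols := cols) (𝒥 := 𝒥)
    (fun s y v => ∃ J' ≤ y,
      (editDist (seg z I (I + s * w')) (seg z J' y) : ℚ) ≤ s * w' + (y - v))
    (fun J hJ => by have := h𝒥 J hJ; omega)
    (fun col hc e he => by have := hcols col hc e he; omega)
    -- An unset key counts as benefit 0; the empty substring at y itself is the witness.
    (fun y => ⟨y, le_rfl, by simp [seg_self, editDist_self]⟩)
    (fun J _ y hy => ⟨y, le_rfl, by simp [seg_self, editDist_self, hy]⟩)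
    (fun s y v ⟨J', hJ', hd⟩ => ⟨J', hJ', by
      have h1 : editDist (seg z I (I + (s + 1) * w')) (seg z J' y) ≤
          editDist (seg z I (I + s * w')) (seg z J' y) + w' := by
        have := editDist_seg_core_le (z := z) (le_refl I) (show I ≤ I + s * w' by omega)
          (show I + s * w' ≤ I + (s + 1) * w' by nlinarith)
        have h2 := editDist_triangle (seg z I (I + (s + 1) * w')) (seg z I (I + s * w'))
          (seg z J' y)
        have h3 : I + (s + 1) * w' - (I + s * w') = w' := by
          rw [Nat.add_sub_add_left, Nat.succ_mul, Nat.add_sub_cancel_left]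
        omega
      have h2 : (editDist (seg z I (I + (s + 1) * w')) (seg z J' y) : ℚ) ≤
          editDist (seg z I (I + s * w')) (seg z J' y) + w' := by exact_mod_cast h1
      push_cast
      linarith⟩)
    (fun s hs e he v ⟨J', hJ', hd⟩ y hy => ⟨J', by
        have := hcols _ (List.getElem_mem hs) e he; omega, by
      have hlohi := (hcols _ (List.getElem_mem hs) e he).1
      have h1 := hcert s hs e he
      have h2 := editDist_append_le (seg z I (I + s * w')) (seg z J' e.lo)
        (seg z (I + s * w') (I + (s + 1) * w')) (seg z e.lo e.hi)
      rw [seg_append (by omega) (by nlinarith), seg_append hJ' hlohi] at h2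
      have h3 := editDist_seg_core_le (z := z) (le_refl J') (hJ'.trans hlohi) hy
      rw [editDist_comm] at h3
      have h4 := editDist_triangle (seg z I (I + (s + 1) * w')) (seg z J' e.hi) (seg z J' y)
      have h5 : editDist (seg z I (I + (s + 1) * w')) (seg z J' y) + e.hi ≤
        editDist (seg z I (I + s * w')) (seg z J' e.lo) +
        editDist (seg z (I + s * w') (I + (s + 1) * w')) (seg z e.lo e.hi) + y := by omega
      have h6 : (editDist (seg z I (I + (s + 1) * w')) (seg z J' y) : ℚ) + e.hi ≤
        editDist (seg z I (I + s * w')) (seg z J' e.lo) +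
        editDist (seg z (I + s * w') (I + (s + 1) * w')) (seg z e.lo e.hi) + y := by
          exact_mod_cast h5
      push_cast
      linarith⟩) (J + w) (h𝒥 J hJ𝒥)
  obtain ⟨J', hJ', hd⟩ := hs
  rw [hlen] at hd
  have hlenq : (cols.length : ℚ) * w' = w := by exact_mod_cast hlen
  rw [hlenq] at hd
  have hd' : (editDist (seg z I (I + w)) (seg z J' (J + w)) : ℚ) ≤ κ * w := by
    push_cast at hd; linarith
  rw [substr_eq_seg, substr_eq_seg]
  -- The path need not have started at J. Since the lengths are known, J' and J differ by at most
  -- the distance found, and moving the start to J costs at most that much again: hence the factor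
  -- 2.
  have h1 := editDist_triangle (seg z I (I + w)) (seg z J' (J + w)) (seg z J (J + w))
  have h2 := editDist_seg_le (z := z) hJ' (show J ≤ J + w by omega)
  have h3 := length_le_add_editDist (seg z I (I + w)) (seg z J' (J + w))
  have h4 := length_le_add_editDist (seg z J' (J + w)) (seg z I (I + w))
  rw [editDist_comm (seg z J' (J + w))] at h4
  rw [length_seg hI, length_seg hJ] at h3 h4
  have h5 : editDist (seg z I (I + w)) (seg z J (J + w)) ≤
      2 * editDist (seg z I (I + w)) (seg z J' (J + w)) := by omega
  have h6 : (editDist (seg z I (I + w)) (seg z J (J + w)) : ℚ) ≤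
      2 * editDist (seg z I (I + w)) (seg z J' (J + w)) := by exact_mod_cast h5
  linarith

theorem mem_induced {w J : ℕ} {κ : ℚ} {e : WBox} :
    e ∈ induced w J κ ↔ e = ⟨J, J + w, κ⟩ ∨
      ∃ s < Nat.log 2 w, e = ⟨J + 2 ^ s, J + w - 2 ^ s, κ + 2 ^ (s + 1) / w⟩ := by
  simp [induced, eq_comm]

theorem two_pow_succ_le_of_lt_log {w s : ℕ} (hw : w ≠ 0) (h : s < Nat.log 2 w) :
    2 ^ (s + 1) ≤ w :=
  (Nat.pow_le_pow_right (by norm_num) h).trans (Nat.pow_log_le_self 2 hw)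

/-- Cutting 2^s characters off at each end costs 2^(s+1) deletions, which is the surcharge in the
weight of the induced box. -/
theorem induced_certified {σ : Type*} {z : List σ} {w I J : ℕ} {κ : ℚ} {e : WBox} (hw : 0 < w)
    (h : (editDist (substr z w I) (substr z w J) : ℚ) ≤ κ * w) (he : e ∈ induced w J κ) :
    J ≤ e.lo ∧ e.lo ≤ e.hi ∧ e.hi ≤ J + w ∧
      (editDist (seg z I (I + w)) (seg z e.lo e.hi) : ℚ) ≤ e.κ * w := by
  rw [substr_eq_seg, substr_eq_seg] at h
  rcases mem_induced.1 he with rfl | ⟨s, hs, rfl⟩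
  · exact ⟨le_rfl, by simp, le_rfl, h⟩
  · have h1 := two_pow_succ_le_of_lt_log hw.ne' hs
    have h0 : 2 ^ (s + 1) = 2 * 2 ^ s := by ring
    have h2 := editDist_seg_core_le (z := z) (show J ≤ J + 2 ^ s by omega)
      (show J + 2 ^ s ≤ J + w - 2 ^ s by omega) (show J + w - 2 ^ s ≤ J + w by omega)
    have h3 := editDist_triangle (seg z I (I + w)) (seg z J (J + w))
      (seg z (J + 2 ^ s) (J + w - 2 ^ s))
    have h4 : editDist (seg z I (I + w)) (seg z (J + 2 ^ s) (J + w - 2 ^ s)) ≤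
      editDist (seg z I (I + w)) (seg z J (J + w)) + 2 ^ (s + 1) := by omega
    refine ⟨by simp, by simp only; omega, by simp, ?_⟩
    have h5 : (editDist (seg z I (I + w)) (seg z (J + 2 ^ s) (J + w - 2 ^ s)) : ℚ) ≤
      editDist (seg z I (I + w)) (seg z J (J + w)) + 2 ^ (s + 1) := by exact_mod_cast h4
    have h6 : (κ + 2 ^ (s + 1) / w) * w = κ * w + 2 ^ (s + 1) := by
      field_simp
    rw [h6]
    linarith

/-! ### Soundness: what is classified as close is close -/

namespace Env

variable {σ : Type*} (E : Env σ)

/-- The assumptions on a run: valid parameters, a string of the right length, acceptance of the slow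
algorithm only at small distances, and selections within range. -/
structure WellFormed : Prop where
  valid : E.p.Valid
  length_z : E.z.length = 2 * E.p.n
  sound : ∀ j, 1 ≤ j → j ≤ E.p.k → ∀ i ≤ E.p.a, ∀ I J, I + E.p.w j ≤ E.p.n →
    J + E.p.w j ≤ 2 * E.p.n → (E.callED j I J i).val = true →
      (editDist (substr E.z (E.p.w j) I) (substr E.z (E.p.w j) J) : ℚ) ≤
        eps ((i : ℤ) - E.p.q₀) * E.p.w j
  pick_lt : ∀ j I i t m, 0 < m → E.ω.pick j I i t m < m

/-- The edit distance of two substrings of the width of level `j`. -/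
noncomputable def ed (j I J : ℕ) : ℕ := editDist (substr E.z (E.p.w j) I) (substr E.z (E.p.w j) J)

theorem ed_triangle (j I J K : ℕ) : E.ed j I K ≤ E.ed j I J + E.ed j J K :=
  editDist_triangle _ _ _

theorem ed_comm (j I J : ℕ) : E.ed j I J = E.ed j J I := editDist_comm _ _

theorem ed_self (j I : ℕ) : E.ed j I I = 0 := editDist_self _

theorem ed_shift_le (j I J : ℕ) (h : I ≤ J) : E.ed j I J ≤ 2 * (J - I) := by
  rw [ed, substr_eq_seg, substr_eq_seg]
  have := editDist_seg_le (z := E.z) (show I ≤ I + E.p.w j by omega) (show J ≤ J + E.p.w j by omega)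
  omega

/-- The intervals that are removed together with the dense interval `I`. -/
def nearX (D : ℕ → Level) (j I i : ℕ) : List ℕ :=
  (E.enumerate D j I (aligned E.p.n (E.p.w j)) (i - E.p.q (j - 1) - 7)).val

/-- The dense neighborhood that is assigned to these intervals. -/
def nearY (D : ℕ → Level) (j I i : ℕ) : List ℕ :=
  (grid E.p.n (E.p.w j) i).filter fun J => decide (roundDown (E.p.w j)
    (i - 2 * E.p.q (j - 1) - 14) J ∈ (E.enumerate D j I
      (grid E.p.n (E.p.w j) (i - 2 * E.p.q (j - 1) - 14)) (i - 2 * E.p.q (j - 1) - 14)).val)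

theorem foldl_update_const {β : Type*} (X : List ℕ) (Y : β) (dn : ℕ → β) (I : ℕ) :
    X.foldl (fun dn I' => Function.update dn I' Y) dn I = if I ∈ X then Y else dn I := by
  induction X generalizing dn with
  | nil => simp
  | cons x xs ih =>
    rw [List.foldl_cons, ih]
    by_cases h : I = x
    · subst h; simp
    · simp [h]

theorem denseLoop_cons_val (D : ℕ → Level) (j i f I : ℕ) (𝒯 : List ℕ) (sp : ℕ → Bool)
    (dn : ℕ → List ℕ) :
    (E.denseLoop D j i (f + 1) (I :: 𝒯) (sp, dn)).val =
      if (E.testSparse D j I i).val then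
        (E.denseLoop D j i f 𝒯 (Function.update sp I true, dn)).val
      else (E.denseLoop D j i f ((I :: 𝒯).filter fun I' => !decide (I' ∈ E.nearX D j I i))
        (sp, fun I' => if I' ∈ E.nearX D j I i then E.nearY D j I i else dn I')).val := by
  rw [denseLoop]
  simp only [bind_val]
  cases h : (E.testSparse D j I i).val
  · simp only [Bool.false_eq_true, if_false, bind_val, foldL_val, filterL_val, step_val,
      produce_val, write_val]
    have h1 : (markL (E.enumerate D j I (aligned E.p.n (E.p.w j))
        (i - E.p.q (j - 1) - 7)).val).val = fun I' => decide (I' ∈ E.nearX D j I i) :=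
      funext fun I' => markL_val _ _
    have h2 : List.filter (fun J => (markL (E.enumerate D j I
        (grid E.p.n (E.p.w j) (i - 2 * E.p.q (j - 1) - 14))
          (i - 2 * E.p.q (j - 1) - 14)).val).val
        (roundDown (E.p.w j) (i - 2 * E.p.q (j - 1) - 14) J)) (grid E.p.n (E.p.w j) i) =
        E.nearY D j I i := by
      unfold nearY
      congr 1
      funext J
      exact markL_val _ _
    have h3 : List.foldl (fun dn I' => Function.update dn I' (E.nearY D j I i)) dn
        (E.enumerate D j I (aligned E.p.n (E.p.w j)) (i - E.p.q (j - 1) - 7)).val =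
        fun I' => if I' ∈ E.nearX D j I i then E.nearY D j I i else dn I' :=
      funext fun I' => foldl_update_const _ _ _ _
    simp only [h1, h2, h3]
  · simp

/-- What holds for the given neighborhoods and for those of all intervals that are tested holds for the
neighborhoods in the result. -/
theorem denseLoop_sound (D : ℕ → Level) (j i : ℕ) (P : ℕ → ℕ → Prop) (R : ℕ → Prop)
    (hP : ∀ I, R I → ∀ I' ∈ E.nearX D j I i, ∀ J ∈ E.nearY D j I i, P I' J)
    (f : ℕ) (𝒯 : List ℕ) (out : (ℕ → Bool) × (ℕ → List ℕ)) (h𝒯 : ∀ I ∈ 𝒯, R I)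
    (hout : ∀ I', ∀ J ∈ out.2 I', P I' J) :
    ∀ I', ∀ J ∈ (E.denseLoop D j i f 𝒯 out).val.2 I', P I' J := by
  induction f generalizing 𝒯 out with
  | zero => simpa [denseLoop] using hout
  | succ f ih =>
    cases 𝒯 with
    | nil => simpa [denseLoop] using hout
    | cons I 𝒯 =>
      obtain ⟨sp, dn⟩ := out
      rw [denseLoop_cons_val]
      split_ifs
      · exact ih _ _ (fun I' h => h𝒯 I' (List.mem_cons_of_mem _ h)) hout
      · refine ih _ _ (fun I' h => h𝒯 I' (List.mem_filter.1 h).1) (fun I' J hJ => ?_)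
        simp only at hJ
        split_ifs at hJ with h
        · exact hP I (h𝒯 I List.mem_cons_self) I' h J hJ
        · exact hout I' J hJ

/-- Every interval is declared sparse or gets a good neighborhood, if all intervals that are tested belong
to their own neighborhood and give good neighborhoods. -/
theorem denseLoop_complete (D : ℕ → Level) (j i : ℕ) (P : ℕ → List ℕ → Prop) (R : ℕ → Prop)
    (hself : ∀ I, R I → I ∈ E.nearX D j I i)
    (hP : ∀ I, R I → ∀ I' ∈ E.nearX D j I i, P I' (E.nearY D j I i))
    (f : ℕ) (𝒯 : List ℕ) (out : (ℕ → Bool) × (ℕ → List ℕ)) (hf : 𝒯.length ≤ f)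
    (h𝒯 : ∀ I ∈ 𝒯, R I) (I' : ℕ) (h : I' ∈ 𝒯 ∨ out.1 I' = true ∨ P I' (out.2 I')) :
    (E.denseLoop D j i f 𝒯 out).val.1 I' = true ∨
      P I' ((E.denseLoop D j i f 𝒯 out).val.2 I') := by
  induction f generalizing 𝒯 out with
  | zero =>
    have h0 := List.eq_nil_of_length_eq_zero (Nat.le_zero.1 hf)
    subst h0
    simpa [denseLoop] using h
  | succ f ih =>
    cases 𝒯 with
    | nil => simpa [denseLoop] using h
    | cons I 𝒯 =>
      obtain ⟨sp, dn⟩ := out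
      rw [denseLoop_cons_val]
      split_ifs
      · refine ih _ _ (by simpa using hf) (fun I' h => h𝒯 I' (List.mem_cons_of_mem _ h)) ?_
        rcases h with h | h | h
        · rcases List.mem_cons.1 h with rfl | h
          · simp
          · exact .inl h
        · refine .inr (.inl ?_)
          by_cases h' : I' = I
          · simp [h']
          · simpa [h'] using h
        · exact .inr (.inr h)
      · have hI := h𝒯 I List.mem_cons_self
        refine ih _ _ ?_ (fun I' h => h𝒯 I' (List.mem_filter.1 h).1) ?_
        -- The interval I removes itself, so the list shrinks in every round and the bound f on the
        -- number of rounds is never exhausted.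
        · rw [List.filter_cons_of_neg (by simpa using hself I hI)]
          have := List.length_filter_le (fun I' => !decide (I' ∈ E.nearX D j I i)) 𝒯
          rw [List.length_cons] at hf
          omega
        · by_cases hX : I' ∈ E.nearX D j I i
          · exact .inr (.inr (by simpa [hX] using hP I hI I' hX))
          · rcases h with h | h | h
            · exact .inl (List.mem_filter.2 ⟨h, by simpa using hX⟩)
            · exact .inr (.inl h)
            · exact .inr (.inr (by simpa [hX] using h))

theorem dense_of_le {j i : ℕ} (h : i ≤ E.p.q j) (I : ℕ) :
    E.dense j i I = if I ∈ aligned E.p.n (E.p.w j) then grid E.p.n (E.p.w j) i else [] := by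
  simp [dense, denseFor, h, tabulate_val]

theorem dense_of_lt {j i : ℕ} (h : E.p.q j < i) (I : ℕ) :
    E.dense j i I = (E.denseLoop E.data j i (aligned E.p.n (E.p.w j)).length
      (aligned E.p.n (E.p.w j)) (fun _ => false, fun _ => [])).val.2 I := by
  simp [dense, denseFor, h.not_ge]

theorem mem_nearX {D : ℕ → Level} {j I i I' : ℕ} : I' ∈ E.nearX D j I i ↔
    I' ∈ aligned E.p.n (E.p.w j) ∧ E.closeB D j I I' (i - E.p.q (j - 1) - 7) = true :=
  E.mem_enumerate

theorem mem_nearY {D : ℕ → Level} {j I i J : ℕ} : J ∈ E.nearY D j I i ↔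
    J ∈ grid E.p.n (E.p.w j) i ∧
      roundDown (E.p.w j) (i - 2 * E.p.q (j - 1) - 14) J ∈
        grid E.p.n (E.p.w j) (i - 2 * E.p.q (j - 1) - 14) ∧
      E.closeB D j I (roundDown (E.p.w j) (i - 2 * E.p.q (j - 1) - 14) J)
        (i - 2 * E.p.q (j - 1) - 14) = true := by
  simp [nearY, mem_enumerate]

variable {E}

theorem WellFormed.ed_roundDown_le (hE : E.WellFormed) {j : ℕ} (hj : 1 ≤ j) (hk : j ≤ E.p.k)
    (h J : ℕ) : (E.ed j (roundDown (E.p.w j) h J) J : ℚ) ≤ eps h * E.p.w j / 4 := by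
  have h1 := E.ed_shift_le j _ _ (roundDown_le (E.p.w j) h J)
  have h2 := lt_roundDown_add (E.p.w j) h J
  have h3 := hE.valid.gridStep_sub_one_le hj (by omega) h
  have h4 : E.ed j (roundDown (E.p.w j) h J) J ≤ 2 * (gridStep (E.p.w j) h - 1) := by omega
  have h5 : (E.ed j (roundDown (E.p.w j) h J) J : ℚ) ≤
      2 * ((gridStep (E.p.w j) h - 1 : ℕ) : ℚ) := by exact_mod_cast h4
  linarith

theorem WellFormed.length_substr (hE : E.WellFormed) {w J : ℕ} (h : J + w ≤ 2 * E.p.n) :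
    (substr E.z w J).length = w :=
  _root_.length_substr (by rw [hE.length_z]; exact h)

theorem q_eq {p : Params} {j : ℕ} (hj : 1 ≤ j) : p.q j = 3 * p.q (j - 1) + 21 := by
  obtain ⟨j, rfl⟩ : ∃ l, j = l + 1 := ⟨j - 1, by omega⟩
  rfl

/-- Candidates that are classified as close at level `j` are close. -/
def CloseSound (E : Env σ) (j : ℕ) : Prop :=
  ∀ I ∈ aligned E.p.n (E.p.w j), ∀ i ≤ E.p.a, ∀ J ∈ grid E.p.n (E.p.w j) i,
    E.closeB E.data j I J i = true →
      (E.ed j I J : ℚ) ≤ eps ((i : ℤ) - (E.p.q (j - 1) + 6 : ℕ)) * E.p.w j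

/-- The members of the dense neighborhoods of level `j` are close. -/
def DenseSound (E : Env σ) (j : ℕ) : Prop :=
  ∀ I ∈ aligned E.p.n (E.p.w j), ∀ i ≤ E.p.a, ∀ J ∈ E.dense j i I,
    J ∈ grid E.p.n (E.p.w j) i ∧ (E.ed j I J : ℚ) ≤ eps ((i : ℤ) - E.p.q j) * E.p.w j

theorem WellFormed.ed_le (hE : E.WellFormed) {j I J : ℕ} (hI : I + E.p.w j ≤ E.p.n)
    (hJ : J + E.p.w j ≤ 2 * E.p.n) : E.ed j I J ≤ E.p.w j := by
  have h1 := hE.length_substr (w := E.p.w j) (J := I) (by omega)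
  have h2 := hE.length_substr hJ
  exact (editDist_le_of_length_eq (h1.trans h2.symm)).trans h1.le

/-- The pivot I in whose round I' received its neighborhood links I' with J: the triangle inequality
passes through I', I, the rounded J, and J. With q = q_{j-1} the three legs are at most ε_{i-2q-13},
ε_{i-3q-20} and ε_{i-2q-14}/4 times w_j. The second dominates, and q_j = 3q + 21 leaves room for the
sum. For i ≤ q_j the bound is at least the width and hence trivial. -/
theorem WellFormed.denseSound (hE : E.WellFormed) {j : ℕ} (hj : 1 ≤ j) (hk : j ≤ E.p.k)
    (hc : CloseSound E j) : DenseSound E j := by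
  intro I' hI' i hi J hJ
  have hw := hE.valid.w_pos hj (by omega)
  rcases Nat.lt_or_ge (E.p.q j) i with h | h
  · rw [E.dense_of_lt h] at hJ
    refine E.denseLoop_sound E.data j i
      (fun I' J => J ∈ grid E.p.n (E.p.w j) i ∧
        (E.ed j I' J : ℚ) ≤ eps ((i : ℤ) - E.p.q j) * E.p.w j)
      (fun I => I ∈ aligned E.p.n (E.p.w j)) ?_ _ _ _ (fun _ h => h) (by simp) I' J hJ
    intro I hI I' hX J hY
    obtain ⟨hI', hX⟩ := E.mem_nearX.1 hX
    obtain ⟨hJ, hJr, hY⟩ := E.mem_nearY.1 hY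
    refine ⟨hJ, ?_⟩
    have hq := q_eq (p := E.p) hj
    set q := E.p.q (j - 1) with hqdef
    have h1 := hc I hI _ (by omega) I' (hE.valid.mem_grid_of_mem_aligned hj (by omega) hI' _) hX
    have h2 := hc I hI _ (by omega) _ hJr hY
    have h3 := hE.ed_roundDown_le hj hk (i - 2 * q - 14) J
    have h4 : E.ed j I' J ≤ E.ed j I I' + E.ed j I (roundDown (E.p.w j) (i - 2 * q - 14) J) +
        E.ed j (roundDown (E.p.w j) (i - 2 * q - 14) J) J := by
      have := E.ed_triangle j I' I J
      have h5 := E.ed_triangle j I (roundDown (E.p.w j) (i - 2 * q - 14) J) J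
      rw [E.ed_comm j I' I] at this
      omega
    have h5 : (E.ed j I' J : ℚ) ≤ E.ed j I I' +
      E.ed j I (roundDown (E.p.w j) (i - 2 * q - 14) J) +
        E.ed j (roundDown (E.p.w j) (i - 2 * q - 14) J) J := by exact_mod_cast h4
    -- The subtractions in h₁ and h₂ are not truncated, because 3q + 21 = q_j < i.
    have e1 : ((i - q - 7 : ℕ) : ℤ) - (q + 6 : ℕ) = (i : ℤ) - (2 * q + 13 : ℕ) := by omega
    have e2 : ((i - 2 * q - 14 : ℕ) : ℤ) - (q + 6 : ℕ) = (i : ℤ) - (3 * q + 20 : ℕ) := by omega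
    have e3 : ((i - 2 * q - 14 : ℕ) : ℤ) = (i : ℤ) - (2 * q + 14 : ℕ) := by omega
    rw [← hqdef, e1, eps_sub_nat] at h1
    rw [← hqdef, e2, eps_sub_nat] at h2
    rw [e3, eps_sub_nat] at h3
    rw [hq, eps_sub_nat]
    have hx : 0 ≤ eps (i : ℤ) * E.p.w j := by have := eps_pos i; positivity
    have hu : (1 : ℚ) ≤ 2 ^ q := one_le_pow₀ (by norm_num)
    have e4 : (2 : ℚ) ^ (2 * q + 13) ≤ 2 ^ (3 * q + 13) :=
      pow_le_pow_right₀ (by norm_num) (by omega)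
    have e5 : (2 : ℚ) ^ (2 * q + 14) ≤ 2 ^ (3 * q + 14) :=
      pow_le_pow_right₀ (by norm_num) (by omega)
    have e6 := mul_le_mul_of_nonneg_right e4 hx
    have e7 := mul_le_mul_of_nonneg_right e5 hx
    have e8 : (0 : ℚ) ≤ 2 ^ (3 * q) * (eps (i : ℤ) * E.p.w j) := by positivity
    have f1 : (2 : ℚ) ^ (3 * q + 13) = 8192 * 2 ^ (3 * q) := by ring
    have f2 : (2 : ℚ) ^ (3 * q + 14) = 16384 * 2 ^ (3 * q) := by ring
    have f3 : (2 : ℚ) ^ (3 * q + 20) = 1048576 * 2 ^ (3 * q) := by ring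
    have f4 : (2 : ℚ) ^ (3 * q + 21) = 2097152 * 2 ^ (3 * q) := by ring
    rw [f1] at e6
    rw [f2] at e7
    rw [f3] at h2
    rw [f4]
    simp only [mul_assoc, mul_div_assoc] at h1 h2 h3 h5 e6 e7 e8 ⊢
    linarith
  · rw [E.dense_of_le h, if_pos hI'] at hJ
    refine ⟨hJ, ?_⟩
    have h1 := ((hE.valid.mem_aligned_iff hj (by omega)).1 hI').2
    have h2 := ((hE.valid.mem_grid_iff hj (by omega)).1 hJ).2
    have h3 : (E.ed j I' J : ℚ) ≤ E.p.w j := by exact_mod_cast hE.ed_le h1 h2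
    have h4 : (1 : ℚ) ≤ eps ((i : ℤ) - E.p.q j) := by
      unfold eps
      exact one_le_zpow₀ (by norm_num) (by omega)
    exact h3.trans (le_mul_of_one_le_left (by positivity) h4)

theorem mem_boxes {j : ℕ} (hj : 1 ≤ j) (hk : j ≤ E.p.k) {I : ℕ}
    (hI : I ∈ aligned E.p.n (E.p.w j)) {e : WBox} :
    e ∈ (E.data j).boxes I ↔ ∃ i ≤ E.p.a, ∃ J ∈ E.dense j i I,
      e ∈ induced (E.p.w j) J (eps ((i : ℤ) - E.p.q j)) := by
  rw [E.data_boxes hj hk hI]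
  simp

theorem lt_two_pow_log_add_two {n : ℕ} : 2 * n < 2 ^ (Nat.log 2 n + 2) := by
  have := Nat.lt_pow_succ_log_self (b := 2) (by norm_num) n
  rw [pow_succ]
  omega

/-- The lists of boxes on the subintervals of `I` of level `j`. -/
def columns (E : Env σ) (j I : ℕ) : List (List WBox) :=
  (alignedIn (E.p.w (j + 1)) (E.p.w j) I).map fun I' => (E.data j).boxes I'

theorem mem_findBelow {j I i J : ℕ} : (E.findBelow E.data (j + 1) I i).val J = true ↔
    J ∈ (apm (Nat.log 2 E.p.n + 2) (E.p.w (j + 1)) (E.p.w j) (eps ((i : ℤ) - E.p.q j - 5))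
      (columns E j I) (grid E.p.n (E.p.w (j + 1)) i)).val := by
  simp only [findBelow, bind_val, markL_val, mapL_val, step_val, produce_val, decide_eq_true_eq,
    Nat.add_sub_cancel, columns]

theorem WellFormed.length_columns (hE : E.WellFormed) {j : ℕ} (hj : 1 ≤ j) (hk : j ≤ E.p.k)
    (I : ℕ) : (columns E j I).length * E.p.w j = E.p.w (j + 1) := by
  simp only [columns, alignedIn, List.length_map, List.length_range]
  exact Nat.div_mul_cancel (hE.valid.w_dvd_w_succ hj hk)

theorem getElem_columns {j I s : ℕ} (hs : s < (columns E j I).length) :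
    (columns E j I)[s] = (E.data j).boxes (I + s * E.p.w j) := by
  simp [columns, alignedIn]

theorem mem_alignedIn_of_lt_columns {j I s : ℕ} (hs : s < (columns E j I).length) :
    I + s * E.p.w j ∈ alignedIn (E.p.w (j + 1)) (E.p.w j) I := by
  simp only [columns, alignedIn, List.length_map, List.length_range] at hs
  exact mem_alignedIn.2 ⟨s, hs, rfl⟩

theorem WellFormed.box_certified (hE : E.WellFormed) {j : ℕ} (hj : 1 ≤ j) (hk : j ≤ E.p.k)
    (hd : DenseSound E j) {I : ℕ} (hI : I ∈ aligned E.p.n (E.p.w j)) {e : WBox}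
    (he : e ∈ (E.data j).boxes I) :
    e.lo ≤ e.hi ∧ e.hi < 2 ^ (Nat.log 2 E.p.n + 2) ∧
      (editDist (seg E.z I (I + E.p.w j)) (seg E.z e.lo e.hi) : ℚ) ≤ e.κ * E.p.w j := by
  obtain ⟨i, hi, J, hJ, he⟩ := (mem_boxes hj hk hI).1 he
  obtain ⟨hJg, hed⟩ := hd I hI i hi J hJ
  have h1 := ((hE.valid.mem_grid_iff hj (by omega)).1 hJg).2
  obtain ⟨_, h2, h3, h4⟩ := induced_certified (hE.valid.w_pos hj (by omega)) hed he
  have := lt_two_pow_log_add_two (n := E.p.n)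
  exact ⟨h2, by omega, h4⟩

/-- There are two ways to be accepted. The pattern match certifies twice its bound, which turns the
exponent q_j + 5 into q_j + 6; the slow algorithm certifies the exponent q₀, which is smaller. -/
theorem WellFormed.closeSound_succ (hE : E.WellFormed) {j : ℕ} (hj : 1 ≤ j) (hk : j + 1 ≤ E.p.k)
    (hd : DenseSound E j) : CloseSound E (j + 1) := by
  intro I hI i hi J hJ hclose
  have hI' := ((hE.valid.mem_aligned_iff (by omega) (by omega)).1 hI).2
  have hJ' := ((hE.valid.mem_grid_iff (by omega) (by omega)).1 hJ).2
  obtain ⟨j, rfl⟩ : ∃ l, j = l + 1 := ⟨j - 1, by omega⟩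
  rw [closeB_add_two, Bool.or_eq_true, Bool.and_eq_true] at hclose
  simp only [show j + 1 + 1 - 1 = j + 1 from rfl]
  rcases hclose with h | ⟨_, h⟩
  · rw [E.data_below (by omega) hk, if_pos (E.mem_pairs.2 ⟨hI, hi⟩), mem_findBelow] at h
    have hlen := hE.length_columns hj (by omega) I
    have h1 := apm_sound (z := E.z) (I := I) hlen
      (fun J hJ => by
        have := ((hE.valid.mem_grid_iff (by omega) (by omega)).1 hJ).2
        have := lt_two_pow_log_add_two (n := E.p.n)
        omega)
      (fun col hcol e he => by
        obtain ⟨I', hI', rfl⟩ := List.mem_map.1 hcol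
        have := hE.box_certified hj (by omega) hd
          (hE.valid.mem_aligned_of_mem_alignedIn hj (by omega) hI hI') he
        exact ⟨this.1, this.2.1⟩)
      (fun s hs e he => by
        rw [getElem_columns] at he
        have := (hE.box_certified hj (by omega) hd
          (hE.valid.mem_aligned_of_mem_alignedIn hj (by omega) hI
            (mem_alignedIn_of_lt_columns hs)) he).2.2
        rw [Nat.succ_mul, ← Nat.add_assoc]
        exact this)
      (by rw [hE.length_z]; omega) (by rw [hE.length_z]; exact hJ') h
    refine h1.trans (le_of_eq ?_)
    rw [show (i : ℤ) - E.p.q (j + 1) - 5 = (i : ℤ) - (E.p.q (j + 1) + 5 : ℕ) by push_cast; ring,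
      eps_sub_nat, eps_sub_nat]
    ring
  · have h1 := hE.sound (j + 1 + 1) (by omega) hk i hi I J hI' hJ' h
    refine h1.trans (mul_le_mul_of_nonneg_right ?_ (by positivity))
    rw [eps_sub_nat, eps_sub_nat]
    have : E.p.q₀ ≤ E.p.q (j + 1) + 6 := by
      have : ∀ l, E.p.q₀ ≤ E.p.q l := by
        intro l
        induction l with
        | zero => exact le_rfl
        | succ l ih => rw [Params.q]; omega
      have := this (j + 1); omega
    exact mul_le_mul_of_nonneg_right (pow_le_pow_right₀ (by norm_num) this) (eps_pos _).le

theorem WellFormed.closeSound_one (hE : E.WellFormed) : CloseSound E 1 := by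
  intro I hI i hi J hJ h
  have hk := hE.valid.k_pos
  have hI' := ((hE.valid.mem_aligned_iff le_rfl (by omega)).1 hI).2
  have hJ' := ((hE.valid.mem_grid_iff le_rfl (by omega)).1 hJ).2
  refine (hE.sound 1 le_rfl hk i hi I J hI' hJ' h).trans
    (mul_le_mul_of_nonneg_right ?_ (by positivity))
  rw [eps_sub_nat, eps_sub_nat]
  exact mul_le_mul_of_nonneg_right (pow_le_pow_right₀ (by norm_num) (Nat.le_add_right _ _))
    (eps_pos _).le

/-- `denseSound` and `closeSound_succ` alternate. The conclusion holds for every outcome, since the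
slow algorithm rejects distant pairs with certainty. -/
theorem WellFormed.closeSound (hE : E.WellFormed) {j : ℕ} (hj : 1 ≤ j) (hk : j ≤ E.p.k) :
    CloseSound E j := by
  induction j, hj using Nat.le_induction with
  | base => exact hE.closeSound_one
  | succ j hj ih => exact hE.closeSound_succ hj hk (hE.denseSound hj (by omega) (ih (by omega)))

end Env

/-! ### Completeness: on successful randomization all close candidates are found -/

theorem sum_eps_le_two (n : ℕ) : ∑ i ∈ Finset.range n, eps i ≤ 2 := by
  have h : ∑ i ∈ Finset.range n, eps i = 2 - 2 * eps n := by
    induction n with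
    | zero => simp [eps]
    | succ n ih =>
      rw [Finset.sum_range_succ, ih]
      have := eps_add_nat n 1
      push_cast at this ⊢
      linarith
  have := eps_pos n
  linarith

/-- The sum of the terms less than `y` of a geometric series with ratio `1/2` is at most `2 y`. -/
theorem sum_eps_mul_ite_le (n : ℕ) {x y : ℚ} (hx : 0 ≤ x) (hy : 0 ≤ y) :
    (∑ i ∈ Finset.range n, if eps i * x < y then eps i * x else 0) ≤ 2 * y := by
  induction n generalizing x with
  | zero => simpa using hy
  | succ n ih =>
    by_cases hxy : x < y
    · calc _ ≤ ∑ i ∈ Finset.range (n + 1), eps i * x := by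
            refine Finset.sum_le_sum fun i _ => ?_
            have := eps_pos i
            split_ifs
            · exact le_rfl
            · positivity
        _ = (∑ i ∈ Finset.range (n + 1), eps i) * x := by rw [Finset.sum_mul]
        _ ≤ 2 * x := mul_le_mul_of_nonneg_right (sum_eps_le_two _) hx
        _ ≤ 2 * y := by linarith
    · rw [Finset.sum_range_succ']
      have h0 : eps ((0 : ℕ) : ℤ) * x = x := by simp [eps]
      rw [h0, if_neg hxy, add_zero]
      have h1 : ∀ i : ℕ, eps ((i + 1 : ℕ) : ℤ) * x = eps i * (x / 2) := by
        intro i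
        have := eps_add_nat i 1
        push_cast at this ⊢
        linear_combination (x / 2) * this
      simp only [h1]
      exact ih (by positivity)

namespace Env

variable {σ : Type*} {E : Env σ}

/-- All close candidates of level `j` are classified as close. -/
def CloseComplete (E : Env σ) (j : ℕ) : Prop :=
  ∀ I ∈ aligned E.p.n (E.p.w j), ∀ i ≤ E.p.a, ∀ J ∈ grid E.p.n (E.p.w j) i,
    (E.ed j I J : ℚ) ≤ eps i * E.p.w j → E.closeB E.data j I J i = true

/-- The dense neighborhoods of the intervals that are not declared sparse are complete. -/
def DenseComplete (E : Env σ) (j : ℕ) : Prop :=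
  ∀ I ∈ aligned E.p.n (E.p.w j), ∀ i ≤ E.p.a, (E.data j).sparse i I = false →
    ∀ J ∈ grid E.p.n (E.p.w j) i, (E.ed j I J : ℚ) ≤ eps i * E.p.w j → J ∈ E.dense j i I

theorem WellFormed.mem_nearX_self (hE : E.WellFormed) {j : ℕ} (hj : 1 ≤ j) (hk : j ≤ E.p.k)
    (hcc : CloseComplete E j) {i : ℕ} (hi : i ≤ E.p.a) {I I' : ℕ}
    (hI : I ∈ aligned E.p.n (E.p.w j)) (hI' : I' ∈ aligned E.p.n (E.p.w j))
    (h : (E.ed j I I' : ℚ) ≤ eps ((i - E.p.q (j - 1) - 7 : ℕ) : ℤ) * E.p.w j) :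
    I' ∈ E.nearX E.data j I i :=
  E.mem_nearX.2 ⟨hI', hcc I hI _ (by omega) I' (hE.valid.mem_grid_of_mem_aligned hj (by omega) hI' _) h⟩

/-- An interval I' not declared sparse received its neighborhood in the round of some pivot I. With
q = q_{j-1}, the rounded J is within (8192 · 2^(2q) + 1 + 4096 · 2^(2q)) ε_i w_j of I: soundness
bounds the distance from I to I', then J is within ε_i w_j of I', and rounding costs the rest. This
is below 2^(2q+14) ε_i w_j, the distance at which the scale h₂ finds every candidate. -/
theorem WellFormed.denseComplete (hE : E.WellFormed) {j : ℕ} (hj : 1 ≤ j) (hk : j ≤ E.p.k)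
    (hcc : CloseComplete E j) : DenseComplete E j := by
  have hc := hE.closeSound hj hk
  intro I' hI' i hi hsp J hJ hed
  rcases Nat.lt_or_ge (E.p.q j) i with h | h
  · have key := E.denseLoop_complete E.data j i
      (fun I' Y => ∀ J ∈ grid E.p.n (E.p.w j) i, (E.ed j I' J : ℚ) ≤ eps i * E.p.w j → J ∈ Y)
      (fun I => I ∈ aligned E.p.n (E.p.w j))
      (fun I hI => hE.mem_nearX_self hj hk hcc hi hI hI (by
        rw [E.ed_self]; have := eps_pos ((i - E.p.q (j - 1) - 7 : ℕ) : ℤ); simp; positivity))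
      ?_ (aligned E.p.n (E.p.w j)).length (aligned E.p.n (E.p.w j)) (fun _ => false, fun _ => [])
      le_rfl (fun _ h => h) I' (.inl hI')
    · rw [E.data_sparse hj hk hi] at hsp
      simp only [denseFor, if_neg h.not_ge, bind_val, produce_val, lengthL_val] at hsp
      rw [E.dense_of_lt h]
      rcases key with key | key
      · rw [key] at hsp; simp at hsp
      · exact key J hJ hed
    · intro I hI I' hX J hJ hed
      obtain ⟨hI', hX⟩ := E.mem_nearX.1 hX
      have hq := q_eq (p := E.p) hj
      set q := E.p.q (j - 1) with hqdef
      have hr := hE.valid.roundDown_mem_grid hj (by omega) (h := i - 2 * q - 14) hJ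
      refine E.mem_nearY.2 ⟨hJ, hr, hcc I hI _ (by omega) _ hr ?_⟩
      rw [← hqdef]
      have h1 := hc I hI _ (by omega) I' (hE.valid.mem_grid_of_mem_aligned hj (by omega) hI' _) hX
      have h3 := hE.ed_roundDown_le hj hk (i - 2 * q - 14) J
      have h4 : E.ed j I (roundDown (E.p.w j) (i - 2 * q - 14) J) ≤ E.ed j I I' + E.ed j I' J +
          E.ed j (roundDown (E.p.w j) (i - 2 * q - 14) J) J := by
        have := E.ed_triangle j I I' J
        have h5 := E.ed_triangle j I J (roundDown (E.p.w j) (i - 2 * q - 14) J)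
        rw [E.ed_comm j J] at h5
        omega
      have h5 : (E.ed j I (roundDown (E.p.w j) (i - 2 * q - 14) J) : ℚ) ≤
        E.ed j I I' + E.ed j I' J +
          E.ed j (roundDown (E.p.w j) (i - 2 * q - 14) J) J := by exact_mod_cast h4
      have e1 : ((i - q - 7 : ℕ) : ℤ) - (q + 6 : ℕ) = (i : ℤ) - (2 * q + 13 : ℕ) := by omega
      have e3 : ((i - 2 * q - 14 : ℕ) : ℤ) = (i : ℤ) - (2 * q + 14 : ℕ) := by omega
      rw [← hqdef, e1, eps_sub_nat] at h1
      rw [e3, eps_sub_nat] at h3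
      rw [e3, eps_sub_nat]
      have hx : 0 ≤ eps (i : ℤ) * E.p.w j := by have := eps_pos i; positivity
      have hu : (1 : ℚ) ≤ 2 ^ (2 * q) := one_le_pow₀ (by norm_num)
      have e8 := mul_le_mul_of_nonneg_right hu hx
      have f1 : (2 : ℚ) ^ (2 * q + 13) = 8192 * 2 ^ (2 * q) := by ring
      have f2 : (2 : ℚ) ^ (2 * q + 14) = 16384 * 2 ^ (2 * q) := by ring
      rw [f1] at h1
      rw [f2] at h3 ⊢
      simp only [mul_assoc, mul_div_assoc] at h1 h3 h5 e8 ⊢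
      linarith
  · rw [E.dense_of_le h, if_pos hI']
    exact hJ

theorem WellFormed.closeComplete_one (hE : E.WellFormed) (hg : E.GoodED) : CloseComplete E 1 :=
  fun I hI i hi J hJ h => hg 1 le_rfl hE.valid.k_pos i hi I hI J hJ h

theorem close_iff {j I J i : ℕ} : E.Close j I J i ↔ E.closeB E.data j I J i = true := by
  simp [Close, mem_enumerate]

/-- An alignment of the interval `I` of level `j + 1`, cut at the intervals of level `j`, with `J`. -/
structure Alignment (E : Env σ) (j I J : ℕ) (b t : ℕ → ℕ) : Prop where
  first : b 0 = J
  last : b (E.p.w (j + 1) / E.p.w j) = J + E.p.w (j + 1)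
  mono : ∀ s < E.p.w (j + 1) / E.p.w j, b s ≤ b (s + 1)
  dist : ∀ s < E.p.w (j + 1) / E.p.w j,
    editDist (substr E.z (E.p.w j) (I + s * E.p.w j)) (seg E.z (b s) (b (s + 1))) ≤ t s
  sum_le : ∑ s ∈ Finset.range (E.p.w (j + 1) / E.p.w j), t s ≤ E.ed (j + 1) I J

theorem WellFormed.exists_alignment (hE : E.WellFormed) {j : ℕ} (hj : 1 ≤ j) (hk : j ≤ E.p.k)
    {I J : ℕ} (hJ : J + E.p.w (j + 1) ≤ 2 * E.p.n) : ∃ b t, Alignment E j I J b t := by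
  have h1 := Nat.div_mul_cancel (hE.valid.w_dvd_w_succ hj hk)
  have h2 := hE.valid.w_pos (j := j + 1) (by omega) (by omega)
  obtain ⟨N, hN⟩ : ∃ N, E.p.w (j + 1) / E.p.w j = N + 1 := by
    refine Nat.exists_eq_succ_of_ne_zero fun h => ?_
    rw [h] at h1; omega
  rw [hN] at h1
  have h3 := edits_editDist (substr E.z (E.p.w (j + 1)) I) (substr E.z (E.p.w (j + 1)) J)
  have h4 : substr E.z (E.p.w (j + 1)) I = seg E.z I (I + (N + 1) * E.p.w j) := by
    rw [h1, substr_eq_seg]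
  have h5 : substr E.z (E.p.w (j + 1)) J = seg E.z J (J + E.p.w (j + 1)) := substr_eq_seg _ _ _
  have h6 : Edits (seg E.z I (I + (N + 1) * E.p.w j)) (seg E.z J (J + E.p.w (j + 1)))
      (E.ed (j + 1) I J) := by
    rw [← h4, ← h5]; exact h3
  obtain ⟨b, t, hb0, hbN, hb, ht, hs⟩ :=
    exists_block_alignment N (by omega) (by rw [hE.length_z]; exact hJ) h6
  refine ⟨b, t, hb0, by rw [hN]; exact hbN, by rw [hN]; exact hb, ?_, by rw [hN]; exact hs⟩
  rw [hN]
  intro s hs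
  have := ht s hs
  rwa [Nat.succ_mul, ← Nat.add_assoc, ← substr_eq_seg] at this

namespace Alignment

variable {j I J : ℕ} {b t : ℕ → ℕ} (hA : Alignment E j I J b t)

include hA

theorem le_last {s : ℕ} (hs : s ≤ E.p.w (j + 1) / E.p.w j) : b s ≤ J + E.p.w (j + 1) := by
  rw [← hA.last]
  induction hs using Nat.decreasingInduction with
  | self => exact le_rfl
  | of_succ m hm ih => exact (hA.mono m hm).trans ih

theorem first_le {s : ℕ} (hs : s ≤ E.p.w (j + 1) / E.p.w j) : J ≤ b s := by
  induction s with
  | zero => exact hA.first.ge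
  | succ s ih => exact (ih (by omega)).trans (hA.mono s (by omega))

theorem step_bounds (hE : E.WellFormed) (hI : I + E.p.w (j + 1) ≤ 2 * E.p.n)
    (hJ : J + E.p.w (j + 1) ≤ 2 * E.p.n) {s : ℕ} (hs : s < E.p.w (j + 1) / E.p.w j) :
    E.p.w j + b s ≤ b (s + 1) + t s ∧ b (s + 1) ≤ b s + E.p.w j + t s := by
  have h1 := hA.dist s hs
  have h2 := length_le_add_editDist (substr E.z (E.p.w j) (I + s * E.p.w j))
    (seg E.z (b s) (b (s + 1)))
  have h3 := length_le_add_editDist (seg E.z (b s) (b (s + 1)))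
    (substr E.z (E.p.w j) (I + s * E.p.w j))
  rw [editDist_comm (seg E.z (b s) (b (s + 1)))] at h3
  have h4 := Nat.div_mul_le_self (E.p.w (j + 1)) (E.p.w j)
  have h5 := Nat.mul_le_mul_right (E.p.w j) (Nat.succ_le_of_lt hs)
  rw [Nat.succ_mul] at h5
  have h6 := hA.le_last (s := s + 1) (by omega)
  have h7 := hA.mono s hs
  rw [hE.length_substr (by omega), length_seg (by rw [hE.length_z]; omega)] at h2 h3
  omega

/-- In each block the height drifts away from the diagonal by at most the share t s of the distance;
the drifts add up to at most the whole distance. -/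
theorem displacement (hE : E.WellFormed) (hI : I + E.p.w (j + 1) ≤ 2 * E.p.n)
    (hJ : J + E.p.w (j + 1) ≤ 2 * E.p.n) {s : ℕ} (hs : s ≤ E.p.w (j + 1) / E.p.w j) :
    J + s * E.p.w j ≤ b s + E.ed (j + 1) I J ∧ b s ≤ J + s * E.p.w j + E.ed (j + 1) I J := by
  have key : J + s * E.p.w j ≤ b s + ∑ r ∈ Finset.range s, t r ∧
      b s ≤ J + s * E.p.w j + ∑ r ∈ Finset.range s, t r := by
    induction s with
    | zero => simp [hA.first]
    | succ s ih =>
      have h1 := ih (by omega)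
      have h2 := hA.step_bounds hE hI hJ (s := s) (by omega)
      rw [Finset.sum_range_succ, Nat.succ_mul]
      omega
  have h1 : ∑ r ∈ Finset.range s, t r ≤ ∑ r ∈ Finset.range (E.p.w (j + 1) / E.p.w j), t r :=
    Finset.sum_le_sum_of_subset (Finset.range_subset_range.2 hs)
  have h2 := hA.sum_le
  omega

/-- A block with a cheap alignment has a close candidate that is found by ZoomIn. -/
theorem exists_mem_zoomIn (hE : E.WellFormed) (hj : 1 ≤ j) (hk : j ≤ E.p.k) {i i' : ℕ}
    (hi : i ≤ E.p.a) (hI : I + E.p.w (j + 1) ≤ E.p.n)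
    (hJ : J ∈ grid E.p.n (E.p.w (j + 1)) i)
    (hed : (E.ed (j + 1) I J : ℚ) ≤ eps i * E.p.w (j + 1)) {s : ℕ}
    (hs : s < E.p.w (j + 1) / E.p.w j) (ht : 4 * (t s : ℚ) ≤ eps i' * E.p.w j) :
    ∃ J' ∈ zoomIn (E.p.w (j + 1)) (E.p.w j) I J i (I + s * E.p.w j) i',
      (E.ed j (I + s * E.p.w j) J' : ℚ) ≤ eps i' * E.p.w j ∧
      J' ≤ b s ∧ b s ≤ J' + (gridStep (E.p.w j) i' - 1) + t s ∧ J' + E.p.w j ≤ b (s + 1) + t s := by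
  have hV := hE.valid
  obtain ⟨hJg, hJn⟩ := (hV.mem_grid_iff (by omega) (by omega)).1 hJ
  have hst := hA.step_bounds hE (by omega) hJn hs
  have hdi := hA.displacement hE (by omega) hJn hs.le
  have hlast := hA.le_last (s := s + 1) (by omega)
  have hfirst := hA.first_le hs.le
  have hmono := hA.mono s hs
  have hg1 := hV.gridStep_sub_one_le hj (by omega) i'
  have hgpos := gridStep_pos (E.p.w j) i'
  have hgJ : gridStep (E.p.w j) i' ∣ J := (hV.gridStep_dvd_gridStep_succ hj hk hi).trans hJg
  have hgw' : gridStep (E.p.w j) i' ∣ E.p.w j := hV.gridStep_dvd_w hj (by omega) i'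
  have hgw := hgw'.trans (hV.w_dvd_w_succ hj hk)
  have hww := hV.w_lt j hj hk
  have hwpos := hV.w_pos hj (by omega)
  have hd := hA.dist s hs
  obtain ⟨hr1, hr2⟩ : roundDown (E.p.w j) i' (b s) ≤ b s ∧
      b s < roundDown (E.p.w j) i' (b s) + gridStep (E.p.w j) i' :=
    ⟨roundDown_le _ _ _, lt_roundDown_add _ _ _⟩
  have hr3 : J ≤ roundDown (E.p.w j) i' (b s) := by
    obtain ⟨u, hu⟩ := hgJ
    unfold roundDown
    calc J = u * gridStep (E.p.w j) i' := by rw [hu, mul_comm]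
      _ ≤ _ := Nat.mul_le_mul_right _ ((Nat.le_div_iff_mul_le hgpos).2 (by
          rw [mul_comm, ← hu]; exact hfirst))
  have hr4 : gridStep (E.p.w j) i' ∣ roundDown (E.p.w j) i' (b s) := dvd_mul_left _ _
  generalize hg : gridStep (E.p.w j) i' = g at *
  generalize roundDown (E.p.w j) i' (b s) = ρ at *
  -- J' is b s rounded down to the grid or, if that interval would stick out of J, the last position
  -- inside J, which is a grid point as well. In the second case J' ends at the end of J, so not
  -- below b (s + 1).
  obtain ⟨J', hJ'g, hJ'1, hJ'2, hJ'3, hJ'4, hJ'd⟩ : ∃ J', g ∣ J' ∧ J ≤ J' ∧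
      J' ≤ J + E.p.w (j + 1) - E.p.w j ∧ J' ≤ b s ∧ b s ≤ J' + (g - 1) + t s ∧
      (b s - J') + ((b (s + 1) - (J' + E.p.w j)) + (J' + E.p.w j - b (s + 1))) ≤
        t s + 2 * (g - 1) := by
    rcases le_total ρ (J + E.p.w (j + 1) - E.p.w j) with h | h
    · exact ⟨ρ, hr4, hr3, h, hr1, by omega, by omega⟩
    · refine ⟨J + E.p.w (j + 1) - E.p.w j, ?_, by omega, le_rfl, by omega, by omega, by omega⟩
      exact Nat.dvd_sub (dvd_add hgJ hgw) hgw'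
  -- As 4 t s and 8 (g - 1) are at most ε_{i'} w_j, the right side is at most 3/4 of ε_{i'} w_j.
  have hted : E.ed j (I + s * E.p.w j) J' ≤ 2 * t s + 2 * (g - 1) := by
    have h1 := editDist_seg_le (z := E.z) hmono (show J' ≤ J' + E.p.w j by omega)
    have h2 := editDist_triangle (substr E.z (E.p.w j) (I + s * E.p.w j))
      (seg E.z (b s) (b (s + 1))) (seg E.z J' (J' + E.p.w j))
    rw [ed, substr_eq_seg E.z (E.p.w j) J']
    omega
  have hted' : (E.ed j (I + s * E.p.w j) J' : ℚ) ≤ 2 * t s + 2 * ((g - 1 : ℕ) : ℚ) := by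
    exact_mod_cast hted
  have he1 := eps_pos i'
  have he2 : eps i' ≤ 1 := by
    rw [eps_natCast, div_le_one (by positivity)]
    exact one_le_pow₀ (by norm_num)
  have hwq : (0 : ℚ) < E.p.w j := by exact_mod_cast hwpos
  have hew : eps i' * E.p.w j ≤ E.p.w j := mul_le_of_le_one_left hwq.le he2
  -- Blocks are short against the displacement allowed at scale i. So the rounding error and t s fit
  -- between the drift of at most ε_i w_{j+1} and the radius 2 ε_i w_{j+1} of ZoomIn.
  have hww2 : 2 * (E.p.w j : ℚ) ≤ eps i * E.p.w (j + 1) := by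
    have h1 : 2 ^ (i + 1) * E.p.w j ≤ E.p.w (j + 1) :=
      (Nat.mul_le_mul_right _ (Nat.pow_le_pow_right (by norm_num) (by omega))).trans
        (hV.two_pow_mul_w_le hj hk)
    have h2 : (2 : ℚ) ^ (i + 1) * E.p.w j ≤ E.p.w (j + 1) := by exact_mod_cast h1
    rw [eps_natCast, div_mul_eq_mul_div, le_div_iff₀ (by positivity)]
    linear_combination h2
  have hR := hV.two_mul_div_two_pow hj hk hi
  have hb4 : (b s : ℚ) ≤ J' + ((g - 1 : ℕ) : ℚ) + t s := by exact_mod_cast hJ'4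
  have hb3 : (J' : ℚ) ≤ b s := by exact_mod_cast hJ'3
  have hdi1 : (J : ℚ) + s * E.p.w j ≤ b s + E.ed (j + 1) I J := by exact_mod_cast hdi.1
  have hdi2 : (b s : ℚ) ≤ J + s * E.p.w j + E.ed (j + 1) I J := by exact_mod_cast hdi.2
  refine ⟨J', mem_zoomIn.2 ⟨hg ▸ hJ'g, hJ'1, ?_, hJ'2, ?_⟩, by linarith, hJ'3, hJ'4, by omega⟩
  · rw [Nat.add_sub_cancel_left, Nat.sub_le_iff_le_add]
    have : (J : ℚ) + s * E.p.w j ≤ J' + (2 * E.p.w (j + 1) / 2 ^ i : ℕ) := by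
      rw [hR]; linarith
    exact_mod_cast this
  · rw [Nat.add_sub_cancel_left]
    have : (J' : ℚ) ≤ J + s * E.p.w j + (2 * E.p.w (j + 1) / 2 ^ i : ℕ) := by
      rw [hR]; linarith
    exact_mod_cast this

end Alignment

/-- One of the boxes induced by a box lies between two given heights and gives a cheap path. -/
theorem exists_induced {m' J' β β' t g : ℕ} {κ x : ℚ} (_h1 : J' ≤ β) (h2 : β ≤ J' + g + t)
    (h3 : J' + 2 ^ m' ≤ β' + t) (h4 : β' ≤ β + 2 ^ m' + t) (hg : (g : ℚ) * 8 ≤ x)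
    (ht : 4 * (t : ℚ) ≤ x) (hx : x ≤ (2 ^ m' : ℕ)) :
    ∃ e ∈ induced (2 ^ m') J' κ, β ≤ e.lo ∧ e.hi ≤ β' ∧
      e.κ * (2 ^ m' : ℕ) + ((β' : ℚ) - β) - ((e.hi : ℚ) - e.lo) ≤
        κ * (2 ^ m' : ℕ) + x + 9 * t := by
  have hw : (0 : ℚ) < (2 ^ m' : ℕ) := by exact_mod_cast Nat.two_pow_pos m'
  have h4' : (β' : ℚ) ≤ β + (2 ^ m' : ℕ) + t := by exact_mod_cast h4
  rcases Nat.eq_zero_or_pos (g + t) with h0 | h0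
  · refine ⟨⟨J', J' + 2 ^ m', κ⟩, mem_induced.2 (.inl rfl), by simp only; omega,
      by simp only; omega, ?_⟩
    have : (0 : ℚ) ≤ t := by positivity
    have : (0 : ℚ) ≤ g := by positivity
    simp only
    push_cast at h4' ⊢
    linarith
  -- Cutting 2^s ≥ g + t off at both ends puts the box between β and β'. The cut costs 2^(s+1) in
  -- the weight and as much in the height of the box, together 4 · 2^s ≤ 8 g + 8 t ≤ x + 8 t; the
  -- last t comes from comparing β' - β with the width.
  · set s := Nat.clog 2 (g + t) with hs
    have hs1 : g + t ≤ 2 ^ s := Nat.le_pow_clog (by norm_num) _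
    have hs2 : 2 ^ s < 2 * (g + t) := by
      rcases Nat.lt_or_ge 1 (g + t) with h | h
      · have h5 := Nat.pow_pred_clog_lt_self (b := 2) (by norm_num) h
        have h6 : 0 < s := Nat.clog_pos (by norm_num) h
        rw [← hs, Nat.pred_eq_sub_one] at h5
        have h7 : 2 ^ s = 2 * 2 ^ (s - 1) := by
          rw [← pow_succ']; congr 1; omega
        omega
      · have h5 : g + t = 1 := by omega
        rw [hs, h5]; simp
    have hs1' : (g : ℚ) + t ≤ 2 ^ s := by exact_mod_cast hs1
    have hs2' : (2 : ℚ) ^ s < 2 * (g + t) := by exact_mod_cast hs2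
    have hsm : s < m' := by
      have h5 : (2 : ℚ) ^ s < 2 ^ m' := by
        have : (0 : ℚ) ≤ x := le_trans (by positivity) hg
        have e : (2 : ℚ) ^ m' = (2 ^ m' : ℕ) := by push_cast; rfl
        rw [e]
        linarith
      exact (pow_lt_pow_iff_right₀ (by norm_num : (1 : ℚ) < 2)).1 h5
    have h7 : 2 ^ (s + 1) ≤ 2 ^ m' := Nat.pow_le_pow_right (by norm_num) hsm
    have h8 : 2 ^ (s + 1) = 2 * 2 ^ s := by ring
    refine ⟨⟨J' + 2 ^ s, J' + 2 ^ m' - 2 ^ s, κ + 2 ^ (s + 1) / (2 ^ m' : ℕ)⟩,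
      mem_induced.2 (.inr ⟨s, by rw [Nat.log_pow (by norm_num)]; exact hsm, rfl⟩),
      by simp only; omega, by simp only; omega, ?_⟩
    simp only
    have h9 : (κ + 2 ^ (s + 1) / (2 ^ m' : ℕ)) * (2 ^ m' : ℕ) = κ * (2 ^ m' : ℕ) + 2 * 2 ^ s := by
      rw [add_mul, div_mul_cancel₀ _ hw.ne']; ring
    rw [h9, Nat.cast_sub (by omega)]
    push_cast at h4' hs1' hs2' ⊢
    linarith

end Env

namespace Env

variable {σ : Type*} {E : Env σ}

open Classical in
/-- If no member of the samples is a marker for a candidate, then for each `i'` less than a third of the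
sparse blocks are markers. -/
theorem three_mul_card_markers_le (hE : E.WellFormed) {j : ℕ} (hj : 1 ≤ j) (hk : j + 1 ≤ E.p.k)
    (hs : E.GoodSamples (j + 1)) {I i J : ℕ} (hI : I ∈ aligned E.p.n (E.p.w (j + 1)))
    (hi : i ≤ E.p.a) (hJ : J ∈ grid E.p.n (E.p.w (j + 1)) i)
    (hhit : E.hit E.data (j + 1) I J i = false) {i' : ℕ} (hi' : i' ≤ i) :
    3 * ((Finset.range (E.p.w (j + 1) / E.p.w j)).filter fun s =>
      (E.data j).sparse i' (I + s * E.p.w j) = true ∧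
        ∃ J' ∈ zoomIn (E.p.w (j + 1)) (E.p.w j) I J i (I + s * E.p.w j) i',
          E.closeB E.data j (I + s * E.p.w j) J' i' = true).card ≤
    ((Finset.range (E.p.w (j + 1) / E.p.w j)).filter fun s =>
      (E.data j).sparse i' (I + s * E.p.w j) = true).card := by
  have hinj : Function.Injective fun s => I + s * E.p.w j := fun a b h =>
    Nat.eq_of_mul_eq_mul_right (hE.valid.w_pos hj (by omega)) (Nat.add_left_cancel h)
  have h1 : E.sparseIn (j + 1) I i' = ((Finset.range (E.p.w (j + 1) / E.p.w j)).filter fun s =>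
      (E.data j).sparse i' (I + s * E.p.w j) = true).image fun s => I + s * E.p.w j := by
    ext I'
    simp only [sparseIn, Finset.mem_filter, List.mem_toFinset, mem_alignedIn, Finset.mem_image,
      Finset.mem_range, Nat.add_sub_cancel]
    constructor
    · rintro ⟨⟨s, hs, rfl⟩, h⟩; exact ⟨s, ⟨hs, h⟩, rfl⟩
    · rintro ⟨s, ⟨hs, h⟩, rfl⟩; exact ⟨⟨s, hs, rfl⟩, h⟩
  have h2 : E.winners (j + 1) I J i i' = ((Finset.range (E.p.w (j + 1) / E.p.w j)).filter fun s =>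
      (E.data j).sparse i' (I + s * E.p.w j) = true ∧
        ∃ J' ∈ zoomIn (E.p.w (j + 1)) (E.p.w j) I J i (I + s * E.p.w j) i',
          E.closeB E.data j (I + s * E.p.w j) J' i' = true).image fun s => I + s * E.p.w j := by
    ext I'
    simp only [winners, h1, Finset.mem_filter, Finset.mem_image,
      Finset.mem_range, Nat.add_sub_cancel, close_iff]
    constructor
    · rintro ⟨⟨s, ⟨hs, h⟩, rfl⟩, h'⟩; exact ⟨s, ⟨hs, h, h'⟩, rfl⟩
    · rintro ⟨s, ⟨hs, h, h'⟩, rfl⟩; exact ⟨⟨s, ⟨hs, h⟩, rfl⟩, h'⟩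
  have h3 := congrArg Finset.card h1
  have h4 := congrArg Finset.card h2
  rw [Finset.card_image_of_injective _ hinj] at h3 h4
  rw [← h3, ← h4]
  -- Otherwise the winners make up at least a third of the sparse blocks, a successful sample
  -- contains one of them, and the candidate is hit.
  by_contra hlt
  have hlt' := (not_le.1 hlt).le
  have hne : (E.sparseIn (j + 1) I i').Nonempty := by
    by_contra h
    rw [Finset.not_nonempty_iff_eq_empty] at h
    have : E.winners (j + 1) I J i i' = ∅ := by rw [winners, h, Finset.filter_empty]
    rw [h, this] at hlt
    simp at hlt
  obtain ⟨I', hI's, hI'w⟩ := hs I hI i hi J hJ i' hi' hne hlt'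
  obtain ⟨J', hJ', hc⟩ := (Finset.mem_filter.1 hI'w).2
  rw [close_iff] at hc
  have : E.hit E.data (j + 1) I J i = true :=
    (E.hit_iff _ _ _ _ _).2 ⟨i', hi', I', hI's, J', hJ', hc⟩
  rw [hhit] at this
  exact Bool.noConfusion this

open Classical in
/-- The finest scale at which a block is dense and cheaply aligned. -/
theorem exists_scale {w' t : ℚ} (hw' : 0 ≤ w') (i : ℕ) (Sp Wn : ℕ → Prop) (h0 : ¬ Sp 0)
    (hWn : ∀ i' ≤ i, 4 * t ≤ eps i' * w' → Sp i' → Wn i') (ht : 4 * t ≤ w') (ht0 : 0 ≤ t) :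
    ∃ f ≤ i, ¬ Sp f ∧ 4 * t ≤ eps f * w' ∧ eps f * w' ≤ eps i * w' + 8 * t +
      ∑ i' ∈ Finset.range (i + 1), 2 * (if Wn i' then eps i' * w' else 0) := by
  have hP0 : ¬ Sp 0 ∧ 4 * t ≤ eps (0 : ℕ) * w' := ⟨h0, by simpa [eps] using ht⟩
  -- If f < i, one of the conditions fails at f + 1. Either 4 t exceeds ε_{f+1} w', and then ε_f w'
  -- is below 8 t; or the block is sparse there and, its alignment being cheap, satisfies `Wn`, so
  -- the summand 2 ε_{f+1} w' equals ε_f w'.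
  set f := Nat.findGreatest (fun f => ¬ Sp f ∧ 4 * t ≤ eps f * w') i with hf
  have hfi : f ≤ i := Nat.findGreatest_le i
  have hfP : ¬ Sp f ∧ 4 * t ≤ eps f * w' :=
    Nat.findGreatest_spec (P := fun f => ¬ Sp f ∧ 4 * t ≤ eps f * w') (Nat.zero_le i) hP0
  have hterm : ∀ i' ∈ Finset.range (i + 1), 0 ≤ 2 * (if Wn i' then eps i' * w' else 0) := by
    intro i' _
    have := eps_pos i'
    split_ifs <;> positivity
  have hsum := Finset.sum_nonneg hterm
  have hei := eps_pos i
  refine ⟨f, hfi, hfP.1, hfP.2, ?_⟩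
  rcases hfi.eq_or_lt with h | h
  · rw [h]; linarith
  · have h1 : eps f * w' = 2 * (eps (f + 1 : ℕ) * w') := by
      have := eps_add_nat f 1
      push_cast at this ⊢
      linear_combination -w' * this
    have h2 := Nat.findGreatest_is_greatest (P := fun f => ¬ Sp f ∧ 4 * t ≤ eps f * w')
      (Nat.lt_succ_self f) h
    have : 0 ≤ eps i * w' := by positivity
    by_cases h3 : 4 * t ≤ eps (f + 1 : ℕ) * w'
    · have h4 : Sp (f + 1) := by
        by_contra h5; exact h2 ⟨h5, h3⟩
      have h5 := Finset.single_le_sum hterm (Finset.mem_range.2 (Nat.succ_lt_succ h))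
      rw [if_pos (hWn _ h h3 h4)] at h5
      linarith
    · linarith

open Classical in
-- The slow algorithm accepts J, so it remains to see that if J is not hit, the pattern match finds
-- it. Along an optimal alignment, block s is crossed by a box induced by a dense box at the scale
-- given by `exists_scale`. Its size x s is at most ε_i w_j + 8 t s plus a surcharge for the scales
-- at which the block is a marker. Without a hit the markers at a scale are at most half as many as
-- the blocks that are expensive at that scale, so by the geometric series all surcharges together
-- are at most 8 Σ t s.
theorem WellFormed.closeComplete_succ (hE : E.WellFormed) {j : ℕ} (hj : 1 ≤ j)
    (hk : j + 1 ≤ E.p.k) (hg : E.GoodED) (hs : E.GoodSamples (j + 1)) (hcc : CloseComplete E j) :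
    CloseComplete E (j + 1) := by
  intro I hI i hi J hJ hed
  by_contra hnot
  have hV := hE.valid
  have hds := hE.denseSound hj (by omega) (hE.closeSound hj (by omega))
  have hdc := hE.denseComplete hj (by omega) hcc
  have hIn := ((hV.mem_aligned_iff (by omega) (by omega)).1 hI).2
  have hJn := ((hV.mem_grid_iff (by omega) (by omega)).1 hJ).2
  have hcall := hg (j + 1) (by omega) hk i hi I hI J hJ hed
  obtain ⟨l, rfl⟩ : ∃ l, j = l + 1 := ⟨j - 1, by omega⟩
  rw [closeB_add_two, hcall, Bool.and_true, Bool.or_eq_true, not_or, Bool.not_eq_true,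
    Bool.not_eq_true] at hnot
  obtain ⟨hbelow, hhit⟩ := hnot
  replace hhit : E.hit E.data (l + 1 + 1) I J i = false := hhit
  have hbelow' : ¬ J ∈ (apm (Nat.log 2 E.p.n + 2) (E.p.w (l + 1 + 1)) (E.p.w (l + 1))
      (eps ((i : ℤ) - E.p.q (l + 1) - 5)) (columns E (l + 1) I)
      (grid E.p.n (E.p.w (l + 1 + 1)) i)).val := by
    rw [← mem_findBelow]
    rw [E.data_below (by omega) hk, if_pos (E.mem_pairs.2 ⟨hI, hi⟩)] at hbelow
    rw [hbelow]; simp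
  apply hbelow'
  have hw := hV.w_dvd_w_succ hj (by omega)
  have hq : 1 ≤ E.p.q (l + 1) := by rw [Params.q]; omega
  set j := l + 1 with hjdef
  clear_value j
  obtain ⟨b, t, hA⟩ := hE.exists_alignment hj (by omega) (I := I) hJn
  set N := E.p.w (j + 1) / E.p.w j with hN
  have hNw : N * E.p.w j = E.p.w (j + 1) := Nat.div_mul_cancel hw
  have hlen : (columns E j I).length = N := by simp [columns, alignedIn, hN]
  have hwpos := hV.w_pos hj (by omega)
  obtain ⟨m', hm'⟩ := hV.w_pow j hj (by omega)
  set Sp : ℕ → ℕ → Prop := fun s i' => (E.data j).sparse i' (I + s * E.p.w j) = true with hSp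
  set Wn : ℕ → ℕ → Prop := fun s i' => (E.data j).sparse i' (I + s * E.p.w j) = true ∧
    ∃ J' ∈ zoomIn (E.p.w (j + 1)) (E.p.w j) I J i (I + s * E.p.w j) i',
      E.closeB E.data j (I + s * E.p.w j) J' i' = true with hWn
  have hal : ∀ s < N, I + s * E.p.w j ∈ aligned E.p.n (E.p.w j) := fun s hs =>
    hV.mem_aligned_of_mem_alignedIn hj (by omega) hI (mem_alignedIn.2 ⟨s, hs, rfl⟩)
  have hwin : ∀ s < N, ∀ i' ≤ i, 4 * (t s : ℚ) ≤ eps i' * E.p.w j → Sp s i' → Wn s i' := by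
    intro s hs i' hi' ht hsp
    obtain ⟨J', h1, h2, _⟩ := hA.exists_mem_zoomIn hE hj (by omega) hi hIn hJ hed hs ht
    exact ⟨hsp, J', h1, hcc _ (hal s hs) i' (by omega) J'
      (hV.mem_grid_of_mem_zoomIn hj (by omega) hJ h1) h2⟩
  -- No interval is sparse for i = 0 ≤ q_j, so `exists_scale` always has a scale to start from.
  have hSp0 : ∀ s, ¬ Sp s 0 := by
    intro s
    simp only [hSp, E.data_sparse hj (show j ≤ E.p.k by omega) (Nat.zero_le _), denseFor,
      Nat.zero_le, if_true, bind_val, pure_val]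
    simp
  -- the cost of a path through each block
  have hblock : ∀ s, ∃ x : ℚ, s < N → 0 ≤ x ∧
      x ≤ eps i * E.p.w j + 8 * t s + ∑ i' ∈ Finset.range (i + 1),
        2 * (if Wn s i' then eps i' * (E.p.w j : ℚ) else 0) ∧
      ((E.p.w j : ℚ) + ((b (s + 1) : ℚ) - b s) ≤ (2 ^ E.p.q j + 1) * x + 9 * t s ∨
        ∃ e ∈ (E.data j).boxes (I + s * E.p.w j), b s ≤ e.lo ∧ e.hi ≤ b (s + 1) ∧
          e.κ * E.p.w j + ((b (s + 1) : ℚ) - b s) - ((e.hi : ℚ) - e.lo) ≤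
            (2 ^ E.p.q j + 1) * x + 9 * t s) := by
    intro s
    by_cases hs : s < N
    swap
    · exact ⟨0, fun h => absurd h hs⟩
    by_cases ht : 4 * (t s : ℚ) ≤ E.p.w j
    · obtain ⟨f, hfi, hfS, hft, hfx⟩ := exists_scale (w' := E.p.w j) (t := t s) (by positivity) i
        (Sp s) (Wn s) (hSp0 s) (hwin s hs) ht (by positivity)
      have hef := eps_pos f
      refine ⟨eps f * E.p.w j, fun _ => ⟨by positivity, by convert hfx, .inr ?_⟩⟩
      obtain ⟨J', h1, h2, h3, h4, h5⟩ := hA.exists_mem_zoomIn hE hj (by omega) hi hIn hJ hed hs hft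
      have hmem := hdc _ (hal s hs) f (by omega) (by simpa [hSp] using hfS) J'
        (hV.mem_grid_of_mem_zoomIn hj (by omega) hJ h1) h2
      have hst := (hA.step_bounds hE (by omega) hJn hs).2
      have hx : eps f * E.p.w j ≤ (2 ^ m' : ℕ) := by
        rw [hm', eps_natCast]
        refine mul_le_of_le_one_left (by positivity) ?_
        rw [div_le_one (by positivity)]
        exact one_le_pow₀ (by norm_num)
      obtain ⟨e, he, he1, he2, he3⟩ := exists_induced (m' := m')
        (κ := eps ((f : ℤ) - E.p.q j)) h3 h4 (by rw [← hm']; exact h5) (by rw [← hm']; exact hst)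
        (hV.gridStep_sub_one_le hj (by omega) f) hft hx
      refine ⟨e, (mem_boxes hj (by omega) (hal s hs)).2 ⟨f, by omega, J', hmem, by rw [hm']; exact he⟩,
        he1, he2, ?_⟩
      rw [← hm'] at he3
      refine he3.trans (le_of_eq ?_)
      rw [eps_sub_nat]; ring
    -- A block with 4 t > w' is crossed without a box, at the cost of at most 2 w' + t ≤ 9 t.
    · refine ⟨0, fun _ => ⟨le_rfl, ?_, .inl ?_⟩⟩
      · have := eps_pos i
        have h2 : 0 ≤ ∑ i' ∈ Finset.range (i + 1),
            2 * (if Wn s i' then eps i' * (E.p.w j : ℚ) else 0) := by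
          refine Finset.sum_nonneg fun i' _ => ?_
          have := eps_pos i'
          split_ifs <;> positivity
        positivity
      · have h1 := (hA.step_bounds hE (by omega) hJn hs).2
        have h2 : (b (s + 1) : ℚ) ≤ b s + E.p.w j + t s := by exact_mod_cast h1
        linarith
  choose x hx using hblock
  -- the total cost
  have hC : ∑ s ∈ Finset.range N, (t s : ℚ) ≤ eps i * E.p.w (j + 1) := by
    have : ∑ s ∈ Finset.range N, (t s : ℚ) ≤ E.ed (j + 1) I J := by exact_mod_cast hA.sum_le
    exact this.trans hed
  have hNq : (N : ℚ) * E.p.w j = E.p.w (j + 1) := by exact_mod_cast hNw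
  have hmark : ∑ s ∈ Finset.range N, ∑ i' ∈ Finset.range (i + 1),
      2 * (if Wn s i' then eps i' * (E.p.w j : ℚ) else 0) ≤
      ∑ s ∈ Finset.range N, 8 * (t s : ℚ) := by
    have h1 : ∀ i' ∈ Finset.range (i + 1), ∑ s ∈ Finset.range N,
        2 * (if Wn s i' then eps i' * (E.p.w j : ℚ) else 0) ≤ ∑ s ∈ Finset.range N,
          if eps i' * E.p.w j < 4 * (t s : ℚ) then eps i' * (E.p.w j : ℚ) else 0 := by
      intro i' hi'
      have hi'' : i' ≤ i := Nat.lt_succ_iff.1 (Finset.mem_range.1 hi')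
      have h3 := three_mul_card_markers_le hE hj hk hs hI hi hJ hhit hi''
      rw [← hN] at h3
      replace h3 : 3 * ((Finset.range N).filter fun s => Wn s i').card ≤
        ((Finset.range N).filter fun s => Sp s i').card := by convert h3
      -- A sparse block is a marker unless its alignment is expensive at scale i'. As three times
      -- the markers are at most the sparse blocks, twice the markers are at most the expensive
      -- ones.
      have h4 : ((Finset.range N).filter fun s => Sp s i').card ≤
          ((Finset.range N).filter fun s => Wn s i').card +
          ((Finset.range N).filter fun s => eps i' * E.p.w j < 4 * (t s : ℚ)).card := by
        rw [← Finset.card_union_add_card_inter]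
        refine le_trans (Finset.card_le_card fun s hs => ?_) (Nat.le_add_right _ _)
        rw [Finset.mem_filter, Finset.mem_range] at hs
        rw [Finset.mem_union, Finset.mem_filter, Finset.mem_filter, Finset.mem_range]
        rcases lt_or_ge (eps i' * E.p.w j) (4 * (t s : ℚ)) with h | h
        · exact .inr ⟨hs.1, h⟩
        · exact .inl ⟨hs.1, hwin s hs.1 i' hi'' h hs.2⟩
      have h5 : (2 : ℚ) * ((Finset.range N).filter fun s => Wn s i').card ≤
          ((Finset.range N).filter fun s => eps i' * E.p.w j < 4 * (t s : ℚ)).card := by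
        exact_mod_cast (show 2 * ((Finset.range N).filter fun s => Wn s i').card ≤
          ((Finset.range N).filter fun s => eps i' * E.p.w j < 4 * (t s : ℚ)).card by omega)
      rw [← Finset.mul_sum, ← Finset.sum_filter, ← Finset.sum_filter, Finset.sum_const,
        Finset.sum_const, nsmul_eq_mul, nsmul_eq_mul, ← mul_assoc]
      have := eps_pos i'
      exact mul_le_mul_of_nonneg_right h5 (by positivity)
    rw [Finset.sum_comm]
    refine (Finset.sum_le_sum h1).trans ?_
    rw [Finset.sum_comm]
    refine Finset.sum_le_sum fun s _ => ?_
    have := sum_eps_mul_ite_le (i + 1) (x := E.p.w j) (y := 4 * (t s : ℚ)) (by positivity)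
      (by positivity)
    linarith
  -- 17 = 1 + 8 + 8: the base cost, the term 8 t s, and the surcharges for markers.
  have hxsum : ∑ s ∈ Finset.range N, x s ≤ 17 * (eps i * E.p.w (j + 1)) := by
    have h1 : ∑ s ∈ Finset.range N, x s ≤ ∑ s ∈ Finset.range N,
        (eps i * E.p.w j + 8 * t s + ∑ i' ∈ Finset.range (i + 1),
          2 * (if Wn s i' then eps i' * (E.p.w j : ℚ) else 0)) :=
      Finset.sum_le_sum fun s hs => (hx s (Finset.mem_range.1 hs)).2.1
    rw [Finset.sum_add_distrib, Finset.sum_add_distrib, Finset.sum_const, Finset.card_range,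
      nsmul_eq_mul] at h1
    rw [← Finset.mul_sum] at h1 hmark
    have h2 : (N : ℚ) * (eps i * E.p.w j) = eps i * E.p.w (j + 1) := by rw [← hNq]; ring
    linarith
  have hfinal := finalTree_complete (m := Nat.log 2 E.p.n + 2) (w' := E.p.w j)
    (cols := columns E j I) (𝒥 := grid E.p.n (E.p.w (j + 1)) i)
    (fun J hJ => by
      have := ((hV.mem_grid_iff (by omega) (by omega)).1 hJ).2
      have := lt_two_pow_log_add_two (n := E.p.n)
      omega)
    (fun col hcol e he => by
      obtain ⟨I', hI', rfl⟩ := List.mem_map.1 hcol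
      have := hE.box_certified hj (by omega) hds
        (hV.mem_aligned_of_mem_alignedIn hj (by omega) hI hI') he
      exact ⟨by omega, this.2.1⟩)
    b (fun s => (2 ^ E.p.q j + 1) * x s + 9 * t s) (by rw [hA.first]; exact hJ)
    (by rw [hlen]; exact hA.mono)
    (by
      rw [hlen, hA.last]
      have := lt_two_pow_log_add_two (n := E.p.n)
      omega)
    (fun s hs => by
      rw [getElem_columns]
      exact (hx s (by rw [← hlen]; exact hs)).2.2)
  rw [hlen, hA.last, hNq, Finset.sum_add_distrib, ← Finset.mul_sum, ← Finset.mul_sum] at hfinal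
  refine mem_apm.2 ⟨hJ, ?_⟩
  have hB : 0 ≤ eps i * E.p.w (j + 1) := by have := eps_pos i; positivity
  -- The comparison with the threshold of the pattern match is 17 (2^q + 1) + 9 ≤ 2^(q+5), for which
  -- 2^q ≥ 2 is enough.
  have hQ : (2 : ℚ) ≤ 2 ^ E.p.q j := by
    calc (2 : ℚ) = 2 ^ 1 := by norm_num
      _ ≤ _ := pow_le_pow_right₀ (by norm_num) hq
  rw [show (i : ℤ) - E.p.q j - 5 = (i : ℤ) - (E.p.q j + 5 : ℕ) by push_cast; ring, eps_sub_nat,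
    pow_add]
  have h1 : (2 ^ E.p.q j + 1) * ∑ s ∈ Finset.range N, x s ≤
      (2 ^ E.p.q j + 1) * (17 * (eps i * E.p.w (j + 1))) :=
    mul_le_mul_of_nonneg_left hxsum (by positivity)
  have h2 := mul_le_mul_of_nonneg_right hQ hB
  push_cast at hfinal
  nlinarith

theorem WellFormed.closeComplete (hE : E.WellFormed) (hS : E.Success) {j : ℕ} (hj : 1 ≤ j)
    (hk : j ≤ E.p.k) : CloseComplete E j := by
  induction j, hj using Nat.le_induction with
  | base => exact hE.closeComplete_one hS.1
  | succ j hj ih =>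
    exact hE.closeComplete_succ hj hk hS.1 (hS.2.1 (j + 1) (by omega) hk) (ih (by omega))

end Env

/-! ### The cost of all candidates for one interval -/

theorem List.sum_map_eq_sum_toFinset {l : List ℕ} (hl : l.Nodup) (f : ℕ → ℕ) :
    (l.map f).sum = ∑ x ∈ l.toFinset, f x := by
  rw [List.sum_toFinset f hl]

theorem List.sum_map_ite_one {α : Type*} (l : List α) (p : α → Bool) :
    (l.map fun x => if p x then 1 else 0).sum = (l.filter p).length := by
  induction l with
  | nil => rfl
  | cons x l ih =>
    by_cases h : p x <;> simp [h, ih, Nat.add_comm]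

theorem List.length_filter_eq_card {l : List ℕ} (hl : l.Nodup) (p : ℕ → Bool) :
    (l.filter p).length = (l.toFinset.filter fun x => p x = true).card := by
  rw [← List.toFinset_card_of_nodup (hl.filter p), List.toFinset_filter]

namespace Params.Valid

variable {p : Params} (hp : p.Valid)

include hp

theorem length_grid_le {j : ℕ} (hj : 1 ≤ j) (hk : j ≤ p.k + 1) {i : ℕ} (hi : i ≤ p.a) :
    (grid p.n (p.w j) i).length ≤ 16 * 2 ^ p.a * (p.n / p.w j) := by
  obtain ⟨m, hm⟩ := hp.w_pow j hj hk
  have hg := gridStep_pos (p.w j) i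
  have hgw := Nat.le_of_dvd (hp.w_pos hj hk) (hp.gridStep_dvd_w hj hk i)
  have hwn := hp.w_le_n hj hk
  have h1 : (grid p.n (p.w j) i).length = (2 * p.n - p.w j) / gridStep (p.w j) i + 1 := by
    simp [grid]
  have h2 : p.w j ≤ 8 * 2 ^ i * gridStep (p.w j) i := by
    rw [hm, gridStep_two_pow, show (8 : ℕ) = 2 ^ 3 by norm_num, ← pow_add, ← pow_add]
    exact Nat.pow_le_pow_right (by norm_num) (by omega)
  have h3 := Nat.div_mul_cancel (hp.w_dvd_n hj hk)
  refine Nat.le_of_mul_le_mul_right ?_ hg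
  calc (grid p.n (p.w j) i).length * gridStep (p.w j) i
      = (2 * p.n - p.w j) / gridStep (p.w j) i * gridStep (p.w j) i + gridStep (p.w j) i := by
        rw [h1, Nat.succ_mul]
    _ ≤ 2 * p.n := by
        have := Nat.div_mul_le_self (2 * p.n - p.w j) (gridStep (p.w j) i)
        omega
    _ = 2 * (p.n / p.w j * p.w j) := by rw [h3]
    _ ≤ 2 * (p.n / p.w j * (8 * 2 ^ i * gridStep (p.w j) i)) := by gcongr
    _ = 16 * 2 ^ i * (p.n / p.w j) * gridStep (p.w j) i := by ring
    _ ≤ _ := by gcongr; norm_num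

/-- Since n ≤ 2 (w 1)^2 and w 1 = d 0, the number of intervals at any level is O(d 0); terms
proportional to it are covered by the summand h = 1 of the main sum. -/
theorem n_div_w_le {j : ℕ} (hj : 1 ≤ j) (hk : j ≤ p.k + 1) : p.n / p.w j ≤ 2 * p.d 0 := by
  have h1 := hp.w_one_le hj hk
  have h2 := hp.n_le_w_one_sq
  rw [← hp.w_one_eq]
  refine (Nat.div_le_div_left h1 (by have := hp.two_le_w_one; omega)).trans ?_
  refine Nat.div_le_of_le_mul ?_
  linarith

/-- J' confines J to a window whose radius, that of ZoomIn, is at most 16 grid steps, and such a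
window contains at most 33 multiples of the step. -/
theorem card_filter_zoomIn_le {j : ℕ} (hj : 1 ≤ j) (hk : j ≤ p.k) {i : ℕ} (hi : i ≤ p.a)
    (I I' i' J' : ℕ) :
    ((grid p.n (p.w (j + 1)) i).toFinset.filter fun J =>
      J' ∈ zoomIn (p.w (j + 1)) (p.w j) I J i I' i').card ≤ 33 := by
  obtain ⟨m', m, h1, h2, h3⟩ := hp.exists_exponents hj hk
  have hg := gridStep_pos (p.w (j + 1)) i
  have hr : 2 * p.w (j + 1) / 2 ^ i ≤ 16 * gridStep (p.w (j + 1)) i := by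
    rw [h2, gridStep_two_pow, ← pow_succ', Nat.pow_div (by omega) (by norm_num),
      show (16 : ℕ) = 2 ^ 4 by norm_num, ← pow_add]
    exact Nat.pow_le_pow_right (by norm_num) (by omega)
  set S := (grid p.n (p.w (j + 1)) i).toFinset.filter fun J =>
      J' ∈ zoomIn (p.w (j + 1)) (p.w j) I J i I' i' with hS
  have hmem : ∀ J ∈ S, gridStep (p.w (j + 1)) i ∣ J ∧
      J + (I' - I) ≤ J' + 2 * p.w (j + 1) / 2 ^ i ∧
      J' ≤ J + (I' - I) + 2 * p.w (j + 1) / 2 ^ i := by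
    intro J hJ
    rw [hS, Finset.mem_filter, List.mem_toFinset, hp.mem_grid_iff (by omega) (by omega),
      mem_zoomIn] at hJ
    obtain ⟨⟨h4, _⟩, _, _, h5, _, h6⟩ := hJ
    exact ⟨h4, by omega, h6⟩
  generalize 2 * p.w (j + 1) / 2 ^ i = r at *
  generalize gridStep (p.w (j + 1)) i = g at *
  rcases S.eq_empty_or_nonempty with h | h
  · simp [h]
  · set J₀ := S.min' h
    have hJ₀ := hmem _ (S.min'_mem h)
    have : S.card ≤ (Finset.range 33).card := by
      refine Finset.card_le_card_of_injOn (fun J => (J - J₀) / g) (fun J hJ => ?_)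
        (fun J hJ K hK hJK => ?_)
      · have := hmem J hJ
        rw [Finset.coe_range, Set.mem_Iio, Nat.div_lt_iff_lt_mul hg]
        omega
      · have e1 := hmem J hJ
        have e2 := hmem K hK
        have e3 := S.min'_le J hJ
        have e4 := S.min'_le K hK
        have e5 := Nat.div_mul_cancel (Nat.dvd_sub e1.1 hJ₀.1)
        have e6 := Nat.div_mul_cancel (Nat.dvd_sub e2.1 hJ₀.1)
        simp only at hJK
        rw [hJK, e6] at e5
        omega
    simpa using this

/-- Each interval of level `j` is found by ZoomIn for a bounded number of candidates. -/
theorem sum_sum_zoomIn_le {j : ℕ} (hj : 1 ≤ j) (hk : j ≤ p.k) {i : ℕ} (hi : i ≤ p.a)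
    (I I' i' : ℕ) (φ : ℕ → ℕ) :
    ((grid p.n (p.w (j + 1)) i).map fun J =>
      ((zoomIn (p.w (j + 1)) (p.w j) I J i I' i').map φ).sum).sum ≤
    33 * ((grid p.n (p.w j) i').map φ).sum := by
  rw [List.sum_map_eq_sum_toFinset (grid_nodup _ _ _), List.sum_map_eq_sum_toFinset (grid_nodup _ _ _),
    Finset.mul_sum]
  calc _ = ∑ J ∈ (grid p.n (p.w (j + 1)) i).toFinset, ∑ J' ∈ (grid p.n (p.w j) i').toFinset,
        if J' ∈ zoomIn (p.w (j + 1)) (p.w j) I J i I' i' then φ J' else 0 := by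
        refine Finset.sum_congr rfl fun J hJ => ?_
        rw [List.sum_map_eq_sum_toFinset (zoomIn_nodup _ _ _ _ _ _ _), ← Finset.sum_filter]
        refine Finset.sum_congr ?_ fun _ _ => rfl
        ext J'
        simp only [List.mem_toFinset, Finset.mem_filter] at hJ ⊢
        exact ⟨fun h => ⟨hp.mem_grid_of_mem_zoomIn hj hk hJ h, h⟩, fun h => h.2⟩
    _ = ∑ J' ∈ (grid p.n (p.w j) i').toFinset, ((grid p.n (p.w (j + 1)) i).toFinset.filter fun J =>
          J' ∈ zoomIn (p.w (j + 1)) (p.w j) I J i I' i').card * φ J' := by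
        rw [Finset.sum_comm]
        refine Finset.sum_congr rfl fun J' _ => ?_
        rw [← Finset.sum_filter, Finset.sum_const, smul_eq_mul]
    _ ≤ _ := Finset.sum_le_sum fun J' _ =>
        Nat.mul_le_mul_right _ (hp.card_filter_zoomIn_le hj hk hi I I' i' J')

end Params.Valid

namespace Env

variable {σ : Type*} {E : Env σ}

theorem sparseSample_val (D : ℕ → Level) (j I i : ℕ) :
    (E.sparseSample D j I i).val =
      if (((alignedIn (E.p.w j) (E.p.w (j - 1)) I).filter fun I' =>
        (D (j - 1)).sparse i I').length = 0) then []
      else (List.range (30 * Nat.log 2 E.p.n)).map fun t =>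
        ((alignedIn (E.p.w j) (E.p.w (j - 1)) I).filter fun I' =>
          (D (j - 1)).sparse i I').getD (E.ω.pick j I i t
            ((alignedIn (E.p.w j) (E.p.w (j - 1)) I).filter fun I' =>
              (D (j - 1)).sparse i I').length) 0 := by
  simp only [sparseSample, bind_val, filterL_val, step_val, produce_val, lengthL_val]
  by_cases h : ((alignedIn (E.p.w j) (E.p.w (j - 1)) I).filter fun I' =>
        (D (j - 1)).sparse i I').length = 0
  · rw [if_pos h]
    exact congrArg Timed.val (if_pos h)
  · rw [if_neg h]
    refine (congrArg Timed.val (if_neg h)).trans ?_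
    simp only [bind_val, produce_val, mapL_val, step_val, nthL_val]

theorem WellFormed.mem_sample (hE : E.WellFormed) {j : ℕ} (hj : 2 ≤ j) (hk : j ≤ E.p.k) {I i I' : ℕ}
    (h : I' ∈ (E.data j).sample (I, i)) :
    I ∈ aligned E.p.n (E.p.w j) ∧ i ≤ E.p.a ∧ I' ∈ alignedIn (E.p.w j) (E.p.w (j - 1)) I ∧
      (E.data (j - 1)).sparse i I' = true := by
  rw [E.data_sample hj hk] at h
  split_ifs at h with hp
  · rw [sparseSample_val] at h
    split_ifs at h with h0
    · simp at h
    · obtain ⟨t, _, rfl⟩ := List.mem_map.1 h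
      have := hE.pick_lt j I i t _ (Nat.pos_of_ne_zero h0)
      rw [List.getD_eq_getElem _ _ this]
      have h1 := List.getElem_mem this
      rw [List.mem_filter] at h1
      exact ⟨(E.mem_pairs.1 hp).1, (E.mem_pairs.1 hp).2, h1.1, h1.2⟩
  · simp at h

theorem length_sample_le {j : ℕ} (hj : 2 ≤ j) (hk : j ≤ E.p.k) (I i : ℕ) :
    ((E.data j).sample (I, i)).length ≤ 30 * Nat.log 2 E.p.n := by
  rw [E.data_sample hj hk]
  split_ifs with hp
  · rw [sparseSample_val]
    split_ifs <;> simp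
  · simp

theorem denseLoop_sparse (D : ℕ → Level) (j i f : ℕ) (𝒯 : List ℕ)
    (out : (ℕ → Bool) × (ℕ → List ℕ)) (I' : ℕ)
    (h : (E.denseLoop D j i f 𝒯 out).val.1 I' = true) :
    out.1 I' = true ∨ (E.testSparse D j I' i).val = true := by
  induction f generalizing 𝒯 out with
  | zero => exact .inl (by simpa [denseLoop] using h)
  | succ f ih =>
    cases 𝒯 with
    | nil => exact .inl (by simpa [denseLoop] using h)
    | cons I 𝒯 =>
      obtain ⟨sp, dn⟩ := out
      rw [denseLoop_cons_val] at h
      split_ifs at h with h1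
      · rcases ih _ _ h with h | h
        · by_cases h' : I' = I
          · subst h'; exact .inr h1
          · exact .inl (by simpa [h'] using h)
        · exact .inr h
      · rcases ih _ _ h with h | h
        · exact .inl h
        · exact .inr h

/-- The number of close candidates for `I`. -/
def numClose (E : Env σ) (j I i : ℕ) : ℕ :=
  ((grid E.p.n (E.p.w j) i).filter fun J => E.closeB E.data j I J i).length

/-- An interval that is declared sparse has few close candidates. -/
theorem numClose_le {j : ℕ} (hj : 1 ≤ j) (hk : j ≤ E.p.k) (ht : E.GoodTests j) {I i : ℕ}
    (hI : I ∈ aligned E.p.n (E.p.w j)) (hi : i ≤ E.p.a) (h : (E.data j).sparse i I = true) :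
    E.numClose j I i ≤ 2 * E.p.d j := by
  rw [E.data_sparse hj hk hi] at h
  simp only [denseFor, bind_val, produce_val] at h
  split_ifs at h with hq
  rcases denseLoop_sparse _ _ _ _ _ _ _ h with h | h
  · simp at h
  · by_contra hlt
    have := (ht I hI i (not_le.1 hq) hi).2
    rw [length_enumerate] at this
    rw [this (not_le.1 hlt)] at h
    simp at h

/-- A bound on the total cost of the candidates for one interval. -/
def costBound (G P : ℕ) (M d : ℕ → ℕ) : ℕ → ℕ
  | 0 => 0
  | 1 => G * (M 1 + 1)
  | j + 2 => 7 * G + P * (340 * G + 33 * costBound G P M d (j + 1) + 66 * (d (j + 1) * M (j + 2)))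

/-- Induction on the level. For a sampled subinterval, summing over J repeats the cost of each J' at
most 33 times, and forming the sets ZoomIn costs 10 · 33 G + 10 G = 340 G. The slow algorithm is
charged only for hits; a sampled subinterval is sparse, so it has at most 2 d close J', each
responsible for at most 33 hits, hence the 66 d. -/
theorem WellFormed.sum_cost_le (hE : E.WellFormed) (M : ℕ → ℕ) {G : ℕ}
    (hG : ∀ j, 1 ≤ j → j ≤ E.p.k → ∀ i ≤ E.p.a, (grid E.p.n (E.p.w j) i).length ≤ G)
    {j : ℕ} (hj : 1 ≤ j) (hk : j ≤ E.p.k)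
    (ht : ∀ l, 1 ≤ l → l < j → E.GoodTests l) {I i : ℕ} (hI : I ∈ aligned E.p.n (E.p.w j))
    (hi : i ≤ E.p.a) :
    ((grid E.p.n (E.p.w j) i).map fun J => E.cost E.data M j I J i).sum ≤
      costBound G ((E.p.a + 1) * (30 * Nat.log 2 E.p.n)) M E.p.d j := by
  induction j, hj using Nat.le_induction generalizing I i with
  | base =>
    simp only [cost, costBound, List.map_const', List.sum_replicate, smul_eq_mul]
    exact Nat.mul_le_mul_right _ (hG 1 le_rfl hk i hi)
  | succ j hj ih =>
    obtain ⟨l, rfl⟩ : ∃ l, j = l + 1 := ⟨j - 1, by omega⟩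
    have hV := hE.valid
    set B := costBound G ((E.p.a + 1) * (30 * Nat.log 2 E.p.n)) M E.p.d (l + 1) with hB
    simp only [cost, costBound]
    rw [← hB, List.sum_map_add, List.sum_map_add, List.sum_map_sum_comm]
    simp only [List.sum_map_sum_comm (grid E.p.n (E.p.w (l + 2)) i)]
    have hsample : ∀ i' ≤ i, ∀ I' ∈ (E.data (l + 2)).sample (I, i'),
        I' ∈ aligned E.p.n (E.p.w (l + 1)) ∧ (E.data (l + 1)).sparse i' I' = true := by
      intro i' hi' I' hI'
      obtain ⟨_, _, h1, h2⟩ := hE.mem_sample (by omega) hk hI'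
      exact ⟨hV.mem_aligned_of_mem_alignedIn (by omega) (by omega) hI h1, h2⟩
    have hnum : ∀ i' ≤ i, ∀ I' ∈ (E.data (l + 2)).sample (I, i'),
        ((grid E.p.n (E.p.w (l + 2)) i).map fun J =>
          ((zoomIn (E.p.w (l + 2)) (E.p.w (l + 1)) I J i I' i').map fun J' =>
            if E.closeB E.data (l + 1) I' J' i' then 1 else 0).sum).sum ≤ 66 * E.p.d (l + 1) := by
      intro i' hi' I' hI'
      obtain ⟨h1, h2⟩ := hsample i' hi' I' hI'
      refine (hV.sum_sum_zoomIn_le (by omega) (by omega) hi I I' i' _).trans ?_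
      have h3 := numClose_le (by omega) (by omega) (ht (l + 1) (by omega) (by omega)) h1
        (by omega) h2
      rw [numClose] at h3
      rw [List.sum_map_ite_one]
      omega
    have h1 : ((grid E.p.n (E.p.w (l + 2)) i).map fun _ => 7).sum ≤ 7 * G := by
      have := hG (l + 2) (by omega) hk i hi
      simp; omega
    have h2 : ((List.range (i + 1)).map fun i' => (((E.data (l + 2)).sample (I, i')).map fun I' =>
        ((grid E.p.n (E.p.w (l + 2)) i).map fun J =>
          10 * (zoomIn (E.p.w (l + 2)) (E.p.w (l + 1)) I J i I' i').length + 10 +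
          ((zoomIn (E.p.w (l + 2)) (E.p.w (l + 1)) I J i I' i').map fun J' =>
            E.cost E.data M (l + 1) I' J' i').sum).sum).sum).sum ≤
        (E.p.a + 1) * (30 * Nat.log 2 E.p.n) * (340 * G + 33 * B) := by
      rw [Nat.mul_assoc]
      refine (List.sum_map_le_length_mul (c := 30 * Nat.log 2 E.p.n * (340 * G + 33 * B))
        fun i' hi' => ?_).trans (Nat.mul_le_mul_right _ (by simpa using hi))
      have hi'' : i' ≤ i := Nat.lt_succ_iff.1 (List.mem_range.1 hi')
      refine (List.sum_map_le_length_mul (c := 340 * G + 33 * B) fun I' hI' => ?_).trans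
        (Nat.mul_le_mul_right _ (length_sample_le (by omega) hk _ _))
      rw [List.sum_map_add, List.sum_map_add, List.sum_map_mul_left]
      have e1 := hV.sum_sum_zoomIn_le (j := l + 1) (by omega) (by omega) hi I I' i' (fun _ => 1)
      have e2 := hV.sum_sum_zoomIn_le (j := l + 1) (by omega) (by omega) hi I I' i'
        (fun J' => E.cost E.data M (l + 1) I' J' i')
      have e3 := ih (by omega) (fun m h1 h2 => ht m h1 (by omega)) (hsample i' hi'' I' hI').1
        (show i' ≤ E.p.a by omega)
      have e4 := hG (l + 2) (by omega) hk i hi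
      have e5 := hG (l + 1) (by omega) (by omega) i' (by omega)
      simp only [List.map_const', List.sum_replicate, smul_eq_mul, mul_one] at e1 ⊢
      simp only [show l + 1 + 1 = l + 2 from rfl] at e1 e2
      omega
    have h3 : ((grid E.p.n (E.p.w (l + 2)) i).map fun J =>
        if E.hit E.data (l + 2) I J i = true then M (l + 2) else 0).sum ≤
        (E.p.a + 1) * (30 * Nat.log 2 E.p.n) * (66 * (E.p.d (l + 1) * M (l + 2))) := by
      -- The indicator of a hit is at most the number of its witnesses i', I', J'.
      have e1 : ∀ J ∈ grid E.p.n (E.p.w (l + 2)) i,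
          (if E.hit E.data (l + 2) I J i = true then M (l + 2) else 0) ≤
          ((List.range (i + 1)).map fun i' => (((E.data (l + 2)).sample (I, i')).map fun I' =>
            ((zoomIn (E.p.w (l + 2)) (E.p.w (l + 1)) I J i I' i').map fun J' =>
              if E.closeB E.data (l + 1) I' J' i' then 1 else 0).sum).sum).sum * M (l + 2) := by
        intro J _
        split_ifs with h
        · obtain ⟨i', hi', I', hI', J', hJ', hc⟩ := (E.hit_iff _ _ _ _ _).1 h
          refine Nat.le_mul_of_pos_left _ (lt_of_lt_of_le Nat.one_pos ?_)
          have hc' : (if E.closeB E.data (l + 1) I' J' i' then 1 else 0) = 1 := if_pos hc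
          calc 1 = (if E.closeB E.data (l + 1) I' J' i' then 1 else 0) := hc'.symm
            _ ≤ ((zoomIn (E.p.w (l + 2)) (E.p.w (l + 1)) I J i I' i').map fun J' =>
                if E.closeB E.data (l + 1) I' J' i' then 1 else 0).sum :=
              List.single_le_sum (by simp) _
                (List.mem_map_of_mem (f := fun J' =>
                  if E.closeB E.data (l + 1) I' J' i' then 1 else 0) hJ')
            _ ≤ (((E.data (l + 2)).sample (I, i')).map fun I' =>
                ((zoomIn (E.p.w (l + 2)) (E.p.w (l + 1)) I J i I' i').map fun J' =>
                  if E.closeB E.data (l + 1) I' J' i' then 1 else 0).sum).sum :=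
              List.single_le_sum (by simp) _ (List.mem_map_of_mem (f := fun I' =>
                ((zoomIn (E.p.w (l + 2)) (E.p.w (l + 1)) I J i I' i').map fun J' =>
                  if E.closeB E.data (l + 1) I' J' i' then 1 else 0).sum) hI')
            _ ≤ _ := List.single_le_sum (by simp) _ (List.mem_map_of_mem (f := fun i' =>
                (((E.data (l + 2)).sample (I, i')).map fun I' =>
                ((zoomIn (E.p.w (l + 2)) (E.p.w (l + 1)) I J i I' i').map fun J' =>
                  if E.closeB E.data (l + 1) I' J' i' then 1 else 0).sum).sum)
                (List.mem_range.2 (Nat.lt_succ_iff.2 hi')))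
        · exact Nat.zero_le _
      refine (List.sum_map_le_sum_map' e1).trans ?_
      rw [List.sum_map_mul_right, ← Nat.mul_assoc 66, ← Nat.mul_assoc (_ * _) (66 * _)]
      refine Nat.mul_le_mul_right _ ?_
      rw [List.sum_map_sum_comm]
      simp only [List.sum_map_sum_comm (grid E.p.n (E.p.w (l + 2)) i)]
      rw [Nat.mul_assoc]
      refine (List.sum_map_le_length_mul (c := 30 * Nat.log 2 E.p.n * (66 * E.p.d (l + 1)))
        fun i' hi' => ?_).trans (Nat.mul_le_mul_right _ (by simpa using hi))
      have hi'' : i' ≤ i := Nat.lt_succ_iff.1 (List.mem_range.1 hi')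
      exact (List.sum_map_le_length_mul (c := 66 * E.p.d (l + 1)) fun I' hI' =>
        hnum i' hi'' I' hI').trans
        (Nat.mul_le_mul_right _ (length_sample_le (by omega) hk _ _))
    rw [Nat.mul_add]
    simp only [show l + 1 + 1 = l + 2 from rfl] at *
    omega

end Env

/-! ### Running times of the steps, and the amortized count of dense rounds -/

namespace Env

variable {σ : Type*} {E : Env σ}

/-- `M j` bounds the time of the calls of the slow algorithm at level `j`. -/
def CallBound (E : Env σ) (M : ℕ → ℕ) : Prop :=
  ∀ j, 1 ≤ j → j ≤ E.p.k → ∀ i ≤ E.p.a, ∀ I J, I + E.p.w j ≤ E.p.n → J + E.p.w j ≤ 2 * E.p.n →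
    (E.callED j I J i).time ≤ M j

/-- A bound on the number of candidates for an interval of level `j`. -/
def gridBound (E : Env σ) (j : ℕ) : ℕ := 16 * 2 ^ E.p.a * (E.p.n / E.p.w j)

/-- The overhead of Enumerate at level `j`. -/
def enumOverhead (E : Env σ) (j : ℕ) : ℕ := overhead E.p.a (30 * Nat.log 2 E.p.n) j

/-- The bound on the cost of all candidates for an interval of level `j`. -/
def stackBound (E : Env σ) (M : ℕ → ℕ) (j : ℕ) : ℕ :=
  costBound (E.gridBound 1) ((E.p.a + 1) * (30 * Nat.log 2 E.p.n)) M E.p.d j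

/-- The cost of the candidates that are drawn for the test of `I`. -/
def testCost (E : Env σ) (M : ℕ → ℕ) (j I i : ℕ) : ℕ :=
  ((grid E.p.n (E.p.w j) i).map fun J =>
    if E.ω.draw j I i J < E.p.threshold j then E.cost E.data M j I J i else 0).sum

theorem WellFormed.length_grid_le (hE : E.WellFormed) {j : ℕ} (hj : 1 ≤ j) (hk : j ≤ E.p.k) {i : ℕ}
    (hi : i ≤ E.p.a) : (grid E.p.n (E.p.w j) i).length ≤ E.gridBound j :=
  hE.valid.length_grid_le hj (by omega) hi

theorem WellFormed.gridBound_le_one (hE : E.WellFormed) {j : ℕ} (hj : 1 ≤ j) (hk : j ≤ E.p.k) :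
    E.gridBound j ≤ E.gridBound 1 :=
  Nat.mul_le_mul_left _ (Nat.div_le_div_left (hE.valid.w_one_le hj (by omega))
    (hE.valid.w_pos le_rfl (by omega)))

theorem WellFormed.sum_cost_grid_le (hE : E.WellFormed) (M : ℕ → ℕ) {j : ℕ} (hj : 1 ≤ j)
    (hk : j ≤ E.p.k) (ht : ∀ l, 1 ≤ l → l < j → E.GoodTests l) {I i : ℕ}
    (hI : I ∈ aligned E.p.n (E.p.w j)) (hi : i ≤ E.p.a) :
    ((grid E.p.n (E.p.w j) i).map fun J => E.cost E.data M j I J i).sum ≤ E.stackBound M j :=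
  hE.sum_cost_le M (fun _ h1 h2 _ h3 => (hE.length_grid_le h1 h2 h3).trans
    (hE.gridBound_le_one h1 h2)) hj hk ht hI hi

theorem WellFormed.enumerate_time_le (hE : E.WellFormed) {M : ℕ → ℕ} (hM : E.CallBound M) {j : ℕ}
    (hj : 1 ≤ j) (hk : j ≤ E.p.k) {I i : ℕ} (hI : I ∈ aligned E.p.n (E.p.w j)) (hi : i ≤ E.p.a)
    {𝒥 : List ℕ} (h𝒥 : ∀ J ∈ 𝒥, J ∈ grid E.p.n (E.p.w j) i) :
    (E.enumerate E.data j I 𝒥 i).time ≤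
      E.enumOverhead j + (𝒥.map fun J => E.cost E.data M j I J i).sum := by
  have hV := hE.valid
  refine E.enumerate_time_le E.data M E.p.k (30 * Nat.log 2 E.p.n) hM (fun j h1 h2 => ?_)
    (fun j h1 h2 I i => length_sample_le h1 h2 I i) (fun j h1 h2 I i I' hI' => ?_) j I 𝒥 i hk hi
    ((hV.mem_aligned_iff hj (by omega)).1 hI).2
    (fun J hJ => ((hV.mem_grid_iff hj (by omega)).1 (h𝒥 J hJ)).2)
  · obtain ⟨j, rfl⟩ : ∃ l, j = l + 1 := ⟨j - 1, by omega⟩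
    exact (hV.w_lt j (by omega) (by omega)).le
  · obtain ⟨j, rfl⟩ : ∃ l, j = l + 1 := ⟨j - 1, by omega⟩
    obtain ⟨h3, _, h4, _⟩ := hE.mem_sample h1 h2 hI'
    exact ((hV.mem_aligned_iff (j := j) (by omega) (by omega)).1
      (hV.mem_aligned_of_mem_alignedIn (by omega) (by omega) h3 h4)).2

theorem WellFormed.testSparse_time_le (hE : E.WellFormed) {M : ℕ → ℕ} (hM : E.CallBound M) {j : ℕ}
    (hj : 1 ≤ j) (hk : j ≤ E.p.k) {I i : ℕ} (hI : I ∈ aligned E.p.n (E.p.w j)) (hi : i ≤ E.p.a) :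
    (E.testSparse E.data j I i).time ≤
      4 * E.gridBound j + 4 + E.enumOverhead j + E.testCost M j I i := by
  have hg := hE.length_grid_le hj hk hi
  set S := (grid E.p.n (E.p.w j) i).filter fun J =>
    decide (E.ω.draw j I i J < E.p.threshold j) with hS
  have h1 := hE.enumerate_time_le hM hj hk hI hi (𝒥 := S) fun J hJ => (List.mem_filter.1 hJ).1
  have h2 : (S.map fun J => E.cost E.data M j I J i).sum = E.testCost M j I i := by
    rw [testCost, hS]
    generalize grid E.p.n (E.p.w j) i = l
    induction l with
    | nil => rfl
    | cons x l ih =>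
      by_cases h : E.ω.draw j I i x < E.p.threshold j <;> simp [h, ih]
  have h3 : (E.enumerate E.data j I S i).val.length ≤ (grid E.p.n (E.p.w j) i).length := by
    rw [length_enumerate]
    exact (List.length_filter_le _ _).trans (List.length_filter_le _ _)
  simp only [testSparse, drawSet, bind_time, bind_val, produce_time, produce_val, filterL_time,
    filterL_val, step_time, step_val, lengthL_time, List.map_const', List.sum_replicate,
    smul_eq_mul, ← hS]
  omega

theorem WellFormed.sum_cost_aligned_le (hE : E.WellFormed) (M : ℕ → ℕ) {j : ℕ} (hj : 1 ≤ j)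
    (hk : j ≤ E.p.k) (I i : ℕ) :
    ((aligned E.p.n (E.p.w j)).map fun J => E.cost E.data M j I J i).sum ≤
      ((grid E.p.n (E.p.w j) i).map fun J => E.cost E.data M j I J i).sum := by
  rw [List.sum_map_eq_sum_toFinset (grid_nodup _ _ _),
    List.sum_map_eq_sum_toFinset (aligned_nodup (hE.valid.w_pos hj (by omega)))]
  refine Finset.sum_le_sum_of_subset fun J hJ => ?_
  rw [List.mem_toFinset] at hJ ⊢
  exact hE.valid.mem_grid_of_mem_aligned hj (by omega) hJ _

/-- The number of candidates that are close for one of the given intervals. -/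
def numCovered (E : Env σ) (j i : ℕ) (𝒯 : List ℕ) : ℕ :=
  ((grid E.p.n (E.p.w j) i).toFinset.filter fun J => ∃ I ∈ 𝒯, E.closeB E.data j I J i = true).card

/-- The intervals that are removed together with `I` include all those that share a close candidate
with `I`. -/
theorem WellFormed.mem_nearX_of_common (hE : E.WellFormed) {j : ℕ} (hj : 1 ≤ j) (hk : j ≤ E.p.k)
    (hcc : CloseComplete E j) {i : ℕ} (hi : i ≤ E.p.a) (hq : E.p.q j < i) {I I' J : ℕ}
    (hI : I ∈ aligned E.p.n (E.p.w j)) (hI' : I' ∈ aligned E.p.n (E.p.w j))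
    (hJ : J ∈ grid E.p.n (E.p.w j) i) (h : E.closeB E.data j I J i = true)
    (h' : E.closeB E.data j I' J i = true) : I' ∈ E.nearX E.data j I i := by
  refine hE.mem_nearX_self hj hk hcc hi hI hI' ?_
  have hs := hE.closeSound hj hk
  have h1 := hs I hI i hi J hJ h
  have h2 := hs I' hI' i hi J hJ h'
  have h3 : (E.ed j I I' : ℚ) ≤ E.ed j I J + E.ed j I' J := by
    have := E.ed_triangle j I J I'
    rw [E.ed_comm j J I'] at this
    exact_mod_cast this
  have hq' := q_eq (p := E.p) hj
  have h4 : ((i - E.p.q (j - 1) - 7 : ℕ) : ℤ) = (i : ℤ) - (E.p.q (j - 1) + 6 : ℕ) - (1 : ℕ) := by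
    omega
  rw [h4, eps_sub_nat _ 1, pow_one, mul_assoc]
  linarith

/-- The time of a round in which an interval is declared dense, except for the test. -/
def denseRoundBound (E : Env σ) (M : ℕ → ℕ) (j : ℕ) : ℕ :=
  7 * (E.p.n / E.p.w j) + 6 * E.gridBound j + 8 + 2 * (E.enumOverhead j + E.stackBound M j)

/-- The arrays passed on after the round can stay anonymous, since the remaining loop will be
bounded for all arrays. -/
theorem WellFormed.denseLoop_cons_time_le (hE : E.WellFormed) {M : ℕ → ℕ} (hM : E.CallBound M)
    {j : ℕ} (hj : 1 ≤ j) (hk : j ≤ E.p.k) (ht : ∀ l, 1 ≤ l → l < j → E.GoodTests l) {i : ℕ}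
    (hi : i ≤ E.p.a) {I f : ℕ} {𝒯 : List ℕ}
    (h𝒯 : (I :: 𝒯).Sublist (aligned E.p.n (E.p.w j))) (sp : ℕ → Bool) (dn : ℕ → List ℕ) :
    ∃ out, (E.denseLoop E.data j i (f + 1) (I :: 𝒯) (sp, dn)).time ≤
      2 + (E.testSparse E.data j I i).time + if (E.testSparse E.data j I i).val then
        (E.denseLoop E.data j i f 𝒯 out).time
      else E.denseRoundBound M j + (E.denseLoop E.data j i f
        ((I :: 𝒯).filter fun I' => !decide (I' ∈ E.nearX E.data j I i)) out).time := by
  have hI : I ∈ aligned E.p.n (E.p.w j) := h𝒯.subset List.mem_cons_self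
  rw [denseLoop]
  simp only [bind_time, tick_time]
  cases h : (E.testSparse E.data j I i).val
  · simp only [Bool.false_eq_true, if_false]
    set h₁ := i - E.p.q (j - 1) - 7
    set h₂ := i - 2 * E.p.q (j - 1) - 14
    have hh₁ : h₁ ≤ E.p.a := by omega
    have hh₂ : h₂ ≤ E.p.a := by omega
    have e1 := hE.enumerate_time_le hM hj hk hI hh₁ fun J hJ =>
      hE.valid.mem_grid_of_mem_aligned hj (by omega) hJ h₁
    have e2 := hE.enumerate_time_le hM hj hk hI hh₂ (𝒥 := grid E.p.n (E.p.w j) h₂) fun J hJ => hJ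
    have e3 := hE.sum_cost_aligned_le M hj hk I h₁
    have e4 := hE.sum_cost_grid_le M hj hk ht hI hh₁
    have e5 := hE.sum_cost_grid_le M hj hk ht hI hh₂
    have e6 := hE.length_grid_le hj hk hh₂
    have e7 := hE.length_grid_le hj hk hi
    have e8 := length_aligned E.p.n (E.p.w j)
    have e9 : (E.enumerate E.data j I (aligned E.p.n (E.p.w j)) h₁).val.length ≤
        (aligned E.p.n (E.p.w j)).length := by
      rw [length_enumerate]; exact List.length_filter_le _ _
    have e10 : (E.enumerate E.data j I (grid E.p.n (E.p.w j) h₂) h₂).val.length ≤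
        (grid E.p.n (E.p.w j) h₂).length := by
      rw [length_enumerate]; exact List.length_filter_le _ _
    have e11 := h𝒯.length_le
    have hX : (markL (E.enumerate E.data j I (aligned E.p.n (E.p.w j)) h₁).val).val =
        fun I' => decide (I' ∈ E.nearX E.data j I i) := funext fun I' => markL_val _ _
    simp only [bind_time, produce_time, produce_val, markL_time, filterL_time,
      filterL_val, step_time, step_val, hX, List.map_const', List.sum_replicate, smul_eq_mul]
    have e12 := foldL_time_le (f := fun (dn : ℕ → List ℕ) I' => write dn I'
      ((grid E.p.n (E.p.w j) i).filter fun J => (markL (E.enumerate E.data j I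
        (grid E.p.n (E.p.w j) h₂) h₂).val).val (roundDown (E.p.w j) h₂ J))) (g := fun _ => 1)
      (l := (E.enumerate E.data j I (aligned E.p.n (E.p.w j)) h₁).val)
      (fun _ _ _ => le_rfl) dn
    simp only [List.map_const', List.sum_replicate, smul_eq_mul] at e12
    refine ⟨(sp, (foldL (fun (dn : ℕ → List ℕ) I' => write dn I'
      ((grid E.p.n (E.p.w j) i).filter fun J => (markL (E.enumerate E.data j I
        (grid E.p.n (E.p.w j) h₂) h₂).val).val (roundDown (E.p.w j) h₂ J))) dn
      (E.enumerate E.data j I (aligned E.p.n (E.p.w j)) h₁).val).val), ?_⟩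
    rw [denseRoundBound]
    omega
  · simp only [if_true, bind_time, write_time]
    exact ⟨(Function.update sp I true, dn), by rw [write_val]; omega⟩

/-- Amortization, multiplied by d_j to avoid a quotient. A round that declares I dense removes every
interval sharing a close candidate with I (`mem_nearX_of_common`), so the close candidates of I are
no longer covered by the remaining intervals. By the success of the tests there are at least d_j / 2
of them. Hence each such round lowers twice the number of covered candidates by at least d_j. -/
theorem WellFormed.denseLoop_time_le (hE : E.WellFormed) {M : ℕ → ℕ} (hM : E.CallBound M)
    {j : ℕ} (hj : 1 ≤ j) (hk : j ≤ E.p.k) (hcc : CloseComplete E j)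
    (ht : ∀ l, 1 ≤ l → l ≤ j → E.GoodTests l) {i : ℕ} (hi : i ≤ E.p.a) (hq : E.p.q j < i)
    (f : ℕ) (𝒯 : List ℕ) (h𝒯 : 𝒯.Sublist (aligned E.p.n (E.p.w j)))
    (out : (ℕ → Bool) × (ℕ → List ℕ)) :
    E.p.d j * (E.denseLoop E.data j i f 𝒯 out).time ≤
      E.p.d j * (1 + (𝒯.map fun I => 2 + (E.testSparse E.data j I i).time).sum) +
        2 * E.numCovered j i 𝒯 * E.denseRoundBound M j := by
  induction f generalizing 𝒯 out with
  | zero =>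
    simp only [denseLoop, step_time]
    exact le_add_right (Nat.mul_le_mul_left _ (by omega))
  | succ f ih =>
    cases 𝒯 with
    | nil => simp [denseLoop]
    | cons I 𝒯 =>
      have hI : I ∈ aligned E.p.n (E.p.w j) := h𝒯.subset List.mem_cons_self
      obtain ⟨sp, dn⟩ := out
      obtain ⟨out, h⟩ := hE.denseLoop_cons_time_le hM hj hk (fun l h1 h2 => ht l h1 h2.le) hi
        (f := f) h𝒯 sp dn
      refine (Nat.mul_le_mul_left _ h).trans ?_
      rw [List.map_cons, List.sum_cons]
      split_ifs with hsp
      · have h1 := ih 𝒯 ((List.sublist_cons_self _ _).trans h𝒯) out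
        have h2 : E.numCovered j i 𝒯 ≤ E.numCovered j i (I :: 𝒯) := by
          refine Finset.card_le_card fun J hJ => ?_
          rw [Finset.mem_filter] at hJ ⊢
          obtain ⟨h1, I', h2, h3⟩ := hJ
          exact ⟨h1, I', List.mem_cons_of_mem _ h2, h3⟩
        have h3 := Nat.mul_le_mul_right (E.denseRoundBound M j) (Nat.mul_le_mul_left 2 h2)
        simp only [Nat.mul_add] at *
        omega
      · set 𝒯' := (I :: 𝒯).filter fun I' => !decide (I' ∈ E.nearX E.data j I i) with h𝒯'
        have hself : I ∈ E.nearX E.data j I i := hE.mem_nearX_self hj hk hcc hi hI hI (by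
          rw [E.ed_self]; have := eps_pos ((i - E.p.q (j - 1) - 7 : ℕ) : ℤ); simp; positivity)
        have hsub : 𝒯'.Sublist 𝒯 := by
          rw [h𝒯', List.filter_cons_of_neg (by simpa using hself)]
          exact List.filter_sublist
        have h1 := ih 𝒯' (hsub.trans ((List.sublist_cons_self _ _).trans h𝒯)) out
        have h2 := hsub.sum_map_le fun I => 2 + (E.testSparse E.data j I i).time
        have h3 : E.numCovered j i 𝒯' + E.numClose j I i ≤ E.numCovered j i (I :: 𝒯) := by
          rw [numClose, List.length_filter_eq_card (grid_nodup _ _ _), numCovered, numCovered,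
            ← Finset.card_union_of_disjoint]
          · refine Finset.card_le_card fun J hJ => ?_
            rw [Finset.mem_union, Finset.mem_filter, Finset.mem_filter] at hJ
            rw [Finset.mem_filter]
            rcases hJ with ⟨h1, I', h2, h3⟩ | ⟨h1, h2⟩
            · exact ⟨h1, I', List.mem_cons_of_mem _ (hsub.subset h2), h3⟩
            · exact ⟨h1, I, List.mem_cons_self, h2⟩
          · rw [Finset.disjoint_left]
            intro J hJ hJ'
            rw [Finset.mem_filter] at hJ hJ'
            obtain ⟨h1, I', h2, h3⟩ := hJ
            have h4 := (List.mem_filter.1 h2).2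
            have := hE.mem_nearX_of_common hj hk hcc hi hq hI
              (h𝒯.subset (List.mem_filter.1 h2).1) (List.mem_toFinset.1 h1) hJ'.2 h3
            simp [this] at h4
        have h4 : E.p.d j ≤ 2 * E.numClose j I i := by
          by_contra hlt
          have h5 := (ht j hj le_rfl I hI i hq hi).1
          rw [length_enumerate] at h5
          exact hsp (h5 (not_le.1 hlt))
        have h5 := Nat.mul_le_mul_right (E.denseRoundBound M j)
          (show 2 * E.numCovered j i 𝒯' + E.p.d j ≤ 2 * E.numCovered j i (I :: 𝒯) by omega)
        have h6 := Nat.mul_le_mul_left (E.p.d j) h2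
        simp only [Nat.mul_add, Nat.add_mul] at *
        omega

theorem WellFormed.numCovered_le (hE : E.WellFormed) {j : ℕ} (hj : 1 ≤ j) (hk : j ≤ E.p.k) {i : ℕ}
    (hi : i ≤ E.p.a) (𝒯 : List ℕ) : E.numCovered j i 𝒯 ≤ E.gridBound j :=
  (Finset.card_filter_le _ _).trans ((List.toFinset_card_le _).trans (hE.length_grid_le hj hk hi))

/-- The data of `Dense` is not longer than the list of all candidates. -/
theorem WellFormed.length_dense_le (hE : E.WellFormed) {j : ℕ} (hj : 1 ≤ j) (hk : j ≤ E.p.k) {i : ℕ}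
    (hi : i ≤ E.p.a) (I : ℕ) : (E.dense j i I).length ≤ E.gridBound j := by
  have hg := hE.length_grid_le hj hk hi
  rcases Nat.lt_or_ge (E.p.q j) i with h | h
  · rw [E.dense_of_lt h]
    have key : ∀ (f : ℕ) (𝒯 : List ℕ) (out : (ℕ → Bool) × (ℕ → List ℕ)),
        (∀ I, (out.2 I).length ≤ E.gridBound j) →
        ∀ I, ((E.denseLoop E.data j i f 𝒯 out).val.2 I).length ≤ E.gridBound j := by
      intro f
      induction f with
      | zero => intro 𝒯 out h; simpa [denseLoop] using h
      | succ f ih =>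
        intro 𝒯 out h I
        cases 𝒯 with
        | nil => simpa [denseLoop] using h I
        | cons I₀ 𝒯 =>
          obtain ⟨sp, dn⟩ := out
          rw [denseLoop_cons_val]
          split_ifs
          · exact ih _ (Function.update sp I₀ true, dn) h I
          · refine ih _ _ (fun I => ?_) I
            simp only
            split_ifs
            · exact (List.length_filter_le _ _).trans hg
            · exact h I
    exact key _ _ _ (by simp) I
  · rw [E.dense_of_le h]
    split_ifs
    · exact hg
    · simp

end Env

/-! ### Summing up an iteration and the whole run -/

namespace Params.Valid

variable {p : Params} (hp : p.Valid)

include hp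

/-- One factor is at most 2 w 1 ≤ 2 w j, which cancels the denominator of the other. So there are
O(n) pairs of intervals, even across levels, and the pattern matching stays nearly linear in n/θ. -/
theorem n_div_w_mul_le {j l : ℕ} (hj : 1 ≤ j) (hjk : j ≤ p.k + 1) (hl : 1 ≤ l) (hlk : l ≤ p.k + 1) :
    p.n / p.w j * (p.n / p.w l) ≤ 2 * p.n := by
  have h1 := hp.n_div_w_le hl hlk
  have h2 := hp.w_one_le hj hjk
  have h3 := Nat.div_mul_le_self p.n (p.w j)
  rw [← hp.w_one_eq] at h1
  calc p.n / p.w j * (p.n / p.w l) ≤ p.n / p.w j * (2 * p.w j) := by gcongr; omega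
    _ = 2 * (p.n / p.w j * p.w j) := by ring
    _ ≤ _ := by omega

theorem n_div_w_pos {j : ℕ} (hj : 1 ≤ j) (hjk : j ≤ p.k + 1) : 1 ≤ p.n / p.w j :=
  (Nat.one_le_div_iff (hp.w_pos hj hjk)).2 (hp.w_le_n hj hjk)

theorem two_le_log : 2 ≤ Nat.log 2 p.n :=
  Nat.le_log_of_pow_le (by norm_num) (by have := hp.four_le_n; omega)

end Params.Valid

namespace Env

variable {σ : Type*} {E : Env σ}

/-- A bound on the number of pairs of intervals. -/
def sizeBound (E : Env σ) : ℕ := 32 * 2 ^ E.p.a * E.p.n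

theorem WellFormed.mul_gridBound_le (hE : E.WellFormed) {j l : ℕ} (hj : 1 ≤ j) (hjk : j ≤ E.p.k)
    (hl : 1 ≤ l) (hlk : l ≤ E.p.k) : E.p.n / E.p.w j * E.gridBound l ≤ E.sizeBound := by
  have := hE.valid.n_div_w_mul_le hj (by omega) hl (by omega)
  calc _ = 16 * 2 ^ E.p.a * (E.p.n / E.p.w j * (E.p.n / E.p.w l)) := by rw [gridBound]; ring
    _ ≤ 16 * 2 ^ E.p.a * (2 * E.p.n) := by gcongr
    _ = _ := by rw [sizeBound]; ring

theorem WellFormed.gridBound_le (hE : E.WellFormed) {j : ℕ} (hj : 1 ≤ j) (hjk : j ≤ E.p.k) :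
    E.gridBound j ≤ E.sizeBound :=
  (Nat.le_mul_of_pos_left _ (hE.valid.n_div_w_pos hj (by omega))).trans
    (hE.mul_gridBound_le hj hjk hj hjk)

theorem thirtytwo_mul_n_le : 32 * E.p.n ≤ E.sizeBound := by
  rw [sizeBound]
  have : 1 ≤ 2 ^ E.p.a := Nat.one_le_two_pow
  nlinarith

theorem n_div_w_le_sizeBound (j : ℕ) : E.p.n / E.p.w j ≤ E.sizeBound := by
  have := thirtytwo_mul_n_le (E := E)
  have := Nat.div_le_self E.p.n (E.p.w j)
  omega

theorem WellFormed.sizeBound_pos (hE : E.WellFormed) : 1 ≤ E.sizeBound := by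
  have := thirtytwo_mul_n_le (E := E)
  have := hE.valid.n_pos
  omega

theorem WellFormed.sparseSample_time_le (hE : E.WellFormed) (j I i : ℕ) :
    (E.sparseSample E.data j I i).time ≤
      (4 * (E.p.w j / E.p.w (j - 1)) + 5) * (1 + 30 * Nat.log 2 E.p.n) := by
  set subs := alignedIn (E.p.w j) (E.p.w (j - 1)) I with hsubs
  set sp := subs.filter fun I' => (E.data (j - 1)).sparse i I' with hsp
  have h1 : subs.length = E.p.w j / E.p.w (j - 1) := by simp [hsubs, alignedIn]
  have h2 : sp.length ≤ subs.length := List.length_filter_le _ _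
  set s := 30 * Nat.log 2 E.p.n with hs
  have h3 : (E.sparseSample E.data j I i).time ≤
      (subs.length + 1) + ((1 + subs.length * 2) + ((sp.length + 1) +
        (s + 1 + (1 + s * (3 + subs.length))))) := by
    simp only [sparseSample, bind_time, produce_time, produce_val, filterL_time, filterL_val,
      step_time, step_val, lengthL_time, lengthL_val, List.map_const', List.sum_replicate,
      smul_eq_mul]
    refine Nat.add_le_add_left (Nat.add_le_add_left (Nat.add_le_add_left ?_ _) _) _
    by_cases h : sp.length = 0
    · refine le_trans (le_of_eq (congrArg Timed.time (if_pos h))) ?_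
      simp
    · refine le_trans (le_of_eq (congrArg Timed.time (if_neg h))) ?_
      simp only [bind_time, produce_time, produce_val, mapL_time, step_time, step_val, nthL_time,
        List.length_range]
      refine Nat.add_le_add_left (Nat.add_le_add_left ?_ _) _
      refine (List.sum_map_le_length_mul (c := 3 + subs.length) fun t _ => ?_).trans (by simp [hs])
      have := hE.pick_lt j I i t _ (Nat.pos_of_ne_zero h)
      rw [← hsubs, ← hsp]
      omega
  rw [← h1]
  nlinarith

theorem WellFormed.length_boxes_le (hE : E.WellFormed) {j : ℕ} (hj : 1 ≤ j) (hk : j ≤ E.p.k) {I : ℕ}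
    (hI : I ∈ aligned E.p.n (E.p.w j)) :
    ((E.data j).boxes I).length ≤
      (E.p.a + 1) * (E.gridBound j * (Nat.log 2 E.p.n + 1)) := by
  rw [E.data_boxes hj hk hI, List.length_flatMap]
  refine (List.sum_map_le_length_mul (c := E.gridBound j * (Nat.log 2 E.p.n + 1))
    fun i hi => ?_).trans (by simp)
  have hi' : i ≤ E.p.a := Nat.lt_succ_iff.1 (List.mem_range.1 hi)
  rw [List.length_flatMap]
  refine (List.sum_map_le_length_mul (c := Nat.log 2 E.p.n + 1) fun J _ => ?_).trans
    (Nat.mul_le_mul_right _ (hE.length_dense_le hj hk hi' I))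
  rw [length_induced]
  exact Nat.add_le_add_right (Nat.log_mono_right (hE.valid.w_le_n hj (by omega))) 1

theorem WellFormed.findBelow_time_le (hE : E.WellFormed) {j : ℕ} (hj : 1 ≤ j) (hk : j + 1 ≤ E.p.k)
    {I i : ℕ} (hI : I ∈ aligned E.p.n (E.p.w (j + 1))) (hi : i ≤ E.p.a) :
    (E.findBelow E.data (j + 1) I i).time ≤
      7 + 6 * (E.p.w (j + 1) / E.p.w j) + E.gridBound (j + 1) * (2 * Nat.log 2 E.p.n + 12) +
        E.p.w (j + 1) / E.p.w j * ((E.p.a + 1) * (E.gridBound j * (Nat.log 2 E.p.n + 1)) *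
          (2 * Nat.log 2 E.p.n + 9)) := by
  set L := Nat.log 2 E.p.n with hL
  set subs := alignedIn (E.p.w (j + 1)) (E.p.w j) I with hsubs
  have h1 : subs.length = E.p.w (j + 1) / E.p.w j := by simp [hsubs, alignedIn]
  have hg := hE.length_grid_le (by omega) hk hi
  have h2 := apm_time_le (L + 2) (E.p.w (j + 1)) (E.p.w j) (eps ((i : ℤ) - E.p.q j - 5))
    (columns E j I) (grid E.p.n (E.p.w (j + 1)) i)
  have h3 := length_apm_le (L + 2) (E.p.w (j + 1)) (E.p.w j) (eps ((i : ℤ) - E.p.q j - 5))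
    (columns E j I) (grid E.p.n (E.p.w (j + 1)) i)
  have h4 : ((columns E j I).map fun col => 3 + col.length * (2 * L + 9)).sum ≤
      subs.length * (3 + (E.p.a + 1) * (E.gridBound j * (L + 1)) * (2 * L + 9)) := by
    refine (List.sum_map_le_length_mul
      (c := 3 + (E.p.a + 1) * (E.gridBound j * (L + 1)) * (2 * L + 9)) fun col hcol => ?_).trans
      (Nat.mul_le_mul_right _ (by simp [columns, hsubs]))
    obtain ⟨I', hI', rfl⟩ := List.mem_map.1 hcol
    have := hE.length_boxes_le hj (by omega)
      (hE.valid.mem_aligned_of_mem_alignedIn hj (by omega) hI hI')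
    gcongr
  have h5 := Nat.mul_le_mul_right (2 * L + 9) hg
  simp only [findBelow, bind_time, produce_time, produce_val, mapL_time, mapL_val, step_time,
    step_val, markL_time, Nat.add_sub_cancel, List.map_const', List.sum_replicate, smul_eq_mul,
    ← hsubs, ← hL]
  rw [show (subs.map fun I' => (E.data j).boxes I') = columns E j I from rfl]
  rw [show 2 * (L + 2) + 5 = 2 * L + 9 by omega] at h2
  rw [← h1]
  nlinarith

theorem WellFormed.denseFor_time_le (hE : E.WellFormed) {M : ℕ → ℕ} (hM : E.CallBound M)
    {j : ℕ} (hj : 1 ≤ j) (hk : j ≤ E.p.k) (hcc : CloseComplete E j)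
    (ht : ∀ l, 1 ≤ l → l ≤ j → E.GoodTests l) {i : ℕ} (hi : i ≤ E.p.a) :
    E.p.d j * (E.denseFor E.data j i).time ≤
      E.p.d j * ((17 + E.enumOverhead j) * E.sizeBound +
        ((aligned E.p.n (E.p.w j)).map fun I => E.testCost M j I i).sum) +
        2 * E.gridBound j * E.denseRoundBound M j := by
  have hH := hE.sizeBound_pos
  have hA := n_div_w_le_sizeBound (E := E) j
  have hG := hE.gridBound_le hj hk
  have hAG := hE.mul_gridBound_le hj hk hj hk
  have hg := hE.length_grid_le hj hk hi
  have hl := length_aligned E.p.n (E.p.w j)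
  rcases Nat.lt_or_ge (E.p.q j) i with h | h
  · have h1 := hE.denseLoop_time_le hM hj hk hcc ht hi h (aligned E.p.n (E.p.w j)).length
      (aligned E.p.n (E.p.w j)) (.refl _) (fun _ => false, fun _ => [])
    have h2 : ((aligned E.p.n (E.p.w j)).map fun I => 2 + (E.testSparse E.data j I i).time).sum ≤
        ((aligned E.p.n (E.p.w j)).map fun I =>
          (4 * E.gridBound j + 6 + E.enumOverhead j) + E.testCost M j I i).sum := by
      refine List.sum_map_le_sum_map' fun I hI => ?_
      have := hE.testSparse_time_le hM hj hk hI hi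
      omega
    simp only [List.sum_map_add (f := fun _ => 4 * E.gridBound j + 6 + E.enumOverhead j),
      List.map_const', List.sum_replicate, smul_eq_mul, hl] at h2
    have h3 := Nat.mul_le_mul_right (E.denseRoundBound M j)
      (Nat.mul_le_mul_left 2 (hE.numCovered_le hj hk hi (aligned E.p.n (E.p.w j))))
    have h4 : (E.denseFor E.data j i).time = 2 * (E.p.n / E.p.w j) + 2 +
        (E.denseLoop E.data j i (aligned E.p.n (E.p.w j)).length
      (aligned E.p.n (E.p.w j)) (fun _ => false, fun _ => [])).time := by
      simp only [denseFor, if_neg h.not_ge, bind_time, produce_time, produce_val, lengthL_time,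
        lengthL_val, hl]
      omega
    rw [h4, Nat.mul_add]
    refine (Nat.add_le_add_left (h1.trans (Nat.add_le_add_left h3 _)) _).trans ?_
    rw [← Nat.add_assoc, ← Nat.mul_add]
    refine Nat.add_le_add_right (Nat.mul_le_mul_left _ ?_) _
    have h5 : E.p.n / E.p.w j * (4 * E.gridBound j + 6 + E.enumOverhead j) ≤
        4 * E.sizeBound + 6 * E.sizeBound + E.enumOverhead j * E.sizeBound := by
      have := Nat.mul_le_mul_right (E.enumOverhead j) hA
      nlinarith
    rw [Nat.add_mul]
    omega
  · have h4 : (E.denseFor E.data j i).time ≤ 3 * (E.p.n / E.p.w j) + E.gridBound j + 3 := by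
      simp only [denseFor, if_pos h, bind_time, produce_time, produce_val, tabulate_time,
        pure_time, hl, List.map_const', List.sum_replicate, smul_eq_mul]
      omega
    refine (Nat.mul_le_mul_left _ ?_).trans (Nat.le_add_right _ _)
    rw [Nat.add_mul]
    omega

/-- Samples, pattern matches and boxes cost polylogarithmically many times `sizeBound`. For the
pattern matches this holds because the subintervals of all intervals of the new level are just the
intervals of the level below, so for each scale every box is treated only once. -/
theorem WellFormed.levels_succ_time_le (hE : E.WellFormed) {j : ℕ} (hk : j + 1 ≤ E.p.k) :
    (E.levels (j + 1)).time ≤ (E.levels j).time + 120 * Nat.log 2 E.p.n ^ 4 * E.sizeBound +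
      ((List.range (E.p.a + 1)).map fun i => (E.denseFor E.data (j + 1) i).time).sum := by
  have hH := hE.sizeBound_pos
  have hL := hE.valid.two_le_log
  have ha := hE.valid.a_add_one_le_log
  have hA := n_div_w_le_sizeBound (E := E) (j + 1)
  have hAG := hE.mul_gridBound_le (by omega) hk (by omega) hk
  have h0 := E.levels_succ_time_le hk
  rw [length_pairs, length_aligned] at h0
  generalize hLL : Nat.log 2 E.p.n = L at *
  have hpre : (if j = 0 then 0 else
        ((E.pairs (j + 1)).map fun Ii => 4 + (E.sparseSample E.data (j + 1) Ii.1 Ii.2).time +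
          (E.findBelow E.data (j + 1) Ii.1 Ii.2).time).sum) ≤ 84 * L ^ 4 * E.sizeBound := by
    split_ifs with hj
    · exact Nat.zero_le _
    have hj' : 1 ≤ j := by omega
    have hA' := n_div_w_le_sizeBound (E := E) j
    have hAG' := hE.mul_gridBound_le hj' (by omega) hj' (by omega)
    have hx : E.p.n / E.p.w (j + 1) * (E.p.w (j + 1) / E.p.w j) = E.p.n / E.p.w j := by
      refine Nat.eq_of_mul_eq_mul_right (hE.valid.w_pos hj' (by omega)) ?_
      rw [Nat.mul_assoc, Nat.div_mul_cancel (hE.valid.w_dvd_w_succ hj' (by omega)),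
        Nat.div_mul_cancel (hE.valid.w_dvd_n (by omega) (by omega)),
        Nat.div_mul_cancel (hE.valid.w_dvd_n (by omega) (by omega))]
    generalize hxx : E.p.w (j + 1) / E.p.w j = x at *
    generalize hAA : E.p.n / E.p.w (j + 1) = A at *
    generalize hAA' : E.p.n / E.p.w j = A' at *
    refine (List.sum_map_le_length_mul (c := 4 + (4 * x + 5) * (1 + 30 * L) +
      (7 + 6 * x + E.gridBound (j + 1) * (2 * L + 12) +
        x * ((E.p.a + 1) * (E.gridBound j * (L + 1)) * (2 * L + 9)))) fun Ii hIi => ?_).trans ?_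
    · obtain ⟨h1, h2⟩ := E.mem_pairs.1 (show (Ii.1, Ii.2) ∈ E.pairs (j + 1) from hIi)
      have e1 := hE.sparseSample_time_le (j + 1) Ii.1 Ii.2
      have e2 := hE.findBelow_time_le hj' hk h1 h2
      rw [Nat.add_sub_cancel, hxx, hLL] at e1
      rw [hxx, hLL] at e2
      omega
    · rw [length_pairs, hAA, Nat.mul_assoc]
      have e3 : A * (4 + (4 * x + 5) * (1 + 30 * L) +
          (7 + 6 * x + E.gridBound (j + 1) * (2 * L + 12) +
          x * ((E.p.a + 1) * (E.gridBound j * (L + 1)) * (2 * L + 9)))) =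
          11 * A + (4 * (A * x) + 5 * A) * (1 + 30 * L) + 6 * (A * x) +
          A * E.gridBound (j + 1) * (2 * L + 12) +
          (E.p.a + 1) * (A * x * E.gridBound j * (L + 1)) * (2 * L + 9) := by ring
      rw [e3, hx]
      calc _ ≤ L * (11 * E.sizeBound + (4 * E.sizeBound + 5 * E.sizeBound) * (1 + 30 * L) +
            6 * E.sizeBound + E.sizeBound * (2 * L + 12) +
            L * (E.sizeBound * (L + 1)) * (2 * L + 9)) := by gcongr
        _ = L * (38 + 281 * L + 11 * L ^ 2 + 2 * L ^ 3) * E.sizeBound := by ring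
        _ ≤ _ := by
          refine Nat.mul_le_mul_right _ ?_
          have f1 : 2 * L ≤ L ^ 2 := by nlinarith
          have f2 : 2 * L ^ 2 ≤ L ^ 3 := by nlinarith
          calc L * (38 + 281 * L + 11 * L ^ 2 + 2 * L ^ 3) ≤ L * (84 * L ^ 3) := by
                refine Nat.mul_le_mul_left _ ?_
                omega
            _ = _ := by ring
  have hdense : ((aligned E.p.n (E.p.w (j + 1))).map fun I => 3 + ((List.range (E.p.a + 1)).map
      fun i => 3 + (E.dense (j + 1) i I).length * (6 + 3 * Nat.log 2 (E.p.w (j + 1)))).sum).sum ≤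
      (3 + L * (9 + 3 * L)) * E.sizeBound := by
    have hw : Nat.log 2 (E.p.w (j + 1)) ≤ L :=
      hLL ▸ Nat.log_mono_right (hE.valid.w_le_n (by omega) (by omega))
    refine (List.sum_map_le_length_mul (c := 3 + (E.p.a + 1) *
      (3 + E.gridBound (j + 1) * (6 + 3 * L))) fun I _ => ?_).trans ?_
    · refine Nat.add_le_add_left ?_ _
      refine (List.sum_map_le_length_mul (c := 3 + E.gridBound (j + 1) * (6 + 3 * L))
        fun i hi => ?_).trans (by simp)
      have := hE.length_dense_le (by omega) hk (Nat.lt_succ_iff.1 (List.mem_range.1 hi)) I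
      gcongr
    · rw [length_aligned]
      calc E.p.n / E.p.w (j + 1) * (3 + (E.p.a + 1) * (3 + E.gridBound (j + 1) * (6 + 3 * L)))
          = 3 * (E.p.n / E.p.w (j + 1)) + (E.p.a + 1) * (3 * (E.p.n / E.p.w (j + 1)) +
            E.p.n / E.p.w (j + 1) * E.gridBound (j + 1) * (6 + 3 * L)) := by ring
        _ ≤ 3 * E.sizeBound + L * (3 * E.sizeBound + E.sizeBound * (6 + 3 * L)) := by gcongr
        _ = _ := by ring
  have hpairs : (E.p.a + 1) * (E.p.n / E.p.w (j + 1)) ≤ L * E.sizeBound := by gcongr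
  rw [List.sum_map_add (f := fun _ => 2), List.map_const', List.sum_replicate, List.length_range,
    smul_eq_mul] at h0
  have hf : 11 + E.p.a + (E.p.a + 1) * 2 ≤ (11 + 3 * L) * E.sizeBound := by
    refine le_trans ?_ (Nat.le_mul_of_pos_right _ hH)
    omega
  have hsum : (84 * L ^ 4 + (3 + L * (9 + 3 * L)) + L + (11 + 3 * L) + 1) * E.sizeBound ≤
      120 * L ^ 4 * E.sizeBound := by
    refine Nat.mul_le_mul_right _ ?_
    have f1 : 2 * L ≤ L ^ 2 := by nlinarith
    have f2 : 2 * L ^ 2 ≤ L ^ 3 := by nlinarith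
    have f3 : 2 * L ^ 3 ≤ L ^ 4 := by nlinarith
    have f4 : L * (9 + 3 * L) = 9 * L + 3 * L ^ 2 := by ring
    omega
  simp only [Nat.add_mul] at hsum hdense hf ⊢
  omega

/-- The time of the iterations on successful randomization. -/
theorem WellFormed.run_time_le (hE : E.WellFormed) :
    E.run.time ≤ (E.levels E.p.k).time + 40 * Nat.log 2 E.p.n ^ 4 * E.sizeBound := by
  have hH := hE.sizeBound_pos
  have hL := hE.valid.two_le_log
  have ha := hE.valid.a_add_one_le_log
  have hk := hE.valid.k_pos
  have hA := n_div_w_le_sizeBound (E := E) E.p.k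
  have hAG := hE.mul_gridBound_le hk le_rfl hk le_rfl
  set L := Nat.log 2 E.p.n with hLL
  set cols := (aligned E.p.n (E.p.w E.p.k)).map fun I => (E.data E.p.k).boxes I with hcols
  have h1 := apm_time_le (L + 2) E.p.n (E.p.w E.p.k) (eps ((E.p.a : ℤ) - E.p.q E.p.k - 5))
    cols [E.p.n]
  have h2 : (cols.map fun col => 3 + col.length * (2 * (L + 2) + 5)).sum ≤
      E.p.n / E.p.w E.p.k * (3 + (E.p.a + 1) * (E.gridBound E.p.k * (L + 1)) * (2 * L + 9)) := by
    refine (List.sum_map_le_length_mul (c := 3 + (E.p.a + 1) * (E.gridBound E.p.k * (L + 1)) *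
      (2 * L + 9)) fun col hcol => ?_).trans (Nat.mul_le_mul_right _ ?_)
    · obtain ⟨I, hI, rfl⟩ := List.mem_map.1 hcol
      have := hE.length_boxes_le hk le_rfl hI
      rw [show 2 * (L + 2) + 5 = 2 * L + 9 by omega]
      gcongr
    · simp [hcols, length_aligned]
  have h3 : E.run.time = (E.levels E.p.k).time + ((E.p.n / E.p.w E.p.k + 1) +
      ((1 + E.p.n / E.p.w E.p.k * 2) + ((apm (L + 2) E.p.n (E.p.w E.p.k)
        (eps ((E.p.a : ℤ) - E.p.q E.p.k - 5)) cols [E.p.n]).time + 1))) := by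
    simp only [run, bind_time, produce_time, produce_val, mapL_time, mapL_val, step_time, step_val,
      List.map_const', List.sum_replicate, smul_eq_mul, length_aligned]
    rfl
  have h4 : E.p.n / E.p.w E.p.k * (3 + (E.p.a + 1) * (E.gridBound E.p.k * (L + 1)) * (2 * L + 9)) ≤
      (3 + L * (L + 1) * (2 * L + 9)) * E.sizeBound := by
    calc _ = 3 * (E.p.n / E.p.w E.p.k) + (E.p.a + 1) *
          (E.p.n / E.p.w E.p.k * E.gridBound E.p.k * (L + 1)) * (2 * L + 9) := by ring
      _ ≤ 3 * E.sizeBound + L * (E.sizeBound * (L + 1)) * (2 * L + 9) := by gcongr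
      _ = _ := by ring
  have h5 : 15 + 2 * L ≤ (15 + 2 * L) * E.sizeBound := Nat.le_mul_of_pos_right _ hH
  have hsum : (3 + L * (L + 1) * (2 * L + 9) + (15 + 2 * L) + 3) * E.sizeBound ≤
      40 * L ^ 4 * E.sizeBound := by
    refine Nat.mul_le_mul_right _ ?_
    have f1 : 2 * L ≤ L ^ 2 := by nlinarith
    have f2 : 2 * L ^ 2 ≤ L ^ 3 := by nlinarith
    have f3 : 2 * L ^ 3 ≤ L ^ 4 := by nlinarith
    have f4 : L * (L + 1) * (2 * L + 9) = 9 * L + 11 * L ^ 2 + 2 * L ^ 3 := by ring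
    omega
  rw [h3]
  have h6 := h2.trans h4
  simp only [Nat.add_mul, List.length_singleton] at hsum h1 h6 h5 ⊢
  omega

end Env

/-! ## Counting probabilities -/

section Prob

variable {Ω X : Type*} [Fintype Ω] [Fintype X]

open Classical in
/-- The probability of an event under the uniform distribution. -/
noncomputable def prob (P : Ω → Prop) : ℝ :=
  ((Finset.univ.filter P).card : ℝ) / Fintype.card Ω

theorem prob_eq_card (P : Ω → Prop) [DecidablePred P] :
    prob P = ((Finset.univ.filter P).card : ℝ) / Fintype.card Ω := by
  unfold prob
  congr!

theorem prob_nonneg (P : Ω → Prop) : 0 ≤ prob P := by unfold prob; positivity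

theorem prob_mono {P Q : Ω → Prop} (h : ∀ ω, P ω → Q ω) : prob P ≤ prob Q := by
  classical
  rw [prob_eq_card, prob_eq_card]
  gcongr with ω _
  exact h ω

theorem prob_or_le (P Q : Ω → Prop) : prob (fun ω => P ω ∨ Q ω) ≤ prob P + prob Q := by
  classical
  rw [prob_eq_card, prob_eq_card, prob_eq_card, ← add_div, Finset.filter_or]
  gcongr
  exact_mod_cast Finset.card_union_le _ _

theorem prob_exists_le {ι : Type*} (s : Finset ι) (P : ι → Ω → Prop) {ρ : ℝ}
    (h : ∀ a ∈ s, prob (P a) ≤ ρ) : prob (fun ω => ∃ a ∈ s, P a ω) ≤ s.card * ρ := by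
  classical
  calc prob (fun ω => ∃ a ∈ s, P a ω) ≤ ∑ a ∈ s, prob (P a) := by
        simp only [prob_eq_card]
        rw [← Finset.sum_div]
        gcongr
        have : (Finset.univ.filter fun ω => ∃ a ∈ s, P a ω) =
            s.biUnion fun a => Finset.univ.filter (P a) := by
          ext ω; simp
        rw [this]
        exact_mod_cast Finset.card_biUnion_le
    _ ≤ s.card * ρ := by simpa using Finset.sum_le_card_nsmul s _ ρ h

theorem prob_not [Nonempty Ω] (P : Ω → Prop) : prob (fun ω => ¬P ω) = 1 - prob P := by
  classical
  rw [prob_eq_card, prob_eq_card]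
  have h := Finset.card_filter_add_card_filter_not (s := (Finset.univ : Finset Ω)) P
  have h0 : (Fintype.card Ω : ℝ) ≠ 0 := by exact_mod_cast Fintype.card_ne_zero
  rw [eq_sub_iff_add_eq, ← add_div, div_eq_one_iff_eq h0, ← Finset.card_univ, ← h]
  push_cast
  ring

theorem prob_eq_zero {P : Ω → Prop} (h : ∀ ω, ¬P ω) : prob P = 0 := by
  classical
  unfold prob
  simp [h]

theorem prob_eq_sum (P : Ω → Prop) [DecidablePred P] :
    prob P = (∑ ω, if P ω then (1 : ℝ) else 0) / Fintype.card Ω := by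
  unfold prob
  congr 1
  rw [Finset.sum_boole]
  congr!

theorem prob_forall (s : ℕ) (P : X → Prop) :
    prob (fun x : Fin s → X => ∀ t, P (x t)) = prob P ^ s := by
  classical
  rw [prob_eq_card, prob_eq_card, div_pow]
  congr 1
  · have : (Finset.univ.filter fun x : Fin s → X => ∀ t, P (x t)) =
        Fintype.piFinset fun _ => Finset.univ.filter P := by
      ext x; simp
    rw [this, Fintype.card_piFinset]
    simp
  · simp

end Prob

/-- A coordinate of the points of `Ω`, which can be changed independently of the other coordinates. -/
structure Lens (Ω X : Type*) where
  get : Ω → X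
  set : X → Ω → Ω
  get_set : ∀ x ω, get (set x ω) = x
  set_get : ∀ ω, set (get ω) ω = ω
  set_set : ∀ x y ω, set x (set y ω) = set x ω

namespace Lens

variable {Ω X Y : Type*}

def fst : Lens (X × Y) X := ⟨Prod.fst, fun x ω => (x, ω.2), fun _ _ => rfl, fun _ => rfl, fun _ _ _ => rfl⟩

def snd : Lens (X × Y) Y := ⟨Prod.snd, fun y ω => (ω.1, y), fun _ _ => rfl, fun _ => rfl, fun _ _ _ => rfl⟩

def eval {ι : Type*} [DecidableEq ι] {β : ι → Type*} (a : ι) : Lens ((a : ι) → β a) (β a) :=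
  ⟨fun f => f a, fun x f => Function.update f a x, fun _ _ => Function.update_self _ _ _,
    fun _ => Function.update_eq_self _ _, fun _ _ _ => Function.update_idem _ _ _⟩

def comp (l : Lens Ω X) (m : Lens X Y) : Lens Ω Y where
  get ω := m.get (l.get ω)
  set y ω := l.set (m.set y (l.get ω)) ω
  get_set y ω := by rw [l.get_set, m.get_set]
  set_get ω := by rw [m.set_get, l.set_get]
  set_set x y ω := by rw [l.get_set, m.set_set, l.set_set]

/-- The first `c` members of a sequence of length `b`. -/
def take {b c : ℕ} (h : c ≤ b) : Lens (Fin b → X) (Fin c → X) where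
  get f t := f (Fin.castLE h t)
  set x f t := if ht : t.val < c then x ⟨t, ht⟩ else f t
  get_set x f := by funext t; simp
  set_get f := by funext t; by_cases ht : t.val < c <;> simp [ht]
  set_set x y f := by funext t; by_cases ht : t.val < c <;> simp [ht]

variable [Fintype Ω] [Fintype X]

/-- Resampling a coordinate preserves the uniform distribution: exchanging the coordinate of ω with
x is an involution of Ω × X. -/
theorem card_mul_sum (l : Lens Ω X) (f : Ω → ℝ) :
    (Fintype.card X : ℝ) * ∑ ω, f ω = ∑ ω, ∑ x, f (l.set x ω) := by
  have h : ∑ p : Ω × X, f (l.set p.2 p.1) = ∑ p : Ω × X, f p.1 := by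
    refine Fintype.sum_equiv (⟨fun p => (l.set p.2 p.1, l.get p.1), fun p => (l.set p.2 p.1, l.get p.1),
      fun p => ?_, fun p => ?_⟩ : Ω × X ≃ Ω × X) _ _ fun p => rfl
    all_goals simp [l.get_set, l.set_get, l.set_set]
  rw [Fintype.sum_prod_type, Fintype.sum_prod_type] at h
  rw [h]
  simp [Finset.mul_sum]

omit [Fintype Ω] in
theorem card_pos [Nonempty Ω] (l : Lens Ω X) : 0 < Fintype.card X :=
  Fintype.card_pos_iff.2 ⟨l.get (Classical.arbitrary Ω)⟩

/-- The expectation does not exceed a bound for the conditional expectations. -/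
theorem sum_le [Nonempty Ω] (l : Lens Ω X) (f : Ω → ℝ) (g : Ω → ℝ)
    (h : ∀ ω, ∑ x, f (l.set x ω) ≤ Fintype.card X * g ω) : ∑ ω, f ω ≤ ∑ ω, g ω := by
  have h0 : (0 : ℝ) < Fintype.card X := by exact_mod_cast l.card_pos
  refine le_of_mul_le_mul_left ?_ h0
  rw [l.card_mul_sum, Finset.mul_sum]
  exact Finset.sum_le_sum fun ω _ => h ω

theorem prob_le [Nonempty Ω] (l : Lens Ω X) (P : Ω → Prop) {ρ : ℝ}
    (h : ∀ ω, prob (fun x => P (l.set x ω)) ≤ ρ) : prob P ≤ ρ := by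
  classical
  have h0 : (0 : ℝ) < Fintype.card X := by exact_mod_cast l.card_pos
  have h1 : (0 : ℝ) < Fintype.card Ω := by exact_mod_cast Fintype.card_pos
  rw [prob_eq_sum, div_le_iff₀ h1]
  refine (l.sum_le _ (fun _ => ρ) fun ω => ?_).trans (by simp [mul_comm])
  have := h ω
  rw [prob_eq_sum, div_le_iff₀ h0] at this
  linarith

end Lens

theorem prob_eval {ι : Type*} [DecidableEq ι] [Fintype ι] {β : ι → Type*} [∀ a, Fintype (β a)]
    [∀ a, Nonempty (β a)] (a : ι) (P : β a → Prop) :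
    prob (fun f : (a : ι) → β a => P (f a)) ≤ prob P := by
  refine (Lens.eval (β := β) a).prob_le _ fun ω => ?_
  simp [Lens.eval]

/-! ## Large deviations -/

section Chernoff

variable {ι : Type*} [Fintype ι] [DecidableEq ι] (C : Finset ι) (d thr : ℕ)

/-- The number of elements of `C` that are drawn. -/
def drawn (x : ι → Fin d) : ℕ := (C.filter fun J => (x J).val < thr).card

/-- The coordinates are independent, so the generating function factorizes; each element of C
contributes the factor 1 + (μ - 1) thr/d. -/
theorem sum_pow_drawn (hd : 0 < d) (ht : thr ≤ d) (μ : ℝ) :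
    ∑ x : ι → Fin d, μ ^ drawn C d thr x =
      Fintype.card (ι → Fin d) * (1 + (μ - 1) * (thr / d)) ^ C.card := by
  have hd' : (d : ℝ) ≠ 0 := by exact_mod_cast hd.ne'
  have h1 : ∀ x : ι → Fin d, μ ^ drawn C d thr x =
      ∏ J, if J ∈ C ∧ (x J).val < thr then μ else 1 := by
    intro x
    rw [Finset.prod_ite, Finset.prod_const, Finset.prod_const_one, mul_one, drawn]
    congr 2
    ext J; simp
  have h2 := Finset.sum_prod_piFinset (Finset.univ : Finset (Fin d))
    (fun (J : ι) (v : Fin d) => if J ∈ C ∧ v.val < thr then μ else 1)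
  rw [Fintype.piFinset_univ] at h2
  simp only [h1]
  rw [h2]
  have hcard : ((Finset.univ.filter fun v : Fin d => v.val < thr).card : ℝ) = thr := by
    rw [Fin.card_filter_val_lt, min_eq_right ht]
  have h3 : ∀ J, (∑ v : Fin d, if J ∈ C ∧ v.val < thr then μ else 1) =
      d * if J ∈ C then 1 + (μ - 1) * (thr / d) else 1 := by
    intro J
    by_cases hJ : J ∈ C
    · simp only [hJ, true_and, if_true]
      have : ∀ v : Fin d, (if v.val < thr then μ else 1) = 1 + if v.val < thr then (μ - 1) else 0 := by
        intro v; split_ifs <;> ring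
      simp only [this]
      rw [Finset.sum_add_distrib, ← Finset.sum_filter, Finset.sum_const, Finset.sum_const,
        nsmul_eq_mul, nsmul_eq_mul, hcard]
      simp
      field_simp
    · simp [hJ]
  simp only [h3]
  rw [Finset.prod_mul_distrib, Finset.prod_ite_mem, Finset.univ_inter, Finset.prod_const,
    Finset.prod_const]
  simp

/-- Markov's inequality for 2^drawn: the mean is at most exp(|C| thr/d) ≤ exp(1/2)^thr ≤ (5/3)^thr,
to be divided by 2^thr. -/
theorem prob_drawn_ge (hd : 0 < d) (ht : thr ≤ d) (hC : 2 * C.card ≤ d) :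
    prob (fun x : ι → Fin d => thr ≤ drawn C d thr x) ≤ (5 / 6 : ℝ) ^ thr := by
  classical
  have : NeZero d := ⟨hd.ne'⟩
  have hN : (0 : ℝ) < Fintype.card (ι → Fin d) := by exact_mod_cast Fintype.card_pos
  have hd' : (0 : ℝ) < d := by exact_mod_cast hd
  have h1 := sum_pow_drawn C d thr hd ht 2
  rw [prob_eq_sum, div_le_iff₀ hN]
  have h2 : (∑ x : ι → Fin d, if thr ≤ drawn C d thr x then (1 : ℝ) else 0) * 2 ^ thr ≤
      ∑ x : ι → Fin d, (2 : ℝ) ^ drawn C d thr x := by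
    rw [Finset.sum_mul]
    refine Finset.sum_le_sum fun x _ => ?_
    split_ifs with h
    · rw [one_mul]; exact pow_le_pow_right₀ (by norm_num) h
    · rw [zero_mul]; positivity
  have h3 : (1 + (2 - 1) * ((thr : ℝ) / d)) ^ C.card ≤ (5 / 3) ^ thr := by
    calc (1 + (2 - 1) * ((thr : ℝ) / d)) ^ C.card ≤ Real.exp ((thr : ℝ) / d) ^ C.card := by
          gcongr
          have := Real.add_one_le_exp ((thr : ℝ) / d)
          linarith
      _ = Real.exp (C.card * ((thr : ℝ) / d)) := (Real.exp_nat_mul _ _).symm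
      _ ≤ Real.exp (thr * (1 / 2)) := by
          rw [Real.exp_le_exp]
          have h4 : 2 * (C.card : ℝ) ≤ d := by exact_mod_cast hC
          rw [mul_div_assoc', div_le_iff₀ hd']
          nlinarith [(Nat.cast_nonneg thr : (0 : ℝ) ≤ thr)]
      _ = Real.exp (1 / 2) ^ thr := Real.exp_nat_mul _ _
      _ ≤ _ := by
          gcongr
          have h5 := Real.exp_one_lt_d9
          have h6 : Real.exp (1 / 2) ^ 2 = Real.exp 1 := by
            rw [← Real.exp_nat_mul]; norm_num
          nlinarith [Real.exp_pos (1 / 2)]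
  have h4 : (5 / 6 : ℝ) ^ thr * 2 ^ thr = (5 / 3) ^ thr := by
    rw [← mul_pow]; norm_num
  have h5 : (0 : ℝ) < 2 ^ thr := by positivity
  refine le_of_mul_le_mul_right ?_ h5
  calc _ ≤ Fintype.card (ι → Fin d) * (1 + (2 - 1) * ((thr : ℝ) / d)) ^ C.card := h2.trans h1.le
    _ ≤ Fintype.card (ι → Fin d) * (5 / 3) ^ thr := by gcongr
    _ = _ := by rw [← h4]; ring

/-- Markov's inequality for (1/2)^drawn: the mean is at most exp(-1)^thr ≤ (5/12)^thr, to be divided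
by (1/2)^thr. -/
theorem prob_drawn_lt (hd : 0 < d) (ht : thr ≤ d) (hC : 2 * d ≤ C.card) :
    prob (fun x : ι → Fin d => drawn C d thr x < thr) ≤ (5 / 6 : ℝ) ^ thr := by
  classical
  have : NeZero d := ⟨hd.ne'⟩
  have hN : (0 : ℝ) < Fintype.card (ι → Fin d) := by exact_mod_cast Fintype.card_pos
  have hd' : (0 : ℝ) < d := by exact_mod_cast hd
  have h1 := sum_pow_drawn C d thr hd ht (1 / 2)
  rw [prob_eq_sum, div_le_iff₀ hN]
  have h2 : (∑ x : ι → Fin d, if drawn C d thr x < thr then (1 : ℝ) else 0) * (1 / 2) ^ thr ≤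
      ∑ x : ι → Fin d, (1 / 2 : ℝ) ^ drawn C d thr x := by
    rw [Finset.sum_mul]
    refine Finset.sum_le_sum fun x _ => ?_
    split_ifs with h
    · rw [one_mul]; exact pow_le_pow_of_le_one (by norm_num) (by norm_num) h.le
    · rw [zero_mul]; positivity
  have ht' : (thr : ℝ) / d ≤ 1 := by
    rw [div_le_one hd']; exact_mod_cast ht
  have h3 : (1 + (1 / 2 - 1) * ((thr : ℝ) / d)) ^ C.card ≤ (5 / 12) ^ thr := by
    calc (1 + (1 / 2 - 1) * ((thr : ℝ) / d)) ^ C.card ≤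
          Real.exp (-(1 / 2) * ((thr : ℝ) / d)) ^ C.card := by
          refine pow_le_pow_left₀ (by linarith) ?_ _
          have := Real.add_one_le_exp (-(1 / 2) * ((thr : ℝ) / d))
          linarith
      _ = Real.exp (C.card * (-(1 / 2) * ((thr : ℝ) / d))) := (Real.exp_nat_mul _ _).symm
      _ ≤ Real.exp (thr * (-1)) := by
          rw [Real.exp_le_exp]
          have h4 : 2 * (d : ℝ) ≤ C.card := by exact_mod_cast hC
          have h5 : (d : ℝ) * (thr / d) = thr := by field_simp
          have h6 : (0 : ℝ) ≤ thr / d := by positivity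
          nlinarith
      _ = Real.exp (-1) ^ thr := Real.exp_nat_mul _ _
      _ ≤ _ := by
          gcongr
          have h5 := Real.exp_one_gt_d9
          rw [Real.exp_neg, inv_le_comm₀ (Real.exp_pos 1) (by norm_num)]
          linarith
  have h4 : (5 / 6 : ℝ) ^ thr * (1 / 2) ^ thr = (5 / 12) ^ thr := by
    rw [← mul_pow]; norm_num
  have h5 : (0 : ℝ) < (1 / 2) ^ thr := by positivity
  refine le_of_mul_le_mul_right ?_ h5
  calc _ ≤ Fintype.card (ι → Fin d) * (1 + (1 / 2 - 1) * ((thr : ℝ) / d)) ^ C.card :=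
        h2.trans h1.le
    _ ≤ Fintype.card (ι → Fin d) * (5 / 12) ^ thr := by gcongr
    _ = _ := by rw [← h4]; ring

end Chernoff

/-! ### The data of the levels as functions of the random coordinates -/

namespace Env

variable {σ : Type*} (p : Params) (A : GapAlg σ) (z : List σ) {ω ω' : Randomness}

theorem data_congr (hb : ω.bits = ω'.bits) {j : ℕ} (hj : j ≤ p.k)
    (hp : ∀ l, l ≤ j → ω.pick l = ω'.pick l) (hd : ∀ l, l ≤ j → ω.draw l = ω'.draw l)
    {l : ℕ} (hl : l ≤ j) : (⟨p, A, z, ω⟩ : Env σ).data l = (⟨p, A, z, ω'⟩ : Env σ).data l := by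
  rw [← lev_eq_data (⟨p, A, z, ω⟩ : Env σ) hl hj, ← lev_eq_data (⟨p, A, z, ω'⟩ : Env σ) hl hj, lev,
    lev, levels_congr p A z hb j (fun l _ h => hp l h) (fun l _ h => hd l h)]

/-- At level j itself the draws need not agree: they are read only by ProcessDense, when `below` and
`sample` of level j are complete. -/
theorem data_below_sample_congr (hb : ω.bits = ω'.bits) {j : ℕ} (hj : 1 ≤ j) (hjk : j ≤ p.k)
    (hp : ∀ l, l ≤ j → ω.pick l = ω'.pick l) (hd : ∀ l, l < j → ω.draw l = ω'.draw l)
    {l : ℕ} (hl : l ≤ j) :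
    ((⟨p, A, z, ω⟩ : Env σ).data l).below = ((⟨p, A, z, ω'⟩ : Env σ).data l).below ∧
    ((⟨p, A, z, ω⟩ : Env σ).data l).sample = ((⟨p, A, z, ω'⟩ : Env σ).data l).sample := by
  obtain ⟨j, rfl⟩ : ∃ l, j = l + 1 := ⟨j - 1, by omega⟩
  have h1 := stage_below_sample (⟨p, A, z, ω⟩ : Env σ) hl hjk
  have h2 := stage_below_sample (⟨p, A, z, ω'⟩ : Env σ) hl hjk
  rw [← h1.1, ← h1.2, ← h2.1, ← h2.2]
  have h3 : (⟨p, A, z, ω⟩ : Env σ).stage j = (⟨p, A, z, ω'⟩ : Env σ).stage j := by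
    rw [stage, stage, lev, lev, levels_congr p A z hb j (fun l _ h => hp l (by omega))
      (fun l _ h => hd l (by omega)), preprocess_congr p A z _ (hp (j + 1) le_rfl)]
  rw [h3]
  exact ⟨rfl, rfl⟩

end Env

namespace Outcome

variable {p : Params} {b : ℕ}

/-- The first bits. -/
def bitsLens {c : ℕ} (h : c ≤ b) : Lens (Outcome p b) (Fin c → Bool) := Lens.fst.comp (Lens.take h)

/-- The selections for the sample of `(j, I, i)`. -/
def pickLens (j : Fin (p.k + 1)) (I : Fin (p.n + 1)) (i : Fin (p.a + 1)) :
    Lens (Outcome p b) (Fin (30 * Nat.log 2 p.n) → (m : Fin p.n) → Fin (m.val + 1)) :=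
  (((Lens.snd.comp Lens.fst).comp (Lens.eval j)).comp (Lens.eval I)).comp (Lens.eval i)

/-- The numbers that determine the random set by which `I` is tested at level `j` for `i`. -/
def drawLens (j : Fin (p.k + 1)) (I : Fin (p.n + 1)) (i : Fin (p.a + 1)) :
    Lens (Outcome p b) (Fin (2 * p.n + 1) → Fin (p.d j)) :=
  (((Lens.snd.comp Lens.snd).comp (Lens.eval j)).comp (Lens.eval I)).comp (Lens.eval i)

theorem bits_set {c : ℕ} (h : c ≤ b) (r : Fin c → Bool) (ω : Outcome p b) (t : Fin c) :
    (toRandomness ((bitsLens h).set r ω)).bits t = r t := by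
  have : t.val < b := t.2.trans_le h
  simp [toRandomness, bitsLens, Lens.comp, Lens.fst, Lens.take, this]

section Pick

variable (j : Fin (p.k + 1)) (I : Fin (p.n + 1)) (i : Fin (p.a + 1))
  (x : Fin (30 * Nat.log 2 p.n) → (m : Fin p.n) → Fin (m.val + 1)) (ω : Outcome p b)

theorem bits_pickLens : (toRandomness ((pickLens j I i).set x ω)).bits = (toRandomness ω).bits := rfl

theorem draw_pickLens : (toRandomness ((pickLens j I i).set x ω)).draw = (toRandomness ω).draw := rfl

theorem pick_pickLens_of_ne {l : ℕ} (hl : l ≠ j) :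
    (toRandomness ((pickLens j I i).set x ω)).pick l = (toRandomness ω).pick l := by
  funext I' i' t m
  simp only [toRandomness]
  split_ifs with h
  · have : (⟨l, h.1.1⟩ : Fin (p.k + 1)) ≠ j := fun h' => hl (by rw [← h'])
    simp [pickLens, Lens.comp, Lens.fst, Lens.snd, Lens.eval, this]
  · rfl

theorem pick_pickLens {t m : ℕ} (ht : t < 30 * Nat.log 2 p.n) (hm : m - 1 < p.n) :
    (toRandomness ((pickLens j I i).set x ω)).pick j I i t m = (x ⟨t, ht⟩ ⟨m - 1, hm⟩).val := by
  have h : ((j : ℕ) < p.k + 1 ∧ (I : ℕ) < p.n + 1) ∧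
      ((i : ℕ) < p.a + 1 ∧ t < 30 * Nat.log 2 p.n) ∧ m - 1 < p.n := ⟨⟨j.2, I.2⟩, ⟨i.2, ht⟩, hm⟩
  simp only [toRandomness, dif_pos h]
  simp [pickLens, Lens.comp, Lens.fst, Lens.snd, Lens.eval]

end Pick

section Draw

variable (j : Fin (p.k + 1)) (I : Fin (p.n + 1)) (i : Fin (p.a + 1))
  (x : Fin (2 * p.n + 1) → Fin (p.d j)) (ω : Outcome p b)

theorem bits_drawLens : (toRandomness ((drawLens j I i).set x ω)).bits = (toRandomness ω).bits := rfl

theorem pick_drawLens : (toRandomness ((drawLens j I i).set x ω)).pick = (toRandomness ω).pick := rfl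

theorem draw_drawLens_of_ne {l : ℕ} (hl : l ≠ j) :
    (toRandomness ((drawLens j I i).set x ω)).draw l = (toRandomness ω).draw l := by
  funext I' i' J
  simp only [toRandomness]
  split_ifs with h
  · have : (⟨l, h.1.1⟩ : Fin (p.k + 1)) ≠ j := fun h' => hl (by rw [← h'])
    simp [drawLens, Lens.comp, Lens.snd, Lens.eval, this]
  · rfl

theorem draw_drawLens (J : Fin (2 * p.n + 1)) :
    (toRandomness ((drawLens j I i).set x ω)).draw j I i J = (x J).val := by
  have h : ((j : ℕ) < p.k + 1 ∧ (I : ℕ) < p.n + 1) ∧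
      (i : ℕ) < p.a + 1 ∧ (J : ℕ) < 2 * p.n + 1 := ⟨⟨j.2, I.2⟩, i.2, J.2⟩
  simp only [toRandomness, dif_pos h]
  simp [drawLens, Lens.comp, Lens.snd, Lens.eval]

end Draw

theorem pick_lt (ω : Outcome p b) (j I i t : ℕ) {m : ℕ} (hm : 0 < m) :
    (toRandomness ω).pick j I i t m < m := by
  simp only [toRandomness]
  split_ifs with h
  · have := (ω.2.1 ⟨j, h.1.1⟩ ⟨I, h.1.2⟩ ⟨i, h.2.1.1⟩ ⟨t, h.2.1.2⟩ ⟨m - 1, h.2.2⟩).2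
    simp only at this
    omega
  · exact hm

theorem nonempty (hp : p.Valid) : Nonempty (Outcome p b) :=
  ⟨(fun _ => false, fun _ _ _ _ _ => 0, fun j _ _ _ => ⟨0, hp.d_pos (by omega)⟩)⟩

end Outcome

/-! ### Failure probabilities of tests, calls and samples -/

section Failure

variable {σ : Type*} {p : Params} (hp : p.Valid) (A : GapAlg σ) (x y : List σ)

include hp

theorem Params.Valid.lt_of_mem_aligned {j I : ℕ} (hj : 1 ≤ j) (hk : j ≤ p.k)
    (hI : I ∈ aligned p.n (p.w j)) : I < p.n := by
  have := ((hp.mem_aligned_iff hj (by omega)).1 hI).2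
  have := hp.w_pos hj (by omega)
  omega

theorem Params.Valid.lt_of_mem_grid {j i J : ℕ} (hj : 1 ≤ j) (hk : j ≤ p.k)
    (hJ : J ∈ grid p.n (p.w j) i) : J < 2 * p.n := by
  have := ((hp.mem_grid_iff hj (by omega)).1 hJ).2
  have := hp.w_pos hj (by omega)
  omega

/-- The test of an interval is wrong with small probability. -/
theorem prob_test_fails_le {j : ℕ} (hj : 1 ≤ j) (hk : j ≤ p.k) {I i : ℕ}
    (hI : I ∈ aligned p.n (p.w j)) (hi : i ≤ p.a) :
    prob (fun ω => ¬((2 * ((mainEnv p A x y ω).enumerate (mainEnv p A x y ω).data j I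
        (grid p.n (p.w j) i) i).val.length < p.d j →
          ((mainEnv p A x y ω).testSparse (mainEnv p A x y ω).data j I i).val = true) ∧
      (2 * p.d j < ((mainEnv p A x y ω).enumerate (mainEnv p A x y ω).data j I
        (grid p.n (p.w j) i) i).val.length →
          ((mainEnv p A x y ω).testSparse (mainEnv p A x y ω).data j I i).val = false))) ≤
      2 * (5 / 6 : ℝ) ^ (p.c₀ * Nat.log 2 p.n) := by
  classical
  have := Outcome.nonempty (b := coinBound p A) hp
  have hIn := hp.lt_of_mem_aligned hj hk hI
  have hd := hp.d_pos hk
  set l := Outcome.drawLens (p := p) (b := coinBound p A) ⟨j, by omega⟩ ⟨I, by omega⟩ ⟨i, by omega⟩ with hl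
  refine l.prob_le _ fun ω => ?_
  set C : Finset (Fin (2 * p.n + 1)) := Finset.univ.filter fun J => J.val ∈ grid p.n (p.w j) i ∧
    (mainEnv p A x y ω).closeB (mainEnv p A x y ω).data j I J i = true with hC
  -- The verdicts at level j do not depend on the draws of level j, so C stays fixed while r varies.
  -- The answer for the random set is then the drawn part of C.
  have hclose : ∀ r J, (mainEnv p A x y (l.set r ω)).closeB (mainEnv p A x y (l.set r ω)).data j I J i
      = (mainEnv p A x y ω).closeB (mainEnv p A x y ω).data j I J i := fun r J =>
    Env.closeB_congr p A (x ++ y) (Outcome.bits_drawLens _ _ _ r ω) j (fun m _ hm =>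
      Env.data_below_sample_congr p A (x ++ y) (Outcome.bits_drawLens _ _ _ r ω) hj hk
        (fun m _ => congrFun (Outcome.pick_drawLens _ _ _ r ω) m)
        (fun m hm => Outcome.draw_drawLens_of_ne _ _ _ r ω (by simpa using hm.ne)) hm) I J i
  have hcard : ∀ q : ℕ → Prop, [DecidablePred q] → ((grid p.n (p.w j) i).filter fun J =>
      decide (q J) && (mainEnv p A x y ω).closeB (mainEnv p A x y ω).data j I J i).length =
      (C.filter fun J => q J.val).card := by
    intro q _
    rw [List.length_filter_eq_card (grid_nodup _ _ _), hC, Finset.filter_filter,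
      ← Finset.card_image_of_injective _ Fin.val_injective]
    congr 1
    ext J
    simp only [Finset.mem_filter, List.mem_toFinset, Finset.mem_image, Finset.mem_univ, true_and,
      Bool.and_eq_true, decide_eq_true_eq]
    constructor
    · rintro ⟨h1, h2, h3⟩
      have := hp.lt_of_mem_grid hj hk h1
      exact ⟨⟨J, by omega⟩, ⟨⟨h1, h3⟩, h2⟩, rfl⟩
    · rintro ⟨J, ⟨⟨h1, h3⟩, h2⟩, rfl⟩
      exact ⟨h1, h2, h3⟩
  have hN : ∀ r, ((mainEnv p A x y (l.set r ω)).enumerate (mainEnv p A x y (l.set r ω)).data j I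
      (grid p.n (p.w j) i) i).val.length = C.card := by
    intro r
    rw [Env.length_enumerate]
    simp only [hclose]
    have := hcard (fun _ => True)
    simpa using this
  have ht : ∀ r, ((mainEnv p A x y (l.set r ω)).testSparse (mainEnv p A x y (l.set r ω)).data j I
      i).val = decide (drawn C (p.d j) (p.threshold j) r < p.threshold j) := by
    intro r
    simp only [Env.testSparse, Env.drawSet, Timed.bind_val, Timed.produce_val, Timed.filterL_val,
      Timed.step_val, Timed.lengthL_val, Env.length_enumerate, hclose, List.filter_filter]
    have h1 : ((grid p.n (p.w j) i).filter fun J =>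
        (mainEnv p A x y ω).closeB (mainEnv p A x y ω).data j I J i &&
        decide ((mainEnv p A x y (l.set r ω)).ω.draw j I i J < p.threshold j)).length =
        drawn C (p.d j) (p.threshold j) r := by
      have h2 := hcard (fun J => (mainEnv p A x y (l.set r ω)).ω.draw j I i J < p.threshold j)
      simp only [Bool.and_comm (decide _)] at h2
      rw [h2, drawn]
      congr 1
      ext J
      simp only [Finset.mem_filter, and_congr_right_iff]
      intro _
      exact iff_of_eq (congrArg (· < p.threshold j) (Outcome.draw_drawLens (p := p) (b := coinBound p A)
        ⟨j, by omega⟩ ⟨I, by omega⟩ ⟨i, by omega⟩ r ω J))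
    exact congrArg (fun m => decide (m < p.threshold j)) h1
  have h1 : prob (fun r : Fin (2 * p.n + 1) → Fin (p.d j) => 2 * C.card < p.d j ∧
      p.threshold j ≤ drawn C (p.d j) (p.threshold j) r) ≤
      (5 / 6 : ℝ) ^ (p.c₀ * Nat.log 2 p.n) := by
    by_cases hc : 2 * C.card < p.d j
    -- If the sampling rate is 1, all candidates are drawn and the test makes no error.
    · rcases le_total (p.d j) (p.c₀ * Nat.log 2 p.n) with h | h
      · rw [prob_eq_zero]
        · positivity
        · rintro r ⟨_, h2⟩
          rw [Params.threshold, min_eq_left h] at h2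
          have : drawn C (p.d j) (p.d j) r ≤ C.card := Finset.card_filter_le _ _
          omega
      · rw [Params.threshold, min_eq_right h]
        exact (prob_mono fun r h => h.2).trans (prob_drawn_ge C (p.d j) _ hd h hc.le)
    · rw [prob_eq_zero fun r h => hc h.1]
      positivity
  have h2 : prob (fun r : Fin (2 * p.n + 1) → Fin (p.d j) => 2 * p.d j < C.card ∧
      drawn C (p.d j) (p.threshold j) r < p.threshold j) ≤
      (5 / 6 : ℝ) ^ (p.c₀ * Nat.log 2 p.n) := by
    by_cases hc : 2 * p.d j < C.card
    · rcases le_total (p.d j) (p.c₀ * Nat.log 2 p.n) with h | h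
      · rw [prob_eq_zero]
        · positivity
        · rintro r ⟨_, h2⟩
          rw [Params.threshold, min_eq_left h] at h2
          have : drawn C (p.d j) (p.d j) r = C.card := by
            rw [drawn, Finset.filter_true_of_mem fun J _ => (r J).2]
          omega
      · rw [Params.threshold, min_eq_right h]
        exact (prob_mono fun r h => h.2).trans (prob_drawn_lt C (p.d j) _ hd h hc.le)
    · rw [prob_eq_zero fun r h => hc h.1]
      positivity
  refine (prob_mono fun r h => ?_).trans ((prob_or_le _ _).trans ((add_le_add h1 h2).trans
    (by rw [two_mul])))
  rw [hN, ht] at h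
  by_contra h3
  refine h ⟨fun h4 => ?_, fun h4 => ?_⟩
  · by_contra h5
    exact h3 (.inl ⟨h4, by simpa using h5⟩)
  · by_contra h5
    exact h3 (.inr ⟨h4, by simpa using h5⟩)

/-- A call of the slow algorithm fails with small probability. -/
theorem prob_call_fails_le {Q : ℝ} {j : ℕ} (hj : 1 ≤ j) (hk : j ≤ p.k) {i : ℕ} (hi : i ≤ p.a)
    (hQ : A.HasQuality Q (p.w j) i (((p.n : ℚ) ^ 12)⁻¹)) {I J : ℕ}
    (hI : (substr (x ++ y) (p.w j) I).length = p.w j)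
    (hJ : (substr (x ++ y) (p.w j) J).length = p.w j) :
    prob (fun ω => ¬((editDist (substr (x ++ y) (p.w j) I) (substr (x ++ y) (p.w j) J) : ℚ) ≤
      eps i * p.w j → ((mainEnv p A x y ω).callED j I J i).val = true)) ≤ ((p.n : ℝ) ^ 12)⁻¹ := by
  classical
  have := Outcome.nonempty (b := coinBound p A) hp
  have hc : A.coins (p.w j) i (((p.n : ℚ) ^ 12)⁻¹) ≤ coinBound p A :=
    Finset.le_sup (f := fun ji : ℕ × ℕ => A.coins (p.w ji.1) ji.2 (((p.n : ℚ) ^ 12)⁻¹))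
      (b := (j, i)) (by simp; omega)
  set l := Outcome.bitsLens (p := p) hc with hl
  refine l.prob_le _ fun ω => ?_
  by_cases hed : (editDist (substr (x ++ y) (p.w j) I) (substr (x ++ y) (p.w j) J) : ℚ) ≤
      eps i * p.w j
  · have h1 := (hQ _ _ hI hJ).2 (by
      rw [eps_natCast] at hed
      have : ((editDist (substr (x ++ y) (p.w j) I) (substr (x ++ y) (p.w j) J) : ℚ) : ℝ) ≤
        ((1 / 2 ^ i * p.w j : ℚ) : ℝ) := by exact_mod_cast hed
      push_cast at this
      rwa [one_div_pow])
    have h2 : ∀ r, ((mainEnv p A x y (l.set r ω)).callED j I J i).val =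
        (A.run (p.w j) i (((p.n : ℚ) ^ 12)⁻¹) (substr (x ++ y) (p.w j) I)
          (substr (x ++ y) (p.w j) J) r).val := by
      intro r
      have h3 : (fun t : Fin (A.coins (p.w j) i (((p.n : ℚ) ^ 12)⁻¹)) =>
          (mainEnv p A x y (l.set r ω)).ω.bits t) = r :=
        funext fun t => Outcome.bits_set hc r ω t
      simp only [Env.callED, Timed.bind_val]
      exact congrArg (fun r => (A.run (p.w j) i (((p.n : ℚ) ^ 12)⁻¹)
        (substr (x ++ y) (p.w j) I) (substr (x ++ y) (p.w j) J) r).val) h3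
    simp only [hed, true_imp_iff, h2]
    rw [prob_not, prob_eq_card]
    have h3 : (0 : ℝ) < Fintype.card (Fin (A.coins (p.w j) i (((p.n : ℚ) ^ 12)⁻¹)) → Bool) := by
      exact_mod_cast Fintype.card_pos
    rw [sub_le_comm, le_div_iff₀ h3]
    push_cast at h1
    exact h1
  · rw [prob_eq_zero]
    · positivity
    · intro r h; exact h fun h => absurd h hed

/-- A sample fails with small probability. -/
theorem prob_sample_fails_le {j : ℕ} (hj : 2 ≤ j) (hk : j ≤ p.k) {I i i' J : ℕ}
    (hI : I ∈ aligned p.n (p.w j)) (hi : i ≤ p.a) (hi' : i' ≤ i) :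
    prob (fun ω => ¬(((mainEnv p A x y ω).sparseIn j I i').Nonempty →
      ((mainEnv p A x y ω).sparseIn j I i').card ≤
        3 * ((mainEnv p A x y ω).winners j I J i i').card →
      ∃ I' ∈ ((mainEnv p A x y ω).data j).sample (I, i'),
        I' ∈ (mainEnv p A x y ω).winners j I J i i')) ≤ (2 / 3 : ℝ) ^ (30 * Nat.log 2 p.n) := by
  classical
  have := Outcome.nonempty (b := coinBound p A) hp
  have hIn := hp.lt_of_mem_aligned (by omega) hk hI
  set l := Outcome.pickLens (p := p) (b := coinBound p A) ⟨j, by omega⟩ ⟨I, by omega⟩ ⟨i', by omega⟩ with hl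
  refine l.prob_le _ fun ω => ?_
  set W := (mainEnv p A x y ω).winners j I J i i' with hW
  set sp := (alignedIn (p.w j) (p.w (j - 1)) I).filter fun I' =>
    ((mainEnv p A x y ω).data (j - 1)).sparse i' I' with hsp
  -- The sparse intervals and the verdicts of level j - 1 are fixed before the selections of level j
  -- are made.
  have hdata : ∀ r, ∀ m ≤ j - 1, (mainEnv p A x y (l.set r ω)).data m = (mainEnv p A x y ω).data m :=
    fun r m hm => Env.data_congr p A (x ++ y) (Outcome.bits_pickLens _ _ _ r ω) (j := j - 1) (by omega)
      (fun m hm => Outcome.pick_pickLens_of_ne _ _ _ r ω (by simp only; omega))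
      (fun m _ => congrFun (Outcome.draw_pickLens _ _ _ r ω) m) hm
  have hsparse : ∀ r, (mainEnv p A x y (l.set r ω)).sparseIn j I i' =
      (mainEnv p A x y ω).sparseIn j I i' := by
    intro r
    simp only [Env.sparseIn, hdata r (j - 1) le_rfl]
    rfl
  have hclose : ∀ r I' J', (mainEnv p A x y (l.set r ω)).Close (j - 1) I' J' i' ↔
      (mainEnv p A x y ω).Close (j - 1) I' J' i' := by
    intro r I' J'
    rw [Env.Close, Env.Close]
    refine iff_of_eq (congrArg (fun t : Timed (List ℕ) => J' ∈ t.val) ?_)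
    exact Env.enumerate_congr p A (x ++ y) (Outcome.bits_pickLens _ _ _ r ω) (j - 1)
      (fun m _ hm => by
        have := hdata r m hm
        exact ⟨congrArg Level.below this, congrArg Level.sample this⟩) I' [J'] i'
  have hwin : ∀ r, (mainEnv p A x y (l.set r ω)).winners j I J i i' = W := by
    intro r
    rw [hW, Env.winners, Env.winners, hsparse r]
    refine Finset.filter_congr fun I' _ => ?_
    simp only [hclose]
    rfl
  have hnd : sp.Nodup := by
    refine List.Nodup.filter _ ?_
    rw [alignedIn]
    refine List.Nodup.map (fun a b h => ?_) List.nodup_range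
    exact Nat.eq_of_mul_eq_mul_right (hp.w_pos (j := j - 1) (by omega) (by omega))
      (Nat.add_left_cancel h)
  have hspf : (mainEnv p A x y ω).sparseIn j I i' = sp.toFinset := by
    rw [hsp, List.toFinset_filter]; rfl
  have hcard : ((mainEnv p A x y ω).sparseIn j I i').card = sp.length := by
    rw [hspf, List.toFinset_card_of_nodup hnd]
  by_cases hne : ((mainEnv p A x y ω).sparseIn j I i').Nonempty ∧
      ((mainEnv p A x y ω).sparseIn j I i').card ≤ 3 * W.card
  swap
  · rw [prob_eq_zero]
    · positivity
    · intro r h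
      rw [hsparse, hwin] at h
      exact h fun h1 h2 => absurd ⟨h1, h2⟩ hne
  obtain ⟨hne, h3⟩ := hne
  have hm : 0 < sp.length := by rw [← hcard]; exact hne.card_pos
  have hmn : sp.length - 1 < p.n := by
    have h4 : sp.length ≤ p.w j / p.w (j - 1) :=
      (List.length_filter_le _ _).trans (by simp [alignedIn])
    have h5 := Nat.div_le_self (p.w j) (p.w (j - 1))
    have h6 := hp.w_le_n (j := j) (by omega) (by omega)
    omega
  have hsample : ∀ r, ((mainEnv p A x y (l.set r ω)).data j).sample (I, i') =
      (List.range (30 * Nat.log 2 p.n)).map fun t =>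
        sp.getD ((mainEnv p A x y (l.set r ω)).ω.pick j I i' t sp.length) 0 := by
    intro r
    rw [Env.data_sample _ hj hk, if_pos ((Env.mem_pairs _).2 ⟨hI, by
      change i' ≤ p.a; omega⟩), Env.sparseSample_val, hdata r (j - 1) le_rfl, if_neg]
    · rfl
    · exact hm.ne'
  -- An outcome holds a separate number for each possible size of the set to select from. Since that
  -- size is already determined, the coordinate that is read is uniform below `sp.length`.
  have h4 : prob (fun v : Fin (sp.length - 1 + 1) => sp.getD v.val 0 ∉ W) ≤ 2 / 3 := by
    rw [prob_eq_card, Fintype.card_fin]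
    have h5 : (Finset.univ.filter fun v : Fin (sp.length - 1 + 1) => sp.getD v.val 0 ∉ W).card ≤
        (sp.toFinset \ W).card := by
      refine Finset.card_le_card_of_injOn (fun v => sp.getD v.val 0) (fun v hv => ?_)
        (fun u _ v _ huv => ?_)
      · have hv' : v.val < sp.length := by omega
        rw [Finset.coe_filter] at hv
        simp only [Finset.coe_sdiff, Set.mem_sdiff, Finset.mem_coe, List.mem_toFinset]
        refine ⟨?_, hv.2⟩
        rw [List.getD_eq_getElem _ _ hv']
        exact List.getElem_mem hv'
      · have hu' : u.val < sp.length := by omega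
        have hv' : v.val < sp.length := by omega
        simp only [List.getD_eq_getElem _ _ hu', List.getD_eq_getElem _ _ hv'] at huv
        exact Fin.ext ((List.Nodup.getElem_inj_iff hnd).1 huv)
    have h6 : W ⊆ sp.toFinset := by
      rw [← hspf, hW, Env.winners]; exact Finset.filter_subset _ _
    rw [Finset.card_sdiff_of_subset h6, List.toFinset_card_of_nodup hnd] at h5
    rw [div_le_div_iff₀ (by positivity) (by norm_num)]
    rw [hcard] at h3
    norm_cast
    omega
  calc _ ≤ prob (fun r : Fin (30 * Nat.log 2 p.n) → (m : Fin p.n) → Fin (m.val + 1) =>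
        ∀ t, sp.getD (r t ⟨sp.length - 1, hmn⟩).val 0 ∉ W) := by
        refine prob_mono fun r h t hW => h fun _ _ => ?_
        rw [hsample, hwin]
        refine ⟨_, List.mem_map_of_mem (List.mem_range.2 t.2), ?_⟩
        have := Outcome.pick_pickLens (p := p) (b := coinBound p A) ⟨j, by omega⟩ ⟨I, by omega⟩
          ⟨i', by omega⟩ r ω t.2 hmn
        simp only at this
        rw [show (mainEnv p A x y (l.set r ω)).ω.pick j I i' t sp.length = _ from this]
        exact hW
    _ = prob (fun y : (m : Fin p.n) → Fin (m.val + 1) =>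
        sp.getD (y ⟨sp.length - 1, hmn⟩).val 0 ∉ W) ^ (30 * Nat.log 2 p.n) := by
        rw [← prob_forall]
    _ ≤ _ := by
        gcongr
        · exact prob_nonneg _
        · exact (prob_eval (β := fun m : Fin p.n => Fin (m.val + 1)) ⟨sp.length - 1, hmn⟩
            (fun v => sp.getD v.val 0 ∉ W)).trans h4

end Failure

/-! ### Probability of success, and the expected cost of the tests -/

section Success

variable {σ : Type*} {p : Params} (hp : p.Valid) (A : GapAlg σ) (x y : List σ)

include hp

theorem Params.Valid.le_w {j : ℕ} (hj : 1 ≤ j) (hk : j ≤ p.k + 1) : j ≤ p.w j := by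
  induction j, hj using Nat.le_induction with
  | base => exact hp.w_pos le_rfl hk
  | succ j hj ih => exact Nat.succ_le_of_lt ((ih (by omega)).trans_lt (hp.w_lt j hj (by omega)))

theorem Params.Valid.k_le_n : p.k ≤ p.n := by
  have := hp.le_w (j := p.k + 1) (by omega) le_rfl
  rw [hp.w_last] at this
  omega

theorem Params.Valid.a_add_one_le_n : p.a + 1 ≤ p.n :=
  hp.a_add_one_le_log.trans (Nat.log_le_self 2 _)

/-- As n is a power of two, (2^m) to the power log n is exactly n^m, without loss from rounding the
logarithm. -/
theorem Params.Valid.pow_log_eq {c : ℝ} {m : ℕ} (h0 : 0 ≤ c) (h : c ≤ ((2 : ℝ) ^ m)⁻¹) :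
    c ^ Nat.log 2 p.n ≤ ((p.n : ℝ) ^ m)⁻¹ := by
  obtain ⟨s, hs⟩ := hp.n_pow
  rw [hs, Nat.log_pow (by norm_num)]
  calc c ^ s ≤ (((2 : ℝ) ^ m)⁻¹) ^ s := by gcongr
    _ = _ := by
      push_cast
      rw [inv_pow, ← pow_mul, ← pow_mul, mul_comm]

/-- The randomization is successful with probability at least one half. -/
theorem prob_not_success_le {Q : ℝ} (hc : 40 ≤ p.c₀) (hx : x.length = p.n) (hy : y.length = p.n)
    (hQ : ∀ j, 1 ≤ j → j ≤ p.k → ∀ i ≤ p.a, A.HasQuality Q (p.w j) i (((p.n : ℚ) ^ 12)⁻¹)) :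
    prob (fun ω => ¬(mainEnv p A x y ω).Success) ≤ 1 / 2 := by
  classical
  have hk := hp.k_le_n
  have ha := hp.a_add_one_le_n
  have hn : (4 : ℝ) ≤ p.n := by exact_mod_cast hp.four_le_n
  have hn0 : (0 : ℝ) < p.n := by linarith
  have hk' : (p.k : ℝ) ≤ p.n := by exact_mod_cast hk
  have ha' : (p.a : ℝ) + 1 ≤ p.n := by exact_mod_cast ha
  have h1 := prob_exists_le (Ω := Outcome p (coinBound p A))
    (Finset.Icc 1 p.k ×ˢ Finset.range (p.a + 1) ×ˢ Finset.range p.n ×ˢ Finset.range (2 * p.n))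
    (fun t ω => t.2.2.1 ∈ aligned p.n (p.w t.1) ∧ t.2.2.2 ∈ grid p.n (p.w t.1) t.2.1 ∧
      ¬((editDist (substr (x ++ y) (p.w t.1) t.2.2.1) (substr (x ++ y) (p.w t.1) t.2.2.2) : ℚ) ≤
        eps t.2.1 * p.w t.1 → ((mainEnv p A x y ω).callED t.1 t.2.2.1 t.2.2.2 t.2.1).val = true))
    (ρ := ((p.n : ℝ) ^ 12)⁻¹) (by
      rintro ⟨j, i, I, J⟩ ht
      simp only [Finset.mem_product, Finset.mem_Icc, Finset.mem_range] at ht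
      obtain ⟨⟨hj, hjk⟩, hi, _, _⟩ := ht
      by_cases hIJ : I ∈ aligned p.n (p.w j) ∧ J ∈ grid p.n (p.w j) i
      · have e1 := ((hp.mem_aligned_iff hj (by omega)).1 hIJ.1).2
        have e2 := ((hp.mem_grid_iff hj (by omega)).1 hIJ.2).2
        exact (prob_mono fun ω h => h.2.2).trans (prob_call_fails_le hp A x y hj hjk (by omega)
          (hQ j hj hjk i (by omega)) (length_substr (by simp; omega)) (length_substr (by simp; omega)))
      · rw [prob_eq_zero fun ω h => hIJ ⟨h.1, h.2.1⟩]
        positivity)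
  have h2 := prob_exists_le (Ω := Outcome p (coinBound p A))
    (Finset.Icc 1 p.k ×ˢ Finset.range (p.a + 1) ×ˢ Finset.range p.n ×ˢ Finset.range (2 * p.n) ×ˢ
      Finset.range (p.a + 1))
    (fun t ω => 2 ≤ t.1 ∧ t.2.2.1 ∈ aligned p.n (p.w t.1) ∧ t.2.2.2.2 ≤ t.2.1 ∧
      ¬(((mainEnv p A x y ω).sparseIn t.1 t.2.2.1 t.2.2.2.2).Nonempty →
      ((mainEnv p A x y ω).sparseIn t.1 t.2.2.1 t.2.2.2.2).card ≤
        3 * ((mainEnv p A x y ω).winners t.1 t.2.2.1 t.2.2.2.1 t.2.1 t.2.2.2.2).card →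
      ∃ I' ∈ ((mainEnv p A x y ω).data t.1).sample (t.2.2.1, t.2.2.2.2),
        I' ∈ (mainEnv p A x y ω).winners t.1 t.2.2.1 t.2.2.2.1 t.2.1 t.2.2.2.2))
    (ρ := (2 / 3 : ℝ) ^ (30 * Nat.log 2 p.n)) (by
      rintro ⟨j, i, I, J, i'⟩ ht
      simp only [Finset.mem_product, Finset.mem_Icc, Finset.mem_range] at ht
      obtain ⟨⟨_, hjk⟩, hi, _, _⟩ := ht
      by_cases hIJ : 2 ≤ j ∧ I ∈ aligned p.n (p.w j) ∧ i' ≤ i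
      · exact (prob_mono fun ω h => h.2.2.2).trans (prob_sample_fails_le hp A x y hIJ.1 hjk hIJ.2.1
          (Nat.lt_succ_iff.1 hi) hIJ.2.2)
      · rw [prob_eq_zero fun ω h => hIJ ⟨h.1, h.2.1, h.2.2.1⟩]
        positivity)
  have h3 := prob_exists_le (Ω := Outcome p (coinBound p A))
    (Finset.Icc 1 p.k ×ˢ Finset.range (p.a + 1) ×ˢ Finset.range p.n)
    (fun t ω => t.2.2 ∈ aligned p.n (p.w t.1) ∧
      ¬((2 * ((mainEnv p A x y ω).enumerate (mainEnv p A x y ω).data t.1 t.2.2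
        (grid p.n (p.w t.1) t.2.1) t.2.1).val.length < p.d t.1 →
          ((mainEnv p A x y ω).testSparse (mainEnv p A x y ω).data t.1 t.2.2 t.2.1).val = true) ∧
      (2 * p.d t.1 < ((mainEnv p A x y ω).enumerate (mainEnv p A x y ω).data t.1 t.2.2
        (grid p.n (p.w t.1) t.2.1) t.2.1).val.length →
          ((mainEnv p A x y ω).testSparse (mainEnv p A x y ω).data t.1 t.2.2 t.2.1).val = false)))
    (ρ := 2 * (5 / 6 : ℝ) ^ (p.c₀ * Nat.log 2 p.n)) (by
      rintro ⟨j, i, I⟩ ht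
      simp only [Finset.mem_product, Finset.mem_Icc, Finset.mem_range] at ht
      obtain ⟨⟨hj, hjk⟩, hi, _⟩ := ht
      by_cases hI : I ∈ aligned p.n (p.w j)
      · exact (prob_mono fun ω h => h.2).trans (prob_test_fails_le hp A x y hj hjk hI
          (Nat.lt_succ_iff.1 hi))
      · rw [prob_eq_zero fun ω h => hI h.1]
        positivity)
  simp only [Finset.card_product, Nat.card_Icc, Finset.card_range, Nat.add_sub_cancel] at h1 h2 h3
  push_cast at h1 h2 h3
  -- (2/3)^30 is below 2^(-17).
  have e2 : (2 / 3 : ℝ) ^ (30 * Nat.log 2 p.n) ≤ ((p.n : ℝ) ^ 17)⁻¹ := by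
    rw [pow_mul]
    exact hp.pow_log_eq (by positivity) (by norm_num)
  -- (5/6)^40 is below 2^(-10); this is where the bound 40 for the sampling constant is used.
  have e3 : (5 / 6 : ℝ) ^ (p.c₀ * Nat.log 2 p.n) ≤ ((p.n : ℝ) ^ 10)⁻¹ := by
    rw [pow_mul]
    refine hp.pow_log_eq (by positivity) ?_
    exact (pow_le_pow_of_le_one (by norm_num) (by norm_num) hc).trans (by norm_num)
  -- The three unions run over at most 2 n^4, 2 n^5 and n^3 events, as k and a + 1 are at most n.
  -- With n ≥ 4 each contributes at most 1/8.
  have f1 : (p.k : ℝ) * ((p.a + 1) * (p.n * (2 * p.n))) * ((p.n : ℝ) ^ 12)⁻¹ ≤ 1 / 8 := by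
    calc _ ≤ (p.n : ℝ) * (p.n * (p.n * (2 * p.n))) * ((p.n : ℝ) ^ 12)⁻¹ := by gcongr
      _ = 2 * ((p.n : ℝ) ^ 8)⁻¹ := by field_simp
      _ ≤ 2 * ((4 : ℝ) ^ 8)⁻¹ := by gcongr
      _ ≤ _ := by norm_num
  have f2 : (p.k : ℝ) * ((p.a + 1) * (p.n * (2 * p.n * (p.a + 1)))) *
      (2 / 3 : ℝ) ^ (30 * Nat.log 2 p.n) ≤ 1 / 8 := by
    calc _ ≤ (p.n : ℝ) * (p.n * (p.n * (2 * p.n * p.n))) * ((p.n : ℝ) ^ 17)⁻¹ := by gcongr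
      _ = 2 * ((p.n : ℝ) ^ 12)⁻¹ := by field_simp
      _ ≤ 2 * ((4 : ℝ) ^ 12)⁻¹ := by gcongr
      _ ≤ _ := by norm_num
  have f3 : (p.k : ℝ) * ((p.a + 1) * p.n) * (2 * (5 / 6 : ℝ) ^ (p.c₀ * Nat.log 2 p.n)) ≤ 1 / 8 := by
    calc _ ≤ (p.n : ℝ) * (p.n * p.n) * (2 * ((p.n : ℝ) ^ 10)⁻¹) := by gcongr
      _ = 2 * ((p.n : ℝ) ^ 7)⁻¹ := by field_simp
      _ ≤ 2 * ((4 : ℝ) ^ 7)⁻¹ := by gcongr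
      _ ≤ _ := by norm_num
  refine ((prob_mono fun ω h => ?_).trans ((prob_or_le _ _).trans (add_le_add h1
    ((prob_or_le _ _).trans (add_le_add h2 h3))))).trans (by linarith)
  by_contra hno
  rw [not_or, not_or] at hno
  obtain ⟨n1, n2, n3⟩ := hno
  refine h ⟨fun j hj hjk i hi I hI J hJ => ?_, fun j hj hjk I hI i hi J hJ i' hi' => ?_,
    fun j hj hjk I hI i hq hi => ?_⟩
  · by_contra hcon
    refine n1 ⟨(j, i, I, J), ?_, hI, hJ, hcon⟩
    have := hp.lt_of_mem_aligned hj hjk hI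
    have := hp.lt_of_mem_grid hj hjk hJ
    have hi' : i ≤ p.a := hi
    have hjk' : j ≤ p.k := hjk
    simp only [Finset.mem_product, Finset.mem_Icc, Finset.mem_range]
    omega
  · by_contra hcon
    refine n2 ⟨(j, i, I, J, i'), ?_, hj, hI, hi', hcon⟩
    have := hp.lt_of_mem_aligned (by omega) hjk hI
    have := hp.lt_of_mem_grid (by omega) hjk hJ
    have hi'' : i ≤ p.a := hi
    have hjk' : j ≤ p.k := hjk
    simp only [Finset.mem_product, Finset.mem_Icc, Finset.mem_range]
    omega
  · by_contra hcon
    refine n3 ⟨(j, i, I), ?_, hI, hcon⟩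
    have := hp.lt_of_mem_aligned hj hjk hI
    have hi' : i ≤ p.a := hi
    have hjk' : j ≤ p.k := hjk
    simp only [Finset.mem_product, Finset.mem_Icc, Finset.mem_range]
    omega

theorem card_le_two_mul_card_successSet {Q : ℝ} (hc : 40 ≤ p.c₀) (hx : x.length = p.n)
    (hy : y.length = p.n)
    (hQ : ∀ j, 1 ≤ j → j ≤ p.k → ∀ i ≤ p.a, A.HasQuality Q (p.w j) i (((p.n : ℚ) ^ 12)⁻¹)) :
    (Fintype.card (Outcome p (coinBound p A)) : ℝ) ≤ 2 * (successSet p A x y).card := by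
  classical
  have := Outcome.nonempty (b := coinBound p A) hp
  have h := prob_not_success_le hp A x y hc hx hy hQ
  have h0 : (0 : ℝ) < Fintype.card (Outcome p (coinBound p A)) := by exact_mod_cast Fintype.card_pos
  have h1 : prob (fun ω => (mainEnv p A x y ω).Success) =
      ((successSet p A x y).card : ℝ) / Fintype.card (Outcome p (coinBound p A)) := rfl
  rw [prob_not, h1, sub_le_comm, le_div_iff₀ h0] at h
  linarith

/-- The expected cost of the candidates that are drawn for the test of an interval. -/
theorem sum_testCost_le (hE : ∀ ω, (mainEnv p A x y ω).WellFormed) (M : ℕ → ℕ) {F : ℕ} {j : ℕ}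
    (hj : 1 ≤ j) (hk : j ≤ p.k)
    (hF : ∀ ω, (mainEnv p A x y ω).stackBound M j = F) {I i : ℕ} (hI : I ∈ aligned p.n (p.w j))
    (hi : i ≤ p.a) :
    ∑ ω ∈ successSet p A x y, ((mainEnv p A x y ω).testCost M j I i : ℝ) ≤
      Fintype.card (Outcome p (coinBound p A)) * (p.threshold j / p.d j * F) := by
  classical
  have := Outcome.nonempty (b := coinBound p A) hp
  have hIn := hp.lt_of_mem_aligned hj hk hI
  have hd := hp.d_pos hk
  have hd' : (0 : ℝ) < p.d j := by exact_mod_cast hd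
  have : NeZero (p.d j) := ⟨hd.ne'⟩
  set l := Outcome.drawLens (p := p) (b := coinBound p A) ⟨j, by omega⟩ ⟨I, by omega⟩ ⟨i, by omega⟩
    with hl
  set c : Outcome p (coinBound p A) → ℕ → ℕ := fun ω J =>
    (mainEnv p A x y ω).cost (mainEnv p A x y ω).data M j I J i with hc
  set S := (grid p.n (p.w j) i).toFinset with hS
  -- Success correlates the draws with the costs, so the costs are truncated: f agrees with c on
  -- successful outcomes, where the total is at most F, and has total at most F on all outcomes. The
  -- sum can then be extended to all outcomes, over which the draws are independent of f.
  set f : Outcome p (coinBound p A) → ℕ → ℕ := fun ω J =>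
    if ∑ J ∈ S, c ω J ≤ F then c ω J else 0 with hf
  have hcset : ∀ r ω J, c (l.set r ω) J = c ω J := fun r ω J =>
    Env.cost_congr p A (x ++ y) (Outcome.bits_drawLens _ _ _ r ω) M j (fun m _ hm =>
      Env.data_below_sample_congr p A (x ++ y) (Outcome.bits_drawLens _ _ _ r ω) hj hk
        (fun m _ => congrFun (Outcome.pick_drawLens _ _ _ r ω) m)
        (fun m hm => Outcome.draw_drawLens_of_ne _ _ _ r ω (by simpa using hm.ne)) hm) I J i
  have hfset : ∀ r ω J, f (l.set r ω) J = f ω J := by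
    intro r ω J
    simp only [hf, hcset]
  have h1 : ∀ ω ∈ successSet p A x y, ((mainEnv p A x y ω).testCost M j I i : ℝ) =
      ∑ J ∈ S, if (mainEnv p A x y ω).ω.draw j I i J < p.threshold j then (f ω J : ℝ) else 0 := by
    intro ω hω
    have hsucc : (mainEnv p A x y ω).Success := (Finset.mem_filter.1 hω).2
    have h2 := (hE ω).sum_cost_grid_le M hj hk (fun l h1 h2 => hsucc.2.2 l h1 (by
      change l ≤ p.k; omega)) hI hi
    rw [hF, List.sum_map_eq_sum_toFinset (grid_nodup _ _ _)] at h2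
    rw [Env.testCost, List.sum_map_eq_sum_toFinset (grid_nodup _ _ _)]
    push_cast
    refine Finset.sum_congr rfl fun J _ => ?_
    have h3 : f ω J = c ω J := if_pos h2
    rw [h3]
    rfl
  have h2 : ∀ J ∈ S, ∑ ω, (if (mainEnv p A x y ω).ω.draw j I i J < p.threshold j then (f ω J : ℝ)
      else 0) ≤ ∑ ω, p.threshold j / p.d j * (f ω J : ℝ) := by
    intro J hJ
    have hJn := hp.lt_of_mem_grid hj hk (List.mem_toFinset.1 hJ)
    refine l.sum_le _ _ fun ω => ?_
    have h3 : ∀ r, (mainEnv p A x y (l.set r ω)).ω.draw j I i J =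
        (r ⟨J, by omega⟩).val := fun r =>
      Outcome.draw_drawLens (p := p) (b := coinBound p A) ⟨j, by omega⟩ ⟨I, by omega⟩ ⟨i, by omega⟩
        r ω ⟨J, by omega⟩
    simp only [h3, hfset]
    have h4 := prob_eval (β := fun _ : Fin (2 * p.n + 1) => Fin (p.d j)) ⟨J, by omega⟩
      (fun v => v.val < p.threshold j)
    have h5 : prob (fun v : Fin (p.d j) => v.val < p.threshold j) =
        (p.threshold j : ℝ) / p.d j := by
      rw [prob_eq_card, Fin.card_filter_val_lt, Fintype.card_fin, min_eq_right]
      exact min_le_left _ _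
    have h6 : (0 : ℝ) < Fintype.card (Fin (2 * p.n + 1) → Fin (p.d j)) := by
      exact_mod_cast Fintype.card_pos
    rw [h5, prob_eq_sum, div_le_iff₀ h6] at h4
    calc _ = (∑ r : Fin (2 * p.n + 1) → Fin (p.d j),
          if (r ⟨J, by omega⟩).val < p.threshold j then (1 : ℝ) else 0) * f ω J := by
          rw [Finset.sum_mul]
          refine Finset.sum_congr rfl fun r _ => ?_
          split_ifs <;> simp
      _ ≤ _ := by
          refine (mul_le_mul_of_nonneg_right h4 (by positivity)).trans (le_of_eq ?_)
          ring
  have h3 : ∀ ω, ∑ J ∈ S, (f ω J : ℝ) ≤ F := by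
    intro ω
    have : ∑ J ∈ S, f ω J ≤ F := by
      simp only [hf]
      by_cases h : ∑ J ∈ S, c ω J ≤ F
      · simp only [h, if_true]
      · simp only [h, if_false, Finset.sum_const_zero]
        exact Nat.zero_le _
    exact_mod_cast this
  rw [Finset.sum_congr rfl h1]
  calc _ ≤ ∑ ω, ∑ J ∈ S, (if (mainEnv p A x y ω).ω.draw j I i J < p.threshold j then (f ω J : ℝ)
        else 0) := by
        refine Finset.sum_le_sum_of_subset_of_nonneg (Finset.subset_univ _) fun ω _ _ => ?_
        refine Finset.sum_nonneg fun J _ => ?_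
        split_ifs <;> positivity
    _ = ∑ J ∈ S, ∑ ω, (if (mainEnv p A x y ω).ω.draw j I i J < p.threshold j then (f ω J : ℝ)
        else 0) := Finset.sum_comm
    _ ≤ ∑ J ∈ S, ∑ ω, p.threshold j / p.d j * (f ω J : ℝ) := Finset.sum_le_sum h2
    _ = ∑ ω, p.threshold j / p.d j * ∑ J ∈ S, (f ω J : ℝ) := by
        rw [Finset.sum_comm]
        simp only [Finset.mul_sum]
    _ ≤ ∑ _ω : Outcome p (coinBound p A), p.threshold j / p.d j * (F : ℝ) :=
        Finset.sum_le_sum fun ω _ => mul_le_mul_of_nonneg_left (h3 ω) (by positivity)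
    _ = _ := by rw [Finset.sum_const, nsmul_eq_mul, Finset.card_univ]

end Success

/-! ### Estimates up to polylogarithmic factors -/

namespace Env

/-- By the assumption on G all terms linear in G are covered by the summand h = 1 of the sum. One
step of the recursion multiplies the bound by at most 12000 P; the largest constant to be covered is
347 · 32 = 11104. -/
theorem costBound_le {G P B : ℕ} {M d : ℕ → ℕ} (hP : 1 ≤ P) (hB : 1 ≤ B) (hM : ∀ h, 1 ≤ M h)
    (hG : G ≤ 32 * B * d 0) {j : ℕ} (hj : 1 ≤ j) :
    costBound G P M d j ≤ (12000 * P) ^ j * (B * ∑ h ∈ Finset.Icc 1 j, d (h - 1) * M h) := by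
  have hV : ∀ j, 1 ≤ j → d 0 ≤ ∑ h ∈ Finset.Icc 1 j, d (h - 1) * M h := by
    intro j hj
    calc d 0 ≤ d (1 - 1) * M 1 := Nat.le_mul_of_pos_right _ (hM 1)
      _ ≤ _ := Finset.single_le_sum (f := fun h => d (h - 1) * M h) (fun _ _ => Nat.zero_le _)
        (Finset.mem_Icc.2 ⟨le_rfl, hj⟩)
  induction j, hj using Nat.le_induction with
  | base =>
    have h1 := hM 1
    simp only [costBound, Finset.Icc_self, Finset.sum_singleton, Nat.sub_self, pow_one]
    calc G * (M 1 + 1) ≤ 32 * B * d 0 * (2 * M 1) := by gcongr; omega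
      _ = 64 * 1 * (B * (d 0 * M 1)) := by ring
      _ ≤ 12000 * P * (B * (d 0 * M 1)) := by gcongr; norm_num
  | succ j hj ih =>
    obtain ⟨l, rfl⟩ : ∃ l, j = l + 1 := ⟨j - 1, by omega⟩
    rw [Finset.sum_Icc_succ_top (by omega), Nat.add_sub_cancel]
    have h2 := hV (l + 1) (by omega)
    set V := ∑ h ∈ Finset.Icc 1 (l + 1), d (h - 1) * M h with hVdef
    set X := (12000 * P) ^ (l + 1) with hX
    have hX1 : 12000 ≤ X := by
      calc 12000 ≤ 12000 * P := by omega
        _ = (12000 * P) ^ 1 := (pow_one _).symm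
        _ ≤ X := Nat.pow_le_pow_right (by omega) (by omega)
    set Y := d (l + 1) * M (l + 2) with hY
    change 7 * G + P * (340 * G + 33 * costBound G P M d (l + 1) + 66 * Y) ≤
      (12000 * P) ^ (l + 1 + 1) * (B * (V + Y))
    have h3 : G ≤ 32 * (B * V) := by
      calc G ≤ 32 * B * d 0 := hG
        _ ≤ 32 * B * V := by gcongr
        _ = _ := by ring
    have h4 : Y ≤ B * Y := Nat.le_mul_of_pos_left _ hB
    calc 7 * G + P * (340 * G + 33 * costBound G P M d (l + 1) + 66 * Y)
        ≤ P * (7 * G) + P * (340 * G + 33 * costBound G P M d (l + 1) + 66 * Y) :=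
          Nat.add_le_add_right (Nat.le_mul_of_pos_left _ hP) _
      _ = P * (347 * G + 33 * costBound G P M d (l + 1) + 66 * Y) := by ring
      _ ≤ P * (347 * (32 * (B * V)) + 33 * (X * (B * V)) + 66 * (B * Y)) := by gcongr
      _ ≤ P * (X * (B * V) + 33 * (X * (B * V)) + X * (B * Y)) := by
          have e1 : 347 * (32 * (B * V)) ≤ X * (B * V) := by
            calc 347 * (32 * (B * V)) = 11104 * (B * V) := by ring
              _ ≤ X * (B * V) := Nat.mul_le_mul_right _ (by omega)
          have e2 : 66 * (B * Y) ≤ X * (B * Y) := Nat.mul_le_mul_right _ (by omega)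
          exact Nat.mul_le_mul_left _ (by omega)
      _ ≤ 12000 * P * X * (B * (V + Y)) := by
          have : X * (B * V) + 33 * (X * (B * V)) + X * (B * Y) ≤ 12000 * (X * (B * (V + Y))) := by
            rw [Nat.mul_add B, Nat.mul_add X]; omega
          calc _ ≤ P * (12000 * (X * (B * (V + Y)))) := by gcongr
            _ = _ := by ring
      _ = _ := by rw [pow_succ (12000 * P) (l + 1), ← hX]; ring

theorem overhead_le {a L : ℕ} (ha : a + 1 ≤ L) (hL : 2 ≤ L) (j : ℕ) :
    overhead a (30 * L) j ≤ (500 * L ^ 2) ^ j := by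
  induction j using Nat.strong_induction_on with
  | _ j ih =>
    match j, ih with
    | 0, _ => simp [overhead]
    | 1, _ => simp [overhead]; nlinarith
    | j + 2, ih =>
      have h1 := ih (j + 1) (by omega)
      set X := (500 * L ^ 2) ^ (j + 1) with hX
      have hX1 : 1 ≤ X := Nat.one_le_pow _ _ (by positivity)
      have h2 : 2 * L ≤ L ^ 2 := by nlinarith
      calc overhead a (30 * L) (j + 2) = 6 + (a + 1) * (3 + 30 * L * (5 + overhead a (30 * L) (j + 1))) :=
            rfl
        _ ≤ 6 + L * (3 + 30 * L * (5 + X)) := by gcongr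
        _ ≤ 6 * X + L * (3 * X + 30 * L * (5 * X + X)) := by gcongr <;> omega
        _ = (6 + 3 * L + 180 * L ^ 2) * X := by ring
        _ ≤ 500 * L ^ 2 * X := by gcongr; omega
        _ = _ := by rw [pow_succ (500 * L ^ 2) (j + 1), ← hX]; ring

variable {σ : Type*} {E : Env σ}

/-- The polylogarithmic factor in the cost of Enumerate. -/
def polylog (p : Params) : ℕ := (360000 * Nat.log 2 p.n ^ 2) ^ p.k

/-- The main term of the running time of Enumerate, where `M h` bounds the time of the calls of the slow
algorithm at level `h`. -/
def mainTerm (p : Params) (M : ℕ → ℕ) (j : ℕ) : ℕ := ∑ h ∈ Finset.Icc 1 j, p.d (h - 1) * M h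

theorem _root_.Params.Valid.thirtytwo_le_polylog {p : Params} (hp : p.Valid) : 32 ≤ polylog p := by
  have hL := hp.two_le_log
  have hk := hp.k_pos
  calc 32 ≤ 360000 * Nat.log 2 p.n ^ 2 := by nlinarith
    _ = (360000 * Nat.log 2 p.n ^ 2) ^ 1 := (pow_one _).symm
    _ ≤ _ := Nat.pow_le_pow_right (by positivity) hk

theorem _root_.Params.Valid.d_zero_le_mainTerm {p : Params} {M : ℕ → ℕ}
    (hM : ∀ h, 1 ≤ M h) {j : ℕ} (hj : 1 ≤ j) : p.d 0 ≤ mainTerm p M j :=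
  calc p.d 0 ≤ p.d (1 - 1) * M 1 := Nat.le_mul_of_pos_right _ (hM 1)
    _ ≤ _ := Finset.single_le_sum (f := fun h => p.d (h - 1) * M h) (fun _ _ => Nat.zero_le _)
      (Finset.mem_Icc.2 ⟨le_rfl, hj⟩)

theorem WellFormed.gridBound_one_le (hE : E.WellFormed) :
    E.gridBound 1 ≤ 32 * 2 ^ E.p.a * E.p.d 0 := by
  have := hE.valid.n_div_w_le (j := 1) le_rfl (by omega)
  calc _ ≤ 16 * 2 ^ E.p.a * (2 * E.p.d 0) := Nat.mul_le_mul_left _ this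
    _ = _ := by ring

theorem WellFormed.stackBound_le (hE : E.WellFormed) {M : ℕ → ℕ} (hM : ∀ h, 1 ≤ M h) {j : ℕ}
    (hj : 1 ≤ j) (hk : j ≤ E.p.k) :
    E.stackBound M j ≤ polylog E.p * (2 ^ E.p.a * mainTerm E.p M j) := by
  have hL := hE.valid.two_le_log
  have ha := hE.valid.a_add_one_le_log
  refine (costBound_le (Nat.mul_pos (by omega) (by omega)) Nat.one_le_two_pow hM
    hE.gridBound_one_le hj).trans (Nat.mul_le_mul_right _ ?_)
  have h1 : 12000 * ((E.p.a + 1) * (30 * Nat.log 2 E.p.n)) ≤ 360000 * Nat.log 2 E.p.n ^ 2 := by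
    calc _ ≤ 12000 * (Nat.log 2 E.p.n * (30 * Nat.log 2 E.p.n)) := by gcongr
      _ = _ := by ring
  exact (Nat.pow_le_pow_left h1 j).trans (Nat.pow_le_pow_right (by positivity) hk)

theorem WellFormed.enumOverhead_le (hE : E.WellFormed) {j : ℕ} (hk : j ≤ E.p.k) :
    E.enumOverhead j ≤ polylog E.p := by
  have hL := hE.valid.two_le_log
  refine (overhead_le hE.valid.a_add_one_le_log hL j).trans ?_
  exact (Nat.pow_le_pow_left (Nat.mul_le_mul_right _ (by norm_num)) j).trans
    (Nat.pow_le_pow_right (by positivity) hk)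

theorem WellFormed.denseRoundBound_le (hE : E.WellFormed) {M : ℕ → ℕ} (hM : ∀ h, 1 ≤ M h) {j : ℕ}
    (hj : 1 ≤ j) (hk : j ≤ E.p.k) :
    E.denseRoundBound M j ≤ 25 * (polylog E.p * (2 ^ E.p.a * mainTerm E.p M j)) := by
  have h1 := hE.stackBound_le hM hj hk
  have h2 := hE.enumOverhead_le hk
  have h3 := hE.valid.thirtytwo_le_polylog
  have h4 := Params.Valid.d_zero_le_mainTerm (p := E.p) hM hj
  have h5 := hE.valid.d_pos (j := 0) (by omega)
  have h6 : 1 ≤ 2 ^ E.p.a * mainTerm E.p M j := Nat.mul_pos (by positivity) (by omega)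
  have h7 : polylog E.p ≤ polylog E.p * (2 ^ E.p.a * mainTerm E.p M j) :=
    Nat.le_mul_of_pos_right _ h6
  have h8 : E.gridBound j ≤ polylog E.p * (2 ^ E.p.a * mainTerm E.p M j) := by
    calc E.gridBound j ≤ 32 * 2 ^ E.p.a * E.p.d 0 :=
          (hE.gridBound_le_one hj hk).trans hE.gridBound_one_le
      _ = 32 * (2 ^ E.p.a * E.p.d 0) := by ring
      _ ≤ _ := by gcongr
  have h9 : E.p.n / E.p.w j ≤ E.gridBound j := Nat.le_mul_of_pos_left _ (by positivity)
  rw [denseRoundBound]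
  omega

theorem WellFormed.levels_time_le (hE : E.WellFormed) {j : ℕ} (hk : j ≤ E.p.k) :
    (E.levels j).time ≤ 1 + ∑ l ∈ Finset.Icc 1 j, (120 * Nat.log 2 E.p.n ^ 4 * E.sizeBound +
      ∑ i ∈ Finset.range (E.p.a + 1), (E.denseFor E.data l i).time) := by
  induction j with
  | zero => simp [levels]
  | succ j ih =>
    have h1 := ih (by omega)
    have h2 := hE.levels_succ_time_le hk
    rw [Finset.sum_Icc_succ_top (by omega)]
    rw [← List.sum_toFinset _ List.nodup_range, List.toFinset_range] at h2
    omega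

/-- The running time on successful randomization. -/
theorem WellFormed.run_time_le_real (hE : E.WellFormed) (hS : E.Success) {M : ℕ → ℕ}
    (hM : E.CallBound M) (hM1 : ∀ h, 1 ≤ M h) :
    (E.run.time : ℝ) ≤ 1 + 40 * Nat.log 2 E.p.n ^ 4 * E.sizeBound +
      ∑ j ∈ Finset.Icc 1 E.p.k, (120 * Nat.log 2 E.p.n ^ 4 * E.sizeBound +
        Nat.log 2 E.p.n * (18 * polylog E.p * E.sizeBound) +
        800 * Nat.log 2 E.p.n * polylog E.p *
          (E.p.n * 4 ^ E.p.a / (E.p.w j * E.p.d j) * mainTerm E.p M j) +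
        ∑ i ∈ Finset.range (E.p.a + 1), ∑ I ∈ (aligned E.p.n (E.p.w j)).toFinset,
          (E.testCost M j I i : ℝ)) := by
  have h1 := hE.run_time_le
  have h2 := hE.levels_time_le le_rfl
  have h3 : (E.run.time : ℝ) ≤ 1 + 40 * Nat.log 2 E.p.n ^ 4 * E.sizeBound +
      ∑ l ∈ Finset.Icc 1 E.p.k, (120 * Nat.log 2 E.p.n ^ 4 * E.sizeBound +
      ∑ i ∈ Finset.range (E.p.a + 1), ((E.denseFor E.data l i).time : ℝ)) := by
    have : E.run.time ≤ 1 + 40 * Nat.log 2 E.p.n ^ 4 * E.sizeBound +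
      ∑ l ∈ Finset.Icc 1 E.p.k, (120 * Nat.log 2 E.p.n ^ 4 * E.sizeBound +
      ∑ i ∈ Finset.range (E.p.a + 1), (E.denseFor E.data l i).time) := by omega
    exact_mod_cast this
  refine h3.trans (add_le_add_right (Finset.sum_le_sum fun j hj => ?_) _)
  obtain ⟨hj, hk⟩ := Finset.mem_Icc.1 hj
  have hcc := hE.closeComplete hS hj hk
  have hd : (0 : ℝ) < E.p.d j := by exact_mod_cast hE.valid.d_pos hk
  have hw : (0 : ℝ) < E.p.w j := by exact_mod_cast hE.valid.w_pos hj (by omega)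
  have ha : (E.p.a : ℝ) + 1 ≤ Nat.log 2 E.p.n := by exact_mod_cast hE.valid.a_add_one_le_log
  have hdiv : ((E.p.n / E.p.w j : ℕ) : ℝ) ≤ E.p.n / E.p.w j := Nat.cast_div_le
  have h4 : ∀ i ∈ Finset.range (E.p.a + 1), ((E.denseFor E.data j i).time : ℝ) ≤
      (18 * polylog E.p * E.sizeBound + 800 * polylog E.p *
          (E.p.n * 4 ^ E.p.a / (E.p.w j * E.p.d j) * mainTerm E.p M j)) +
      ∑ I ∈ (aligned E.p.n (E.p.w j)).toFinset, (E.testCost M j I i : ℝ) := by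
    intro i hi
    have h5 := hE.denseFor_time_le hM hj hk hcc (fun l h1 h2 => hS.2.2 l h1 (by omega))
      (Nat.lt_succ_iff.1 (Finset.mem_range.1 hi))
    rw [← List.sum_toFinset _ (aligned_nodup (hE.valid.w_pos hj (by omega)))] at h5
    have h6 : 17 + E.enumOverhead j ≤ 18 * polylog E.p := by
      have := hE.enumOverhead_le hk
      have := hE.valid.thirtytwo_le_polylog
      omega
    have h7 := hE.denseRoundBound_le hM1 hj hk
    have h8 : E.p.d j * (E.denseFor E.data j i).time ≤ E.p.d j * (18 * polylog E.p * E.sizeBound +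
        ∑ I ∈ (aligned E.p.n (E.p.w j)).toFinset, E.testCost M j I i) + 2 * E.gridBound j *
          (25 * (polylog E.p * (2 ^ E.p.a * mainTerm E.p M j))) := by
      refine h5.trans ?_
      gcongr
    have h9 : (E.p.d j : ℝ) * (E.denseFor E.data j i).time ≤
        E.p.d j * (18 * polylog E.p * E.sizeBound +
        ∑ I ∈ (aligned E.p.n (E.p.w j)).toFinset, (E.testCost M j I i : ℝ)) +
          2 * (16 * 2 ^ E.p.a * ((E.p.n / E.p.w j : ℕ) : ℝ)) *
          (25 * (polylog E.p * (2 ^ E.p.a * mainTerm E.p M j))) := by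
      rw [gridBound] at h8
      exact_mod_cast h8
    -- Division by d_j turns the amortized term into 2 · 16 · 25 = 800 times n 4^a / (w_j d_j): one
    -- factor 2^a counts the candidates for an interval, the other comes from the cost of a round.
    refine le_of_mul_le_mul_left (h9.trans ?_) hd
    calc _ ≤ E.p.d j * (18 * polylog E.p * E.sizeBound +
        ∑ I ∈ (aligned E.p.n (E.p.w j)).toFinset, (E.testCost M j I i : ℝ)) +
          2 * (16 * 2 ^ E.p.a * ((E.p.n : ℝ) / E.p.w j)) *
          (25 * (polylog E.p * (2 ^ E.p.a * mainTerm E.p M j))) := by gcongr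
      _ = _ := by
          have : (4 : ℝ) ^ E.p.a = 2 ^ E.p.a * 2 ^ E.p.a := by rw [← mul_pow]; norm_num
          rw [this]
          field_simp
          ring
  have h10 := Finset.sum_le_sum h4
  rw [Finset.sum_add_distrib, Finset.sum_const, Finset.card_range, nsmul_eq_mul] at h10
  have h11 : ((E.p.a + 1 : ℕ) : ℝ) * (18 * polylog E.p * E.sizeBound + 800 * polylog E.p *
          (E.p.n * 4 ^ E.p.a / (E.p.w j * E.p.d j) * mainTerm E.p M j)) ≤
      Nat.log 2 E.p.n * (18 * polylog E.p * E.sizeBound + 800 * polylog E.p *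
          (E.p.n * 4 ^ E.p.a / (E.p.w j * E.p.d j) * mainTerm E.p M j)) := by
    gcongr
    exact hE.valid.a_add_one_le_log
  linarith

end Env

/-! ### Averaging over the successful outcomes -/

open Env (polylog mainTerm)

/-- In the bound `run_time_le_real` only the test costs vary with the outcome. Their sum over the
successful outcomes is controlled by the number of all outcomes, at most twice the number of
successful ones; this factor is the price of conditioning. -/
theorem condExpTime_le {σ : Type*} {p : Params} (hp : p.Valid) (A : GapAlg σ) (x y : List σ)
    (hx : x.length = p.n) (hy : y.length = p.n) (hE : ∀ ω, (mainEnv p A x y ω).WellFormed)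
    {M : ℕ → ℕ} (hM : ∀ ω, (mainEnv p A x y ω).CallBound M) (hM1 : ∀ h, 1 ≤ M h)
    (hS : (Fintype.card (Outcome p (coinBound p A)) : ℝ) ≤ 2 * (successSet p A x y).card)
    (hne : (successSet p A x y).Nonempty) :
    condExpTime p A x y ≤ 4 * (p.n : ℝ) + 40 * (Nat.log 2 p.n : ℝ) ^ 4 * (32 * 2 ^ p.a * (p.n : ℝ)) +
      ∑ j ∈ Finset.Icc 1 p.k, (120 * (Nat.log 2 p.n : ℝ) ^ 4 * (32 * 2 ^ p.a * (p.n : ℝ)) +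
        (Nat.log 2 p.n : ℝ) * (18 * (polylog p : ℝ) * (32 * 2 ^ p.a * (p.n : ℝ))) +
        (800 * (Nat.log 2 p.n : ℝ) + 2 * (p.c₀ : ℝ) * (Nat.log 2 p.n : ℝ) ^ 2) * (polylog p : ℝ) *
          ((p.n : ℝ) * 4 ^ p.a / ((p.w j : ℝ) * (p.d j : ℝ)) * (mainTerm p M j : ℝ))) := by
  classical
  set S := successSet p A x y with hSdef
  have hs : (0 : ℝ) < S.card := by exact_mod_cast hne.card_pos
  have hn : (1 : ℝ) ≤ p.n := by exact_mod_cast hp.n_pos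
  set L := Nat.log 2 p.n with hL
  set F := Env.costBound (16 * 2 ^ p.a * (p.n / p.w 1)) ((p.a + 1) * (30 * L)) M p.d with hF
  have hcost : ∀ j ∈ Finset.Icc 1 p.k, ∑ i ∈ Finset.range (p.a + 1),
      ∑ I ∈ (aligned p.n (p.w j)).toFinset, ∑ ω ∈ S, ((mainEnv p A x y ω).testCost M j I i : ℝ) ≤
      (S.card : ℝ) * (2 * (p.c₀ : ℝ) * (L : ℝ) ^ 2 * (polylog p : ℝ) *
        ((p.n : ℝ) * 4 ^ p.a / ((p.w j : ℝ) * (p.d j : ℝ)) * (mainTerm p M j : ℝ))) := by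
    intro j hj
    obtain ⟨hj, hk⟩ := Finset.mem_Icc.1 hj
    have hd : (0 : ℝ) < p.d j := by exact_mod_cast hp.d_pos hk
    have hw : (0 : ℝ) < p.w j := by exact_mod_cast hp.w_pos hj (by omega)
    have hFj : (F j : ℝ) ≤ (polylog p : ℝ) * (2 ^ p.a * mainTerm p M j) := by
      obtain ⟨ω, -⟩ := hne
      exact_mod_cast (hE ω).stackBound_le hM1 hj hk
    have hthr : (p.threshold j : ℝ) ≤ p.c₀ * L := by exact_mod_cast Nat.min_le_right _ _
    have h1 : ∀ i ∈ Finset.range (p.a + 1), ∀ I ∈ (aligned p.n (p.w j)).toFinset,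
        ∑ ω ∈ S, ((mainEnv p A x y ω).testCost M j I i : ℝ) ≤
        (S.card : ℝ) * (2 * (p.c₀ : ℝ) * (L : ℝ) * (polylog p : ℝ) * (2 ^ p.a / p.d j * mainTerm p M j)) := by
      intro i hi I hI
      refine (sum_testCost_le hp A x y hE M (F := F j) hj hk (fun ω => rfl) (List.mem_toFinset.1 hI)
        (Nat.lt_succ_iff.1 (Finset.mem_range.1 hi))).trans ?_
      calc _ ≤ 2 * (S.card : ℝ) * (p.c₀ * L / p.d j *
            ((polylog p : ℝ) * (2 ^ p.a * mainTerm p M j))) := by gcongr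
        _ = _ := by field_simp
    have h2 := Finset.sum_le_sum fun i hi => Finset.sum_le_sum (h1 i hi)
    refine h2.trans ?_
    rw [Finset.sum_const, Finset.sum_const, Finset.card_range, nsmul_eq_mul, nsmul_eq_mul,
      List.toFinset_card_of_nodup (aligned_nodup (hp.w_pos hj (by omega))), length_aligned]
    have ha : ((p.a + 1 : ℕ) : ℝ) ≤ L := by exact_mod_cast hp.a_add_one_le_log
    have hdiv : ((p.n / p.w j : ℕ) : ℝ) ≤ p.n / p.w j := Nat.cast_div_le
    calc _ ≤ L * (p.n / p.w j * ((S.card : ℝ) * (2 * (p.c₀ : ℝ) * (L : ℝ) * (polylog p : ℝ) *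
          (4 ^ p.a / p.d j * mainTerm p M j)))) := by gcongr; norm_num
      _ = _ := by field_simp
  have htime : ∀ ω ∈ S, ((mainAlg p A x y ω).time : ℝ) ≤
      (4 * (p.n : ℝ) + 40 * (L : ℝ) ^ 4 * (32 * 2 ^ p.a * (p.n : ℝ))) +
      ∑ j ∈ Finset.Icc 1 p.k, ((120 * (L : ℝ) ^ 4 * (32 * 2 ^ p.a * (p.n : ℝ)) +
        (L : ℝ) * (18 * (polylog p : ℝ) * (32 * 2 ^ p.a * (p.n : ℝ))) +
        800 * (L : ℝ) * (polylog p : ℝ) * ((p.n : ℝ) * 4 ^ p.a / ((p.w j : ℝ) * (p.d j : ℝ)) * (mainTerm p M j : ℝ))) +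
        ∑ i ∈ Finset.range (p.a + 1), ∑ I ∈ (aligned p.n (p.w j)).toFinset,
          ((mainEnv p A x y ω).testCost M j I i : ℝ)) := by
    intro ω hω
    have hsucc : (mainEnv p A x y ω).Success := (Finset.mem_filter.1 hω).2
    have h1 := (hE ω).run_time_le_real hsucc (hM ω) hM1
    have h2 : (mainAlg p A x y ω).time = x.length + y.length + 1 + (mainEnv p A x y ω).run.time := rfl
    have h3 : ((mainEnv p A x y ω).sizeBound : ℝ) = 32 * 2 ^ p.a * p.n := by
      simp only [Env.sizeBound, mainEnv]
      push_cast
      rfl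
    rw [h3] at h1
    change _ ≤ 1 + 40 * (L : ℝ) ^ 4 * (32 * 2 ^ p.a * (p.n : ℝ)) + ∑ j ∈ Finset.Icc 1 p.k,
      (120 * (L : ℝ) ^ 4 * (32 * 2 ^ p.a * (p.n : ℝ)) +
        (L : ℝ) * (18 * (polylog p : ℝ) * (32 * 2 ^ p.a * (p.n : ℝ))) +
        800 * (L : ℝ) * (polylog p : ℝ) * ((p.n : ℝ) * 4 ^ p.a / ((p.w j : ℝ) * (p.d j : ℝ)) * (mainTerm p M j : ℝ)) +
        ∑ i ∈ Finset.range (p.a + 1), ∑ I ∈ (aligned p.n (p.w j)).toFinset,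
          ((mainEnv p A x y ω).testCost M j I i : ℝ)) at h1
    rw [h2, hx, hy]
    push_cast
    linarith
  rw [condExpTime, div_le_iff₀ hs]
  refine (Finset.sum_le_sum htime).trans ?_
  rw [Finset.sum_add_distrib, Finset.sum_const, nsmul_eq_mul, Finset.sum_comm]
  have hlevel : ∀ j ∈ Finset.Icc 1 p.k, ∑ ω ∈ S, ((120 * (L : ℝ) ^ 4 * (32 * 2 ^ p.a * (p.n : ℝ)) +
        (L : ℝ) * (18 * (polylog p : ℝ) * (32 * 2 ^ p.a * (p.n : ℝ))) +
        800 * (L : ℝ) * (polylog p : ℝ) * ((p.n : ℝ) * 4 ^ p.a / ((p.w j : ℝ) * (p.d j : ℝ)) * (mainTerm p M j : ℝ))) +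
        ∑ i ∈ Finset.range (p.a + 1), ∑ I ∈ (aligned p.n (p.w j)).toFinset,
          ((mainEnv p A x y ω).testCost M j I i : ℝ)) ≤
      (S.card : ℝ) * (120 * (L : ℝ) ^ 4 * (32 * 2 ^ p.a * (p.n : ℝ)) +
        (L : ℝ) * (18 * (polylog p : ℝ) * (32 * 2 ^ p.a * (p.n : ℝ))) +
        (800 * (L : ℝ) + 2 * (p.c₀ : ℝ) * (L : ℝ) ^ 2) * (polylog p : ℝ) *
          ((p.n : ℝ) * 4 ^ p.a / ((p.w j : ℝ) * (p.d j : ℝ)) * (mainTerm p M j : ℝ))) := by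
    intro j hj
    have h1 := hcost j hj
    rw [Finset.sum_add_distrib, Finset.sum_const, nsmul_eq_mul, Finset.sum_comm]
    have h2 : ∑ i ∈ Finset.range (p.a + 1), ∑ ω ∈ S, ∑ I ∈ (aligned p.n (p.w j)).toFinset,
        ((mainEnv p A x y ω).testCost M j I i : ℝ) = ∑ i ∈ Finset.range (p.a + 1),
        ∑ I ∈ (aligned p.n (p.w j)).toFinset, ∑ ω ∈ S,
        ((mainEnv p A x y ω).testCost M j I i : ℝ) :=
      Finset.sum_congr rfl fun i _ => Finset.sum_comm
    rw [h2]
    linarith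
  refine (add_le_add_right (Finset.sum_le_sum hlevel) _).trans (le_of_eq ?_)
  rw [← Finset.mul_sum]
  ring

/-- The final estimate of the polylogarithmic factors. -/
theorem polylog_factor_le {l L K B : ℝ} {k e c : ℕ} (hl : 1 ≤ l) (hL0 : 0 ≤ L) (hL : L ≤ 2 * l)
    (hK1 : 1 ≤ K) (hK : K ≤ 1440000 ^ k * l ^ (2 * k)) (hB : 0 ≤ B) :
    4 + 1280 * L ^ 4 + k * (3840 * L ^ 4 + 576 * L * K) +
      (800 * L + 2 * c * L ^ 2) * K * (B * l ^ (e + 1)) ≤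
    1440000 ^ k * (20484 + 62592 * k + (1600 + 8 * c) * B) * l ^ (2 * k + (4 + e)) := by
  set Z := l ^ (4 + e) with hZ
  have hZ1 : 1 ≤ Z := one_le_pow₀ hl
  have hl4 : l ^ 4 ≤ Z := pow_le_pow_right₀ hl (by omega)
  have hl1 : l ≤ Z := by
    calc l = l ^ 1 := (pow_one l).symm
      _ ≤ Z := pow_le_pow_right₀ hl (by omega)
  have h4 : L ^ 4 ≤ 16 * Z := by
    calc L ^ 4 ≤ (2 * l) ^ 4 := by gcongr
      _ = 16 * l ^ 4 := by ring
      _ ≤ _ := by gcongr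
  have hKZ : Z ≤ K * Z := le_mul_of_one_le_left (by linarith) hK1
  have hK0 : 0 ≤ K := by linarith
  have h5 : L * K ≤ 2 * (K * Z) := by
    calc L * K ≤ 2 * Z * K := by gcongr; linarith
      _ = _ := by ring
  have h6 : L * l ^ (e + 1) ≤ 2 * Z := by
    calc L * l ^ (e + 1) ≤ 2 * l * l ^ (e + 1) := by gcongr
      _ = 2 * l ^ (e + 2) := by ring
      _ ≤ 2 * Z := by
        gcongr
        exact pow_le_pow_right₀ hl (by omega)
  have h7 : L ^ 2 * l ^ (e + 1) ≤ 4 * Z := by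
    calc L ^ 2 * l ^ (e + 1) ≤ (2 * l) ^ 2 * l ^ (e + 1) := by gcongr
      _ = 4 * l ^ (e + 3) := by ring
      _ ≤ 4 * Z := by
        gcongr
        exact pow_le_pow_right₀ hl (by omega)
  have h8 : (800 * L + 2 * c * L ^ 2) * K * (B * l ^ (e + 1)) ≤ (1600 + 8 * c) * B * (K * Z) := by
    calc _ = (800 * (L * l ^ (e + 1)) + 2 * c * (L ^ 2 * l ^ (e + 1))) * (K * B) := by ring
      _ ≤ (800 * (2 * Z) + 2 * c * (4 * Z)) * (K * B) := by gcongr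
      _ = _ := by ring
  have h9 : (k : ℝ) * (3840 * L ^ 4 + 576 * L * K) ≤ 62592 * k * (K * Z) := by
    calc _ = (k : ℝ) * (3840 * L ^ 4 + 576 * (L * K)) := by ring
      _ ≤ k * (3840 * (16 * (K * Z)) + 576 * (2 * (K * Z))) := by gcongr; linarith
      _ = _ := by ring
  calc _ ≤ (20484 + 62592 * k + (1600 + 8 * c) * B) * (K * Z) := by
        nlinarith
    _ ≤ (20484 + 62592 * k + (1600 + 8 * c) * B) * (1440000 ^ k * l ^ (2 * k) * Z) := by gcongr
    _ = _ := by rw [hZ, pow_add]; ring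

theorem one_le_log_of_four_le {n : ℕ} (hn : 4 ≤ n) : 1 ≤ Real.log n := by
  have h1 : Real.log 4 ≤ Real.log n := Real.log_le_log (by norm_num) (by exact_mod_cast hn)
  have h2 : Real.log 4 = 2 * Real.log 2 := by
    rw [show (4 : ℝ) = 2 ^ 2 by norm_num, Real.log_pow]; norm_num
  have := Real.log_two_gt_d9
  linarith

theorem nat_log_two_le {n : ℕ} (hn : n ≠ 0) : (Nat.log 2 n : ℝ) ≤ 2 * Real.log n := by
  have h1 : ((2 ^ Nat.log 2 n : ℕ) : ℝ) ≤ n := by exact_mod_cast Nat.pow_log_le_self 2 hn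
  have h2 := Real.log_le_log (by positivity) h1
  push_cast at h2
  rw [Real.log_pow] at h2
  have := Real.log_two_gt_d9
  have h3 : (0 : ℝ) ≤ Nat.log 2 n := by positivity
  nlinarith

/-- As Q ≤ 2^q₀ for q₀ = ⌈log₂ Q⌉, the loss of quality is a shift of the scale by q₀, and the
certain rejection of pairs beyond Q ε_i w gives soundness by contraposition. -/
theorem mainEnv_wellFormed {σ : Type*} {p : Params} (hp : p.Valid) (A : GapAlg σ) {x y : List σ}
    (hx : x.length = p.n) (hy : y.length = p.n) {Q : ℝ} (hQ0 : 1 ≤ Q)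
    (hq : p.q₀ = ⌈Real.logb 2 Q⌉₊)
    (hQ : ∀ j, 1 ≤ j → j ≤ p.k → ∀ i ≤ p.a, A.HasQuality Q (p.w j) i (((p.n : ℚ) ^ 12)⁻¹))
    (ω : Outcome p (coinBound p A)) : (mainEnv p A x y ω).WellFormed where
  valid := hp
  length_z := by simp [mainEnv, hx, hy]; omega
  pick_lt j I i t m hm := Outcome.pick_lt ω j I i t hm
  sound j hj hk i hi I J hI hJ h := by
    change (editDist (substr (x ++ y) (p.w j) I) (substr (x ++ y) (p.w j) J) : ℚ) ≤
      eps ((i : ℤ) - p.q₀) * p.w j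
    have hI' : I + p.w j ≤ p.n := hI
    have hJ' : J + p.w j ≤ 2 * p.n := hJ
    have hQ' : Q ≤ 2 ^ p.q₀ := by
      rw [hq, ← Real.rpow_natCast, ← Real.logb_le_iff_le_rpow (by norm_num) (by linarith)]
      exact Nat.le_ceil _
    have h1 := (hQ j hj hk i hi (substr (x ++ y) (p.w j) I) (substr (x ++ y) (p.w j) J)
      (length_substr (by simp; omega)) (length_substr (by simp; omega))).1
    by_contra hlt
    rw [not_le, eps_sub_nat, eps_natCast] at hlt
    have h2 : ((2 ^ p.q₀ * (1 / 2 ^ i) * p.w j : ℚ) : ℝ) <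
        ((editDist (substr (x ++ y) (p.w j) I) (substr (x ++ y) (p.w j) J) : ℚ) : ℝ) := by
      exact_mod_cast hlt
    push_cast at h2
    have h3 : Q * (1 / 2 : ℝ) ^ i * p.w j <
        (editDist (substr (x ++ y) (p.w j) I) (substr (x ++ y) (p.w j) J) : ℝ) := by
      refine lt_of_le_of_lt ?_ h2
      rw [one_div_pow]
      gcongr
    have h4 : ((mainEnv p A x y ω).callED j I J i).val = false := h1 h3 _
    rw [h] at h4
    simp at h4

/-! ### Assembly of the bound -/

open Env (polylog mainTerm)

/-- The gap condition is most demanding for the smallest width and the smallest ε, which is θ. So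
the assumption on w 1 covers all calls. -/
theorem Params.Valid.gap_rpow_le {p : Params} (hp : p.Valid) {ζ : ℝ} (hζ : 0 ≤ ζ)
    (hθ : (p.w 1 : ℝ) ^ (-ζ) ≤ p.θ) {j i : ℕ} (hj : 1 ≤ j) (hk : j ≤ p.k) (hi : i ≤ p.a) :
    (p.w j : ℝ) ^ (-ζ) ≤ (1 / 2 : ℝ) ^ i := by
  have h1 : (0 : ℝ) < p.w 1 := by exact_mod_cast hp.w_pos le_rfl (by omega)
  have h2 : (p.w 1 : ℝ) ≤ p.w j := by exact_mod_cast hp.w_one_le hj (by omega)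
  calc (p.w j : ℝ) ^ (-ζ) ≤ (p.w 1 : ℝ) ^ (-ζ) :=
        Real.rpow_le_rpow_of_nonpos h1 h2 (by linarith)
    _ ≤ (1 / 2 : ℝ) ^ p.a := hθ
    _ ≤ _ := pow_le_pow_of_le_one (by norm_num) (by norm_num) hi

/-- The bound on the time of the calls of the slow algorithm at level `h` that is given by its gap
condition. -/
noncomputable def slowBound (p : Params) (C : ℝ) (e : ℕ) (T : ℝ) (h : ℕ) : ℕ :=
  ⌈C * (1 + Real.log p.n) ^ e * (p.w h : ℝ) ^ (1 + 1 / T) * (1 + 12 * Real.log p.n)⌉₊ +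
    (2 * p.w h + 1)

/-- Since log n ≥ 1, the factors 1 + log n and 1 + 12 log n are at most 2 log n and 13 log n.
Rounding up and copying the strings add at most 2 w + 2 ≤ 4 w. -/
theorem slowBound_le {p : Params} (hp : p.Valid) {C : ℝ} (hC : 0 ≤ C) (e : ℕ) {T : ℝ} (hT : 1 ≤ T)
    {h : ℕ} (hh : 1 ≤ h) (hk : h ≤ p.k) :
    (slowBound p C e T h : ℝ) ≤
      (13 * 2 ^ e * C + 4) * Real.log p.n ^ (e + 1) * (p.w h : ℝ) ^ (1 + 1 / T) := by
  have hl : 1 ≤ Real.log p.n := one_le_log_of_four_le hp.four_le_n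
  have hw : (1 : ℝ) ≤ p.w h := by exact_mod_cast hp.w_pos hh (by omega)
  set l := Real.log p.n with hldef
  set W := (p.w h : ℝ) ^ (1 + 1 / T) with hW
  have hT0 : 0 ≤ 1 / T := by positivity
  have hwW : (p.w h : ℝ) ≤ W := by
    calc (p.w h : ℝ) = (p.w h : ℝ) ^ (1 : ℝ) := (Real.rpow_one _).symm
      _ ≤ W := Real.rpow_le_rpow_of_exponent_le hw (by linarith)
  have h0 : 0 ≤ C * (1 + l) ^ e * W * (1 + 12 * l) := by positivity
  have h1 : C * (1 + l) ^ e * W * (1 + 12 * l) ≤ 13 * 2 ^ e * C * (l ^ (e + 1) * W) := by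
    calc C * (1 + l) ^ e * W * (1 + 12 * l) ≤ C * (2 * l) ^ e * W * (13 * l) := by
          gcongr <;> linarith
      _ = _ := by rw [mul_pow, pow_succ]; ring
  have h2 : W ≤ l ^ (e + 1) * W := le_mul_of_one_le_left (by linarith) (one_le_pow₀ hl)
  have h3 := (Nat.ceil_lt_add_one h0).le
  rw [slowBound]
  push_cast
  calc _ ≤ 13 * 2 ^ e * C * (l ^ (e + 1) * W) + 4 * (l ^ (e + 1) * W) := by linarith
    _ = _ := by ring

theorem mainEnv_callBound {σ : Type*} {p : Params} (hp : p.Valid) (A : GapAlg σ) {x y : List σ}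
    (hx : x.length = p.n) (hy : y.length = p.n) {C : ℝ} (hC : 0 ≤ C) {e : ℕ} {T : ℝ}
    (hA : ∀ j, 1 ≤ j → j ≤ p.k → ∀ i ≤ p.a, ∀ u v : List σ, u.length = p.w j → v.length = p.w j →
      ∀ r, ((A.run (p.w j) i (((p.n : ℚ) ^ 12)⁻¹) u v r).time : ℝ) ≤
        C * (1 + Real.log (p.w j)) ^ e * (p.w j : ℝ) ^ (1 + 1 / T) * (1 + 12 * Real.log p.n))
    (ω : Outcome p (coinBound p A)) : (mainEnv p A x y ω).CallBound (slowBound p C e T) := by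
  intro j hj hk i hi I J hI hJ
  replace hk : j ≤ p.k := hk
  have hI' : I + p.w j ≤ p.n := hI
  have hJ' : J + p.w j ≤ 2 * p.n := hJ
  have h1 := hA j hj hk i hi (substr (x ++ y) (p.w j) I) (substr (x ++ y) (p.w j) J)
    (length_substr (by simp; omega)) (length_substr (by simp; omega))
    (fun t => (Outcome.toRandomness ω).bits t)
  have hw : 0 < p.w j := hp.w_pos hj (by omega)
  have hl : Real.log (p.w j) ≤ Real.log p.n :=
    Real.log_le_log (by exact_mod_cast hw) (by exact_mod_cast hp.w_le_n hj (by omega))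
  have hl0 : 0 ≤ Real.log (p.w j) := Real.log_nonneg (by exact_mod_cast hw)
  have h2 : C * (1 + Real.log (p.w j)) ^ e * (p.w j : ℝ) ^ (1 + 1 / T) * (1 + 12 * Real.log p.n) ≤
      C * (1 + Real.log p.n) ^ e * (p.w j : ℝ) ^ (1 + 1 / T) * (1 + 12 * Real.log p.n) := by
    gcongr
  have h3 := Nat.cast_le.1 ((h1.trans h2).trans (Nat.le_ceil _))
  change 2 * p.w j + 1 + (A.run (p.w j) i (((p.n : ℚ) ^ 12)⁻¹) (substr (x ++ y) (p.w j) I)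
    (substr (x ++ y) (p.w j) J) (fun t => (Outcome.toRandomness ω).bits t)).time ≤ _
  rw [slowBound]
  omega

/-- The sum that bounds the running time up to a polylogarithmic factor. -/
noncomputable def levelSum (p : Params) (T : ℝ) : ℝ :=
  ∑ j ∈ Finset.Icc 1 p.k, (p.n : ℝ) / (p.θ ^ 2 * p.w j * p.d j) *
    ∑ h ∈ Finset.Icc 1 j, (p.d (h - 1) : ℝ) * (p.w h : ℝ) ^ (1 + 1 / T)

theorem Params.level_factor_eq (p : Params) (j : ℕ) :
    (p.n : ℝ) / (p.θ ^ 2 * p.w j * p.d j) = p.n * 4 ^ p.a / (p.w j * p.d j) := by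
  rw [Params.θ, ← pow_mul, mul_comm p.a 2, pow_mul, show ((1 : ℝ) / 2) ^ 2 = 4⁻¹ by norm_num, inv_pow]
  field_simp

/-- The summand j = h = 1 alone suffices, since d 0 ≥ d 1 and w_1^(1+1/T) ≥ w_1. Through this bound
the nearly linear work outside the main term is absorbed. -/
theorem le_levelSum {p : Params} (hp : p.Valid) {T : ℝ} (hT : 1 ≤ T) :
    (p.n : ℝ) * 4 ^ p.a ≤ levelSum p T := by
  have hk := hp.k_pos
  have hw : (1 : ℝ) ≤ p.w 1 := by exact_mod_cast hp.w_pos le_rfl (by omega)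
  have hd : (0 : ℝ) < p.d 1 := by exact_mod_cast hp.d_pos hk
  have hd' : (p.d 1 : ℝ) ≤ p.d 0 := by exact_mod_cast hp.d_le (Nat.zero_le 1) hk
  have hT0 : 0 ≤ 1 / T := by positivity
  have hwW : (p.w 1 : ℝ) ≤ (p.w 1 : ℝ) ^ (1 + 1 / T) := by
    calc (p.w 1 : ℝ) = (p.w 1 : ℝ) ^ (1 : ℝ) := (Real.rpow_one _).symm
      _ ≤ _ := Real.rpow_le_rpow_of_exponent_le hw (by linarith)
  have h1 : (p.n : ℝ) / (p.θ ^ 2 * p.w 1 * p.d 1) *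
      ∑ h ∈ Finset.Icc 1 1, (p.d (h - 1) : ℝ) * (p.w h : ℝ) ^ (1 + 1 / T) ≤ levelSum p T := by
    refine Finset.single_le_sum (f := fun j => (p.n : ℝ) / (p.θ ^ 2 * p.w j * p.d j) *
      ∑ h ∈ Finset.Icc 1 j, (p.d (h - 1) : ℝ) * (p.w h : ℝ) ^ (1 + 1 / T)) (fun j _ => ?_)
      (Finset.mem_Icc.2 ⟨le_rfl, hk⟩)
    positivity
  refine le_trans ?_ h1
  rw [Params.level_factor_eq, Finset.Icc_self, Finset.sum_singleton, Nat.sub_self]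
  calc (p.n : ℝ) * 4 ^ p.a = p.n * 4 ^ p.a / (p.w 1 * p.d 1) * (p.d 1 * p.w 1) := by field_simp
    _ ≤ _ := by gcongr

theorem sum_mainTerm_le {p : Params} {M : ℕ → ℕ} {B T : ℝ}
    (hM : ∀ h, 1 ≤ h → h ≤ p.k → (M h : ℝ) ≤ B * (p.w h : ℝ) ^ (1 + 1 / T)) :
    ∑ j ∈ Finset.Icc 1 p.k, (p.n : ℝ) * 4 ^ p.a / ((p.w j : ℝ) * (p.d j : ℝ)) * (mainTerm p M j : ℝ) ≤
      B * levelSum p T := by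
  rw [levelSum, Finset.mul_sum]
  refine Finset.sum_le_sum fun j hj => ?_
  rw [Params.level_factor_eq, mul_left_comm]
  refine mul_le_mul_of_nonneg_left ?_ (by positivity)
  rw [mainTerm, Finset.mul_sum]
  push_cast
  refine Finset.sum_le_sum fun h hh => ?_
  rw [mul_left_comm]
  have h1 := Finset.mem_Icc.1 hj
  have h2 := Finset.mem_Icc.1 hh
  exact mul_le_mul_of_nonneg_left (hM h h2.1 (by omega)) (by positivity)

theorem condExpTime_le_levelSum {σ : Type*} {p : Params} (hp : p.Valid) (A : GapAlg σ) (x y : List σ)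
    (hx : x.length = p.n) (hy : y.length = p.n) (hE : ∀ ω, (mainEnv p A x y ω).WellFormed)
    {M : ℕ → ℕ} (hM : ∀ ω, (mainEnv p A x y ω).CallBound M) (hM1 : ∀ h, 1 ≤ M h)
    (hS : (Fintype.card (Outcome p (coinBound p A)) : ℝ) ≤ 2 * (successSet p A x y).card)
    (hne : (successSet p A x y).Nonempty) {B T : ℝ} {e : ℕ} (hB : 0 ≤ B) (hT : 1 ≤ T)
    (hMB : ∀ h, 1 ≤ h → h ≤ p.k →
      (M h : ℝ) ≤ B * Real.log p.n ^ (e + 1) * (p.w h : ℝ) ^ (1 + 1 / T)) :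
    condExpTime p A x y ≤ 1440000 ^ p.k * (20484 + 62592 * p.k + (1600 + 8 * p.c₀) * B) *
      Real.log p.n ^ (2 * p.k + (4 + e)) * levelSum p T := by
  refine (condExpTime_le hp A x y hx hy hE hM hM1 hS hne).trans ?_
  have hsum := sum_mainTerm_le hMB
  have hR := le_levelSum hp hT
  have hl := one_le_log_of_four_le hp.four_le_n
  have hL := nat_log_two_le hp.n_pos.ne'
  have hK1 : (1 : ℝ) ≤ (polylog p : ℝ) := by
    exact_mod_cast le_trans (by norm_num) hp.thirtytwo_le_polylog
  have hK : (polylog p : ℝ) ≤ 1440000 ^ p.k * Real.log p.n ^ (2 * p.k) := by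
    rw [polylog, pow_mul, ← mul_pow]
    push_cast
    refine pow_le_pow_left₀ (by positivity) ?_ _
    calc (360000 : ℝ) * (Nat.log 2 p.n : ℝ) ^ 2 ≤ 360000 * (2 * Real.log p.n) ^ 2 := by gcongr
      _ = _ := by ring
  have hfac := polylog_factor_le (k := p.k) (e := e) (c := p.c₀) hl (Nat.cast_nonneg _) hL hK1 hK hB
  set R := levelSum p T with hRdef
  set K : ℝ := (polylog p : ℝ)
  set L : ℝ := (Nat.log 2 p.n : ℝ)
  have hL0 : 0 ≤ L := Nat.cast_nonneg _
  have hR0 : 0 ≤ R := le_trans (by positivity) hR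
  have h2 : (2 : ℝ) ^ p.a ≤ 4 ^ p.a := by gcongr; norm_num
  have hnR : 2 ^ p.a * (p.n : ℝ) ≤ R := by
    calc 2 ^ p.a * (p.n : ℝ) ≤ 4 ^ p.a * p.n := by gcongr
      _ = p.n * 4 ^ p.a := by ring
      _ ≤ R := hR
  have hnR' : (p.n : ℝ) ≤ R :=
    (le_mul_of_one_le_left (by positivity) (one_le_pow₀ (by norm_num))).trans hnR
  rw [Finset.sum_add_distrib, Finset.sum_const, ← Finset.mul_sum, Nat.card_Icc, Nat.add_sub_cancel,
    nsmul_eq_mul]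
  calc _ ≤ 4 * R + 40 * L ^ 4 * (32 * R) + (p.k * (120 * L ^ 4 * (32 * R) + L * (18 * K * (32 * R))) +
        (800 * L + 2 * p.c₀ * L ^ 2) * K * (B * Real.log p.n ^ (e + 1) * R)) := by
        have h3 : 32 * 2 ^ p.a * (p.n : ℝ) ≤ 32 * R := by linarith
        gcongr
    _ = (4 + 1280 * L ^ 4 + p.k * (3840 * L ^ 4 + 576 * L * K) +
        (800 * L + 2 * p.c₀ * L ^ 2) * K * (B * Real.log p.n ^ (e + 1))) * R := by ring
    _ ≤ _ := by gcongr

theorem theorem5 :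
    ∃ cmin : ℕ, ∀ c₀ : ℕ, cmin ≤ c₀ →
    ∀ (σ : Type*) (A : GapAlg σ) (T ζ Q : ℝ), 1 ≤ T → 0 ≤ ζ → 1 ≤ Q →
    A.GapCondition T ζ Q →
    ∀ k : ℕ, ∃ (C : ℝ) (e : ℕ), ∀ p : Params,
      p.Valid → p.k = k → p.c₀ = c₀ → p.q₀ = ⌈Real.logb 2 Q⌉₊ → (p.w 1 : ℝ) ^ (-ζ) ≤ p.θ →
      ∀ x y : List σ, x.length = p.n → y.length = p.n →
        (successSet p A x y).Nonempty ∧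
        condExpTime p A x y ≤
          C * Real.log p.n ^ e *
            ∑ j ∈ Finset.Icc 1 p.k, (p.n : ℝ) / (p.θ ^ 2 * p.w j * p.d j) *
              ∑ h ∈ Finset.Icc 1 j, (p.d (h - 1) : ℝ) * (p.w h : ℝ) ^ (1 + 1 / T) := by
  refine ⟨40, fun c₀ hc₀ σ A T ζ Q hT hζ hQ1 hgap k => ?_⟩
  obtain ⟨C, e, hgap⟩ := hgap
  -- The constant of the gap condition could be negative, so its absolute value is used to keep the
  -- bounds monotone. 1440000 is 4 · 360000, from log₂ n ≤ 2 log n in the polylogarithmic factor.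
  refine ⟨1440000 ^ k * (20484 + 62592 * k + (1600 + 8 * c₀) * (13 * 2 ^ e * |C| + 4)),
    2 * k + (4 + e), fun p hp hk hc hq hθ x y hx hy => ?_⟩
  subst hk hc
  have hn : 4 ≤ p.n := hp.four_le_n
  have hn1 : (1 : ℚ) < (p.n : ℚ) ^ 12 := one_lt_pow₀ (by exact_mod_cast (by omega : 1 < p.n)) (by norm_num)
  have hg := fun j hj hk i hi => hgap (p.w j) i (hp.w_pow j hj (by omega))
    (hp.gap_rpow_le hζ hθ (j := j) (i := i) hj hk hi) (((p.n : ℚ) ^ 12)⁻¹)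
    (by positivity) (inv_lt_one_of_one_lt₀ hn1)
  have hqual : ∀ j, 1 ≤ j → j ≤ p.k → ∀ i ≤ p.a, A.HasQuality Q (p.w j) i (((p.n : ℚ) ^ 12)⁻¹) :=
    fun j hj hk i hi => (hg j hj hk i hi).1
  have hlog : Real.log (1 / ((((p.n : ℚ) ^ 12)⁻¹ : ℚ) : ℝ)) = 12 * Real.log p.n := by
    push_cast
    rw [one_div, inv_inv, Real.log_pow]
    norm_num
  have hcall := mainEnv_callBound hp A hx hy (abs_nonneg C) (e := e) (T := T)
    (fun j hj hk i hi u v hu hv r => by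
      have hw : 0 < p.w j := hp.w_pos hj (by omega)
      have h1 : 0 ≤ Real.log (p.w j) := Real.log_nonneg (by exact_mod_cast hw)
      have h2 : 1 ≤ Real.log p.n := one_le_log_of_four_le hn
      refine ((hg j hj hk i hi).2 u v hu hv r).trans ?_
      rw [hlog]
      gcongr
      exact le_abs_self C)
  have hcard := card_le_two_mul_card_successSet hp A x y hc₀ hx hy hqual
  have hne : (successSet p A x y).Nonempty := by
    have := Outcome.nonempty (b := coinBound p A) hp
    have h0 : (0 : ℝ) < Fintype.card (Outcome p (coinBound p A)) := by exact_mod_cast Fintype.card_pos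
    rw [← Finset.card_pos]
    have : (0 : ℝ) < (successSet p A x y).card := by linarith
    exact_mod_cast this
  refine ⟨hne, ?_⟩
  exact condExpTime_le_levelSum hp A x y hx hy (fun ω => mainEnv_wellFormed hp A hx hy hQ1 hq hqual ω)
    hcall (fun h => by rw [slowBound]; omega) hcard hne (by positivity) hT
    (fun h hh hk => slowBound_le hp (abs_nonneg C) e hT hh hk)
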